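/- **Setting.** Let $L>0$, let $\mathcal W:\mathbb R^{3\times3}\to[0,\infty]$ be continuous, with $\mathcal W(RA)=\mathcal W(A)$ for $R\in SO(3)$, $\mathcal W(A)=0$ iff $A\in SO(3)$, $\mathcal W(A)\ge c_0\,\mathrm{dist}^2(A,SO(3))$ for some $c_0>0$, and finite and $C^2$ in a neighbourhood of $SO(3)$; put $\mathcal Q_3(B)=\frac12D^2\mathcal W(I)(B,B)$. Consider a ribbon with flat mid-surface, given in Fermi coordinates $(z_1,z_2)$ by a smooth geodesic curvature $\kappa(z_1)$ of the midline, the metric $\mathfrak a=\mathrm{diag}((1-\kappa(z_1)z_2)^2,1)$, and a smooth symmetric reference second form $\mathrm{II}(z_1,z_2)\in\mathbb R^{2\times 2}$ (all smooth up to the boundary). Write $$\mathrm{II}^0=\mathrm{II}|_{z_2=0}=\begin{pmatrix}l_0&m_0\\m_0&n_0\end{pmatrix},\qquad \partial_2\mathrm{II}|_{z_2=0}=\begin{pmatrix}l_1&m_1\\m_1&n_1\end{pmatrix},$$ $$\delta^C_1=l_1-m_0'+\kappa(l_0+n_0),\quad \delta^C_2=m_1-n_0'-\kappa m_0,\quad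 \delta^{G,1}=l_1n_0+n_1l_0-2m_0m_1.$$ Let $(e_1,e_2,e_3)$ be a positively oriented orthonormal frame with $e_1'=\kappa e_2+l_0e_3$, $e_2'=-\kappa e_1+m_0e_3$, $e_3'=-l_0e_1-m_0e_2$, and let $$\Phi(z_1,z_2)=\int_0^{z_1}e_1\,ds+z_2e_2+\tfrac12z_2^2n_0e_3-\tfrac16z_2^3n_0(m_0e_1+n_0e_2)$$ ($e_i,m_0,n_0$ evaluated at $z_1$), $\tilde{\mathfrak n}$ its unit normal, $N=(\nabla\Phi\,|\,\tilde{\mathfrak n})$, and $A_0=\big(N^{-T}\,\mathrm{diag}((1-\kappa(z_1) z_2)^2,1,1)\,N^{-1}\big)^{1/2}N$. Let $S=(0,L)\times(-\frac12,\frac12)$, $\nabla_w=(\partial_1\,|\,w^{-1}\partial_2)$ and, for $w>0$, call $f\in W^{2,2}(S;\mathbb R^3)$ a rescaled isometric immersion if $\nabla_wf^T\nabla_wf(x)=\mathfrak a(x_1,wx_2)$ a.e. in $S$. With $\nu_f$ the unit normal of $f$, let $\mathrm{II}^w_f=(\langle \partial^w_i\partial^w_jf,\nu_f\rangle)_{ij}$,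 where $\partial^w_1=\partial_1$, $\partial^w_2=w^{-1}\partial_2$, be its rescaled second fundamental form, let $\mathrm{II}^w(x)=\mathrm{II}(x_1,wx_2)$, and define on rescaled isometric immersions $$\tilde E_w(f)=\frac1{12}\,\frac1{|S|}\int_S\mathcal Q_w(x,\mathrm{II}^w_f-\mathrm{II}^w)\,dx,$$ $$\mathcal Q_w(x,F)=\min\{\mathcal Q_3(A_0^{-T}GA_0^{-1}): G\in\mathbb R^{3\times3},\ G_{2\times2}=F\},\qquad A_0=A_0(x_1,wx_2).$$ **Statement.** Assume $\det\mathrm{II}^0\equiv0$ and $l_0\neq0$ on $[0,L]$. For all sufficiently small $w>0$ rescaled isometric immersions exist, and $\tilde E_w$ is finite and bounded below on them. The limit $\lim_{w\to0}\inf\frac1{w^2}\tilde E_w$ exists, and $$ c\,D\le\lim_{w\to0}\Big(\inf\frac1{w^2}\tilde E_w\Big)\le C\,D,\qquad D=\int_0^L|\delta^C|^2+|\delta^{G,1}-n_0\delta^C_1+2m_0\delta^C_2|^2\,dx_1,$$ with constants $c,C>0$ that depend only on $\mathcal W$, $L$ and on numbers $\lambda>0$, $\Lambda$ with $\lambda\le|l_0|\le\Lambda$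 on $[0,L]$ (in particular not on $w$). Moreover, if $(f_w)$ are rescaled isometric immersions with $\frac1{w^2}(\tilde E_w(f_w)-\inf\tilde E_w)\to0$ as $w\to0$, then $\|\mathrm{II}^w_{f_w}-\mathrm{II}^0\|_{L^2(S)}=O(w)$ and $$\frac1w\Big(\int_{-1/2}^{1/2}\mathrm{II}^w_{f_w}\,dx_2-\mathrm{II}^0\Big)\to0\quad\text{in }L^2(0,L).$$ -/

import Mathlib

open Set Filter Topology MeasureTheory
open scoped ENNReal ContDiff Matrix

/- Matrices carry the Frobenius norm. -/
attribute [local instance] Matrix.frobeniusNormedAddCommGroup Matrix.frobeniusNormedSpace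

namespace Ribbon

/-- Euclidean three-space. -/
abbrev E3 : Type := EuclideanSpace ℝ (Fin 3)

/-- Real `3 × 3` matrices. -/
abbrev Mat3 : Type := Matrix (Fin 3) (Fin 3) ℝ

/-- Real `2 × 2` matrices. -/
abbrev Mat2 : Type := Matrix (Fin 2) (Fin 2) ℝ

/-- The rotation group `SO(3)`, as a set of matrices. -/
def SO3 : Set Mat3 := {A | A ∈ Matrix.specialOrthogonalGroup (Fin 3) ℝ}

/-! ### The elastic energy density -/

/-- The standing assumptions on an elastic energy density `W : ℝ^{3×3} → [0,∞]`. -/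
structure IsEnergyDensity (W : Mat3 → ℝ≥0∞) : Prop where
  continuous : Continuous W
  frame_indifference : ∀ A : Mat3, ∀ R ∈ SO3, W (R * A) = W A
  zero_iff : ∀ A : Mat3, W A = 0 ↔ A ∈ SO3
  coercive : ∃ c : ℝ, 0 < c ∧
    ∀ A : Mat3, ENNReal.ofReal (c * Metric.infDist A SO3 ^ 2) ≤ W A
  regular : ∃ U : Set Mat3, IsOpen U ∧ SO3 ⊆ U ∧ (∀ A ∈ U, W A ≠ ⊤) ∧
    ContDiffOn ℝ 2 (fun A => (W A).toReal) U

/-- The quadratic form `𝒬₃(B) = ½ D²W(I)(B, B)`. -/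
noncomputable def Q3 (W : Mat3 → ℝ≥0∞) (B : Mat3) : ℝ :=
  (1 / 2) * fderiv ℝ (fderiv ℝ (fun A : Mat3 => (W A).toReal)) 1 B B

/-! ### Vectors in three-space -/

/-- The cross product on Euclidean three-space. -/
def cross (u v : E3) : E3 := WithLp.toLp 2 (crossProduct u.ofLp v.ofLp)

/-- The unit normal `(u × v) / |u × v|`. -/
noncomputable def unitNormal (u v : E3) : E3 := ‖cross u v‖⁻¹ • cross u v

/-! ### The reference geometry of a ribbon with flat mid-surface -/

/-- The reference geometry of a ribbon with flat mid-surface, in the natural (Fermi) coordinates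
`(z₁, z₂)`: the geodesic curvature `κ` of the midline in the mid-surface and the reference
second fundamental form `II` of the mid-surface. Both are smooth up to the boundary of the
ribbon; they are represented by smooth extensions to the line and to the plane, of which only
the values on the ribbon are ever used. -/
structure FlatGeometry where
  κ : ℝ → ℝ
  II : ℝ × ℝ → Mat2
  smooth_κ : ContDiff ℝ ∞ κ
  smooth_II : ∀ i j, ContDiff ℝ ∞ (fun z => II z i j)
  symm_II : ∀ z, (II z).IsSymm

namespace FlatGeometry

variable (R : FlatGeometry)

/-- The flat reference metric of the mid-surface, `diag((1 - κ(z₁) z₂)², 1)`. -/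
def metric (z : ℝ × ℝ) : Mat2 := !![(1 - R.κ z.1 * z.2) ^ 2, 0; 0, 1]

/-- The reference second form along the midline. -/
def II0 (s : ℝ) : Mat2 := R.II (s, 0)

/-- The derivative `∂₂ II` along the midline. -/
noncomputable def II1 (s : ℝ) : Mat2 := fun i j => deriv (fun r => R.II (s, r) i j) 0

/-- The components `l₀, m₀, n₀` of `II` and `l₁, m₁, n₁` of `∂₂ II` along the midline. -/
def l₀ (s : ℝ) : ℝ := R.II0 s 0 0
/-- See `l₀`. -/
def m₀ (s : ℝ) : ℝ := R.II0 s 0 1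
/-- See `l₀`. -/
def n₀ (s : ℝ) : ℝ := R.II0 s 1 1
/-- See `l₀`. -/
noncomputable def l₁ (s : ℝ) : ℝ := R.II1 s 0 0
/-- See `l₀`. -/
noncomputable def m₁ (s : ℝ) : ℝ := R.II1 s 0 1
/-- See `l₀`. -/
noncomputable def n₁ (s : ℝ) : ℝ := R.II1 s 1 1

/-- First component of the Codazzi deficit along the midline. -/
noncomputable def δC₁ (s : ℝ) : ℝ := R.l₁ s - deriv R.m₀ s + R.κ s * (R.l₀ s + R.n₀ s)

/-- Second component of the Codazzi deficit along the midline. -/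
noncomputable def δC₂ (s : ℝ) : ℝ := R.m₁ s - deriv R.n₀ s - R.κ s * R.m₀ s

/-- The first order Gauss deficit along the midline. -/
noncomputable def δG1 (s : ℝ) : ℝ := R.l₁ s * R.n₀ s + R.n₁ s * R.l₀ s - 2 * R.m₀ s * R.m₁ s

/-- The integral `∫₀ᴸ |δᶜ|² + |δ^{G,1} - n₀ δᶜ₁ + 2 m₀ δᶜ₂|²`. -/
noncomputable def deficit (L : ℝ) : ℝ :=
  ∫ s in (0 : ℝ)..L, ((R.δC₁ s ^ 2 + R.δC₂ s ^ 2) +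
    (R.δG1 s - R.n₀ s * R.δC₁ s + 2 * R.m₀ s * R.δC₂ s) ^ 2)

/-! ### The associated Euclidean ribbon -/

/-- `e = (e₁, e₂, e₃)` is a positively oriented orthonormal frame solving the Darboux equations
with geodesic curvature `κ`, normal curvature `l₀` and relative torsion `m₀`. -/
structure IsDarbouxFrame (e : Fin 3 → ℝ → E3) : Prop where
  orthonormal : ∀ s, Orthonormal ℝ (fun i => e i s)
  oriented : ∀ s, cross (e 0 s) (e 1 s) = e 2 s
  deriv₁ : ∀ s, HasDerivAt (e 0) (R.κ s • e 1 s + R.l₀ s • e 2 s) s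
  deriv₂ : ∀ s, HasDerivAt (e 1) (-(R.κ s • e 0 s) + R.m₀ s • e 2 s) s
  deriv₃ : ∀ s, HasDerivAt (e 2) (-(R.l₀ s • e 0 s) - R.m₀ s • e 1 s) s

/-- The mid-surface `Φ` of the associated Euclidean ribbon built on the frame `e`. -/
noncomputable def Phi (e : Fin 3 → ℝ → E3) (z : ℝ × ℝ) : E3 :=
  (∫ s in (0 : ℝ)..z.1, e 0 s) + z.2 • e 1 z.1 + (z.2 ^ 2 / 2 * R.n₀ z.1) • e 2 z.1
    - (z.2 ^ 3 / 6 * R.n₀ z.1) • (R.m₀ z.1 • e 0 z.1 + R.n₀ z.1 • e 1 z.1)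

/-- The matrix `(∂₁Φ | ∂₂Φ | normal)`. -/
noncomputable def frameMatrix (e : Fin 3 → ℝ → E3) (z : ℝ × ℝ) : Mat3 :=
  let v₁ : E3 := deriv (fun s => R.Phi e (s, z.2)) z.1
  let v₂ : E3 := deriv (fun r => R.Phi e (z.1, r)) z.2
  Matrix.of fun i j => (![v₁, v₂, unitNormal v₁ v₂] j) i

/-- The reference metric in the Euclidean coordinates of the associated ribbon. -/
noncomputable def F₀ (e : Fin 3 → ℝ → E3) (z : ℝ × ℝ) : Mat3 :=
  ((R.frameMatrix e z)⁻¹)ᵀ * Matrix.diagonal ![(1 - R.κ z.1 * z.2) ^ 2, 1, 1]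
    * (R.frameMatrix e z)⁻¹

/-- `A₀ = F₀^{1/2} (∇Φ | normal)`, with the positive semidefinite square root. -/
noncomputable def A₀ (e : Fin 3 → ℝ → E3) (z : ℝ × ℝ) : Mat3 :=
  cfc Real.sqrt (R.F₀ e z) * R.frameMatrix e z

/-- The density `𝒬_w(x, F)`: the minimum of `𝒬₃(A₀⁻ᵀ G A₀⁻¹)` over the `3 × 3` matrices `G` whose
upper left `2 × 2` block is `F`, with `A₀` taken at `(x₁, w x₂)`. -/
noncomputable def Qw (W : Mat3 → ℝ≥0∞) (e : Fin 3 → ℝ → E3) (w : ℝ) (x : ℝ × ℝ) (F : Mat2) : ℝ :=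
  ⨅ G : {G : Mat3 // ∀ i j : Fin 2, G i.castSucc j.castSucc = F i j},
    Q3 W (((R.A₀ e (x.1, w * x.2))⁻¹)ᵀ * G.1 * (R.A₀ e (x.1, w * x.2))⁻¹)

end FlatGeometry

/-! ### The Sobolev space `W^{2,2}` -/

/-- The rescaled mid-surface `S = (0, L) × (-1/2, 1/2)`. -/
def strip (L : ℝ) : Set (ℝ × ℝ) := Ioo 0 L ×ˢ Ioo (-(1 / 2)) (1 / 2)

/-- The coordinate directions of the plane. -/
def dir : Fin 2 → ℝ × ℝ := ![(1, 0), (0, 1)]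

/-- `g` is the weak partial derivative `∂ᵢ u` on the open set `Ω`. -/
def HasWeakPartial (Ω : Set (ℝ × ℝ)) (i : Fin 2) (u g : ℝ × ℝ → E3) : Prop :=
  ∀ φ : ℝ × ℝ → ℝ, ContDiff ℝ ∞ φ → HasCompactSupport φ → tsupport φ ⊆ Ω →
    ∫ x in Ω, (fderiv ℝ φ x (dir i)) • u x = -∫ x in Ω, φ x • g x

/-- A map in `W^{2,2}(Ω; ℝ³)`, together with (representatives of) its weak derivatives. -/
structure W22 (Ω : Set (ℝ × ℝ)) where
  toFun : ℝ × ℝ → E3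
  grad : Fin 2 → ℝ × ℝ → E3
  hess : Fin 2 → Fin 2 → ℝ × ℝ → E3
  memLp_toFun : MemLp toFun 2 (volume.restrict Ω)
  memLp_grad : ∀ i, MemLp (grad i) 2 (volume.restrict Ω)
  memLp_hess : ∀ i j, MemLp (hess i j) 2 (volume.restrict Ω)
  weak_grad : ∀ i, HasWeakPartial Ω i toFun (grad i)
  weak_hess : ∀ i j, HasWeakPartial Ω i (grad j) (hess i j)

namespace W22

variable {Ω : Set (ℝ × ℝ)}

/-- The scaling factors of `∇_w = (∂₁ | w⁻¹ ∂₂)`. -/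
noncomputable def scale (w : ℝ) : Fin 2 → ℝ := ![1, w⁻¹]

/-- The columns of the rescaled gradient `∇_w f = (∂₁f | w⁻¹ ∂₂f)`. -/
noncomputable def gradW (f : W22 Ω) (w : ℝ) (i : Fin 2) (x : ℝ × ℝ) : E3 :=
  scale w i • f.grad i x

/-- The normal of `f`, computed from the rescaled gradient. -/
noncomputable def normal (f : W22 Ω) (w : ℝ) (x : ℝ × ℝ) : E3 :=
  unitNormal (f.gradW w 0 x) (f.gradW w 1 x)

/-- The rescaled second fundamental form of `f`. -/
noncomputable def secondForm (f : W22 Ω) (w : ℝ) (x : ℝ × ℝ) : Mat2 :=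
  Matrix.of fun i j => inner ℝ ((scale w i * scale w j) • f.hess i j x) (f.normal w x)

end W22

/-! ### The plate energy -/

namespace FlatGeometry

variable (R : FlatGeometry)

/-- `f` is a rescaled isometric immersion: `∇_w fᵀ ∇_w f (x) = 𝔞(x₁, w x₂)` a.e. -/
def IsIsometric (L w : ℝ) (f : W22 (strip L)) : Prop :=
  ∀ᵐ x ∂(volume.restrict (strip L)), ∀ i j : Fin 2,
    inner ℝ (f.gradW w i x) (f.gradW w j x) = R.metric (x.1, w * x.2) i j

/-- The energy density `𝒬_w(x, II_f - II)` of the plate energy. -/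
noncomputable def density (W : Mat3 → ℝ≥0∞) (e : Fin 3 → ℝ → E3) (L w : ℝ)
    (f : W22 (strip L)) (x : ℝ × ℝ) : ℝ :=
  R.Qw W e w x (f.secondForm w x - R.II (x.1, w * x.2))

/-- The plate energy: one twelfth of the average of the density over `S`. -/
noncomputable def plateEnergy (W : Mat3 → ℝ≥0∞) (e : Fin 3 → ℝ → E3) (L w : ℝ)
    (f : W22 (strip L)) : ℝ :=
  (1 / 12) * ⨍ x in strip L, R.density W e L w f x

/-- The values of the plate energy on rescaled isometric immersions. -/
def energyValues (W : Mat3 → ℝ≥0∞) (e : Fin 3 → ℝ → E3) (L w : ℝ) : Set ℝ :=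
  {E | ∃ f : W22 (strip L), R.IsIsometric L w f ∧ E = R.plateEnergy W e L w f}

/-- The infimum of the plate energy over rescaled isometric immersions. -/
noncomputable def infEnergy (W : Mat3 → ℝ≥0∞) (e : Fin 3 → ℝ → E3) (L w : ℝ) : ℝ :=
  sInf (R.energyValues W e L w)

/-- `II_f - II⁰` on `S`, for the rescaled second form of `f`. -/
noncomputable def deviation (L w : ℝ) (f : W22 (strip L)) (x : ℝ × ℝ) : Mat2 :=
  f.secondForm w x - R.II0 x.1

/-- `∫ II_f dx₂ - II⁰` on the midline, for the rescaled second form of `f`. -/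
noncomputable def meanDeviation (L w : ℝ) (f : W22 (strip L)) (s : ℝ) : Mat2 :=
  (Matrix.of fun i j => ∫ r in (-(1 / 2) : ℝ)..(1 / 2), f.secondForm w (s, r) i j) - R.II0 s

end FlatGeometry

end Ribbon

/-! The energy sees an isometric immersion only through its second form $A$, and all that is used
about $A$ is that it is an $L^2$ solution of the rescaled Gauss and Codazzi equations
(`isGaussCodazzi_secondForm`). The immersions are merely $W^{2,2}$, so these equations are derived
from a weak Jacobian identity, in which no third derivatives occur.

Compactness. Write $A = \mathrm{II}^0 + wQ$, where $Q$ (`quot`) stays bounded in $L^2$ when the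
rescaled energy does. At leading order the Codazzi equations say that $\partial_2$ of the first row
of $Q - x_2\Theta$ tends to zero in distributions, where the first row of $\Theta$ (`slope`) is read
off from $\kappa$ and $\mathrm{II}^0$. The linearised Gauss equation, solvable because $l_0 \ne 0$,
transfers this to the lower right entry. Hence the oscillation $Q - x_2\Theta$ becomes independent
of $x_2$, in the sense that its moments against $x_2 c(x_1)$ vanish in the limit (`tendsto_moment`).

Splitting. Up to a uniformly small error, $(A - \mathrm{II})/w$ is the sum of the oscillation and of
$x_2(\Theta - \partial_2\mathrm{II})$ (`gap`). In the quadratic energy the cross term is a first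
moment of the oscillation and drops out, so the rescaled energy is the energy of the oscillation
plus that of $x_2$ times the gap, up to $o(1)$ (`tendsto_formEnergy_sub`). The first summand is
nonnegative, which is the lower bound.

Recovery. The developable surface ruled along the kernel of $\mathrm{II}^0$ has as second form a
fixed smooth field equal to $\mathrm{II}^0$ on the midline. The moment statement applied to this
family shows that its transversal derivative is $\Theta$, so its oscillation vanishes in the limit
(`exists_recovery`). The infima therefore converge to the gap energy, up to the factor $1/(12L)$. Up
to sign, the entries of the gap are the two Codazzi deficits and the corrected Gauss deficit divided
by $l_0$ (`gapEnergy_bounds`). For almost minimizers the energy of the oscillation tends to zero,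
hence by coercivity the oscillation does so in $L^2$; averaging over $x_2$ removes $x_2\Theta$ and
gives the last claim.

Energy density. $\mathcal Q_w$ is a Schur complement of the Hessian of $\mathcal W$ at the identity.
That Hessian vanishes exactly on skew matrices, so the complement is coercive on symmetric ones. On
the midline $A_0$ is orthogonal, which is why the bounds depend on $\mathcal W$ alone
(`exists_isPlateForm`). -/

namespace Ribbon

/-! ### Square-integrable functions -/

section SquareIntegrable

variable {α : Type*} [MeasurableSpace α] {μ : Measure α}

theorem integrable_mul_of_memLp_two {f g : α → ℝ} (hf : MemLp f 2 μ) (hg : MemLp g 2 μ) :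
    Integrable (fun x => f x * g x) μ :=
  hf.integrable_mul hg

theorem integrable_sq_of_memLp_two {f : α → ℝ} (hf : MemLp f 2 μ) :
    Integrable (fun x => f x ^ 2) μ :=
  hf.integrable_sq

theorem integral_linear_combination {f g h : α → ℝ} (hf : Integrable f μ) (hg : Integrable g μ)
    (hh : Integrable h μ) (a b c : ℝ) :
    ∫ x, (a * f x + b * g x + c * h x) ∂μ
      = a * (∫ x, f x ∂μ) + b * (∫ x, g x ∂μ) + c * ∫ x, h x ∂μ := by
  have h1 : Integrable (fun x => a * f x + b * g x) μ := (hf.const_mul a).add (hg.const_mul b)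
  rw [integral_add h1 (hh.const_mul c), integral_add (hf.const_mul a) (hg.const_mul b),
    integral_const_mul, integral_const_mul, integral_const_mul]

theorem eLpNorm_two_eq {E : Type*} [NormedAddCommGroup E] {f : α → E} (hf : MemLp f 2 μ) :
    eLpNorm f 2 μ = ENNReal.ofReal √(∫ x, ‖f x‖ ^ 2 ∂μ) := by
  rw [hf.eLpNorm_eq_integral_rpow_norm (by norm_num) (by norm_num), Real.sqrt_eq_rpow]
  norm_num

theorem integral_mul_sq_le {f g : α → ℝ} (hf : MemLp f 2 μ) (hg : MemLp g 2 μ) :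
    (∫ x, f x * g x ∂μ) ^ 2 ≤ (∫ x, f x ^ 2 ∂μ) * ∫ x, g x ^ 2 ∂μ := by
  have hff := hf.integrable_sq
  have hgg := hg.integrable_sq
  have hfg := integrable_mul_of_memLp_two hf hg
  have key : ∀ t : ℝ, 0 ≤ (∫ x, g x ^ 2 ∂μ) * (t * t) + (2 * ∫ x, f x * g x ∂μ) * t
      + ∫ x, f x ^ 2 ∂μ := by
    intro t
    have h : ∫ x, (f x + t * g x) ^ 2 ∂μ = (∫ x, g x ^ 2 ∂μ) * (t * t)
        + (2 * ∫ x, f x * g x ∂μ) * t + ∫ x, f x ^ 2 ∂μ := by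
      have e : (fun x => (f x + t * g x) ^ 2)
          = fun x => (t * t) * g x ^ 2 + (2 * t) * (f x * g x) + 1 * f x ^ 2 := by
        funext x; ring
      rw [e, integral_linear_combination hgg hfg hff]
      ring
    rw [← h]
    exact integral_nonneg fun x => sq_nonneg _
  have := discrim_le_zero key
  rw [discrim] at this
  nlinarith

/-- Strong convergence in `L²` implies convergence of the pairings. -/
theorem tendsto_integral_mul_of_tendsto_sq {ι : Type*} {l : Filter ι} {f g : α → ℝ}
    {u : ι → α → ℝ} (hf : MemLp f 2 μ) (hg : MemLp g 2 μ) (hu : ∀ᶠ n in l, MemLp (u n) 2 μ)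
    (h : Tendsto (fun n => ∫ x, (u n x - g x) ^ 2 ∂μ) l (𝓝 0)) :
    Tendsto (fun n => ∫ x, f x * u n x ∂μ) l (𝓝 (∫ x, f x * g x ∂μ)) := by
  rw [tendsto_iff_norm_sub_tendsto_zero]
  have h2 : Tendsto (fun n => √((∫ x, f x ^ 2 ∂μ) * ∫ x, (u n x - g x) ^ 2 ∂μ)) l (𝓝 0) := by
    have := (h.const_mul (∫ x, f x ^ 2 ∂μ)).sqrt
    simpa using this
  refine squeeze_zero' (.of_forall fun _ => norm_nonneg _) ?_ h2
  filter_upwards [hu] with n hn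
  rw [← integral_sub (integrable_mul_of_memLp_two hf hn) (integrable_mul_of_memLp_two hf hg)]
  apply Real.le_sqrt_of_sq_le
  rw [Real.norm_eq_abs, sq_abs]
  have := integral_mul_sq_le hf (hn.sub hg)
  simp only [Pi.sub_apply] at this
  simpa only [mul_sub] using this

theorem integral_add_sq_le {f g : α → ℝ} (hf : MemLp f 2 μ) (hg : MemLp g 2 μ) :
    ∫ x, (f x + g x) ^ 2 ∂μ ≤ 2 * (∫ x, f x ^ 2 ∂μ) + 2 * ∫ x, g x ^ 2 ∂μ := by
  rw [← integral_const_mul, ← integral_const_mul,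
    ← integral_add (hf.integrable_sq.const_mul _) (hg.integrable_sq.const_mul _)]
  refine integral_mono (hf.add hg).integrable_sq
    ((hf.integrable_sq.const_mul _).add (hg.integrable_sq.const_mul _)) fun x => ?_
  show (f x + g x) ^ 2 ≤ 2 * f x ^ 2 + 2 * g x ^ 2
  nlinarith [sq_nonneg (f x - g x)]

end SquareIntegrable

/-! ### Mollification in the plane -/

/-- The standard mollifiers. -/
noncomputable def bump (n : ℕ) : ContDiffBump (0 : ℝ × ℝ) where
  rIn := 1 / (2 * (n + 1))
  rOut := 1 / (n + 1)
  rIn_pos := by positivity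
  rIn_lt_rOut := by
    have : (0 : ℝ) < n + 1 := by positivity
    exact one_div_lt_one_div_of_lt this (by linarith)

/-- The mollification of a function on the plane. -/
noncomputable def mollify (n : ℕ) (g : ℝ × ℝ → ℝ) : ℝ × ℝ → ℝ :=
  convolution ((bump n).normed volume) g (ContinuousLinearMap.lsmul ℝ ℝ) volume

theorem mollify_apply (n : ℕ) (g : ℝ × ℝ → ℝ) (x : ℝ × ℝ) :
    mollify n g x = ∫ y, (bump n).normed volume y * g (x - y) := rfl

theorem mollify_apply' (n : ℕ) (g : ℝ × ℝ → ℝ) (x : ℝ × ℝ) :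
    mollify n g x = ∫ y, (bump n).normed volume (x - y) * g y := by
  rw [mollify, convolution_eq_swap]; rfl

theorem contDiff_mollify (n : ℕ) {g : ℝ × ℝ → ℝ} (hg : LocallyIntegrable g volume) :
    ContDiff ℝ ∞ (mollify n g) :=
  (bump n).hasCompactSupport_normed.contDiff_convolution_left _ (bump n).contDiff_normed hg

theorem integrable_bump (n : ℕ) : Integrable ((bump n).normed volume) (volume : Measure (ℝ × ℝ)) :=
  (bump n).integrable_normed

theorem memLp_two_locallyIntegrable {g : ℝ × ℝ → ℝ} (hg : MemLp g 2 volume) :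
    LocallyIntegrable g volume :=
  hg.locallyIntegrable (by norm_num)

theorem integrable_bump_mul (n : ℕ) {g : ℝ × ℝ → ℝ} (hg : LocallyIntegrable g volume)
    (x : ℝ × ℝ) : Integrable (fun y => (bump n).normed volume y * g (x - y)) := by
  have := ((bump n).hasCompactSupport_normed (μ := (volume : Measure (ℝ × ℝ)))).convolutionExists_left
    (ContinuousLinearMap.lsmul ℝ ℝ) (bump n).continuous_normed hg x
  exact this

theorem mollify_sub (n : ℕ) {g h : ℝ × ℝ → ℝ} (hg : LocallyIntegrable g volume)
    (hh : LocallyIntegrable h volume) (x : ℝ × ℝ) :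
    mollify n (fun y => g y - h y) x = mollify n g x - mollify n h x := by
  simp only [mollify_apply, mul_sub]
  exact integral_sub (integrable_bump_mul n hg x) (integrable_bump_mul n hh x)

/-- Jensen's inequality for the probability density `bump n`: expand the nonnegative average of $(g
- c)^2$, where $c$ is the average of $g$. -/
theorem mollify_sq_le (n : ℕ) {g : ℝ × ℝ → ℝ} (hg : MemLp g 2 volume) (x : ℝ × ℝ) :
    mollify n g x ^ 2 ≤ mollify n (fun y => g y ^ 2) x := by
  have h1 := integrable_bump_mul n (memLp_two_locallyIntegrable hg) x
  have h2 := integrable_bump_mul n hg.integrable_sq.locallyIntegrable x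
  set c := mollify n g x with hc
  have h3 : 0 ≤ ∫ y, (bump n).normed volume y * (g (x - y) - c) ^ 2 :=
    integral_nonneg fun y => mul_nonneg ((bump n).nonneg_normed y) (sq_nonneg _)
  have e : (fun y => (bump n).normed volume y * (g (x - y) - c) ^ 2)
      = fun y => 1 * ((bump n).normed volume y * g (x - y) ^ 2)
        + (-(2 * c)) * ((bump n).normed volume y * g (x - y))
        + c ^ 2 * (bump n).normed volume y := by
    funext y; ring
  rw [e, integral_linear_combination h2 h1 (integrable_bump n), (bump n).integral_normed, ← mollify_apply, ← hc] at h3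
  rw [mollify_apply n (fun y => g y ^ 2)]
  nlinarith

theorem memLp_mollify (n : ℕ) {g : ℝ × ℝ → ℝ} (hg : MemLp g 2 volume) :
    MemLp (mollify n g) 2 volume := by
  have hc := (contDiff_mollify n (memLp_two_locallyIntegrable hg)).continuous
  rw [memLp_two_iff_integrable_sq hc.aestronglyMeasurable]
  refine Integrable.mono' (g := mollify n (fun y => g y ^ 2)) ?_
    (hc.pow 2).aestronglyMeasurable (.of_forall fun x => ?_)
  · exact (integrable_bump n).integrable_convolution (ContinuousLinearMap.lsmul ℝ ℝ)
      hg.integrable_sq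
  · rw [Real.norm_eq_abs, abs_of_nonneg (sq_nonneg _)]
    exact mollify_sq_le n hg x

theorem integral_mollify_sq_le (n : ℕ) {g : ℝ × ℝ → ℝ} (hg : MemLp g 2 volume) :
    ∫ x, mollify n g x ^ 2 ≤ ∫ x, g x ^ 2 := by
  have h : ∫ x, mollify n (fun y => g y ^ 2) x = ∫ x, g x ^ 2 := by
    have := integral_convolution (μ := (volume : Measure (ℝ × ℝ)))
      (ν := (volume : Measure (ℝ × ℝ))) (ContinuousLinearMap.lsmul ℝ ℝ)
      (integrable_bump n) hg.integrable_sq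
    rw [(bump n).integral_normed] at this
    simpa [mollify] using this
  rw [← h]
  exact integral_mono (memLp_mollify n hg).integrable_sq
    ((integrable_bump n).integrable_convolution (ContinuousLinearMap.lsmul ℝ ℝ) hg.integrable_sq)
    fun x => mollify_sq_le n hg x

/-- Dominated convergence: the mollifications are bounded by the same constant as `g` and all live
in the 1-neighbourhood of its support, because the mollification radii are at most 1. -/
theorem tendsto_mollify_of_continuous {g : ℝ × ℝ → ℝ} (hg : Continuous g)
    (hs : HasCompactSupport g) :
    Tendsto (fun n => ∫ x, (mollify n g x - g x) ^ 2) atTop (𝓝 0) := by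
  obtain ⟨C, hC⟩ := hs.exists_bound_of_continuous hg
  have hC0 : 0 ≤ C := (norm_nonneg _).trans (hC 0)
  set K := Metric.cthickening 1 (tsupport g) with hK
  have hKc : IsCompact K := hs.isCompact.cthickening
  have hr : Tendsto (fun n => (bump n).rOut) atTop (𝓝 0) := tendsto_one_div_add_atTop_nhds_zero_nat
  have hpt : ∀ x, Tendsto (fun n => (mollify n g x - g x) ^ 2) atTop (𝓝 0) := fun x => by
    have h := ContDiffBump.convolution_tendsto_right_of_continuous
      (μ := (volume : Measure (ℝ × ℝ))) hr hg x
    have := (h.sub_const (g x)).pow 2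
    simpa [mollify] using this
  have hb : ∀ n x, |mollify n g x| ≤ C := fun n x => by
    rw [mollify_apply]
    have h : ‖∫ y, (bump n).normed volume y * g (x - y)‖ ≤ ∫ y, (bump n).normed volume y * C := by
      refine norm_integral_le_of_norm_le ((integrable_bump n).mul_const C) (.of_forall fun y => ?_)
      rw [norm_mul, Real.norm_of_nonneg ((bump n).nonneg_normed y)]
      exact mul_le_mul_of_nonneg_left (hC _) ((bump n).nonneg_normed y)
    rwa [integral_mul_const, (bump n).integral_normed, one_mul] at h
  have hz : ∀ n x, x ∉ K → mollify n g x = 0 := fun n x hx => by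
    rw [mollify_apply]
    refine integral_eq_zero_of_ae (.of_forall fun y => ?_)
    by_cases hy : y ∈ Metric.ball (0 : ℝ × ℝ) (bump n).rOut
    · have : x - y ∉ tsupport g := fun h => hx <| by
        refine Metric.mem_cthickening_of_dist_le x (x - y) 1 _ h ?_
        rw [dist_eq_norm, sub_sub_cancel]
        rw [mem_ball_zero_iff] at hy
        have : (bump n).rOut ≤ 1 := by
          show (1 : ℝ) / (n + 1) ≤ 1
          rw [div_le_one (by positivity)]
          linarith [(Nat.cast_nonneg n : (0 : ℝ) ≤ n)]
        linarith
      simp [image_eq_zero_of_notMem_tsupport this]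
    · rw [← (bump n).support_normed_eq (μ := volume), Function.notMem_support] at hy
      simp [hy]
  have := tendsto_integral_of_dominated_convergence (μ := (volume : Measure (ℝ × ℝ)))
    (F := fun n x => (mollify n g x - g x) ^ 2) (f := fun _ => 0)
    (K.indicator fun _ => (2 * C) ^ 2)
    (fun n => (((contDiff_mollify n hg.locallyIntegrable).continuous.sub hg).pow 2).aestronglyMeasurable)
    ((integrable_indicator_iff hKc.measurableSet).2
      (integrableOn_const (hs := hKc.measure_lt_top.ne)))
    (fun n => .of_forall fun x => ?_) (.of_forall hpt)
  · simpa using this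
  · by_cases hx : x ∈ K
    · rw [indicator_of_mem hx, Real.norm_eq_abs, abs_of_nonneg (sq_nonneg _)]
      have h1 := abs_le.1 (hb n x)
      have h2 := abs_le.1 (hC x)
      exact sq_le_sq' (by linarith) (by linarith)
    · have : g x = 0 := image_eq_zero_of_notMem_tsupport fun h =>
        hx (Metric.self_subset_cthickening _ h)
      simp [hx, hz n x hx, this]

theorem tendsto_mollify {g : ℝ × ℝ → ℝ} (hg : MemLp g 2 volume) :
    Tendsto (fun n => ∫ x, (mollify n g x - g x) ^ 2) atTop (𝓝 0) := by
  rw [Metric.tendsto_atTop]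
  intro ε hε
  -- Mollification is a contraction of $L^2$, so it suffices to treat a continuous approximation.
  -- The three errors enter with weights 2, 4, 4, hence $10\varepsilon/16 < \varepsilon$ in total.
  obtain ⟨h, hs, hh, hhc, hhL⟩ : ∃ h : ℝ × ℝ → ℝ, HasCompactSupport h ∧
      (∫ x, (g x - h x) ^ 2) ≤ ε / 16 ∧ Continuous h ∧ MemLp h 2 volume := by
    obtain ⟨h, hs, hh, hhc⟩ := hg.exist_eLpNorm_sub_le (by norm_num) (by norm_num)
      (show 0 < √(ε / 16) by positivity)
    have hhL : MemLp h 2 volume := hh.continuous.memLp_of_hasCompactSupport hs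
    refine ⟨h, hs, ?_, hh.continuous, hhL⟩
    rw [eLpNorm_two_eq (hg.sub hhL), ENNReal.ofReal_le_ofReal_iff (Real.sqrt_nonneg _)] at hhc
    simpa using (Real.sqrt_le_sqrt_iff (by positivity)).1 hhc
  have h1 := tendsto_mollify_of_continuous hhc hs
  obtain ⟨N, hN⟩ := Metric.tendsto_atTop.1 h1 (ε / 16) (by positivity)
  refine ⟨N, fun n hn => ?_⟩
  have hN' := hN n hn
  rw [Real.dist_eq, sub_zero, abs_of_nonneg (integral_nonneg fun x => sq_nonneg _)] at hN' ⊢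
  have e : ∀ x, mollify n g x - g x
      = mollify n (fun y => g y - h y) x + ((mollify n h x - h x) + (h x - g x)) := fun x => by
    rw [mollify_sub n (memLp_two_locallyIntegrable hg) (memLp_two_locallyIntegrable hhL)]; ring
  simp only [e]
  have m1 := memLp_mollify n (hg.sub hhL)
  have m2 := (memLp_mollify n hhL).sub hhL
  have m3 := hhL.sub hg
  have a1 := integral_add_sq_le m1 (m2.add m3)
  have a2 := integral_add_sq_le m2 m3
  have a3 := integral_mollify_sq_le n (hg.sub hhL)
  simp only [Pi.sub_apply, Pi.add_apply] at a1 a2 a3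
  have a4 : ∫ x, (h x - g x) ^ 2 = ∫ x, (g x - h x) ^ 2 := by
    congr 1; funext x; ring
  rw [show (fun x => g x - h x) = g - h from rfl]
  linarith

theorem fderiv_mollify (n : ℕ) {g : ℝ × ℝ → ℝ} (hg : LocallyIntegrable g volume) (x v : ℝ × ℝ) :
    fderiv ℝ (mollify n g) x v
      = ∫ y, fderiv ℝ ((bump n).normed volume) (x - y) v * g y := by
  have hc := (bump n).hasCompactSupport_normed (μ := (volume : Measure (ℝ × ℝ)))
  have hd : ContDiff ℝ 1 ((bump n).normed (volume : Measure (ℝ × ℝ))) := (bump n).contDiff_normed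
  have h := hc.hasFDerivAt_convolution_left (ContinuousLinearMap.lsmul ℝ ℝ) hd hg x
  rw [show mollify n g = convolution ((bump n).normed volume) g
    (ContinuousLinearMap.lsmul ℝ ℝ) volume from rfl, h.fderiv, convolution_eq_swap,
    ContinuousLinearMap.integral_apply]
  · rfl
  · have := (hc.fderiv ℝ).convolutionExists_left
      ((ContinuousLinearMap.lsmul ℝ ℝ : ℝ →L[ℝ] ℝ →L[ℝ] ℝ).precompL (ℝ × ℝ))
      (hd.continuous_fderiv (by norm_num)) hg x
    exact this.integrable_swap

/-! ### Weak partial derivatives of scalar functions -/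

/-- `g` is the weak partial derivative `∂ᵢ u` of the scalar function `u` on `Ω`. -/
def WeakPartial (Ω : Set (ℝ × ℝ)) (i : Fin 2) (u g : ℝ × ℝ → ℝ) : Prop :=
  ∀ φ : ℝ × ℝ → ℝ, ContDiff ℝ ∞ φ → HasCompactSupport φ → tsupport φ ⊆ Ω →
    ∫ x in Ω, fderiv ℝ φ x (dir i) * u x = -∫ x in Ω, φ x * g x

section WeakCalculus

variable {Ω : Set (ℝ × ℝ)}

theorem memLp_indicator_two (hΩ : MeasurableSet Ω) {u : ℝ × ℝ → ℝ}
    (hu : MemLp u 2 (volume.restrict Ω)) : MemLp (Ω.indicator u) 2 volume :=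
  (memLp_indicator_iff_restrict hΩ).2 hu

theorem tsupport_bump_translate (n : ℕ) (x : ℝ × ℝ) :
    tsupport (fun y => (bump n).normed volume (x - y)) ⊆ Metric.closedBall x (bump n).rOut := by
  refine closure_minimal (fun y hy => ?_) Metric.isClosed_closedBall
  have : x - y ∈ Function.support ((bump n).normed (volume : Measure (ℝ × ℝ))) := hy
  rw [(bump n).support_normed_eq, mem_ball_zero_iff] at this
  rw [Metric.mem_closedBall, dist_comm, dist_eq_norm]
  exact this.le

/-- The reflected and translated bump is itself an admissible test function, as long as its support
stays in `Ω`. The sign from the reflection cancels the sign in the definition of the weak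
derivative. -/
theorem fderiv_mollify_indicator (hΩ : MeasurableSet Ω) {i : Fin 2} {u g : ℝ × ℝ → ℝ}
    (h : WeakPartial Ω i u g) (hu : MemLp u 2 (volume.restrict Ω)) {n : ℕ} {x : ℝ × ℝ}
    (hx : Metric.closedBall x (bump n).rOut ⊆ Ω) :
    fderiv ℝ (mollify n (Ω.indicator u)) x (dir i) = mollify n (Ω.indicator g) x := by
  rw [fderiv_mollify n (memLp_two_locallyIntegrable (memLp_indicator_two hΩ hu)), mollify_apply']
  have hd : ContDiff ℝ ∞ ((bump n).normed (volume : Measure (ℝ × ℝ))) := (bump n).contDiff_normed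
  have hts := tsupport_bump_translate n x
  have h1 := h (fun y => (bump n).normed volume (x - y)) (hd.comp (contDiff_const.sub contDiff_id))
    ((isCompact_closedBall x _).of_isClosed_subset (isClosed_tsupport _) hts) (hts.trans hx)
  have h2 : ∀ y, fderiv ℝ (fun y => (bump n).normed volume (x - y)) y (dir i)
      = -fderiv ℝ ((bump n).normed volume) (x - y) (dir i) := fun y => by
    have h3 : HasFDerivAt (fun y : ℝ × ℝ => x - y) (-ContinuousLinearMap.id ℝ (ℝ × ℝ)) y := by
      simpa using (hasFDerivAt_id y).const_sub x
    have h4 := ((hd.differentiable (by norm_num)) (x - y)).hasFDerivAt.comp y h3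
    rw [show (fun y => (bump n).normed volume (x - y))
      = ((bump n).normed volume) ∘ (fun y => x - y) from rfl, h4.fderiv]
    simp
  simp only [h2, neg_mul, integral_neg, neg_inj] at h1
  have e : ∀ (F v : ℝ × ℝ → ℝ), ∫ y, F y * Ω.indicator v y = ∫ y in Ω, F y * v y := fun F v => by
    rw [← integral_indicator hΩ]
    congr 1; funext y
    by_cases hy : y ∈ Ω <;> simp [hy]
  rw [e, e, h1]

/-- Local approximation in `W^{1,2}` by smooth functions. -/
theorem tendsto_setIntegral_mollify (hΩ : MeasurableSet Ω) {u : ℝ × ℝ → ℝ}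
    (hu : MemLp u 2 (volume.restrict Ω)) :
    Tendsto (fun n => ∫ x in Ω, (mollify n (Ω.indicator u) x - u x) ^ 2) atTop (𝓝 0) := by
  have h := memLp_indicator_two hΩ hu
  refine squeeze_zero (fun n => integral_nonneg fun x => sq_nonneg _) (fun n => ?_)
    (tendsto_mollify h)
  have e : ∫ x in Ω, (mollify n (Ω.indicator u) x - u x) ^ 2
      = ∫ x in Ω, (mollify n (Ω.indicator u) x - Ω.indicator u x) ^ 2 :=
    setIntegral_congr_fun hΩ fun x hx => by simp [indicator_of_mem hx]
  rw [e]
  exact setIntegral_le_integral ((memLp_mollify n h).sub h).integrable_sq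
    (.of_forall fun x => sq_nonneg _)

theorem bounded_mul_memLp {μ : Measure (ℝ × ℝ)} {F v : ℝ × ℝ → ℝ} (hF : Continuous F)
    (hs : HasCompactSupport F) (hv : MemLp v 2 μ) : MemLp (fun x => F x * v x) 2 μ := by
  obtain ⟨C, hC⟩ := hs.exists_bound_of_continuous hF
  exact hv.of_le_mul (c := C) (hF.aestronglyMeasurable.mul hv.1) (.of_forall fun x => by
    rw [norm_mul]; exact mul_le_mul_of_nonneg_right (hC x) (norm_nonneg _))

theorem continuous_fderiv_dir {φ : ℝ × ℝ → ℝ} (hφ : ContDiff ℝ ∞ φ) (v : ℝ × ℝ) :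
    Continuous fun x => fderiv ℝ φ x v :=
  (hφ.continuous_fderiv (by norm_num)).clm_apply continuous_const

theorem contDiff_fderiv_dir {φ : ℝ × ℝ → ℝ} (hφ : ContDiff ℝ ∞ φ) (v : ℝ × ℝ) :
    ContDiff ℝ ∞ fun x => fderiv ℝ φ x v :=
  (hφ.fderiv_right (m := ∞) (by norm_num)).clm_apply contDiff_const

theorem hasCompactSupport_fderiv_dir {φ : ℝ × ℝ → ℝ} (hs : HasCompactSupport φ) (v : ℝ × ℝ) :
    HasCompactSupport fun x => fderiv ℝ φ x v :=
  hs.fderiv_apply ℝ v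

theorem tsupport_fderiv_dir_subset (φ : ℝ × ℝ → ℝ) (v : ℝ × ℝ) :
    tsupport (fun x => fderiv ℝ φ x v) ⊆ tsupport φ :=
  tsupport_fderiv_apply_subset ℝ v

theorem fderiv_mul_dir {φ ψ : ℝ × ℝ → ℝ} (hφ : ContDiff ℝ ∞ φ) (hψ : ContDiff ℝ ∞ ψ)
    (x v : ℝ × ℝ) : fderiv ℝ (fun x => φ x * ψ x) x v
      = fderiv ℝ φ x v * ψ x + φ x * fderiv ℝ ψ x v := by
  rw [fderiv_fun_mul (hφ.differentiable (by norm_num) x) (hψ.differentiable (by norm_num) x)]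
  simp; ring

theorem eventually_closedBall_bump_subset (hΩ : IsOpen Ω) {K : Set (ℝ × ℝ)} (hK : IsCompact K)
    (hKΩ : K ⊆ Ω) : ∀ᶠ n in atTop, ∀ x ∈ K, Metric.closedBall x (bump n).rOut ⊆ Ω := by
  obtain ⟨δ, hδ, hd⟩ := hK.exists_cthickening_subset_open hΩ hKΩ
  have hr : Tendsto (fun n => (bump n).rOut) atTop (𝓝 0) := tendsto_one_div_add_atTop_nhds_zero_nat
  filter_upwards [hr.eventually (ge_mem_nhds hδ)] with n hn x hx
  exact (Metric.closedBall_subset_closedBall hn).trans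
    ((Metric.closedBall_subset_cthickening hx δ).trans hd)

/-- The product rule for weak derivatives. -/
theorem WeakPartial.mul (hΩ : IsOpen Ω) {i : Fin 2} {u v gu gv : ℝ × ℝ → ℝ}
    (hu : WeakPartial Ω i u gu) (hv : WeakPartial Ω i v gv)
    (mu : MemLp u 2 (volume.restrict Ω)) (mv : MemLp v 2 (volume.restrict Ω))
    (mgu : MemLp gu 2 (volume.restrict Ω)) (mgv : MemLp gv 2 (volume.restrict Ω)) :
    WeakPartial Ω i (fun x => u x * v x) (fun x => gu x * v x + u x * gv x) := by
  intro φ hφ hs ht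
  -- Only `v` is mollified: then `φ * m n` is a test function for `u`, and each term is the pairing
  -- of a fixed $L^2$ function with a strongly convergent sequence.
  set m := fun n => mollify n (Ω.indicator v) with hm
  have hmd : ∀ n, ContDiff ℝ ∞ (m n) := fun n =>
    contDiff_mollify n (memLp_two_locallyIntegrable (memLp_indicator_two hΩ.measurableSet mv))
  have L1 := tendsto_setIntegral_mollify hΩ.measurableSet mv
  have L2 := tendsto_setIntegral_mollify hΩ.measurableSet mgv
  have M1 : ∀ n, MemLp (mollify n (Ω.indicator v)) 2 (volume.restrict Ω) := fun n =>
    (memLp_mollify n (memLp_indicator_two hΩ.measurableSet mv)).restrict Ω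
  have M2 : ∀ n, MemLp (mollify n (Ω.indicator gv)) 2 (volume.restrict Ω) := fun n =>
    (memLp_mollify n (memLp_indicator_two hΩ.measurableSet mgv)).restrict Ω
  have F1 := bounded_mul_memLp (continuous_fderiv_dir hφ (dir i))
    (hasCompactSupport_fderiv_dir hs (dir i)) mu
  have F2 := bounded_mul_memLp hφ.continuous hs mu
  have F3 := bounded_mul_memLp hφ.continuous hs mgu
  have T1 := tendsto_integral_mul_of_tendsto_sq F1 mv (.of_forall M1) L1
  have T2 := tendsto_integral_mul_of_tendsto_sq F2 mgv (.of_forall M2) L2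
  have T3 := tendsto_integral_mul_of_tendsto_sq F3 mv (.of_forall M1) L1
  have hev := eventually_closedBall_bump_subset hΩ hs.isCompact ht
  have key := tendsto_nhds_unique_of_eventuallyEq (T1.add T2) T3.neg (by
    filter_upwards [hev] with n hn
    have h := hu (fun x => φ x * m n x) (hφ.mul (hmd n)) hs.mul_right
      ((tsupport_mul_subset_left).trans ht)
    rw [← integral_add (integrable_mul_of_memLp_two F1 (M1 n))
      (integrable_mul_of_memLp_two F2 (M2 n))]
    calc _ = ∫ x in Ω, fderiv ℝ (fun x => φ x * m n x) x (dir i) * u x := by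
          congr 1; funext x
          rw [fderiv_mul_dir hφ (hmd n)]
          by_cases hx : x ∈ tsupport φ
          · rw [hm, fderiv_mollify_indicator hΩ.measurableSet hv mv (hn x hx)]; ring
          · rw [image_eq_zero_of_notMem_tsupport hx]; simp only [hm]; ring
      _ = _ := by
          rw [h]; congr 2; funext x; ring)
  rw [← integral_add (integrable_mul_of_memLp_two F1 mv) (integrable_mul_of_memLp_two F2 mgv)]
    at key
  have I1 := integrable_mul_of_memLp_two F1 mv
  have I2 := integrable_mul_of_memLp_two F2 mgv
  have I3 := integrable_mul_of_memLp_two F3 mv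
  rw [integral_add I1 I2] at key
  have e1 : ∫ x in Ω, fderiv ℝ φ x (dir i) * (u x * v x)
      = ∫ x in Ω, fderiv ℝ φ x (dir i) * u x * v x := by
    congr 1; funext x; ring
  have e2 : ∫ x in Ω, φ x * (gu x * v x + u x * gv x)
      = (∫ x in Ω, φ x * gu x * v x) + ∫ x in Ω, φ x * u x * gv x := by
    rw [← integral_add I3 I2]
    congr 1; funext x; ring
  rw [e1, e2]
  linarith

/-- Weak gradients are weakly curl free. -/
theorem WeakPartial.curl {u u₀ u₁ : ℝ × ℝ → ℝ} (h0 : WeakPartial Ω 0 u u₀)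
    (h1 : WeakPartial Ω 1 u u₁) {ψ : ℝ × ℝ → ℝ} (hψ : ContDiff ℝ ∞ ψ) (hs : HasCompactSupport ψ)
    (ht : tsupport ψ ⊆ Ω) :
    ∫ x in Ω, fderiv ℝ ψ x (dir 0) * u₁ x = ∫ x in Ω, fderiv ℝ ψ x (dir 1) * u₀ x := by
  have a := h1 _ (contDiff_fderiv_dir hψ (dir 0)) (hasCompactSupport_fderiv_dir hs _)
    ((tsupport_fderiv_dir_subset ψ _).trans ht)
  have b := h0 _ (contDiff_fderiv_dir hψ (dir 1)) (hasCompactSupport_fderiv_dir hs _)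
    ((tsupport_fderiv_dir_subset ψ _).trans ht)
  -- Testing each weak derivative with a partial derivative of `ψ` produces a mixed second
  -- derivative of `ψ`; the two agree by symmetry.
  have e : ∀ x v w, fderiv ℝ (fun y => fderiv ℝ ψ y v) x w = fderiv ℝ (fderiv ℝ ψ) x w v := by
    intro x v w
    have hd : DifferentiableAt ℝ (fderiv ℝ ψ) x :=
      (hψ.fderiv_right (m := ∞) (by norm_num)).differentiable (by norm_num) x
    rw [fderiv_clm_apply hd (differentiableAt_const v)]
    simp
  have sy : ∀ x v w, fderiv ℝ (fderiv ℝ ψ) x w v = fderiv ℝ (fderiv ℝ ψ) x v w := fun x v w =>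
    (hψ.contDiffAt.isSymmSndFDerivAt (by
      rw [minSmoothness_of_isRCLikeNormedField]
      exact WithTop.coe_le_coe.2 (le_top : (2 : ℕ∞) ≤ ⊤))).eq w v
  simp only [e] at a b
  simp only [sy _ (dir 0)] at a
  rw [a] at b
  linarith

/-- The weak Jacobian identity `∂₁(∂₂u v) - ∂₂(∂₁u v) = ∂₂u ∂₁v - ∂₁u ∂₂v`. -/
theorem WeakPartial.jacobian (hΩ : IsOpen Ω) {u u₀ u₁ v v₀ v₁ : ℝ × ℝ → ℝ}
    (hu0 : WeakPartial Ω 0 u u₀) (hu1 : WeakPartial Ω 1 u u₁)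
    (hv0 : WeakPartial Ω 0 v v₀) (hv1 : WeakPartial Ω 1 v v₁)
    (mu0 : MemLp u₀ 2 (volume.restrict Ω)) (mu1 : MemLp u₁ 2 (volume.restrict Ω))
    (mv : MemLp v 2 (volume.restrict Ω))
    (mv0 : MemLp v₀ 2 (volume.restrict Ω)) (mv1 : MemLp v₁ 2 (volume.restrict Ω))
    {φ : ℝ × ℝ → ℝ} (hφ : ContDiff ℝ ∞ φ) (hs : HasCompactSupport φ) (ht : tsupport φ ⊆ Ω) :
    ∫ x in Ω, (fderiv ℝ φ x (dir 0) * (u₁ x * v x) - fderiv ℝ φ x (dir 1) * (u₀ x * v x))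
      = -∫ x in Ω, φ x * (u₁ x * v₀ x - u₀ x * v₁ x) := by
  set m := fun n => mollify n (Ω.indicator v) with hm
  have hmd : ∀ n, ContDiff ℝ ∞ (m n) := fun n =>
    contDiff_mollify n (memLp_two_locallyIntegrable (memLp_indicator_two hΩ.measurableSet mv))
  have L := fun {w : ℝ × ℝ → ℝ} (mw : MemLp w 2 (volume.restrict Ω)) =>
    tendsto_setIntegral_mollify hΩ.measurableSet mw
  have M := fun {w : ℝ × ℝ → ℝ} (mw : MemLp w 2 (volume.restrict Ω)) (n : ℕ) =>
    (memLp_mollify n (memLp_indicator_two hΩ.measurableSet mw)).restrict Ω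
  have F1 := bounded_mul_memLp (continuous_fderiv_dir hφ (dir 0))
    (hasCompactSupport_fderiv_dir hs (dir 0)) mu1
  have F2 := bounded_mul_memLp (continuous_fderiv_dir hφ (dir 1))
    (hasCompactSupport_fderiv_dir hs (dir 1)) mu0
  have F3 := bounded_mul_memLp hφ.continuous hs mu1
  have F4 := bounded_mul_memLp hφ.continuous hs mu0
  have T1 := tendsto_integral_mul_of_tendsto_sq F1 mv (.of_forall (M mv)) (L mv)
  have T2 := tendsto_integral_mul_of_tendsto_sq F2 mv (.of_forall (M mv)) (L mv)
  have T3 := tendsto_integral_mul_of_tendsto_sq F3 mv0 (.of_forall (M mv0)) (L mv0)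
  have T4 := tendsto_integral_mul_of_tendsto_sq F4 mv1 (.of_forall (M mv1)) (L mv1)
  have hev := eventually_closedBall_bump_subset hΩ hs.isCompact ht
  have key := tendsto_nhds_unique_of_eventuallyEq (T1.add T3) (T2.add T4) (by
    filter_upwards [hev] with n hn
    -- The gradient of `u` is curl free, so it is tested with `φ * m n`. No derivative falls on `u₀`
    -- and `u₁`, which are only square integrable.
    have h := hu0.curl hu1 (hφ.mul (hmd n)) hs.mul_right ((tsupport_mul_subset_left).trans ht)
    rw [← integral_add (integrable_mul_of_memLp_two F1 (M mv n))
      (integrable_mul_of_memLp_two F3 (M mv0 n)),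
      ← integral_add (integrable_mul_of_memLp_two F2 (M mv n))
      (integrable_mul_of_memLp_two F4 (M mv1 n))]
    calc _ = ∫ x in Ω, fderiv ℝ (fun x => φ x * m n x) x (dir 0) * u₁ x := by
          congr 1; funext x
          rw [fderiv_mul_dir hφ (hmd n)]
          by_cases hx : x ∈ tsupport φ
          · rw [hm, fderiv_mollify_indicator hΩ.measurableSet hv0 mv (hn x hx)]; ring
          · rw [image_eq_zero_of_notMem_tsupport hx]; simp only [hm]; ring
      _ = ∫ x in Ω, fderiv ℝ (fun x => φ x * m n x) x (dir 1) * u₀ x := h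
      _ = _ := by
          congr 1; funext x
          rw [fderiv_mul_dir hφ (hmd n)]
          by_cases hx : x ∈ tsupport φ
          · rw [hm, fderiv_mollify_indicator hΩ.measurableSet hv1 mv (hn x hx)]; ring
          · rw [image_eq_zero_of_notMem_tsupport hx]; simp only [hm]; ring)
  have I1 := integrable_mul_of_memLp_two F1 mv
  have I2 := integrable_mul_of_memLp_two F2 mv
  have I3 := integrable_mul_of_memLp_two F3 mv0
  have I4 := integrable_mul_of_memLp_two F4 mv1
  have e1 : ∫ x in Ω, (fderiv ℝ φ x (dir 0) * (u₁ x * v x) - fderiv ℝ φ x (dir 1) * (u₀ x * v x))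
      = (∫ x in Ω, fderiv ℝ φ x (dir 0) * u₁ x * v x)
        - ∫ x in Ω, fderiv ℝ φ x (dir 1) * u₀ x * v x := by
    rw [← integral_sub I1 I2]
    congr 1; funext x; ring
  have e2 : ∫ x in Ω, φ x * (u₁ x * v₀ x - u₀ x * v₁ x)
      = (∫ x in Ω, φ x * u₁ x * v₀ x) - ∫ x in Ω, φ x * u₀ x * v₁ x := by
    rw [← integral_sub I3 I4]
    congr 1; funext x; ring
  rw [e1, e2]
  linarith

/-- A smooth function is its own weak primitive. -/
theorem WeakPartial.of_contDiff {i : Fin 2} {u : ℝ × ℝ → ℝ} (hu : ContDiff ℝ ∞ u) :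
    WeakPartial Ω i u (fun x => fderiv ℝ u x (dir i)) := by
  intro φ hφ hs ht
  have h0 : ∀ F : ℝ × ℝ → ℝ, tsupport F ⊆ Ω → ∫ x in Ω, F x = ∫ x, F x := fun F hF =>
    setIntegral_eq_integral_of_forall_compl_eq_zero fun x hx =>
      image_eq_zero_of_notMem_tsupport fun h => hx (hF h)
  rw [h0 _ ((tsupport_mul_subset_left).trans ((tsupport_fderiv_dir_subset φ _).trans ht)),
    h0 _ ((tsupport_mul_subset_left).trans ht)]
  have := integral_mul_fderiv_eq_neg_fderiv_mul_of_integrable (μ := (volume : Measure (ℝ × ℝ)))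
    (f := φ) (g := u) (v := dir i)
    (((continuous_fderiv_dir hφ _).mul hu.continuous).integrable_of_hasCompactSupport
      (hasCompactSupport_fderiv_dir hs _).mul_right)
    ((hφ.continuous.mul (continuous_fderiv_dir hu _)).integrable_of_hasCompactSupport hs.mul_right)
    ((hφ.continuous.mul hu.continuous).integrable_of_hasCompactSupport hs.mul_right)
    (fun x _ => hφ.differentiable (by norm_num) x) (fun x _ => hu.differentiable (by norm_num) x)
  rw [this, neg_neg]

/-- Weak derivatives are unique. -/
theorem WeakPartial.unique (hΩ : IsOpen Ω) {i : Fin 2} {u g g' : ℝ × ℝ → ℝ}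
    (h : WeakPartial Ω i u g) (h' : WeakPartial Ω i u g')
    (hg : IntegrableOn g Ω) (hg' : IntegrableOn g' Ω) :
    ∀ᵐ x ∂(volume.restrict Ω), g x = g' x := by
  rw [ae_restrict_iff' hΩ.measurableSet]
  have hl : LocallyIntegrableOn (fun x => g x - g' x) Ω volume :=
    (hg.sub hg').locallyIntegrableOn
  filter_upwards [hΩ.ae_eq_zero_of_integral_contDiff_smul_eq_zero hl fun φ hφ hs ht => by
    obtain ⟨C, hC⟩ := hs.exists_bound_of_continuous hφ.continuous
    have e : ∫ x, φ x • (g x - g' x) = ∫ x in Ω, φ x * (g x - g' x) :=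
      (setIntegral_eq_integral_of_forall_compl_eq_zero fun x hx => by
        rw [image_eq_zero_of_notMem_tsupport fun h => hx (ht h), zero_smul]).symm
    have b : ∀ {w : ℝ × ℝ → ℝ}, IntegrableOn w Ω → IntegrableOn (fun x => φ x * w x) Ω :=
      fun hw => hw.bdd_mul hφ.continuous.aestronglyMeasurable (.of_forall hC)
    simp only [mul_sub] at e
    rw [e, integral_sub (b hg) (b hg')]
    have h1 := h φ hφ hs ht
    have h2 := h' φ hφ hs ht
    linarith] with x hx hxΩ
  exact sub_eq_zero.1 (hx hxΩ)

theorem WeakPartial.congr {i : Fin 2} {u u' g g' : ℝ × ℝ → ℝ} (h : WeakPartial Ω i u g)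
    (hu : u =ᵐ[volume.restrict Ω] u') (hg : g =ᵐ[volume.restrict Ω] g') :
    WeakPartial Ω i u' g' := by
  intro φ hφ hs ht
  have e1 : ∫ x in Ω, fderiv ℝ φ x (dir i) * u' x = ∫ x in Ω, fderiv ℝ φ x (dir i) * u x :=
    integral_congr_ae (by filter_upwards [hu] with x hx; rw [hx])
  have e2 : ∫ x in Ω, φ x * g' x = ∫ x in Ω, φ x * g x :=
    integral_congr_ae (by filter_upwards [hg] with x hx; rw [hx])
  rw [e1, e2]
  exact h φ hφ hs ht

end WeakCalculus

end Ribbon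

namespace Ribbon

/-! ### The cross product and orthonormal frames -/

section Cross

theorem inner_eq_sum (u v : E3) : inner ℝ u v = u 0 * v 0 + u 1 * v 1 + u 2 * v 2 := by
  rw [PiLp.inner_apply, Fin.sum_univ_three]
  simp only [RCLike.inner_apply, conj_trivial]
  ring

theorem cross_zero (u v : E3) : cross u v 0 = u 1 * v 2 - u 2 * v 1 := by
  simp [cross, cross_apply]

theorem cross_one (u v : E3) : cross u v 1 = u 2 * v 0 - u 0 * v 2 := by
  simp [cross, cross_apply]

theorem cross_two (u v : E3) : cross u v 2 = u 0 * v 1 - u 1 * v 0 := by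
  simp [cross, cross_apply]

theorem E3.ext_iff' {u v : E3} : u = v ↔ u 0 = v 0 ∧ u 1 = v 1 ∧ u 2 = v 2 := by
  constructor
  · rintro rfl; exact ⟨rfl, rfl, rfl⟩
  · rintro ⟨h0, h1, h2⟩
    ext i; fin_cases i <;> assumption

theorem inner_cross_left (u v : E3) : inner ℝ u (cross u v) = 0 := by
  simp only [inner_eq_sum, cross_zero, cross_one, cross_two]; ring

theorem inner_cross_right (u v : E3) : inner ℝ v (cross u v) = 0 := by
  simp only [inner_eq_sum, cross_zero, cross_one, cross_two]; ring

theorem inner_cross_cross (u v : E3) :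
    inner ℝ (cross u v) (cross u v) = inner ℝ u u * inner ℝ v v - inner ℝ u v ^ 2 := by
  simp only [inner_eq_sum, cross_zero, cross_one, cross_two]; ring

theorem cross_smul_left (c : ℝ) (u v : E3) : cross (c • u) v = c • cross u v := by
  rw [E3.ext_iff']
  simp only [PiLp.smul_apply, smul_eq_mul, cross_zero, cross_one, cross_two]
  refine ⟨?_, ?_, ?_⟩ <;> ring

theorem cross_smul_right (c : ℝ) (u v : E3) : cross u (c • v) = c • cross u v := by
  rw [E3.ext_iff']
  simp only [PiLp.smul_apply, smul_eq_mul, cross_zero, cross_one, cross_two]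
  refine ⟨?_, ?_, ?_⟩ <;> ring

theorem cross_cross_self (u v : E3) :
    cross v (cross u v) = (inner ℝ v v) • u - (inner ℝ u v) • v := by
  rw [E3.ext_iff']
  simp only [PiLp.smul_apply, PiLp.sub_apply, smul_eq_mul, cross_zero, cross_one, cross_two,
    inner_eq_sum]
  refine ⟨?_, ?_, ?_⟩ <;> ring

theorem cross_self_cross (u v : E3) :
    cross u (cross u v) = (inner ℝ u v) • u - (inner ℝ u u) • v := by
  rw [E3.ext_iff']
  simp only [PiLp.smul_apply, PiLp.sub_apply, smul_eq_mul, cross_zero, cross_one, cross_two,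
    inner_eq_sum]
  refine ⟨?_, ?_, ?_⟩ <;> ring

/-- The vector with coordinates `(a, b, c)` in the frame `(u, v, u × v)`. -/
def comb (u v : E3) (a b c : ℝ) : E3 := a • u + b • v + c • cross u v

theorem inner_comb {u v : E3} (hu : inner ℝ u u = 1) (hv : inner ℝ v v = 1)
    (huv : inner ℝ u v = 0) (a b c a' b' c' : ℝ) :
    inner ℝ (comb u v a b c) (comb u v a' b' c') = a * a' + b * b' + c * c' := by
  have h1 := inner_cross_left u v
  have h2 := inner_cross_right u v
  have h3 := inner_cross_cross u v
  have h4 : inner ℝ v u = 0 := by rw [real_inner_comm, huv]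
  have h5 : inner ℝ (cross u v) u = 0 := by rw [real_inner_comm, h1]
  have h6 : inner ℝ (cross u v) v = 0 := by rw [real_inner_comm, h2]
  simp only [comb, inner_add_left, inner_add_right, real_inner_smul_left, real_inner_smul_right,
    hu, hv, huv, h1, h2, h3, h4, h5, h6]
  ring

theorem cross_comb {u v : E3} (hu : inner ℝ u u = 1) (hv : inner ℝ v v = 1)
    (huv : inner ℝ u v = 0) (a b c a' b' c' : ℝ) :
    cross (comb u v a b c) (comb u v a' b' c')
      = comb u v (b * c' - c * b') (c * a' - a * c') (a * b' - b * a') := by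
  have e1 := cross_cross_self u v
  have e2 := cross_self_cross u v
  rw [hv, huv, one_smul, zero_smul, sub_zero] at e1
  rw [hu, huv, one_smul, zero_smul, zero_sub] at e2
  rw [E3.ext_iff'] at e1 e2 ⊢
  simp only [PiLp.neg_apply, cross_zero u, cross_one u, cross_two u, cross_zero v, cross_one v,
    cross_two v] at e1 e2
  obtain ⟨x0, x1, x2⟩ := e1
  obtain ⟨y0, y1, y2⟩ := e2
  simp only [comb, PiLp.smul_apply, PiLp.add_apply, smul_eq_mul, cross_zero, cross_one, cross_two]
  refine ⟨?_, ?_, ?_⟩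
  · linear_combination (b * c' - c * b') * x0 + (a * c' - c * a') * y0
  · linear_combination (b * c' - c * b') * x1 + (a * c' - c * a') * y1
  · linear_combination (b * c' - c * b') * x2 + (a * c' - c * a') * y2

theorem eq_comb {u v : E3} (hu : inner ℝ u u = 1) (hv : inner ℝ v v = 1)
    (huv : inner ℝ u v = 0) (h : E3) :
    h = comb u v (inner ℝ h u) (inner ℝ h v) (inner ℝ h (cross u v)) := by
  have h3 := inner_cross_cross u v
  rw [hu, hv, huv] at h3
  have ho : Orthonormal ℝ ![u, v, cross u v] := by
    rw [orthonormal_iff_ite]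
    intro i j
    have h4 : inner ℝ v u = 0 := by rw [real_inner_comm, huv]
    have h1 := inner_cross_left u v
    have h2 := inner_cross_right u v
    have h5 : inner ℝ (cross u v) u = 0 := by rw [real_inner_comm, h1]
    have h6 : inner ℝ (cross u v) v = 0 := by rw [real_inner_comm, h2]
    fin_cases i <;> fin_cases j <;> simp [hu, hv, huv, h1, h2, h4, h5, h6, h3, -inner_self_eq_norm_sq_to_K]
  have hb : ⊤ ≤ Submodule.span ℝ (range ![u, v, cross u v]) := by
    have := (basisOfOrthonormalOfCardEqFinrank ho (by simp)).span_eq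
    rw [coe_basisOfOrthonormalOfCardEqFinrank] at this
    exact this.ge
  have := (OrthonormalBasis.mk ho hb).sum_repr' h
  rw [Fin.sum_univ_three] at this
  simp only [OrthonormalBasis.coe_mk] at this
  conv_lhs => rw [← this]
  simp only [comb, Matrix.cons_val_zero, Matrix.cons_val_one, Matrix.cons_val]
  rw [real_inner_comm u, real_inner_comm v, real_inner_comm (cross u v)]

end Cross

/-- The algebraic content of the Gauss and Codazzi equations: `g₁, g₂` are the derivatives of an
immersion with metric `diag(p², 1)`, `∂₂p = -κ`, `∂₁p = q`, and `hᵢⱼ` its second derivatives. -/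
theorem hessian_identities {g₁ g₂ h₁₁ h₁₂ h₂₂ : E3} {p q κ : ℝ} (hp : 0 < p)
    (e11 : inner ℝ g₁ g₁ = p ^ 2) (e22 : inner ℝ g₂ g₂ = 1) (e12 : inner ℝ g₁ g₂ = 0)
    (a : inner ℝ h₁₁ g₁ = p * q) (b : inner ℝ h₁₂ g₁ = -(κ * p)) (c : inner ℝ h₁₂ g₂ = 0)
    (d : inner ℝ h₂₂ g₂ = 0) (e : inner ℝ h₁₁ g₂ = κ * p)
    (f : inner ℝ h₂₂ g₁ = 0) :
    let A₁₁ := inner ℝ h₁₁ (unitNormal g₁ g₂)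
    let A₁₂ := inner ℝ h₁₂ (unitNormal g₁ g₂)
    let A₂₂ := inner ℝ h₂₂ (unitNormal g₁ g₂)
    let n₁ := cross h₁₁ g₂ + cross g₁ h₁₂
    let n₂ := cross h₁₂ g₂ + cross g₁ h₂₂
    inner ℝ h₁₂ h₁₂ - inner ℝ h₁₁ h₂₂ = κ ^ 2 - (A₁₁ * A₂₂ - A₁₂ ^ 2) ∧
    inner ℝ h₁₁ (cross g₁ g₂) = p * A₁₁ ∧ inner ℝ h₁₂ (cross g₁ g₂) = p * A₁₂ ∧
    inner ℝ h₂₂ (cross g₁ g₂) = p * A₂₂ ∧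
    inner ℝ h₁₂ n₁ - inner ℝ h₁₁ n₂ = 2 * κ * A₁₁ + 2 * q * A₁₂ + κ * p ^ 2 * A₂₂ ∧
    inner ℝ h₂₂ n₁ - inner ℝ h₁₂ n₂ = q * A₂₂ := by
  intro A₁₁ A₁₂ A₂₂ n₁ n₂
  have hp' : p ≠ 0 := hp.ne'
  -- With the unit tangent `t`, the frame `(t, g₂, t × g₂)` is orthonormal, and all vectors are
  -- compared in its coordinates. Orthonormality of this frame also identifies the unit normal with
  -- `t × g₂`.
  obtain ⟨t, rfl⟩ : ∃ t : E3, g₁ = p • t := ⟨p⁻¹ • g₁, by rw [smul_smul, mul_inv_cancel₀ hp', one_smul]⟩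
  have ht : inner ℝ t t = 1 := by
    rw [real_inner_smul_left, real_inner_smul_right] at e11
    field_simp at e11
    exact e11
  have htg : inner ℝ t g₂ = 0 := by
    rw [real_inner_smul_left] at e12
    simpa [hp'] using e12
  have hn : unitNormal (p • t) g₂ = cross t g₂ := by
    have h1 := inner_cross_cross t g₂
    rw [ht, e22, htg, real_inner_self_eq_norm_sq] at h1
    have h2 : ‖cross t g₂‖ = 1 := by
      have := norm_nonneg (cross t g₂)
      nlinarith
    rw [unitNormal, cross_smul_left, norm_smul, h2, mul_one, Real.norm_of_nonneg hp.le, smul_smul,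
      inv_mul_cancel₀ hp', one_smul]
  rw [real_inner_smul_right] at a b f
  have a' : inner ℝ h₁₁ t = q := mul_left_cancel₀ hp' a
  have b' : inner ℝ h₁₂ t = -κ := mul_left_cancel₀ hp' (by rw [b]; ring)
  have f' : inner ℝ h₂₂ t = 0 := by simpa [hp'] using f
  have x1 := eq_comb ht e22 htg h₁₁
  have x2 := eq_comb ht e22 htg h₁₂
  have x3 := eq_comb ht e22 htg h₂₂
  rw [← hn] at x1 x2 x3
  change h₁₁ = comb t g₂ (inner ℝ h₁₁ t) (inner ℝ h₁₁ g₂) A₁₁ at x1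
  change h₁₂ = comb t g₂ (inner ℝ h₁₂ t) (inner ℝ h₁₂ g₂) A₁₂ at x2
  change h₂₂ = comb t g₂ (inner ℝ h₂₂ t) (inner ℝ h₂₂ g₂) A₂₂ at x3
  rw [a', e] at x1
  rw [b', c] at x2
  rw [f', d] at x3
  have y1 : p • t = comb t g₂ p 0 0 := by simp [comb]
  have y2 : g₂ = comb t g₂ 0 1 0 := by simp [comb]
  have y3 : cross (p • t) g₂ = comb t g₂ 0 0 p := by simp [comb, cross_smul_left]
  have add : ∀ a b c a' b' c' : ℝ, comb t g₂ a b c + comb t g₂ a' b' c'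
      = comb t g₂ (a + a') (b + b') (c + c') := by
    intros; simp only [comb, add_smul]; abel
  have z1 : n₁ = comb t g₂ (-A₁₁) (-(p * A₁₂)) q := by
    show cross h₁₁ g₂ + cross (p • t) h₁₂ = _
    rw [x1, x2, y1]
    conv_lhs => enter [1, 2]; rw [y2]
    rw [cross_comb ht e22 htg, cross_comb ht e22 htg, add]
    congr 1 <;> ring
  have z2 : n₂ = comb t g₂ (-A₁₂) (-(p * A₂₂)) (-κ) := by
    show cross h₁₂ g₂ + cross (p • t) h₂₂ = _
    rw [x2, x3, y1]
    conv_lhs => enter [1, 2]; rw [y2]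
    rw [cross_comb ht e22 htg, cross_comb ht e22 htg, add]
    congr 1 <;> ring
  rw [y3, z1, z2]
  clear_value A₁₁ A₁₂ A₂₂
  rw [x1, x2, x3]
  simp only [inner_comb ht e22 htg]
  refine ⟨?_, ?_, ?_, ?_, ?_, ?_⟩ <;> ring

end Ribbon

namespace Ribbon

/-! ### Weak derivatives of maps into three-space -/

section VectorWeak

variable {Ω : Set (ℝ × ℝ)}

theorem memLp_apply {μ : Measure (ℝ × ℝ)} {u : ℝ × ℝ → E3} (hu : MemLp u 2 μ) (a : Fin 3) :
    MemLp (fun x => u x a) 2 μ :=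
  (EuclideanSpace.proj a : E3 →L[ℝ] ℝ).comp_memLp' hu

theorem memLp_test {φ : ℝ × ℝ → ℝ} (hφ : Continuous φ) (hs : HasCompactSupport φ) :
    MemLp φ 2 (volume.restrict Ω) :=
  (hφ.memLp_of_hasCompactSupport hs).restrict Ω

theorem HasWeakPartial.apply {i : Fin 2} {u g : ℝ × ℝ → E3} (h : HasWeakPartial Ω i u g)
    (hu : MemLp u 2 (volume.restrict Ω)) (hg : MemLp g 2 (volume.restrict Ω)) (a : Fin 3) :
    WeakPartial Ω i (fun x => u x a) (fun x => g x a) := by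
  intro φ hφ hs ht
  have key : ∀ {ψ : ℝ × ℝ → ℝ} {v : ℝ × ℝ → E3}, Continuous ψ → HasCompactSupport ψ →
      MemLp v 2 (volume.restrict Ω) →
      (∫ x in Ω, ψ x • v x) a = ∫ x in Ω, ψ x * v x a := fun hψ hψs hv => by
    rw [eval_integral_piLp fun b => ?_]
    · rfl
    · exact integrable_mul_of_memLp_two (memLp_test hψ hψs) (memLp_apply hv b)
  rw [← key (continuous_fderiv_dir hφ _) (hasCompactSupport_fderiv_dir hs _) hu,
    ← key hφ.continuous hs hg, h φ hφ hs ht]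
  rfl

theorem integrable_test_mul {φ w : ℝ × ℝ → ℝ} (hφ : Continuous φ) (hs : HasCompactSupport φ)
    (hw : IntegrableOn w Ω) : IntegrableOn (fun x => φ x * w x) Ω := by
  obtain ⟨C, hC⟩ := hs.exists_bound_of_continuous hφ
  exact hw.bdd_mul hφ.aestronglyMeasurable (.of_forall hC)

theorem WeakPartial.linear {i : Fin 2} {u v gu gv : ℝ × ℝ → ℝ} (hu : WeakPartial Ω i u gu)
    (hv : WeakPartial Ω i v gv) (mu : IntegrableOn u Ω) (mv : IntegrableOn v Ω)
    (mgu : IntegrableOn gu Ω) (mgv : IntegrableOn gv Ω) (c : ℝ) :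
    WeakPartial Ω i (fun x => u x + c * v x) (fun x => gu x + c * gv x) := by
  intro φ hφ hs ht
  have key : ∀ {ψ s t : ℝ × ℝ → ℝ}, Continuous ψ → HasCompactSupport ψ → IntegrableOn s Ω →
      IntegrableOn t Ω → ∫ x in Ω, ψ x * (s x + c * t x)
        = (∫ x in Ω, ψ x * s x) + c * ∫ x in Ω, ψ x * t x := fun hψ hψs a b => by
    rw [← integral_const_mul, ← integral_add (integrable_test_mul hψ hψs a)
      ((integrable_test_mul hψ hψs b).const_mul c)]
    congr 1; funext x; ring
  rw [key (continuous_fderiv_dir hφ _) (hasCompactSupport_fderiv_dir hs _) mu mv,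
    key hφ.continuous hs mgu mgv, hu φ hφ hs ht, hv φ hφ hs ht]
  ring

theorem WeakPartial.const_mul {i : Fin 2} {u g : ℝ × ℝ → ℝ} (hu : WeakPartial Ω i u g) (c : ℝ) :
    WeakPartial Ω i (fun x => c * u x) (fun x => c * g x) := by
  intro φ hφ hs ht
  have h := hu φ hφ hs ht
  simp only [mul_left_comm _ c, integral_const_mul, h]
  ring

/-- The components of `u` are square integrable with weak partial derivatives those of `g`. -/
structure SobolevPartial (Ω : Set (ℝ × ℝ)) (i : Fin 2) (u g : ℝ × ℝ → E3) : Prop where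
  weak : ∀ a, WeakPartial Ω i (fun x => u x a) (fun x => g x a)
  memLp : ∀ a, MemLp (fun x => u x a) 2 (volume.restrict Ω)
  memLp_partial : ∀ a, MemLp (fun x => g x a) 2 (volume.restrict Ω)

theorem SobolevPartial.weakPartial_inner (hΩ : IsOpen Ω) {i : Fin 2} {u v gu gv : ℝ × ℝ → E3}
    (hu : SobolevPartial Ω i u gu) (hv : SobolevPartial Ω i v gv) :
    WeakPartial Ω i (fun x => inner ℝ (u x) (v x))
      (fun x => inner ℝ (gu x) (v x) + inner ℝ (u x) (gv x)) := by
  have W := fun a => (hu.weak a).mul hΩ (hv.weak a) (hu.memLp a) (hv.memLp a) (hu.memLp_partial a)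
    (hv.memLp_partial a)
  have I := fun a => integrable_mul_of_memLp_two (hu.memLp a) (hv.memLp a)
  have J := fun a => (integrable_mul_of_memLp_two (hu.memLp_partial a) (hv.memLp a)).add
    (integrable_mul_of_memLp_two (hu.memLp a) (hv.memLp_partial a))
  have h := ((W 0).linear (W 1) (I 0) (I 1) (J 0) (J 1) 1)
  have h' := h.linear (W 2) ((I 0).add ((I 1).const_mul 1)) (I 2) ((J 0).add ((J 1).const_mul 1))
    (J 2) 1
  refine h'.congr (.of_forall fun x => ?_) (.of_forall fun x => ?_) <;>
  · simp only [inner_eq_sum]; ring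

theorem integrable_inner {u v : ℝ × ℝ → E3} {μ : Measure (ℝ × ℝ)}
    (hu : ∀ a, MemLp (fun x => u x a) 2 μ) (hv : ∀ a, MemLp (fun x => v x a) 2 μ) :
    Integrable (fun x => inner ℝ (u x) (v x)) μ := by
  simp only [inner_eq_sum]
  exact ((integrable_mul_of_memLp_two (hu 0) (hv 0)).add
    (integrable_mul_of_memLp_two (hu 1) (hv 1))).add (integrable_mul_of_memLp_two (hu 2) (hv 2))

theorem SobolevPartial.jacobian (hΩ : IsOpen Ω) {u u₀ u₁ v v₀ v₁ : ℝ × ℝ → E3}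
    (hu0 : SobolevPartial Ω 0 u u₀) (hu1 : SobolevPartial Ω 1 u u₁)
    (hv0 : SobolevPartial Ω 0 v v₀) (hv1 : SobolevPartial Ω 1 v v₁)
    {φ : ℝ × ℝ → ℝ} (hφ : ContDiff ℝ ∞ φ) (hs : HasCompactSupport φ) (ht : tsupport φ ⊆ Ω) :
    ∫ x in Ω, (fderiv ℝ φ x (dir 0) * inner ℝ (u₁ x) (v x)
        - fderiv ℝ φ x (dir 1) * inner ℝ (u₀ x) (v x))
      = -∫ x in Ω, φ x * (inner ℝ (u₁ x) (v₀ x) - inner ℝ (u₀ x) (v₁ x)) := by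
  have J := fun a => WeakPartial.jacobian hΩ (hu0.weak a) (hu1.weak a) (hv0.weak a) (hv1.weak a)
    (hu0.memLp_partial a) (hu1.memLp_partial a) (hv0.memLp a) (hv0.memLp_partial a)
    (hv1.memLp_partial a) hφ hs ht
  have I1 : ∀ a, IntegrableOn (fun x => fderiv ℝ φ x (dir 0) * (u₁ x a * v x a)
      - fderiv ℝ φ x (dir 1) * (u₀ x a * v x a)) Ω := fun a =>
    (integrable_test_mul (continuous_fderiv_dir hφ _) (hasCompactSupport_fderiv_dir hs _)
      (integrable_mul_of_memLp_two (hu1.memLp_partial a) (hv0.memLp a))).sub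
    (integrable_test_mul (continuous_fderiv_dir hφ _) (hasCompactSupport_fderiv_dir hs _)
      (integrable_mul_of_memLp_two (hu0.memLp_partial a) (hv0.memLp a)))
  have I2 : ∀ a, IntegrableOn (fun x => φ x * (u₁ x a * v₀ x a - u₀ x a * v₁ x a)) Ω := fun a =>
    integrable_test_mul hφ.continuous hs
      ((integrable_mul_of_memLp_two (hu1.memLp_partial a) (hv0.memLp_partial a)).sub
      (integrable_mul_of_memLp_two (hu0.memLp_partial a) (hv1.memLp_partial a)))
  have S1 := integral_linear_combination (I1 0) (I1 1) (I1 2) 1 1 1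
  have S2 := integral_linear_combination (I2 0) (I2 1) (I2 2) 1 1 1
  have e1 : ∫ x in Ω, (fderiv ℝ φ x (dir 0) * inner ℝ (u₁ x) (v x)
        - fderiv ℝ φ x (dir 1) * inner ℝ (u₀ x) (v x)) = _ :=
    Eq.trans (by congr 1; funext x; simp only [inner_eq_sum]; ring) S1
  have e2 : ∫ x in Ω, φ x * (inner ℝ (u₁ x) (v₀ x) - inner ℝ (u₀ x) (v₁ x)) = _ :=
    Eq.trans (by congr 1; funext x; simp only [inner_eq_sum]; ring) S2
  rw [e1, e2, J, J, J]
  ring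

/-- The uniform bounds keep the derivative of the product in $L^2$; two general $W^{1,2}$ factors
would only give an integrable derivative. -/
theorem SobolevPartial.cross_mul (hΩ : IsOpen Ω) {i : Fin 2} {u v gu gv : ℝ × ℝ → E3}
    (hu : SobolevPartial Ω i u gu) (hv : SobolevPartial Ω i v gv) {C : ℝ}
    (bu : ∀ᵐ x ∂(volume.restrict Ω), ‖u x‖ ≤ C) (bv : ∀ᵐ x ∂(volume.restrict Ω), ‖v x‖ ≤ C) :
    SobolevPartial Ω i (fun x => cross (u x) (v x))
      (fun x => cross (gu x) (v x) + cross (u x) (gv x)) := by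
  have W := fun a b => (hu.weak a).mul hΩ (hv.weak b) (hu.memLp a) (hv.memLp b)
    (hu.memLp_partial a) (hv.memLp_partial b)
  have I := fun a b => integrable_mul_of_memLp_two (hu.memLp a) (hv.memLp b)
  have J := fun a b => (integrable_mul_of_memLp_two (hu.memLp_partial a) (hv.memLp b)).add
    (integrable_mul_of_memLp_two (hu.memLp a) (hv.memLp_partial b))
  have D := fun a b => (W a b).linear (W b a) (I a b) (I b a) (J a b) (J b a) (-1)
  have M1 : ∀ {z : ℝ × ℝ → ℝ} (b : Fin 3), MemLp z 2 (volume.restrict Ω) →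
      MemLp (fun x => z x * v x b) 2 (volume.restrict Ω) := fun b hz =>
    hz.of_le_mul (c := C) (hz.1.mul (hv.memLp b).1) (by
      filter_upwards [bv] with x hx
      rw [norm_mul, mul_comm]
      exact mul_le_mul_of_nonneg_right ((PiLp.norm_apply_le (v x) b).trans hx) (norm_nonneg _))
  have M2 : ∀ {z : ℝ × ℝ → ℝ} (b : Fin 3), MemLp z 2 (volume.restrict Ω) →
      MemLp (fun x => u x b * z x) 2 (volume.restrict Ω) := fun b hz =>
    hz.of_le_mul (c := C) ((hu.memLp b).1.mul hz.1) (by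
      filter_upwards [bu] with x hx
      rw [norm_mul]
      exact mul_le_mul_of_nonneg_right ((PiLp.norm_apply_le (u x) b).trans hx) (norm_nonneg _))
  have N1 := fun a b => (M1 b (hu.memLp a)).sub (M1 a (hu.memLp b))
  have N2 := fun a b => ((M1 b (hu.memLp_partial a)).sub (M1 a (hu.memLp_partial b))).add
    ((M2 a (hv.memLp_partial b)).sub (M2 b (hv.memLp_partial a)))
  refine ⟨fun a => ?_, fun a => ?_, fun a => ?_⟩
  · have key : ∀ b c, (∀ s t : E3, cross s t a = s b * t c - s c * t b) →
        WeakPartial Ω i (fun x => cross (u x) (v x) a)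
          (fun x => (cross (gu x) (v x) + cross (u x) (gv x)) a) := fun b c h => by
      refine (D b c).congr (.of_forall fun x => ?_) (.of_forall fun x => ?_)
      · simp only [h]; ring
      · simp only [PiLp.add_apply, h]; ring
    fin_cases a
    · exact key 1 2 cross_zero
    · exact key 2 0 cross_one
    · exact key 0 1 cross_two
  · fin_cases a
    · exact (N1 1 2).ae_eq (.of_forall fun x => (cross_zero _ _).symm)
    · exact (N1 2 0).ae_eq (.of_forall fun x => (cross_one _ _).symm)
    · exact (N1 0 1).ae_eq (.of_forall fun x => (cross_two _ _).symm)
  · have key : ∀ b c, (∀ s t : E3, cross s t a = s b * t c - s c * t b) →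
        MemLp (fun x => (cross (gu x) (v x) + cross (u x) (gv x)) a) 2
          (volume.restrict Ω) := fun b c h => by
      refine (N2 b c).ae_eq (.of_forall fun x => ?_)
      simp only [PiLp.add_apply, Pi.add_apply, Pi.sub_apply, h]
    fin_cases a
    · exact key 1 2 cross_zero
    · exact key 2 0 cross_one
    · exact key 0 1 cross_two

end VectorWeak

/-! ### The Gauss and Codazzi equations -/

theorem isOpen_strip (L : ℝ) : IsOpen (strip L) := isOpen_Ioo.prod isOpen_Ioo

theorem measurableSet_strip (L : ℝ) : MeasurableSet (strip L) := (isOpen_strip L).measurableSet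

namespace FlatGeometry

variable (R : FlatGeometry)

/-- The length density `1 - κ z₂` of the midline parallels, in rescaled coordinates. -/
def len (w : ℝ) (x : ℝ × ℝ) : ℝ := 1 - R.κ x.1 * (w * x.2)

/-- The first derivative `∂₁` of `len`. -/
noncomputable def len' (w : ℝ) (x : ℝ × ℝ) : ℝ := -(deriv R.κ x.1 * (w * x.2))

/-- A field of symmetric matrices that solves the rescaled Gauss and Codazzi equations. -/
structure IsGaussCodazzi (L w : ℝ) (A : ℝ × ℝ → Mat2) : Prop where
  memLp : ∀ i j, MemLp (fun x => A x i j) 2 (volume.restrict (strip L))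
  symm : ∀ᵐ x ∂(volume.restrict (strip L)), A x 1 0 = A x 0 1
  gauss : ∀ᵐ x ∂(volume.restrict (strip L)), A x 0 0 * A x 1 1 - A x 0 1 ^ 2 = 0
  codazzi₁ : ∀ φ : ℝ × ℝ → ℝ, ContDiff ℝ ∞ φ → HasCompactSupport φ → tsupport φ ⊆ strip L →
    ∫ x in strip L, (fderiv ℝ φ x (dir 0) * (R.len w x * A x 0 1)
        - w⁻¹ * fderiv ℝ φ x (dir 1) * (R.len w x * A x 0 0))
      = -∫ x in strip L, φ x * (2 * R.κ x.1 * A x 0 0 + 2 * R.len' w x * A x 0 1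
          + R.κ x.1 * R.len w x ^ 2 * A x 1 1)
  codazzi₂ : ∀ φ : ℝ × ℝ → ℝ, ContDiff ℝ ∞ φ → HasCompactSupport φ → tsupport φ ⊆ strip L →
    ∫ x in strip L, (fderiv ℝ φ x (dir 0) * (R.len w x * A x 1 1)
        - w⁻¹ * fderiv ℝ φ x (dir 1) * (R.len w x * A x 0 1))
      = -∫ x in strip L, φ x * (R.len' w x * A x 1 1)

theorem contDiff_len (w : ℝ) : ContDiff ℝ ∞ (R.len w) :=
  contDiff_const.sub ((R.smooth_κ.comp contDiff_fst).mul (contDiff_const.mul contDiff_snd))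

theorem hasFDerivAt_κ (x : ℝ × ℝ) : HasFDerivAt (fun y : ℝ × ℝ => R.κ y.1)
    (deriv R.κ x.1 • ContinuousLinearMap.fst ℝ ℝ ℝ) x :=
  ((R.smooth_κ.differentiable (by norm_num)) x.1).hasDerivAt.comp_hasFDerivAt x hasFDerivAt_fst

theorem hasFDerivAt_len (w : ℝ) (x : ℝ × ℝ) : HasFDerivAt (R.len w)
    (R.len' w x • ContinuousLinearMap.fst ℝ ℝ ℝ
      + (-(R.κ x.1 * w)) • ContinuousLinearMap.snd ℝ ℝ ℝ) x := by
  have h : HasFDerivAt (fun y : ℝ × ℝ => w * y.2) (w • ContinuousLinearMap.snd ℝ ℝ ℝ) x :=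
    hasFDerivAt_snd.const_mul w
  refine ((R.hasFDerivAt_κ x).mul h |>.const_sub 1).congr_fderiv ?_
  ext
  · simp [len']; ring
  · simp [len']

end FlatGeometry

end Ribbon

/-! ### Second forms of isometric immersions solve the Gauss and Codazzi equations -/

namespace Ribbon

theorem aestronglyMeasurable_cross {μ : Measure (ℝ × ℝ)} {u v : ℝ × ℝ → E3}
    (hu : AEStronglyMeasurable u μ) (hv : AEStronglyMeasurable v μ) :
    AEStronglyMeasurable (fun x => cross (u x) (v x)) μ := by
  have hc : Continuous fun q : E3 × E3 => cross q.1 q.2 := by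
    refine (PiLp.continuous_toLp 2 _).comp (continuous_pi fun i => ?_)
    fin_cases i <;> simp only [cross_apply] <;> simp <;> fun_prop
  exact hc.comp_aestronglyMeasurable (hu.prodMk hv)

theorem aestronglyMeasurable_unitNormal {μ : Measure (ℝ × ℝ)} {u v : ℝ × ℝ → E3}
    (hu : AEStronglyMeasurable u μ) (hv : AEStronglyMeasurable v μ) :
    AEStronglyMeasurable (fun x => unitNormal (u x) (v x)) μ := by
  have h := aestronglyMeasurable_cross hu hv
  exact (h.norm.aemeasurable.inv.aestronglyMeasurable).smul h

theorem norm_unitNormal_le (u v : E3) : ‖unitNormal u v‖ ≤ 1 := by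
  rw [unitNormal, norm_smul, norm_inv, norm_norm]
  exact inv_mul_le_one

namespace W22

variable {Ω : Set (ℝ × ℝ)}

theorem aestronglyMeasurable_normal (f : W22 Ω) (w : ℝ) :
    AEStronglyMeasurable (f.normal w) (volume.restrict Ω) :=
  aestronglyMeasurable_unitNormal ((f.memLp_grad 0).1.const_smul (scale w 0))
    ((f.memLp_grad 1).1.const_smul (scale w 1))

theorem memLp_secondForm (f : W22 Ω) (w : ℝ) (i j : Fin 2) :
    MemLp (fun x => f.secondForm w x i j) 2 (volume.restrict Ω) := by
  have h : MemLp (fun x => (scale w i * scale w j) • f.hess i j x) 2 (volume.restrict Ω) :=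
    (f.memLp_hess i j).const_smul (scale w i * scale w j)
  refine h.of_le (h.1.inner (f.aestronglyMeasurable_normal w)) (.of_forall fun x => ?_)
  exact (norm_inner_le_norm _ _).trans
    (mul_le_of_le_one_right (norm_nonneg _) (norm_unitNormal_le _ _))

theorem sobolevPartial_gradW (f : W22 Ω) (w : ℝ) (i j : Fin 2) :
    SobolevPartial Ω i (f.gradW w j) (fun x => scale w j • f.hess i j x) where
  weak a := ((f.weak_hess i j).apply (f.memLp_grad j) (f.memLp_hess i j) a).const_mul _
  memLp a := memLp_apply ((f.memLp_grad j).const_smul (scale w j)) a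
  memLp_partial a := memLp_apply ((f.memLp_hess i j).const_smul (scale w j)) a

/-- Weak gradients are curl free, so `hess 1 0` is also a weak derivative of `grad 1` in the first
direction; uniqueness gives the equality. -/
theorem hess_symm (hΩ : IsOpen Ω) (hfin : volume Ω ≠ ⊤) (f : W22 Ω) :
    ∀ᵐ x ∂(volume.restrict Ω), f.hess 1 0 x = f.hess 0 1 x := by
  have : IsFiniteMeasure (volume.restrict Ω) := isFiniteMeasure_restrict.2 hfin
  have hint : ∀ {v : ℝ × ℝ → ℝ}, MemLp v 2 (volume.restrict Ω) → IntegrableOn v Ω := fun hv =>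
    hv.integrable (by norm_num)
  have key : ∀ a, ∀ᵐ x ∂(volume.restrict Ω), f.hess 1 0 x a = f.hess 0 1 x a := fun a => by
    have g0 := (f.weak_grad 0).apply f.memLp_toFun (f.memLp_grad 0) a
    have g1 := (f.weak_grad 1).apply f.memLp_toFun (f.memLp_grad 1) a
    have h01 := (f.weak_hess 0 1).apply (f.memLp_grad 1) (f.memLp_hess 0 1) a
    have h10 := (f.weak_hess 1 0).apply (f.memLp_grad 0) (f.memLp_hess 1 0) a
    have h10' : WeakPartial Ω 0 (fun x => f.grad 1 x a) (fun x => f.hess 1 0 x a) := by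
      intro φ hφ hs ht
      rw [g0.curl g1 hφ hs ht]
      exact h10 φ hφ hs ht
    exact h10'.unique hΩ h01 (hint (memLp_apply (f.memLp_hess 1 0) a))
      (hint (memLp_apply (f.memLp_hess 0 1) a))
  filter_upwards [key 0, key 1, key 2] with x h0 h1 h2
  exact E3.ext_iff'.2 ⟨h0, h1, h2⟩

end W22

theorem volume_strip_ne_top (L : ℝ) : volume (strip L) ≠ ⊤ := by
  rw [strip, Measure.volume_eq_prod, Measure.prod_prod, Real.volume_Ioo, Real.volume_Ioo]
  exact ENNReal.mul_ne_top ENNReal.ofReal_ne_top ENNReal.ofReal_ne_top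

instance isFiniteMeasure_strip (L : ℝ) : IsFiniteMeasure (volume.restrict (strip L)) :=
  isFiniteMeasure_restrict.2 (volume_strip_ne_top L)

namespace FlatGeometry

variable (R : FlatGeometry)

theorem metric_rescaled (w : ℝ) (x : ℝ × ℝ) :
    R.metric (x.1, w * x.2) = !![R.len w x ^ 2, 0; 0, 1] := rfl

theorem continuous_integrableOn_strip {F : ℝ × ℝ → ℝ} (hF : Continuous F) (L : ℝ) :
    IntegrableOn F (strip L) :=
  (hF.continuousOn.integrableOn_compact (isCompact_Icc.prod isCompact_Icc)).mono_set
    (prod_mono Ioo_subset_Icc_self Ioo_subset_Icc_self)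

/-- The tangential components of the second derivatives of a rescaled isometric immersion. -/
theorem hessian_relations {L w : ℝ} (hw : 0 < w) {f : W22 (strip L)} (hf : R.IsIsometric L w f) :
    ∀ᵐ x ∂(volume.restrict (strip L)),
      (inner ℝ (f.gradW w 0 x) (f.gradW w 0 x) = R.len w x ^ 2 ∧
        inner ℝ (f.gradW w 1 x) (f.gradW w 1 x) = 1 ∧
        inner ℝ (f.gradW w 0 x) (f.gradW w 1 x) = 0) ∧
      f.hess 1 0 x = f.hess 0 1 x ∧
      inner ℝ (f.hess 0 0 x) (f.gradW w 0 x) = R.len w x * R.len' w x ∧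
      inner ℝ (w⁻¹ • f.hess 0 1 x) (f.gradW w 0 x) = -(R.κ x.1 * R.len w x) ∧
      inner ℝ (w⁻¹ • f.hess 0 1 x) (f.gradW w 1 x) = 0 ∧
      inner ℝ ((w⁻¹ * w⁻¹) • f.hess 1 1 x) (f.gradW w 1 x) = 0 ∧
      inner ℝ (f.hess 0 0 x) (f.gradW w 1 x) = R.κ x.1 * R.len w x ∧
      inner ℝ ((w⁻¹ * w⁻¹) • f.hess 1 1 x) (f.gradW w 0 x) = 0 := by
  have hΩ := isOpen_strip L
  have hw' : w ≠ 0 := hw.ne'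
  have S00 := f.sobolevPartial_gradW w 0 0
  have S10 := f.sobolevPartial_gradW w 1 0
  have S01 := f.sobolevPartial_gradW w 0 1
  have S11 := f.sobolevPartial_gradW w 1 1
  have met : ∀ᵐ x ∂(volume.restrict (strip L)),
      inner ℝ (f.gradW w 0 x) (f.gradW w 0 x) = R.len w x ^ 2 ∧
      inner ℝ (f.gradW w 1 x) (f.gradW w 1 x) = 1 ∧
      inner ℝ (f.gradW w 0 x) (f.gradW w 1 x) = 0 := by
    filter_upwards [hf] with x hx
    have h00 := hx 0 0
    have h11 := hx 1 1
    have h01 := hx 0 1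
    rw [metric_rescaled] at h00 h11 h01
    exact ⟨h00, h11, h01⟩
  have hlen2 : ContDiff ℝ ∞ (fun x => R.len w x ^ 2) := (R.contDiff_len w).pow 2
  have d2 : ∀ x v, fderiv ℝ (fun x => R.len w x ^ 2) x v
      = 2 * R.len w x * (R.len' w x * v.1 - R.κ x.1 * w * v.2) := fun x v => by
    rw [((R.hasFDerivAt_len w x).pow 2).fderiv]; simp; ring
  -- An a.e. identity between an inner product and a smooth function may be differentiated: both
  -- sides have a weak derivative, and weak derivatives are unique.
  have D : ∀ {i : Fin 2} {u v gu gv : ℝ × ℝ → E3} {F : ℝ × ℝ → ℝ},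
      SobolevPartial (strip L) i u gu → SobolevPartial (strip L) i v gv → ContDiff ℝ ∞ F →
      (∀ᵐ x ∂(volume.restrict (strip L)), inner ℝ (u x) (v x) = F x) →
      ∀ᵐ x ∂(volume.restrict (strip L)), inner ℝ (gu x) (v x) + inner ℝ (u x) (gv x)
        = fderiv ℝ F x (dir i) := fun {i u v gu gv F} hu hv hF h =>
    ((hu.weakPartial_inner hΩ hv).congr h .rfl).unique hΩ (WeakPartial.of_contDiff hF)
      ((integrable_inner hu.memLp_partial hv.memLp).add (integrable_inner hu.memLp hv.memLp_partial))
      (continuous_integrableOn_strip (continuous_fderiv_dir hF _) L)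
  have met00 := met.mono fun x h => h.1
  have met11 := met.mono fun x h => h.2.1
  have met01 := met.mono fun x h => h.2.2
  filter_upwards [met, f.hess_symm hΩ (volume_strip_ne_top L), D S00 S00 hlen2 met00,
    D S10 S10 hlen2 met00, D S01 S01 (contDiff_const (c := (1 : ℝ))) met11,
    D S11 S11 (contDiff_const (c := (1 : ℝ))) met11,
    D S00 S01 (contDiff_const (c := (0 : ℝ))) met01,
    D S10 S11 (contDiff_const (c := (0 : ℝ))) met01] with x m hs h000 h100 h011 h111 h001 h101
  refine ⟨m, hs, ?_⟩
  rw [hs] at h100 h101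
  have s0 : W22.scale w 0 = 1 := rfl
  have s1 : W22.scale w 1 = w⁻¹ := rfl
  have c0 : dir 0 = ((1, 0) : ℝ × ℝ) := rfl
  have c1 : dir 1 = ((0, 1) : ℝ × ℝ) := rfl
  have z : ∀ c : ℝ, fderiv ℝ (fun _ : ℝ × ℝ => c) x = 0 := fun c => by simp
  rw [d2, s0, c0, one_smul, real_inner_comm _ (f.gradW w 0 x)] at h000
  rw [d2, s0, c1, one_smul, real_inner_comm _ (f.gradW w 0 x)] at h100
  rw [z, s1, real_inner_comm _ (f.gradW w 1 x)] at h011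
  rw [z, s1, real_inner_comm _ (f.gradW w 1 x)] at h111
  rw [z, s0, s1, one_smul, real_inner_comm _ (f.gradW w 0 x)] at h001
  rw [z, s0, s1, one_smul, real_inner_comm _ (f.gradW w 0 x)] at h101
  simp only [_root_.zero_apply] at h011 h111 h001 h101
  simp only [real_inner_smul_left, mul_one, mul_zero, sub_zero, zero_sub] at h000 h100 h011 h111 h001 h101 ⊢
  generalize inner ℝ (f.hess 0 0 x) (f.gradW w 0 x) = a at *
  generalize inner ℝ (f.hess 0 0 x) (f.gradW w 1 x) = b at *
  generalize inner ℝ (f.hess 0 1 x) (f.gradW w 0 x) = c at *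
  generalize inner ℝ (f.hess 0 1 x) (f.gradW w 1 x) = d at *
  generalize inner ℝ (f.hess 1 1 x) (f.gradW w 0 x) = s at *
  generalize inner ℝ (f.hess 1 1 x) (f.gradW w 1 x) = t at *
  have hc : w⁻¹ * c = -(R.κ x.1 * R.len w x) := by
    have : c = -(w * (R.κ x.1 * R.len w x)) := by linarith
    rw [this]; field_simp
  have hd : w⁻¹ * d = 0 := by linarith
  have hd' : d = 0 := by simpa [hw'] using hd
  refine ⟨by linarith, hc, hd, ?_, by linarith, ?_⟩
  · have : w⁻¹ * t = 0 := by linarith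
    rw [mul_assoc, this, mul_zero]
  · have : w⁻¹ * s = 0 := by linarith
    rw [mul_assoc, this, mul_zero]

/-- The rescaled second fundamental form of a rescaled isometric immersion solves the Gauss and
Codazzi equations. -/
theorem isGaussCodazzi_secondForm {L w : ℝ} (hw : 0 < w)
    (hp : ∀ x ∈ strip L, 0 < R.len w x) {f : W22 (strip L)} (hf : R.IsIsometric L w f) :
    R.IsGaussCodazzi L w (f.secondForm w) := by
  have hΩ := isOpen_strip L
  have hw' : w ≠ 0 := hw.ne'
  have S00 := f.sobolevPartial_gradW w 0 0
  have S10 := f.sobolevPartial_gradW w 1 0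
  have S01 := f.sobolevPartial_gradW w 0 1
  have S11 := f.sobolevPartial_gradW w 1 1
  have rel := R.hessian_relations hw hf
  have hmem : ∀ᵐ x ∂(volume.restrict (strip L)), x ∈ strip L :=
    ae_restrict_mem (measurableSet_strip L)
  have s0 : W22.scale w 0 = 1 := rfl
  have s1 : W22.scale w 1 = w⁻¹ := rfl
  have A00 : ∀ x, f.secondForm w x 0 0 = inner ℝ (f.hess 0 0 x) (f.normal w x) := fun x => by
    simp [W22.secondForm, s0]
  have A01 : ∀ x, f.secondForm w x 0 1 = inner ℝ (w⁻¹ • f.hess 0 1 x) (f.normal w x) := fun x => by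
    simp [W22.secondForm, s0, s1]
  have A11 : ∀ x, f.secondForm w x 1 1 = inner ℝ ((w⁻¹ * w⁻¹) • f.hess 1 1 x) (f.normal w x) :=
    fun x => by simp [W22.secondForm, s1]
  have key : ∀ᵐ x ∂(volume.restrict (strip L)), _ :=
    (rel.and hmem).mono fun x h => hessian_identities (hp x h.2) h.1.1.1 h.1.1.2.1 h.1.1.2.2
      h.1.2.2.1 h.1.2.2.2.1 h.1.2.2.2.2.1 h.1.2.2.2.2.2.1 h.1.2.2.2.2.2.2.1 h.1.2.2.2.2.2.2.2
  have hh10 : ∀ x, f.hess 1 0 x = f.hess 0 1 x →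
      W22.scale w 0 • f.hess 1 0 x = w • (w⁻¹ • f.hess 0 1 x) := fun x h => by
    rw [s0, one_smul, h, smul_smul, mul_inv_cancel₀ hw', one_smul]
  have hh11 : ∀ x, W22.scale w 1 • f.hess 1 1 x = w • ((w⁻¹ * w⁻¹) • f.hess 1 1 x) := fun x => by
    rw [s1, smul_smul, ← mul_assoc, mul_inv_cancel₀ hw', one_mul]
  obtain ⟨C, hC⟩ : ∃ C, ∀ x ∈ strip L, |R.len w x| ≤ C := by
    obtain ⟨C, hC⟩ := (isCompact_Icc.prod isCompact_Icc :
      IsCompact (Icc 0 L ×ˢ Icc (-(1 / 2) : ℝ) (1 / 2))).exists_bound_of_continuousOn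
      (R.contDiff_len w).continuous.continuousOn
    exact ⟨C, fun x hx => hC x (prod_mono Ioo_subset_Icc_self Ioo_subset_Icc_self hx)⟩
  have b0 : ∀ᵐ x ∂(volume.restrict (strip L)), ‖f.gradW w 0 x‖ ≤ max C 1 := by
    filter_upwards [rel, hmem] with x h hx
    have h1 := h.1.1
    rw [real_inner_self_eq_norm_sq] at h1
    exact ((sq_eq_sq₀ (norm_nonneg _) (hp x hx).le).1 h1).le.trans
      (((le_abs_self _).trans (hC x hx)).trans (le_max_left _ _))
  have b1 : ∀ᵐ x ∂(volume.restrict (strip L)), ‖f.gradW w 1 x‖ ≤ max C 1 := by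
    filter_upwards [rel] with x h
    have h1 := h.1.2.1
    rw [real_inner_self_eq_norm_sq] at h1
    exact ((sq_eq_sq₀ (norm_nonneg _) zero_le_one).1 (by rw [h1, one_pow])).le.trans
      (le_max_right _ _)
  -- The unnormalised normal `∂₁f × ∂₂f`, which is `len` times the unit normal, is a product of
  -- bounded Sobolev functions. This is the second factor in the Jacobian identity for the Codazzi
  -- equations.
  have N0 := S00.cross_mul hΩ S01 b0 b1
  have N1 := S10.cross_mul hΩ S11 b0 b1
  refine ⟨f.memLp_secondForm w, ?_, ?_, ?_, ?_⟩
  · filter_upwards [rel] with x h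
    simp only [W22.secondForm, Matrix.of_apply, h.2.1, mul_comm]
  · have hd : ContDiff ℝ ∞ fun x : ℝ × ℝ => R.κ x.1 * R.len w x :=
      (R.smooth_κ.comp contDiff_fst).mul (R.contDiff_len w)
    have d1 : ∀ x, fderiv ℝ (fun x : ℝ × ℝ => R.κ x.1 * R.len w x) x (dir 1)
        = -(w * R.κ x.1 ^ 2) := fun x => by
      rw [((R.hasFDerivAt_κ x).fun_mul (R.hasFDerivAt_len w x)).fderiv]
      simp [dir]; ring
    -- Gauss equation: the smooth function $\kappa\cdot$`len` is $\langle \partial_1\partial_1 f,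
    -- \partial_2^w f\rangle$. Its $\partial_2$ is computed once directly and once by the Jacobian
    -- identity for the two columns of the rescaled gradient; the difference of the results is $w
    -- \det A$.
    have W1 : WeakPartial (strip L) 1 (fun x => R.κ x.1 * R.len w x) (fun x => -(w * R.κ x.1 ^ 2)) :=
      (WeakPartial.of_contDiff hd).congr .rfl (.of_forall d1)
    have W2 : WeakPartial (strip L) 1 (fun x => R.κ x.1 * R.len w x) (fun x => w * ((f.secondForm w x 0 0
        * f.secondForm w x 1 1 - f.secondForm w x 0 1 * f.secondForm w x 0 1) - R.κ x.1 ^ 2)) := by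
      intro φ hφ hs ht
      have h := SobolevPartial.jacobian hΩ S00 S10 S01 S11 hφ hs ht
      have e1 : ∫ x in strip L, fderiv ℝ φ x (dir 1) * (R.κ x.1 * R.len w x)
          = -∫ x in strip L, (fderiv ℝ φ x (dir 0) * inner ℝ (W22.scale w 0 • f.hess 1 0 x)
            (f.gradW w 1 x) - fderiv ℝ φ x (dir 1) * inner ℝ (W22.scale w 0 • f.hess 0 0 x)
            (f.gradW w 1 x)) := by
        rw [← integral_neg]
        refine integral_congr_ae ?_
        filter_upwards [rel] with x r
        rw [hh10 x r.2.1, s0, one_smul, real_inner_smul_left, r.2.2.2.2.1, r.2.2.2.2.2.2.1]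
        ring
      rw [e1, h, neg_neg, ← integral_neg]
      refine integral_congr_ae ?_
      filter_upwards [rel, key] with x r k
      rw [hh10 x r.2.1, hh11, s0, s1, one_smul, real_inner_smul_left,
        real_inner_smul_right (f.hess 0 0 x), A00, A01, A11]
      have := k.1
      simp only [W22.normal]
      linear_combination φ x * w * this
    have M := f.memLp_secondForm w
    have iκ : IntegrableOn (fun x : ℝ × ℝ => R.κ x.1 ^ 2) (strip L) :=
      continuous_integrableOn_strip ((R.smooth_κ.continuous.comp continuous_fst).pow 2) L
    filter_upwards [W2.unique hΩ W1 ((((integrable_mul_of_memLp_two (M 0 0) (M 1 1)).sub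
      (integrable_mul_of_memLp_two (M 0 1) (M 0 1))).sub iκ).const_mul w) (iκ.const_mul w).neg] with x hx
    have h1 : w * (f.secondForm w x 0 0 * f.secondForm w x 1 1 - f.secondForm w x 0 1 ^ 2) = 0 := by
      linear_combination hx
    exact (mul_eq_zero.1 h1).resolve_left hw'
  · intro φ hφ hs ht
    -- First Codazzi equation: the Jacobian identity for `∂₁f` paired with the unnormalised normal.
    have h := SobolevPartial.jacobian hΩ S00 S10 N0 N1 hφ hs ht
    refine mul_left_cancel₀ hw' ?_
    rw [mul_neg, ← integral_const_mul, ← integral_const_mul]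
    refine Eq.trans (integral_congr_ae ?_) (h.trans (neg_inj.2 (integral_congr_ae ?_)))
    · filter_upwards [rel, key] with x r k
      rw [hh10 x r.2.1, s0, one_smul, real_inner_smul_left, k.2.1, k.2.2.1, A00, A01]
      simp only [W22.normal]
      field_simp
    · filter_upwards [rel, key] with x r k
      have := k.2.2.2.2.1
      rw [hh10 x r.2.1, hh11, s0, s1, one_smul, cross_smul_left, cross_smul_right _ _ ((w⁻¹ * w⁻¹) • _),
        ← smul_add, real_inner_smul_left, real_inner_smul_right, A00, A01, A11]
      simp only [W22.normal]
      linear_combination φ x * w * this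
  · intro φ hφ hs ht
    -- Second Codazzi equation: the same with the rescaled `∂₂f` in place of `∂₁f`.
    have h := SobolevPartial.jacobian hΩ S01 S11 N0 N1 hφ hs ht
    refine mul_left_cancel₀ hw' ?_
    rw [mul_neg, ← integral_const_mul, ← integral_const_mul]
    refine Eq.trans (integral_congr_ae ?_) (h.trans (neg_inj.2 (integral_congr_ae ?_)))
    · filter_upwards [key] with x k
      rw [hh11 x, s1, real_inner_smul_left, k.2.2.1, k.2.2.2.1, A01, A11]
      simp only [W22.normal]
      field_simp
    · filter_upwards [rel, key] with x r k
      have := k.2.2.2.2.2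
      rw [hh10 x r.2.1, hh11, s0, s1, one_smul, cross_smul_left, cross_smul_right _ _ ((w⁻¹ * w⁻¹) • _),
        ← smul_add, real_inner_smul_left, real_inner_smul_right, A11]
      simp only [W22.normal]
      linear_combination φ x * w * this

end FlatGeometry

end Ribbon

namespace Ribbon

/-! ### Test functions of product form -/

theorem exists_cutoff (a : ℝ) {r δ : ℝ} (hr : 0 < r) (hδ : 0 < δ) :
    ∃ χ : ContDiffBump a, χ.rOut < r ∧ ∫ s in Ioo (a - r) (a + r), (1 - χ s) ^ 2 ≤ δ := by
  -- The cutoff is 1 except within distance `d` of each endpoint, so the error is at most $2d \le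
  -- \delta$.
  set d := min (r / 2) (δ / 2) with hd
  have hd0 : 0 < d := lt_min (by linarith) (by linarith)
  have hdr : d ≤ r / 2 := min_le_left _ _
  have hdδ : d ≤ δ / 2 := min_le_right _ _
  let χ : ContDiffBump a := ⟨r - d, r - d / 2, by linarith, by linarith⟩
  refine ⟨χ, show r - d / 2 < r by linarith, ?_⟩
  have hsub : Icc (a - (r - d)) (a + (r - d)) ⊆ Ioo (a - r) (a + r) := fun x hx =>
    ⟨by linarith [hx.1], by linarith [hx.2]⟩
  have h1 : ∀ s, (1 - χ s) ^ 2 ≤ 1 - (Icc (a - (r - d)) (a + (r - d))).indicator (fun _ => (1 : ℝ)) s :=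
    fun s => by
    by_cases hs : s ∈ Icc (a - (r - d)) (a + (r - d))
    · rw [indicator_of_mem hs, χ.one_of_mem_closedBall (by rwa [Real.closedBall_eq_Icc])]; simp
    · rw [indicator_of_notMem hs]
      nlinarith [χ.nonneg' s, χ.le_one (x := s)]
  have i0 : Integrable (fun _ : ℝ => (1 : ℝ)) (volume.restrict (Ioo (a - r) (a + r))) :=
    integrable_const _
  have hi : IntegrableOn (fun s => 1 - (Icc (a - (r - d)) (a + (r - d))).indicator
      (fun _ => (1 : ℝ)) s) (Ioo (a - r) (a + r)) :=
    i0.sub (i0.indicator measurableSet_Icc)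
  refine (integral_mono_of_nonneg (.of_forall fun s => sq_nonneg _) hi (.of_forall h1)).trans ?_
  rw [integral_sub i0 (i0.indicator measurableSet_Icc),
    setIntegral_indicator measurableSet_Icc, inter_eq_right.2 hsub]
  simp only [integral_const, smul_eq_mul, mul_one, measureReal_restrict_apply_univ,
    Real.volume_real_Ioo_of_le (show a - r ≤ a + r by linarith),
    Real.volume_real_Icc_of_le (show a - (r - d) ≤ a + (r - d) by linarith)]
  linarith

/-- Continuous functions on `[0, L]` are `L²`-limits of test functions on `(0, L)`. -/
theorem exists_test_approx {L : ℝ} (hL : 0 < L) {c : ℝ → ℝ} (hc : ContinuousOn c (Icc 0 L)) {ε : ℝ}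
    (hε : 0 < ε) : ∃ g : ℝ → ℝ, ContDiff ℝ ∞ g ∧ HasCompactSupport g ∧ tsupport g ⊆ Ioo 0 L ∧
      ∫ s in Ioo 0 L, (c s - g s) ^ 2 ≤ ε := by
  set e := √(ε / (4 * L)) with he
  have he0 : 0 < e := Real.sqrt_pos.2 (by positivity)
  have he2 : e ^ 2 = ε / (4 * L) := Real.sq_sqrt (by positivity)
  -- A Weierstrass polynomial supplies smoothness and the cutoff supplies compact support. Each of
  -- the two errors contributes at most $\varepsilon/2$.
  obtain ⟨p, hp⟩ := exists_polynomial_near_of_continuousOn 0 L c hc e he0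
  obtain ⟨M, hM⟩ := isCompact_Icc.exists_bound_of_continuousOn (p.continuous.continuousOn (s := Icc 0 L))
  obtain ⟨χ, hχ, hχi⟩ := exists_cutoff (L / 2) (r := L / 2) (δ := ε / (4 * (M ^ 2 + 1))) (by linarith)
    (by positivity)
  rw [sub_self, add_halves] at hχi
  have hcont : Continuous fun s => (1 - χ s) ^ 2 := (continuous_const.sub χ.continuous).pow 2
  have hts : tsupport (fun s => p.eval s * χ s) ⊆ Metric.closedBall (L / 2) χ.rOut :=
    tsupport_mul_subset_right.trans χ.tsupport_eq.le
  have hpd : ContDiff ℝ ∞ fun s => p.eval s := by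
    simpa using Polynomial.contDiff_aeval (𝕜 := ℝ) p ∞
  refine ⟨fun s => p.eval s * χ s, hpd.mul χ.contDiff, ?_, ?_, ?_⟩
  · exact (isCompact_closedBall _ _).of_isClosed_subset (isClosed_tsupport _) hts
  · rw [Real.closedBall_eq_Icc] at hts
    exact hts.trans fun x hx => ⟨by linarith [hx.1], by linarith [hx.2]⟩
  have hint : IntegrableOn (fun s => 2 * e ^ 2 + 2 * M ^ 2 * (1 - χ s) ^ 2) (Ioo 0 L) :=
    (((continuous_const.add (continuous_const.mul hcont)).continuousOn.integrableOn_compact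
      isCompact_Icc).mono_set Ioo_subset_Icc_self)
  refine (integral_mono_of_nonneg (.of_forall fun s => sq_nonneg _) hint ?_).trans ?_
  · filter_upwards [ae_restrict_mem measurableSet_Ioo] with s hs
    have hs' := Ioo_subset_Icc_self hs
    have h1 := abs_lt.1 (hp s hs')
    have h2 : (c s - p.eval s) ^ 2 ≤ e ^ 2 := sq_le_sq' (by linarith) (by linarith)
    have h3 : p.eval s ^ 2 ≤ M ^ 2 := by
      have := abs_le.1 (hM s hs')
      exact sq_le_sq' this.1 this.2
    have h4 := mul_le_mul_of_nonneg_right h3 (sq_nonneg (1 - χ s))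
    show (c s - p.eval s * χ s) ^ 2 ≤ 2 * e ^ 2 + 2 * M ^ 2 * (1 - χ s) ^ 2
    nlinarith [sq_nonneg ((c s - p.eval s) - p.eval s * (1 - χ s))]
  · have i1 : IntegrableOn (fun s => 2 * M ^ 2 * (1 - χ s) ^ 2) (Ioo 0 L) :=
      ((continuous_const.mul hcont).continuousOn.integrableOn_compact isCompact_Icc).mono_set
        Ioo_subset_Icc_self
    have i0 : Integrable (fun _ : ℝ => 2 * e ^ 2) (volume.restrict (Ioo 0 L)) := integrable_const _
    rw [integral_add i0 i1]
    simp only [integral_const, smul_eq_mul, measureReal_restrict_apply_univ,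
      Real.volume_real_Ioo_of_le hL.le, sub_zero]
    have h5 : L * (2 * e ^ 2) = ε / 2 := by rw [he2]; field_simp; ring
    have h6 : 2 * M ^ 2 * ∫ s in Ioo 0 L, (1 - χ s) ^ 2 ≤ ε / 2 := by
      calc _ ≤ 2 * M ^ 2 * (ε / (4 * (M ^ 2 + 1))) := mul_le_mul_of_nonneg_left hχi (by positivity)
        _ ≤ 2 * (M ^ 2 + 1) * (ε / (4 * (M ^ 2 + 1))) :=
          mul_le_mul_of_nonneg_right (by linarith) (by positivity)
        _ = ε / 2 := by field_simp; ring
    rw [← integral_const_mul] at h6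
    linarith

/-- The function `t ↦ t` on `(-1/2, 1/2)` is an `L²`-limit of derivatives of test functions. -/
theorem exists_test_primitive {ε : ℝ} (hε : 0 < ε) : ∃ η : ℝ → ℝ, ContDiff ℝ ∞ η ∧
    HasCompactSupport η ∧ tsupport η ⊆ Ioo (-(1 / 2)) (1 / 2) ∧
      ∫ t in Ioo (-(1 / 2) : ℝ) (1 / 2), (t - deriv η t) ^ 2 ≤ ε := by
  obtain ⟨χ, hχ, hχi⟩ := exists_cutoff 0 (r := 1 / 2) (δ := ε) (by norm_num) hε
  rw [zero_sub, zero_add] at hχi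
  have hcont : Continuous fun t => t * χ t := continuous_id.mul χ.continuous
  -- A primitive of $t\chi(t)$ with an even cutoff $\chi$. The integrand is odd, so the primitive
  -- vanishes again to the right of the support.
  set η : ℝ → ℝ := fun x => ∫ t in (-(1 / 2) : ℝ)..x, t * χ t with hη
  have hd : ∀ x, HasDerivAt η (x * χ x) x := fun x => hcont.integral_hasStrictDerivAt _ x |>.hasDerivAt
  have hde : deriv η = fun x => x * χ x := funext fun x => (hd x).deriv
  have hzero : ∀ t, χ.rOut ≤ |t| → t * χ t = 0 := fun t ht => by
    rw [χ.zero_of_le_dist (by rwa [Real.dist_eq, sub_zero]), mul_zero]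
  have hodd : ∀ x, ∫ t in -x..x, t * χ t = 0 := fun x => by
    have h := intervalIntegral.integral_comp_neg (a := -x) (b := x) fun t => t * χ t
    simp only [χ.neg, neg_neg, neg_mul, intervalIntegral.integral_neg] at h
    linarith
  have hsupp : Function.support η ⊆ Icc (-χ.rOut) χ.rOut := by
    intro x hx
    by_contra hcon
    refine hx ?_
    have hr := χ.rOut_pos
    have hneg : ∀ y, y ≤ -χ.rOut → ∫ t in (-(1 / 2) : ℝ)..y, t * χ t = 0 := fun y hy => by
      refine intervalIntegral.integral_zero_ae (.of_forall fun t ht => hzero t ?_)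
      have : t ≤ -χ.rOut := by
        rcases le_total (-(1 / 2)) y with h | h
        · rw [uIoc_of_le h] at ht; linarith [ht.2]
        · rw [uIoc_of_ge h] at ht; linarith [ht.2]
      rw [abs_of_nonpos (by linarith)]
      linarith
    rcases le_or_gt x (-χ.rOut) with h | h
    · exact hneg x h
    · have hx' : χ.rOut < x := by
        by_contra h'
        exact hcon ⟨h.le, not_lt.1 h'⟩
      show ∫ t in (-(1 / 2) : ℝ)..x, t * χ t = 0
      rw [← intervalIntegral.integral_add_adjacent_intervals (b := -x)
        (hcont.intervalIntegrable _ _) (hcont.intervalIntegrable _ _), hneg (-x) (by linarith),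
        hodd, add_zero]
  have hts : tsupport η ⊆ Icc (-χ.rOut) χ.rOut := closure_minimal hsupp isClosed_Icc
  refine ⟨η, ?_, isCompact_Icc.of_isClosed_subset (isClosed_tsupport _) hts,
    hts.trans fun x hx => ⟨by linarith [hx.1], by linarith [hx.2]⟩, ?_⟩
  · rw [contDiff_infty_iff_deriv]
    exact ⟨fun x => (hd x).differentiableAt, by rw [hde]; exact contDiff_id.mul χ.contDiff⟩
  · rw [hde]
    refine (integral_mono_of_nonneg (.of_forall fun s => sq_nonneg _)
      ((((continuous_const.sub χ.continuous).pow 2).continuousOn.integrableOn_compact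
      isCompact_Icc).mono_set Ioo_subset_Icc_self) ?_).trans hχi
    filter_upwards [ae_restrict_mem measurableSet_Ioo] with t ht
    show (t - t * χ t) ^ 2 ≤ (1 - χ t) ^ 2
    rw [show t - t * χ t = t * (1 - χ t) by ring, mul_pow]
    have : t ^ 2 ≤ 1 := by nlinarith [ht.1, ht.2]
    nlinarith [sq_nonneg (1 - χ t)]

theorem integral_strip_mul (L : ℝ) (f g : ℝ → ℝ) :
    ∫ x in strip L, f x.1 * g x.2
      = (∫ s in Ioo 0 L, f s) * ∫ t in Ioo (-(1 / 2) : ℝ) (1 / 2), g t := by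
  rw [strip, Measure.volume_eq_prod, ← Measure.prod_restrict]
  exact integral_prod_mul f g

theorem continuousOn_memLp_strip {L : ℝ} {F : ℝ × ℝ → ℝ}
    (hF : ContinuousOn F (Icc 0 L ×ˢ Icc (-(1 / 2)) (1 / 2))) :
    MemLp F 2 (volume.restrict (strip L)) := by
  have hK : IsCompact (Icc 0 L ×ˢ Icc (-(1 / 2) : ℝ) (1 / 2)) := isCompact_Icc.prod isCompact_Icc
  have hsub : strip L ⊆ Icc 0 L ×ˢ Icc (-(1 / 2)) (1 / 2) :=
    prod_mono Ioo_subset_Icc_self Ioo_subset_Icc_self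
  obtain ⟨C, hC⟩ := hK.exists_bound_of_continuousOn hF
  exact MemLp.of_bound ((hF.mono hsub).aestronglyMeasurable (measurableSet_strip L)) C
    ((ae_restrict_mem (measurableSet_strip L)).mono fun x hx => hC x (hsub hx))

theorem continuousOn_comp_fst {L : ℝ} {c : ℝ → ℝ} (hc : ContinuousOn c (Icc 0 L)) :
    ContinuousOn (fun x : ℝ × ℝ => c x.1) (Icc 0 L ×ˢ Icc (-(1 / 2)) (1 / 2)) :=
  hc.comp continuous_fst.continuousOn fun _ hx => hx.1

theorem tsupport_mul_prod_subset {L : ℝ} {g η : ℝ → ℝ} (hg : tsupport g ⊆ Ioo 0 L)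
    (hη : tsupport η ⊆ Ioo (-(1 / 2)) (1 / 2)) :
    tsupport (fun x : ℝ × ℝ => g x.1 * η x.2) ⊆ strip L := by
  have h : tsupport (fun x : ℝ × ℝ => g x.1 * η x.2) ⊆ tsupport g ×ˢ tsupport η := by
    refine closure_minimal (fun x hx => ?_) ((isClosed_tsupport g).prod (isClosed_tsupport η))
    exact ⟨subset_tsupport g (left_ne_zero_of_mul hx), subset_tsupport η (right_ne_zero_of_mul hx)⟩
  exact h.trans (prod_mono hg hη)

theorem hasCompactSupport_mul_prod {g η : ℝ → ℝ} (hg : HasCompactSupport g)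
    (hη : HasCompactSupport η) : HasCompactSupport (fun x : ℝ × ℝ => g x.1 * η x.2) := by
  refine HasCompactSupport.of_support_subset_isCompact (hg.isCompact.prod hη.isCompact) fun x hx => ?_
  exact ⟨subset_tsupport g (left_ne_zero_of_mul hx), subset_tsupport η (right_ne_zero_of_mul hx)⟩

/-- A bounded family in `L²(S)` whose `∂₂` tends weakly to zero has vanishing first moments. -/
theorem tendsto_moment_of_tendsto_test {L : ℝ} (hL : 0 < L) {D : ℝ → ℝ × ℝ → ℝ} {l : Filter ℝ}
    (hD : ∀ᶠ w in l, MemLp (D w) 2 (volume.restrict (strip L))) {K : ℝ}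
    (hK : ∀ᶠ w in l, ∫ x in strip L, D w x ^ 2 ≤ K)
    (ht : ∀ φ : ℝ × ℝ → ℝ, ContDiff ℝ ∞ φ → HasCompactSupport φ → tsupport φ ⊆ strip L →
      Tendsto (fun w => ∫ x in strip L, fderiv ℝ φ x (dir 1) * D w x) l (𝓝 0))
    {c : ℝ → ℝ} (hc : ContinuousOn c (Icc 0 L)) :
    Tendsto (fun w => ∫ x in strip L, x.2 * c x.1 * D w x) l (𝓝 0) := by
  rw [Metric.tendsto_nhds]
  intro ε hε
  set K' := max K 1 with hK'
  have hK'0 : 0 < K' := lt_of_lt_of_le one_pos (le_max_right _ _)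
  -- Chosen so that Cauchy–Schwarz bounds the error by $\sqrt{\delta K'} = \varepsilon/2$.
  set δ := ε ^ 2 / (4 * K') with hδ
  have hδ0 : 0 < δ := by positivity
  obtain ⟨g, hg, hgs, hgt, hgi⟩ := exists_test_approx hL hc (ε := δ / 4) (by positivity)
  set G := ∫ s in Ioo 0 L, g s ^ 2 with hG
  have hG0 : 0 ≤ G := integral_nonneg fun s => sq_nonneg _
  obtain ⟨η, hη, hηs, hηt, hηi⟩ := exists_test_primitive (ε := δ / (4 * (G + 1))) (by positivity)
  -- Since $g \approx c$ and $\eta'(t) \approx t$, the weight $x_2c(x_1)$ is $L^2$-close to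
  -- $\partial_2\varphi$, to which the hypothesis applies.
  set φ : ℝ × ℝ → ℝ := fun x => g x.1 * η x.2 with hφ
  have hφd : ContDiff ℝ ∞ φ := (hg.comp contDiff_fst).mul (hη.comp contDiff_snd)
  have hφ1 : ∀ x, fderiv ℝ φ x (dir 1) = g x.1 * deriv η x.2 := fun x => by
    have h1 : HasFDerivAt (fun y : ℝ × ℝ => g y.1) (deriv g x.1 • ContinuousLinearMap.fst ℝ ℝ ℝ) x :=
      ((hg.differentiable (by norm_num)) x.1).hasDerivAt.comp_hasFDerivAt x hasFDerivAt_fst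
    have h2 : HasFDerivAt (fun y : ℝ × ℝ => η y.2) (deriv η x.2 • ContinuousLinearMap.snd ℝ ℝ ℝ) x :=
      ((hη.differentiable (by norm_num)) x.2).hasDerivAt.comp_hasFDerivAt x hasFDerivAt_snd
    rw [hφ, (h1.fun_mul h2).fderiv]
    simp [dir]
  have hdη : Continuous (deriv η) := hη.continuous_deriv (by norm_num)
  have mc := continuousOn_comp_fst hc
  have M1 : MemLp (fun x : ℝ × ℝ => (c x.1 - g x.1) * x.2) 2 (volume.restrict (strip L)) :=
    continuousOn_memLp_strip ((mc.sub (hg.continuous.comp continuous_fst).continuousOn).mul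
      continuous_snd.continuousOn)
  have M2 : MemLp (fun x : ℝ × ℝ => g x.1 * (x.2 - deriv η x.2)) 2 (volume.restrict (strip L)) :=
    continuousOn_memLp_strip (by
      have := hg.continuous
      fun_prop)
  have M3 : MemLp (fun x : ℝ × ℝ => fderiv ℝ φ x (dir 1)) 2 (volume.restrict (strip L)) :=
    continuousOn_memLp_strip (continuous_fderiv_dir hφd _).continuousOn
  have err : ∫ x in strip L, ((c x.1 - g x.1) * x.2 + g x.1 * (x.2 - deriv η x.2)) ^ 2 ≤ δ := by
    refine (integral_add_sq_le M1 M2).trans ?_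
    have e1 : ∫ x in strip L, ((c x.1 - g x.1) * x.2) ^ 2 ≤ δ / 4 := by
      simp only [mul_pow]
      rw [integral_strip_mul L (fun s => (c s - g s) ^ 2) (fun t => t ^ 2)]
      have : ∫ t in Ioo (-(1 / 2) : ℝ) (1 / 2), t ^ 2 = 1 / 12 := by
        rw [← integral_Ioc_eq_integral_Ioo, ← intervalIntegral.integral_of_le (by norm_num)]
        simp; norm_num
      rw [this]
      have : 0 ≤ ∫ s in Ioo 0 L, (c s - g s) ^ 2 := integral_nonneg fun s => sq_nonneg _
      linarith
    have e2 : ∫ x in strip L, (g x.1 * (x.2 - deriv η x.2)) ^ 2 ≤ δ / 4 := by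
      simp only [mul_pow]
      rw [integral_strip_mul L (fun s => g s ^ 2) (fun t => (t - deriv η t) ^ 2), ← hG]
      calc G * _ ≤ (G + 1) * (δ / (4 * (G + 1))) :=
            mul_le_mul (by linarith) hηi (integral_nonneg fun s => sq_nonneg _) (by linarith)
        _ = δ / 4 := by field_simp
    linarith
  filter_upwards [hD, hK, (Metric.tendsto_nhds.1 (ht φ hφd (hasCompactSupport_mul_prod hgs hηs)
    (tsupport_mul_prod_subset hgt hηt))) (ε / 2) (by positivity)] with w hDw hKw hw
  rw [Real.dist_eq, sub_zero] at hw ⊢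
  have cs := integral_mul_sq_le (M1.add M2) hDw
  simp only [Pi.add_apply] at cs
  have split : ∫ x in strip L, x.2 * c x.1 * D w x
      = (∫ x in strip L, ((c x.1 - g x.1) * x.2 + g x.1 * (x.2 - deriv η x.2)) * D w x)
        + ∫ x in strip L, fderiv ℝ φ x (dir 1) * D w x := by
    have I1 : Integrable (fun x : ℝ × ℝ => ((c x.1 - g x.1) * x.2 + g x.1 * (x.2 - deriv η x.2))
      * D w x) (volume.restrict (strip L)) := integrable_mul_of_memLp_two (M1.add M2) hDw
    rw [← integral_add I1 (integrable_mul_of_memLp_two M3 hDw)]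
    congr 1; funext x
    rw [hφ1]; ring
  have hb : |∫ x in strip L, ((c x.1 - g x.1) * x.2 + g x.1 * (x.2 - deriv η x.2)) * D w x|
      ≤ ε / 2 := by
    refine abs_le_of_sq_le_sq (cs.trans ?_) (by positivity)
    calc _ ≤ δ * K' := mul_le_mul err (hKw.trans (le_max_left _ _))
          (integral_nonneg fun s => sq_nonneg _) hδ0.le
      _ = (ε / 2) ^ 2 := by rw [hδ]; field_simp; ring
  rw [split]
  exact (abs_add_le _ _).trans_lt (by linarith)

/-- Terms of order `w` against a bounded family in `L²` vanish in the limit. -/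
theorem tendsto_remainder {L : ℝ} {a b c : ℝ → ℝ × ℝ → ℝ} {K : ℝ}
    (ha : ∀ᶠ w in 𝓝[>] (0 : ℝ), MemLp (a w) 2 (volume.restrict (strip L)) ∧
      MemLp (b w) 2 (volume.restrict (strip L)) ∧ MemLp (c w) 2 (volume.restrict (strip L)))
    (hK : ∀ᶠ w in 𝓝[>] (0 : ℝ), ∫ x in strip L, a w x ^ 2 ≤ K ∧ ∫ x in strip L, b w x ^ 2 ≤ K ∧
      ∫ x in strip L, c w x ^ 2 ≤ K) {M : ℝ} {F : ℝ → ℝ × ℝ → ℝ}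
    (hF : ∀ᶠ w in 𝓝[>] (0 : ℝ), ∀ᵐ x ∂(volume.restrict (strip L)),
      |F w x| ≤ w * M * (1 + a w x ^ 2 + b w x ^ 2 + c w x ^ 2)) :
    Tendsto (fun w => ∫ x in strip L, F w x) (𝓝[>] 0) (𝓝 0) := by
  set V := (volume.restrict (strip L)).real univ with hV
  have lim : Tendsto (fun w : ℝ => w * (|M| * (V + 3 * |K|))) (𝓝[>] 0) (𝓝 0) := by
    have : Tendsto (fun w : ℝ => w * (|M| * (V + 3 * |K|))) (𝓝 0) (𝓝 (0 * (|M| * (V + 3 * |K|)))) :=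
      tendsto_id.mul_const _
    rw [zero_mul] at this
    exact this.mono_left nhdsWithin_le_nhds
  refine squeeze_zero_norm' ?_ lim
  filter_upwards [ha, hK, hF, self_mem_nhdsWithin] with w ⟨m1, m2, m3⟩ ⟨k1, k2, k3⟩ hw hw0
  have hw0' : 0 < w := hw0
  have i1 := m1.integrable_sq
  have i2 := m2.integrable_sq
  have i3 := m3.integrable_sq
  have i0 : Integrable (fun _ : ℝ × ℝ => (1 : ℝ)) (volume.restrict (strip L)) := integrable_const _
  have i : Integrable (fun x => 1 + a w x ^ 2 + b w x ^ 2 + c w x ^ 2) (volume.restrict (strip L)) :=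
    ((i0.add i1).add i2).add i3
  have e : ∫ x in strip L, (1 + a w x ^ 2 + b w x ^ 2 + c w x ^ 2) ≤ V + 3 * |K| := by
    have h1 : Integrable (fun x => 1 + a w x ^ 2) (volume.restrict (strip L)) := i0.add i1
    have h2 : Integrable (fun x => 1 + a w x ^ 2 + b w x ^ 2) (volume.restrict (strip L)) := h1.add i2
    rw [integral_add h2 i3, integral_add h1 i2, integral_add i0 i1, integral_const, smul_eq_mul, mul_one]
    have := le_abs_self K
    linarith
  refine (norm_integral_le_of_norm_le (g := fun x => w * |M| * (1 + a w x ^ 2 + b w x ^ 2 + c w x ^ 2))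
    (i.const_mul _) ?_).trans ?_
  · filter_upwards [hw] with x hx
    refine hx.trans (mul_le_mul_of_nonneg_right
      (mul_le_mul_of_nonneg_left (le_abs_self M) hw0'.le) (by positivity))
  · rw [integral_const_mul, mul_assoc]
    exact mul_le_mul_of_nonneg_left (mul_le_mul_of_nonneg_left e (abs_nonneg M)) hw0'.le

end Ribbon

/-! ### First moments of the difference quotient -/

namespace Ribbon

theorem exists_bound_strip (L : ℝ) {k : ℝ × ℝ × ℝ → ℝ} (hk : Continuous k) :
    ∃ M, ∀ w ∈ Ioc (0 : ℝ) 1, ∀ x ∈ strip L, |k (w, x)| ≤ M := by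
  have hK : IsCompact (Icc (0 : ℝ) 1 ×ˢ (Icc 0 L ×ˢ Icc (-(1 / 2) : ℝ) (1 / 2))) :=
    isCompact_Icc.prod (isCompact_Icc.prod isCompact_Icc)
  obtain ⟨M, hM⟩ := hK.exists_bound_of_continuousOn hk.continuousOn
  exact ⟨M, fun w hw x hx => hM (w, x) ⟨Ioc_subset_Icc_self hw, Ioo_subset_Icc_self hx.1,
    Ioo_subset_Icc_self hx.2⟩⟩

/-- The coefficients are continuous up to $w = 0$, hence bounded uniformly in `w`. The quadratic
growth on the right is the one `tendsto_remainder` admits. -/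
theorem exists_bound_affine (L : ℝ) {k₀ k₁ k₂ k₃ : ℝ × ℝ × ℝ → ℝ} (h₀ : Continuous k₀)
    (h₁ : Continuous k₁) (h₂ : Continuous k₂) (h₃ : Continuous k₃) :
    ∃ M, ∀ w ∈ Ioc (0 : ℝ) 1, ∀ x ∈ strip L, ∀ a b c : ℝ,
      |k₀ (w, x) + k₁ (w, x) * a + k₂ (w, x) * b + k₃ (w, x) * c|
        ≤ M * (1 + a ^ 2 + b ^ 2 + c ^ 2) := by
  obtain ⟨M₀, H₀⟩ := exists_bound_strip L h₀
  obtain ⟨M₁, H₁⟩ := exists_bound_strip L h₁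
  obtain ⟨M₂, H₂⟩ := exists_bound_strip L h₂
  obtain ⟨M₃, H₃⟩ := exists_bound_strip L h₃
  refine ⟨M₀ + M₁ + M₂ + M₃, fun w hw x hx a b c => ?_⟩
  have a₀ := H₀ w hw x hx
  have a₁ := H₁ w hw x hx
  have a₂ := H₂ w hw x hx
  have a₃ := H₃ w hw x hx
  have key : ∀ k M t : ℝ, |k| ≤ M → |k * t| ≤ M * (1 + t ^ 2) := fun k M t h => by
    rw [abs_mul]
    exact mul_le_mul h (by nlinarith [sq_nonneg (|t| - 1), sq_abs t]) (abs_nonneg t)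
      ((abs_nonneg k).trans h)
  have b₁ := key _ _ a a₁
  have b₂ := key _ _ b a₂
  have b₃ := key _ _ c a₃
  have c₀ := (abs_nonneg _).trans a₀
  have c₁ := (abs_nonneg _).trans a₁
  have c₂ := (abs_nonneg _).trans a₂
  have c₃ := (abs_nonneg _).trans a₃
  have t1 := abs_add_le (k₀ (w, x) + k₁ (w, x) * a + k₂ (w, x) * b) (k₃ (w, x) * c)
  have t2 := abs_add_le (k₀ (w, x) + k₁ (w, x) * a) (k₂ (w, x) * b)
  have t3 := abs_add_le (k₀ (w, x)) (k₁ (w, x) * a)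
  have p1 := sq_nonneg a
  have p2 := sq_nonneg b
  have p3 := sq_nonneg c
  nlinarith [mul_nonneg c₀ p1, mul_nonneg c₀ p2, mul_nonneg c₀ p3, mul_nonneg c₁ p2,
    mul_nonneg c₁ p3, mul_nonneg c₂ p1, mul_nonneg c₂ p3, mul_nonneg c₃ p1, mul_nonneg c₃ p2]

/-- The integrand is the divergence $\partial_1(\varphi a) - t\,\partial_2(\varphi b) +
\partial_2(\varphi x_2 c)$. With $t = w^{-1}$ this removes the singular term of the Codazzi
equations, because the leading coefficient `b` does not depend on $x_2$. -/
theorem integral_test_divergence {L : ℝ} {φ : ℝ × ℝ → ℝ} (hφ : ContDiff ℝ ∞ φ)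
    (hs : HasCompactSupport φ) (ht : tsupport φ ⊆ strip L) {a b c : ℝ → ℝ} (ha : ContDiff ℝ ∞ a)
    (hb : ContDiff ℝ ∞ b) (hc : ContDiff ℝ ∞ c) (t : ℝ) :
    Integrable (fun x : ℝ × ℝ => fderiv ℝ φ x (dir 0) * a x.1 + φ x * deriv a x.1
        - t * (fderiv ℝ φ x (dir 1) * b x.1) + (fderiv ℝ φ x (dir 1) * (x.2 * c x.1) + φ x * c x.1))
        (volume.restrict (strip L)) ∧
      ∫ x in strip L, (fderiv ℝ φ x (dir 0) * a x.1 + φ x * deriv a x.1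
        - t * (fderiv ℝ φ x (dir 1) * b x.1) + (fderiv ℝ φ x (dir 1) * (x.2 * c x.1) + φ x * c x.1))
        = 0 := by
  have hf : ∀ {f : ℝ → ℝ}, ContDiff ℝ ∞ f → ∀ x : ℝ × ℝ, HasFDerivAt (fun y : ℝ × ℝ => f y.1)
      (deriv f x.1 • ContinuousLinearMap.fst ℝ ℝ ℝ) x := fun h x =>
    ((h.differentiable (by norm_num)) x.1).hasDerivAt.comp_hasFDerivAt x hasFDerivAt_fst
  have wa := WeakPartial.of_contDiff (Ω := strip L) (i := 0) (ha.comp contDiff_fst) φ hφ hs ht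
  have wb := WeakPartial.of_contDiff (Ω := strip L) (i := 1) (hb.comp contDiff_fst) φ hφ hs ht
  have wc := WeakPartial.of_contDiff (Ω := strip L) (i := 1)
    (contDiff_snd.mul (hc.comp contDiff_fst)) φ hφ hs ht
  have da : ∀ x : ℝ × ℝ, fderiv ℝ (a ∘ Prod.fst) x (dir 0) = deriv a x.1 := fun x => by
    rw [show a ∘ Prod.fst = fun y : ℝ × ℝ => a y.1 from rfl, (hf ha x).fderiv]; simp [dir]
  have db : ∀ x : ℝ × ℝ, fderiv ℝ (b ∘ Prod.fst) x (dir 1) = 0 := fun x => by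
    rw [show b ∘ Prod.fst = fun y : ℝ × ℝ => b y.1 from rfl, (hf hb x).fderiv]; simp [dir]
  have dc : ∀ x : ℝ × ℝ, fderiv ℝ (fun y : ℝ × ℝ => y.2 * c y.1) x (dir 1) = c x.1 :=
    fun x => by
    rw [(hasFDerivAt_snd.fun_mul (hf hc x)).fderiv]
    simp [dir]
  simp only [Function.comp_apply, da, db, dc] at wa wb wc
  have c0 := continuous_fderiv_dir hφ (dir 0)
  have c1 := continuous_fderiv_dir hφ (dir 1)
  have cφ := hφ.continuous
  have ca := ha.continuous
  have cb := hb.continuous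
  have cc := hc.continuous
  have cda : Continuous (deriv a) := ha.continuous_deriv (by norm_num)
  have int : ∀ {f : ℝ × ℝ → ℝ}, Continuous f → Integrable f (volume.restrict (strip L)) := fun h =>
    (continuousOn_memLp_strip h.continuousOn).integrable (by norm_num)
  have i1 : Integrable (fun x : ℝ × ℝ => fderiv ℝ φ x (dir 0) * a x.1)
    (volume.restrict (strip L)) := int (by fun_prop)
  have i2 : Integrable (fun x : ℝ × ℝ => φ x * deriv a x.1)
    (volume.restrict (strip L)) := int (by fun_prop)
  have i3 : Integrable (fun x : ℝ × ℝ => t * (fderiv ℝ φ x (dir 1) * b x.1))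
    (volume.restrict (strip L)) := int (by fun_prop)
  have i4 : Integrable (fun x : ℝ × ℝ => fderiv ℝ φ x (dir 1) * (x.2 * c x.1))
    (volume.restrict (strip L)) := int (by fun_prop)
  have i5 : Integrable (fun x : ℝ × ℝ => φ x * c x.1)
    (volume.restrict (strip L)) := int (by fun_prop)
  have i12 : Integrable (fun x : ℝ × ℝ => fderiv ℝ φ x (dir 0) * a x.1 + φ x * deriv a x.1)
    (volume.restrict (strip L)) := i1.add i2
  have i123 : Integrable (fun x : ℝ × ℝ => fderiv ℝ φ x (dir 0) * a x.1 + φ x * deriv a x.1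
    - t * (fderiv ℝ φ x (dir 1) * b x.1)) (volume.restrict (strip L)) := i12.sub i3
  have i45 : Integrable (fun x : ℝ × ℝ => fderiv ℝ φ x (dir 1) * (x.2 * c x.1) + φ x * c x.1)
    (volume.restrict (strip L)) := i4.add i5
  refine ⟨i123.add i45, ?_⟩
  rw [integral_add i123 i45, integral_sub i12 i3, integral_add i1 i2,
    integral_add i4 i5, integral_const_mul, wa, wb, wc]
  simp

namespace FlatGeometry

variable (R : FlatGeometry)

theorem contDiff_l₀ : ContDiff ℝ ∞ R.l₀ := (R.smooth_II 0 0).comp (contDiff_id.prodMk contDiff_const)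
theorem contDiff_m₀ : ContDiff ℝ ∞ R.m₀ := (R.smooth_II 0 1).comp (contDiff_id.prodMk contDiff_const)
theorem contDiff_n₀ : ContDiff ℝ ∞ R.n₀ := (R.smooth_II 1 1).comp (contDiff_id.prodMk contDiff_const)

theorem II0_one_zero (s : ℝ) : R.II0 s 1 0 = R.m₀ s := (R.symm_II (s, 0)).apply 0 1

theorem det_II0 (s : ℝ) : (R.II0 s).det = R.l₀ s * R.n₀ s - R.m₀ s ^ 2 := by
  rw [Matrix.det_fin_two, II0_one_zero, sq]; rfl

/-- The normal derivative along the midline of the second form of an isometric immersion of the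
flat ribbon which agrees with `II⁰` on the midline. -/
noncomputable def slope (s : ℝ) : Mat2 :=
  !![deriv R.m₀ s - R.κ s * (R.l₀ s + R.n₀ s), deriv R.n₀ s + R.κ s * R.m₀ s;
    deriv R.n₀ s + R.κ s * R.m₀ s,
    (-(R.n₀ s * (deriv R.m₀ s - R.κ s * (R.l₀ s + R.n₀ s)))
      + 2 * R.m₀ s * (deriv R.n₀ s + R.κ s * R.m₀ s)) / R.l₀ s]

theorem contDiff_slope_zero (i : Fin 2) : ContDiff ℝ ∞ fun s => R.slope s 0 i := by
  have h1 := R.contDiff_l₀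
  have h2 := R.contDiff_m₀
  have h3 := R.contDiff_n₀
  have h4 : ContDiff ℝ ∞ (deriv R.m₀) := (contDiff_infty_iff_deriv.1 h2).2
  have h5 : ContDiff ℝ ∞ (deriv R.n₀) := (contDiff_infty_iff_deriv.1 h3).2
  have h6 := R.smooth_κ
  fin_cases i
  · exact h4.sub (h6.mul (h1.add h3))
  · exact h5.add (h6.mul h2)

/-- The difference quotient `(A - II⁰) / w`. -/
noncomputable def quot (w : ℝ) (A : ℝ × ℝ → Mat2) (x : ℝ × ℝ) : Mat2 :=
  w⁻¹ • (A x - R.II0 x.1)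

theorem eq_add_quot {w : ℝ} (hw : w ≠ 0) (A : ℝ × ℝ → Mat2) (x : ℝ × ℝ) (i j : Fin 2) :
    A x i j = R.II0 x.1 i j + w * R.quot w A x i j := by
  simp only [quot, Matrix.smul_apply, Matrix.sub_apply, smul_eq_mul]
  field_simp
  ring

theorem memLp_quot {L w : ℝ} {A : ℝ × ℝ → Mat2} (hA : R.IsGaussCodazzi L w A) (i j : Fin 2) :
    MemLp (fun x => R.quot w A x i j) 2 (volume.restrict (strip L)) := by
  have h : MemLp (fun x : ℝ × ℝ => R.II0 x.1 i j) 2 (volume.restrict (strip L)) :=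
    continuousOn_memLp_strip (((R.smooth_II i j).continuous.comp
      (continuous_fst.prodMk continuous_const)).continuousOn)
  exact ((hA.memLp i j).sub h).const_mul w⁻¹

/-- The common mechanism for both Codazzi equations. `F` is the integrand of an equation, so it
integrates to zero; after adding $\partial_2\varphi\, D$ it becomes a divergence plus terms of order
`w` that are affine in the difference quotient. Hence $\partial_2 D \to 0$ in distributions. -/
theorem tendsto_test_of_identity {L : ℝ} {φ : ℝ × ℝ → ℝ} (hφ : ContDiff ℝ ∞ φ)
    (hs : HasCompactSupport φ) (ht : tsupport φ ⊆ strip L) {a b c : ℝ → ℝ} (ha : ContDiff ℝ ∞ a)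
    (hb : ContDiff ℝ ∞ b) (hc : ContDiff ℝ ∞ c) {u v z : ℝ → ℝ × ℝ → ℝ} {K : ℝ}
    (hm : ∀ᶠ w in 𝓝[>] (0 : ℝ), MemLp (u w) 2 (volume.restrict (strip L)) ∧
      MemLp (v w) 2 (volume.restrict (strip L)) ∧ MemLp (z w) 2 (volume.restrict (strip L)))
    (hK : ∀ᶠ w in 𝓝[>] (0 : ℝ), ∫ x in strip L, u w x ^ 2 ≤ K ∧ ∫ x in strip L, v w x ^ 2 ≤ K ∧
      ∫ x in strip L, z w x ^ 2 ≤ K) {F D : ℝ → ℝ × ℝ → ℝ}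
    (hD : ∀ᶠ w in 𝓝[>] (0 : ℝ), MemLp (D w) 2 (volume.restrict (strip L)))
    (hF : ∀ᶠ w in 𝓝[>] (0 : ℝ), Integrable (F w) (volume.restrict (strip L)) ∧
      ∫ x in strip L, F w x = 0)
    {k₀ k₁ k₂ k₃ : ℝ × ℝ × ℝ → ℝ} (h₀ : Continuous k₀)
    (h₁ : Continuous k₁) (h₂ : Continuous k₂) (h₃ : Continuous k₃)
    (hid : ∀ᶠ w in 𝓝[>] (0 : ℝ), ∀ x,
      F w x + fderiv ℝ φ x (dir 1) * D w x
        = (fderiv ℝ φ x (dir 0) * a x.1 + φ x * deriv a x.1 - w⁻¹ * (fderiv ℝ φ x (dir 1) * b x.1)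
          + (fderiv ℝ φ x (dir 1) * (x.2 * c x.1) + φ x * c x.1))
        + w * (k₀ (w, x) + k₁ (w, x) * u w x + k₂ (w, x) * v w x + k₃ (w, x) * z w x)) :
    Tendsto (fun w => ∫ x in strip L, fderiv ℝ φ x (dir 1) * D w x) (𝓝[>] 0) (𝓝 0) := by
  obtain ⟨M, hM⟩ := exists_bound_affine L h₀ h₁ h₂ h₃
  have h1 : ∀ᶠ w in 𝓝[>] (0 : ℝ), w ∈ Ioc (0 : ℝ) 1 := Ioc_mem_nhdsGT one_pos
  have rem : Tendsto (fun w => ∫ x in strip L,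
      w * (k₀ (w, x) + k₁ (w, x) * u w x + k₂ (w, x) * v w x + k₃ (w, x) * z w x)) (𝓝[>] 0) (𝓝 0) := by
    refine tendsto_remainder hm hK (M := M) ?_
    filter_upwards [h1] with w hw
    filter_upwards [ae_restrict_mem (measurableSet_strip L)] with x hx
    rw [abs_mul, abs_of_pos hw.1, mul_assoc]
    exact mul_le_mul_of_nonneg_left (hM w hw x hx _ _ _) hw.1.le
  refine rem.congr' ?_
  filter_upwards [hD, hF, hid] with w hDw ⟨hFi, hF0⟩ hw
  obtain ⟨hi, h0⟩ := integral_test_divergence hφ hs ht ha hb hc w⁻¹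
  have hφD : Integrable (fun x => fderiv ℝ φ x (dir 1) * D w x) (volume.restrict (strip L)) :=
    integrable_mul_of_memLp_two
      (continuousOn_memLp_strip (continuous_fderiv_dir hφ _).continuousOn) hDw
  have e : ∀ x, w * (k₀ (w, x) + k₁ (w, x) * u w x + k₂ (w, x) * v w x + k₃ (w, x) * z w x)
      = F w x + fderiv ℝ φ x (dir 1) * D w x
        - (fderiv ℝ φ x (dir 0) * a x.1 + φ x * deriv a x.1 - w⁻¹ * (fderiv ℝ φ x (dir 1) * b x.1)
          + (fderiv ℝ φ x (dir 1) * (x.2 * c x.1) + φ x * c x.1)) := fun x => by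
    rw [hw x]; ring
  have hsum : Integrable (fun x => F w x + fderiv ℝ φ x (dir 1) * D w x)
    (volume.restrict (strip L)) := hFi.add hφD
  simp only [e]
  rw [integral_sub hsum hi, h0, integral_add hFi hφD, hF0]
  ring

theorem continuous_deriv_κ : Continuous (deriv R.κ) := R.smooth_κ.continuous_deriv (by norm_num)

theorem integrable_test_mul_of_memLp {L : ℝ} {k u : ℝ × ℝ → ℝ} (hk : Continuous k)
    (hu : MemLp u 2 (volume.restrict (strip L))) :
    Integrable (fun x => k x * u x) (volume.restrict (strip L)) :=
  integrable_mul_of_memLp_two (continuousOn_memLp_strip hk.continuousOn) hu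

/-- The first moments in `x₂` of `(A_w - II⁰) / w - x₂ Θ` vanish in the limit, for solutions `A_w` of
the rescaled Gauss–Codazzi equations which are `O(w)`-close to `II⁰`. -/
theorem tendsto_moment {L : ℝ} (hL : 0 < L) (hdet : ∀ s ∈ Icc 0 L, (R.II0 s).det = 0)
    (hl : ∀ s ∈ Icc 0 L, R.l₀ s ≠ 0) {A : ℝ → ℝ × ℝ → Mat2}
    (hA : ∀ᶠ w in 𝓝[>] (0 : ℝ), R.IsGaussCodazzi L w (A w)) {K : ℝ}
    (hK : ∀ᶠ w in 𝓝[>] (0 : ℝ), ∀ i j, ∫ x in strip L, R.quot w (A w) x i j ^ 2 ≤ K)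
    {c : ℝ → ℝ} (hc : ContinuousOn c (Icc 0 L)) (i j : Fin 2) :
    Tendsto (fun w => ∫ x in strip L, x.2 * c x.1 * (R.quot w (A w) x i j - x.2 * R.slope x.1 i j))
      (𝓝[>] 0) (𝓝 0) := by
  have hpos : ∀ᶠ w in 𝓝[>] (0 : ℝ), (0 : ℝ) < w := self_mem_nhdsWithin
  have cκ := R.smooth_κ.continuous
  have cκ' := R.continuous_deriv_κ
  have sl := R.contDiff_l₀
  have sm := R.contDiff_m₀
  have sn := R.contDiff_n₀
  have cl := sl.continuous
  have cm := sm.continuous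
  have cn := sn.continuous
  have s00 := R.contDiff_slope_zero 0
  have s01 := R.contDiff_slope_zero 1
  have hm : ∀ᶠ w in 𝓝[>] (0 : ℝ), ∀ i j, MemLp (fun x => R.quot w (A w) x i j) 2
      (volume.restrict (strip L)) := hA.mono fun w h => R.memLp_quot h
  have hm3 : ∀ᶠ w in 𝓝[>] (0 : ℝ), MemLp (fun x => R.quot w (A w) x 0 0) 2
      (volume.restrict (strip L)) ∧ MemLp (fun x => R.quot w (A w) x 0 1) 2
      (volume.restrict (strip L)) ∧ MemLp (fun x => R.quot w (A w) x 1 1) 2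
      (volume.restrict (strip L)) := hm.mono fun w h => ⟨h 0 0, h 0 1, h 1 1⟩
  have hK3 : ∀ᶠ w in 𝓝[>] (0 : ℝ), ∫ x in strip L, R.quot w (A w) x 0 0 ^ 2 ≤ K ∧
      ∫ x in strip L, R.quot w (A w) x 0 1 ^ 2 ≤ K ∧ ∫ x in strip L, R.quot w (A w) x 1 1 ^ 2 ≤ K :=
    hK.mono fun w h => ⟨h 0 0, h 0 1, h 1 1⟩
  have mslope : ∀ i, MemLp (fun x : ℝ × ℝ => x.2 * R.slope x.1 0 i) 2 (volume.restrict (strip L)) :=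
    fun i => continuousOn_memLp_strip (continuous_snd.mul
      ((R.contDiff_slope_zero i).continuous.comp continuous_fst)).continuousOn
  have hD : ∀ i, ∀ᶠ w in 𝓝[>] (0 : ℝ), MemLp (fun x => R.quot w (A w) x 0 i - x.2 * R.slope x.1 0 i) 2
      (volume.restrict (strip L)) := fun i => hm.mono fun w h => (h 0 i).sub (mslope i)
  have hDK : ∀ i, ∀ᶠ w in 𝓝[>] (0 : ℝ), ∫ x in strip L,
      (R.quot w (A w) x 0 i - x.2 * R.slope x.1 0 i) ^ 2
        ≤ 2 * K + 2 * ∫ x in strip L, (x.2 * R.slope x.1 0 i) ^ 2 := fun i => by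
    filter_upwards [hm, hK] with w h h'
    have := integral_add_sq_le (h 0 i) (mslope i).neg
    simp only [Pi.neg_apply, neg_sq, ← sub_eq_add_neg] at this
    linarith [h' 0 i]
  -- The first row of the difference quotient is controlled by the two Codazzi equations, one for
  -- each entry.
  have row : ∀ i {d : ℝ → ℝ}, ContinuousOn d (Icc 0 L) → Tendsto (fun w => ∫ x in strip L,
      x.2 * d x.1 * (R.quot w (A w) x 0 i - x.2 * R.slope x.1 0 i)) (𝓝[>] 0) (𝓝 0) := by
    intro i d hd
    refine tendsto_moment_of_tendsto_test hL (hD i) (hDK i) (fun φ hφ hs ht => ?_) hd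
    have c0 := continuous_fderiv_dir hφ (dir 0)
    have c1 := continuous_fderiv_dir hφ (dir 1)
    have cφ := hφ.continuous
    have clen : ∀ w, Continuous (R.len w) := fun w => (R.contDiff_len w).continuous
    have clen' : ∀ w, Continuous (R.len' w) := fun w => by unfold len'; fun_prop
    obtain rfl | rfl : i = 0 ∨ i = 1 := by omega
    -- The terms of order 1 with $\varphi$ undifferentiated are $2\kappa l_0 + \kappa n_0$. They
    -- equal $m_0' + c$ for $c = \kappa l_0 - \Theta_{00}$, which is also the coefficient left in
    -- front of $x_2\partial_2\varphi$; this is what determines $\Theta_{00}$.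
    · refine tendsto_test_of_identity hφ hs ht sm sl
        ((R.smooth_κ.mul sl).sub s00) hm3 hK3
        (F := fun w x => fderiv ℝ φ x (dir 0) * (R.len w x * A w x 0 1)
          - w⁻¹ * fderiv ℝ φ x (dir 1) * (R.len w x * A w x 0 0)
          + φ x * (2 * R.κ x.1 * A w x 0 0 + 2 * R.len' w x * A w x 0 1
            + R.κ x.1 * R.len w x ^ 2 * A w x 1 1)) (hD 0) ?_
        (k₀ := fun y => -(fderiv ℝ φ y.2 (dir 0) * (R.κ y.2.1 * y.2.2 * R.m₀ y.2.1))
          + φ y.2 * (-(2 * deriv R.κ y.2.1 * y.2.2 * R.m₀ y.2.1)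
            + R.κ y.2.1 * (R.n₀ y.2.1 * (-(2 * R.κ y.2.1 * y.2.2)
              + y.1 * R.κ y.2.1 ^ 2 * y.2.2 ^ 2))))
        (k₁ := fun y => fderiv ℝ φ y.2 (dir 1) * (R.κ y.2.1 * y.2.2) + φ y.2 * (2 * R.κ y.2.1))
        (k₂ := fun y => fderiv ℝ φ y.2 (dir 0) * (1 - y.1 * R.κ y.2.1 * y.2.2)
          - φ y.2 * (2 * deriv R.κ y.2.1 * y.2.2 * y.1))
        (k₃ := fun y => φ y.2 * (R.κ y.2.1 * (1 - y.1 * R.κ y.2.1 * y.2.2) ^ 2))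
        (by fun_prop) (by fun_prop) (by fun_prop) (by fun_prop) ?_
      · filter_upwards [hA] with w h
        have i1 := integrable_test_mul_of_memLp (c0.mul (clen w)) (h.memLp 0 1)
        have i2 := integrable_test_mul_of_memLp ((continuous_const (y := w⁻¹)).mul
          (c1.mul (clen w))) (h.memLp 0 0)
        have i3 := integrable_test_mul_of_memLp (cφ.mul ((continuous_const (y := (2 : ℝ))).mul
          (cκ.comp continuous_fst))) (h.memLp 0 0)
        have i4 := integrable_test_mul_of_memLp (cφ.mul ((continuous_const (y := (2 : ℝ))).mul
          (clen' w))) (h.memLp 0 1)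
        have i5 := integrable_test_mul_of_memLp (cφ.mul ((cκ.comp continuous_fst).mul
          ((clen w).pow 2))) (h.memLp 1 1)
        have I1 : Integrable (fun x => fderiv ℝ φ x (dir 0) * (R.len w x * A w x 0 1)
            - w⁻¹ * fderiv ℝ φ x (dir 1) * (R.len w x * A w x 0 0)) (volume.restrict (strip L)) := by
          refine (i1.sub i2).congr (.of_forall fun x => ?_)
          simp only [Pi.sub_apply, Pi.mul_apply]; ring
        have I2 : Integrable (fun x => φ x * (2 * R.κ x.1 * A w x 0 0 + 2 * R.len' w x * A w x 0 1
            + R.κ x.1 * R.len w x ^ 2 * A w x 1 1)) (volume.restrict (strip L)) := by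
          refine ((i3.add i4).add i5).congr (.of_forall fun x => ?_)
          simp only [Pi.add_apply, Pi.mul_apply, Pi.pow_apply, Function.comp_apply]; ring
        exact ⟨I1.add I2, by rw [integral_add I1 I2, h.codazzi₁ φ hφ hs ht, neg_add_cancel]⟩
      · filter_upwards [hpos] with w hw x
        have q := R.eq_add_quot hw.ne' (A w) x
        simp only [q 0 0, q 0 1, q 1 1, len, len']
        simp only [show R.II0 x.1 0 0 = R.l₀ x.1 from rfl, show R.II0 x.1 0 1 = R.m₀ x.1 from rfl,
          show R.II0 x.1 1 1 = R.n₀ x.1 from rfl, slope, Matrix.of_apply]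
        simp only [Matrix.cons_val', Matrix.cons_val_zero]
        field_simp
        ring
    -- The same balance for the second equation, with $n_0' + c = 0$ replacing it: this fixes
    -- $\Theta_{01} = n_0' + \kappa m_0$.
    · refine tendsto_test_of_identity hφ hs ht sn sm
        ((R.smooth_κ.mul sm).sub s01) hm3 hK3
        (F := fun w x => fderiv ℝ φ x (dir 0) * (R.len w x * A w x 1 1)
          - w⁻¹ * fderiv ℝ φ x (dir 1) * (R.len w x * A w x 0 1)
          + φ x * (R.len' w x * A w x 1 1)) (hD 1) ?_
        (k₀ := fun y => -(fderiv ℝ φ y.2 (dir 0) * (R.κ y.2.1 * y.2.2 * R.n₀ y.2.1))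
          - φ y.2 * (deriv R.κ y.2.1 * y.2.2 * R.n₀ y.2.1))
        (k₁ := fun y => 0)
        (k₂ := fun y => fderiv ℝ φ y.2 (dir 1) * (R.κ y.2.1 * y.2.2))
        (k₃ := fun y => fderiv ℝ φ y.2 (dir 0) * (1 - y.1 * R.κ y.2.1 * y.2.2)
          - φ y.2 * (deriv R.κ y.2.1 * y.2.2 * y.1))
        (by fun_prop) (by fun_prop) (by fun_prop) (by fun_prop) ?_
      · filter_upwards [hA] with w h
        have i1 := integrable_test_mul_of_memLp (c0.mul (clen w)) (h.memLp 1 1)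
        have i2 := integrable_test_mul_of_memLp ((continuous_const (y := w⁻¹)).mul
          (c1.mul (clen w))) (h.memLp 0 1)
        have i3 := integrable_test_mul_of_memLp (cφ.mul (clen' w)) (h.memLp 1 1)
        have I1 : Integrable (fun x => fderiv ℝ φ x (dir 0) * (R.len w x * A w x 1 1)
            - w⁻¹ * fderiv ℝ φ x (dir 1) * (R.len w x * A w x 0 1)) (volume.restrict (strip L)) := by
          refine (i1.sub i2).congr (.of_forall fun x => ?_)
          simp only [Pi.sub_apply, Pi.mul_apply]; ring
        have I2 : Integrable (fun x => φ x * (R.len' w x * A w x 1 1))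
            (volume.restrict (strip L)) := by
          refine i3.congr (.of_forall fun x => ?_)
          simp only [Pi.mul_apply]; ring
        exact ⟨I1.add I2, by rw [integral_add I1 I2, h.codazzi₂ φ hφ hs ht, neg_add_cancel]⟩
      · filter_upwards [hpos] with w hw x
        have q := R.eq_add_quot hw.ne' (A w) x
        simp only [q 0 1, q 1 1, len, len']
        simp only [show R.II0 x.1 0 1 = R.m₀ x.1 from rfl,
          show R.II0 x.1 1 1 = R.n₀ x.1 from rfl, slope, Matrix.of_apply]
        simp only [Matrix.cons_val', Matrix.cons_val_zero, Matrix.cons_val_one]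
        field_simp
        ring
  have hsym : ∀ᶠ w in 𝓝[>] (0 : ℝ), ∀ᵐ x ∂(volume.restrict (strip L)),
      R.quot w (A w) x 1 0 = R.quot w (A w) x 0 1 := by
    filter_upwards [hA] with w h
    filter_upwards [h.symm] with x hx
    simp only [quot, Matrix.smul_apply, Matrix.sub_apply, hx, II0_one_zero]
    rfl
  -- The weights with which the linearised Gauss equation expresses the lower right entry through
  -- the first row.
  have d1 : ContinuousOn (fun s => R.n₀ s * c s / R.l₀ s) (Icc 0 L) :=
    (cn.continuousOn.mul hc).div cl.continuousOn hl
  have d2 : ContinuousOn (fun s => 2 * R.m₀ s * c s / R.l₀ s) (Icc 0 L) :=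
    (((continuous_const.mul cm).continuousOn).mul hc).div cl.continuousOn hl
  have d3 : ContinuousOn (fun s => c s / R.l₀ s) (Icc 0 L) := hc.div cl.continuousOn hl
  obtain rfl | rfl : i = 0 ∨ i = 1 := by omega
  · exact row j hc
  · obtain rfl | rfl : j = 0 ∨ j = 1 := by omega
    · refine (row 1 hc).congr' ?_
      filter_upwards [hsym] with w hw
      refine integral_congr_ae ?_
      filter_upwards [hw] with x hx
      simp only [hx]
      rfl
    · obtain ⟨M, hM⟩ := isCompact_Icc.exists_bound_of_continuousOn d3
      -- The quadratic part of the Gauss equation carries a factor `w` and is otherwise bounded in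
      -- $L^1$.
      have rem : Tendsto (fun w => ∫ x in strip L, w * (x.2 * (c x.1 / R.l₀ x.1)
          * (R.quot w (A w) x 0 0 * R.quot w (A w) x 1 1 - R.quot w (A w) x 0 1 ^ 2)))
          (𝓝[>] 0) (𝓝 0) := by
        refine tendsto_remainder hm3 hK3 (M := M) ?_
        filter_upwards [hpos] with w hw
        filter_upwards [ae_restrict_mem (measurableSet_strip L)] with x hx
        have hb := hM x.1 (Ioo_subset_Icc_self hx.1)
        rw [Real.norm_eq_abs] at hb
        have h2 : |x.2| ≤ 1 := abs_le.2 ⟨by linarith [hx.2.1], by linarith [hx.2.2]⟩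
        have h3 : |R.quot w (A w) x 0 0 * R.quot w (A w) x 1 1 - R.quot w (A w) x 0 1 ^ 2|
            ≤ 1 + R.quot w (A w) x 0 0 ^ 2 + R.quot w (A w) x 0 1 ^ 2 + R.quot w (A w) x 1 1 ^ 2 :=
          abs_le.2 ⟨by nlinarith [sq_nonneg (R.quot w (A w) x 0 0 + R.quot w (A w) x 1 1),
              sq_nonneg (R.quot w (A w) x 0 0), sq_nonneg (R.quot w (A w) x 1 1)],
            by nlinarith [sq_nonneg (R.quot w (A w) x 0 0 - R.quot w (A w) x 1 1),
              sq_nonneg (R.quot w (A w) x 0 1), sq_nonneg (R.quot w (A w) x 0 0),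
              sq_nonneg (R.quot w (A w) x 1 1)]⟩
        rw [abs_mul, abs_of_pos hw, mul_assoc w M, abs_mul, abs_mul]
        refine mul_le_mul_of_nonneg_left (mul_le_mul ?_ h3 (abs_nonneg _)
          ((abs_nonneg _).trans hb)) hw.le
        calc |x.2| * |c x.1 / R.l₀ x.1| ≤ 1 * M := mul_le_mul h2 hb (abs_nonneg _) zero_le_one
          _ = M := one_mul M
      have tot := ((row 1 d2).sub (row 0 d1)).sub rem
      rw [sub_zero, sub_zero] at tot
      refine tot.congr' ?_
      filter_upwards [hA, hpos, hD 0, hD 1, hm] with w h hw h0 h1 hmw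
      have mc : ∀ {d : ℝ → ℝ}, ContinuousOn d (Icc 0 L) →
          MemLp (fun x : ℝ × ℝ => x.2 * d x.1) 2 (volume.restrict (strip L)) := fun hd =>
        continuousOn_memLp_strip (continuous_snd.continuousOn.mul (continuousOn_comp_fst hd))
      have J1 := integrable_mul_of_memLp_two (mc d2) h1
      have J0 := integrable_mul_of_memLp_two (mc d1) h0
      have hgauss : ∀ᵐ x ∂(volume.restrict (strip L)), x ∈ strip L →
          x.2 * (2 * R.m₀ x.1 * c x.1 / R.l₀ x.1) *
              (R.quot w (A w) x 0 1 - x.2 * R.slope x.1 0 1)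
            - x.2 * (R.n₀ x.1 * c x.1 / R.l₀ x.1) *
              (R.quot w (A w) x 0 0 - x.2 * R.slope x.1 0 0)
            - w * (x.2 * (c x.1 / R.l₀ x.1)
          * (R.quot w (A w) x 0 0 * R.quot w (A w) x 1 1 - R.quot w (A w) x 0 1 ^ 2))
          = x.2 * c x.1 * (R.quot w (A w) x 1 1 - x.2 * R.slope x.1 1 1) := by
        filter_upwards [h.gauss] with x hx hxs
        have hxs' := Ioo_subset_Icc_self hxs.1
        have q := R.eq_add_quot hw.ne' (A w) x
        have hdx := hdet x.1 hxs'
        rw [det_II0] at hdx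
        rw [q 0 0, q 0 1, q 1 1] at hx
        simp only [show R.II0 x.1 0 0 = R.l₀ x.1 from rfl, show R.II0 x.1 0 1 = R.m₀ x.1 from rfl,
          show R.II0 x.1 1 1 = R.n₀ x.1 from rfl] at hx
        -- Both $A$ and $\mathrm{II}^0$ have determinant zero; the difference of the two
        -- determinants is divided by `w`.
        have hE : R.l₀ x.1 * R.quot w (A w) x 1 1 = -(R.n₀ x.1 * R.quot w (A w) x 0 0)
            + 2 * R.m₀ x.1 * R.quot w (A w) x 0 1
            - w * (R.quot w (A w) x 0 0 * R.quot w (A w) x 1 1 - R.quot w (A w) x 0 1 ^ 2) := by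
          refine mul_left_cancel₀ hw.ne' ?_
          linear_combination hx - hdx
        have hS : R.l₀ x.1 * R.slope x.1 1 1 = -(R.n₀ x.1 * R.slope x.1 0 0)
            + 2 * R.m₀ x.1 * R.slope x.1 0 1 := mul_div_cancel₀ _ (hl _ hxs')
        have hl' := hl _ hxs'
        field_simp
        linear_combination (-(x.2 * c x.1)) * hE + x.2 ^ 2 * c x.1 * hS
      have J2 : Integrable (fun x : ℝ × ℝ => w * (x.2 * (c x.1 / R.l₀ x.1)
          * (R.quot w (A w) x 0 0 * R.quot w (A w) x 1 1 - R.quot w (A w) x 0 1 ^ 2)))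
          (volume.restrict (strip L)) := by
        have J3 := integrable_mul_of_memLp_two (hmw 0 0) (hmw 1 1)
        have J4 := (hmw 0 1).integrable_sq
        refine ((J3.sub J4).bdd_mul (f := fun x : ℝ × ℝ => x.2 * (c x.1 / R.l₀ x.1)) (c := M)
          (mc d3).1 ?_).const_mul w
        filter_upwards [ae_restrict_mem (measurableSet_strip L)] with x hx
        have hb := hM x.1 (Ioo_subset_Icc_self hx.1)
        rw [Real.norm_eq_abs] at hb
        have h2 : |x.2| ≤ 1 := abs_le.2 ⟨by linarith [hx.2.1], by linarith [hx.2.2]⟩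
        rw [Real.norm_eq_abs, abs_mul]
        calc |x.2| * |c x.1 / R.l₀ x.1| ≤ 1 * M := mul_le_mul h2 hb (abs_nonneg _) zero_le_one
          _ = M := one_mul M
      have J10 : Integrable (fun x : ℝ × ℝ => x.2 * (2 * R.m₀ x.1 * c x.1 / R.l₀ x.1) *
              (R.quot w (A w) x 0 1 - x.2 * R.slope x.1 0 1)
            - x.2 * (R.n₀ x.1 * c x.1 / R.l₀ x.1) *
              (R.quot w (A w) x 0 0 - x.2 * R.slope x.1 0 0)) (volume.restrict (strip L)) := J1.sub J0
      rw [← integral_sub J1 J0, ← integral_sub J10 J2]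
      refine integral_congr_ae ?_
      filter_upwards [hgauss, ae_restrict_mem (measurableSet_strip L)] with x hx hxs
      exact hx hxs

end FlatGeometry

end Ribbon

namespace Ribbon

/-! ### An implicit function along a compact set -/

/-- The map $(z, s) \mapsto (z, G(z,s))$ is a local diffeomorphism near the graph of `s₀` and
injective on this compact graph, hence injective on a neighbourhood of it. There the zero of
$G(z,\cdot)$ is unique, so the locally defined smooth implicit functions agree and form a single
`σ`. -/
theorem exists_implicit {G : (ℝ × ℝ) × ℝ → ℝ} (hG : ContDiff ℝ ∞ G) {K : Set (ℝ × ℝ)}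
    (hK : IsCompact K) {s₀ : ℝ × ℝ → ℝ} (hs : ContinuousOn s₀ K) (h0 : ∀ z ∈ K, G (z, s₀ z) = 0)
    (h1 : ∀ z ∈ K, fderiv ℝ G (z, s₀ z) (0, 1) ≠ 0) :
    ∃ U : Set (ℝ × ℝ), ∃ σ : ℝ × ℝ → ℝ, IsOpen U ∧ K ⊆ U ∧ ContDiffOn ℝ ∞ σ U ∧
      (∀ z ∈ U, G (z, σ z) = 0) ∧ ∀ z ∈ K, σ z = s₀ z := by
  set T : (ℝ × ℝ) × ℝ → (ℝ × ℝ) × ℝ := fun p => (p.1, G p) with hT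
  have hTd : ContDiff ℝ ∞ T := contDiff_fst.prodMk hG
  have hGdiff : ∀ p, HasFDerivAt G (fderiv ℝ G p) p := fun p =>
    (hG.differentiable (by norm_num) p).hasFDerivAt
  have hsplit : ∀ p (v : ℝ × ℝ) (t : ℝ), fderiv ℝ G p (v, t)
      = fderiv ℝ G p (v, 0) + t * fderiv ℝ G p (0, 1) := fun p v t => by
    rw [← smul_eq_mul, ← map_smul, ← map_add]
    simp
  have hequiv : ∀ p, fderiv ℝ G p (0, 1) ≠ 0 → ∃ T' : ((ℝ × ℝ) × ℝ) ≃L[ℝ] ((ℝ × ℝ) × ℝ),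
      HasFDerivAt T (T' : ((ℝ × ℝ) × ℝ) →L[ℝ] ((ℝ × ℝ) × ℝ)) p := fun p hp => by
    let f₁ : ((ℝ × ℝ) × ℝ) →L[ℝ] ((ℝ × ℝ) × ℝ) := (ContinuousLinearMap.fst ℝ (ℝ × ℝ) ℝ).prod (fderiv ℝ G p)
    let f₂ : ((ℝ × ℝ) × ℝ) →L[ℝ] ((ℝ × ℝ) × ℝ) := (ContinuousLinearMap.fst ℝ (ℝ × ℝ) ℝ).prod
      ((fderiv ℝ G p (0, 1))⁻¹ • (ContinuousLinearMap.snd ℝ (ℝ × ℝ) ℝ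
        - (fderiv ℝ G p).comp ((ContinuousLinearMap.inl ℝ (ℝ × ℝ) ℝ).comp
          (ContinuousLinearMap.fst ℝ (ℝ × ℝ) ℝ))))
    refine ⟨ContinuousLinearEquiv.equivOfInverse f₁ f₂ (fun q => ?_) (fun q => ?_), ?_⟩
    · refine Prod.ext rfl ?_
      show (fderiv ℝ G p (0, 1))⁻¹ * (fderiv ℝ G p q - fderiv ℝ G p (q.1, 0)) = q.2
      rw [show q = (q.1, q.2) from rfl, hsplit p q.1 q.2]
      field_simp
      ring
    · refine Prod.ext rfl ?_
      show fderiv ℝ G p (q.1, (fderiv ℝ G p (0, 1))⁻¹ * (q.2 - fderiv ℝ G p (q.1, 0))) = q.2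
      rw [hsplit]
      field_simp
      ring
    · exact hasFDerivAt_fst.prodMk (hGdiff p)
  set K' : Set ((ℝ × ℝ) × ℝ) := (fun z => (z, s₀ z)) '' K with hK'
  have hK'c : IsCompact K' := hK.image_of_continuousOn (continuousOn_id.prodMk hs)
  have hinj : InjOn T K' := by
    rintro _ ⟨z, hz, rfl⟩ _ ⟨z', hz', rfl⟩ h
    have : z = z' := congrArg Prod.fst h
    rw [this]
  have hloc : ∀ p ∈ K', ∃ u ∈ 𝓝 p, InjOn T u := by
    rintro _ ⟨z, hz, rfl⟩
    obtain ⟨T', hT'⟩ := hequiv _ (h1 z hz)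
    let e := hTd.contDiffAt.toOpenPartialHomeomorph (n := ∞) T hT' (by norm_num)
    exact ⟨e.source, e.open_source.mem_nhds
      (hTd.contDiffAt.mem_toOpenPartialHomeomorph_source hT' (by norm_num)), e.injOn⟩
  obtain ⟨t, ht, htinj⟩ := hinj.exists_mem_nhdsSet hK'c (fun p _ => hTd.continuous.continuousAt) hloc
  obtain ⟨N₁, hN₁, hKN₁, hN₁t⟩ := mem_nhdsSet_iff_exists.1 ht
  have hopen : IsOpen {p | fderiv ℝ G p (0, 1) ≠ 0} :=
    isOpen_ne_fun ((hG.continuous_fderiv (by norm_num)).clm_apply continuous_const) continuous_const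
  set N := N₁ ∩ {p | fderiv ℝ G p (0, 1) ≠ 0} with hN
  have hNo : IsOpen N := hN₁.inter hopen
  have hKN : ∀ z ∈ K, (z, s₀ z) ∈ N := fun z hz => ⟨hKN₁ ⟨z, hz, rfl⟩, h1 z hz⟩
  have hNinj : InjOn T N := htinj.mono (inter_subset_left.trans hN₁t)
  classical
  -- `U` collects the points over which a zero exists inside `N`. That it is open, and that the
  -- chosen zero is smooth, both follow from the local inverse below; the value 0 outside `U` plays
  -- no role.
  set U : Set (ℝ × ℝ) := {z | ∃ s, (z, s) ∈ N ∧ G (z, s) = 0} with hU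
  set σ : ℝ × ℝ → ℝ := fun z => if h : z ∈ U then h.choose else 0 with hσ
  have hσU : ∀ z ∈ U, (z, σ z) ∈ N ∧ G (z, σ z) = 0 := fun z hz => by
    simp only [hσ, dif_pos hz]
    exact Exists.choose_spec hz
  have huniq : ∀ z s, (z, s) ∈ N → G (z, s) = 0 → z ∈ U ∧ σ z = s := fun z s hzs hg => by
    have hz : z ∈ U := ⟨s, hzs, hg⟩
    have h := hσU z hz
    exact ⟨hz, congrArg Prod.snd (hNinj h.1 hzs (Prod.ext rfl (h.2.trans hg.symm)))⟩
  have key : ∀ z ∈ U, U ∈ 𝓝 z ∧ ContDiffAt ℝ ∞ σ z := fun z hz => by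
    obtain ⟨hzN, hzG⟩ := hσU z hz
    obtain ⟨T', hT'⟩ := hequiv _ hzN.2
    have hne : (∞ : WithTop ℕ∞) ≠ 0 := by norm_num
    let g := hTd.contDiffAt.localInverse (n := ∞) hT' hne
    have hg : ContDiffAt ℝ ∞ g (T (z, σ z)) := hTd.contDiffAt.to_localInverse hT' hne
    have hgz : g (T (z, σ z)) = (z, σ z) := hTd.contDiffAt.localInverse_apply_image hT' hne
    have hTz : T (z, σ z) = (z, 0) := Prod.ext rfl hzG
    rw [hTz] at hg hgz
    have hstrict := hTd.contDiffAt.hasStrictFDerivAt' (x := (z, σ z)) hT' hne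
    have hr : ∀ᶠ q in 𝓝 (T (z, σ z)), T (g q) = q := hstrict.eventually_right_inverse
    rw [hTz] at hr
    have hj : ContDiff ℝ ∞ fun z' : ℝ × ℝ => (z', (0 : ℝ)) := contDiff_id.prodMk contDiff_const
    have hgN : ∀ᶠ q in 𝓝 (z, (0 : ℝ)), g q ∈ N :=
      hg.continuousAt.eventually_mem (by rw [hgz]; exact hNo.mem_nhds hzN)
    have hev : ∀ᶠ z' in 𝓝 z, z' ∈ U ∧ σ z' = (g (z', 0)).2 := by
      filter_upwards [hj.continuous.continuousAt.eventually (hr.and hgN)] with z' hz'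
      obtain ⟨h1, h2⟩ := hz'
      have e1 : (g (z', 0)).1 = z' := congrArg Prod.fst h1
      have e2 : G (g (z', 0)) = 0 := congrArg Prod.snd h1
      have e3 : g (z', 0) = (z', (g (z', 0)).2) := Prod.ext e1 rfl
      rw [e3] at h2 e2
      exact huniq _ _ h2 e2
    refine ⟨hev.mono fun _ h => h.1, ?_⟩
    refine ContDiffAt.congr_of_eventuallyEq ?_ (hev.mono fun _ h => h.2)
    exact contDiff_snd.contDiffAt.comp z (ContDiffAt.comp (f := fun z' : ℝ × ℝ => (z', (0 : ℝ))) z hg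
      hj.contDiffAt)
  exact ⟨U, σ, isOpen_iff_mem_nhds.2 fun z hz => (key z hz).1, fun z hz => ⟨_, hKN z hz, h0 z hz⟩,
    fun z hz => (key z hz).2.contDiffWithinAt, fun z hz => (hσU z hz).2,
    fun z hz => (huniq z _ (hKN z hz) (h0 z hz)).2⟩

/-! ### Smooth maps as elements of the Sobolev space -/

theorem HasWeakPartial.of_hasLineDerivAt {Ω : Set (ℝ × ℝ)} (hΩ : IsOpen Ω) {i : Fin 2}
    {u g : ℝ × ℝ → E3} (hu : ContinuousOn u Ω) (hg : ContinuousOn g Ω)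
    (h : ∀ x ∈ Ω, HasLineDerivAt ℝ u (g x) x (dir i)) : HasWeakPartial Ω i u g := by
  intro φ hφ hs ht
  have h0 : ∀ F : ℝ × ℝ → E3, tsupport F ⊆ Ω → ∫ x in Ω, F x = ∫ x, F x := fun F hF =>
    setIntegral_eq_integral_of_forall_compl_eq_zero fun x hx =>
      image_eq_zero_of_notMem_tsupport fun h => hx (hF h)
  have hsub : ∀ (ψ : ℝ × ℝ → ℝ) (v : ℝ × ℝ → E3), tsupport ψ ⊆ Ω → tsupport (fun x => ψ x • v x) ⊆ Ω :=
    fun ψ v h => (tsupport_smul_subset_left ψ v).trans h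
  have hint : ∀ {ψ : ℝ × ℝ → ℝ} {v : ℝ × ℝ → E3}, Continuous ψ → HasCompactSupport ψ → tsupport ψ ⊆ Ω →
      ContinuousOn v Ω → Integrable (fun x => ψ x • v x) := fun hψ hψs hψt hv =>
    ((hψ.continuousOn.smul hv).continuous_of_tsupport_subset hΩ (hsub _ _ hψt)).integrable_of_hasCompactSupport
      hψs.smul_right
  have ht' := (tsupport_fderiv_dir_subset φ (dir i)).trans ht
  rw [h0 _ (hsub _ _ ht'), h0 _ (hsub _ _ ht)]
  have := integral_bilinear_hasLineDerivAt_right_eq_neg_left_of_integrable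
    (μ := (volume : Measure (ℝ × ℝ))) (f := φ) (f' := fun x => fderiv ℝ φ x (dir i)) (g := u) (g' := g)
    (v := dir i) (B := ContinuousLinearMap.lsmul ℝ ℝ)
    (hint (continuous_fderiv_dir hφ _) (hasCompactSupport_fderiv_dir hs _) ht' hu)
    (hint hφ.continuous hs ht hg) (hint hφ.continuous hs ht hu)
    (fun x _ => (hφ.differentiable (by norm_num) x).hasFDerivAt.hasLineDerivAt _)
    (fun x hx => h x (ht hx))
  simp only [ContinuousLinearMap.lsmul_apply] at this
  rw [this, neg_neg]

theorem memLp_of_continuousOn_closedStrip {L : ℝ} {F : ℝ × ℝ → E3}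
    (hF : ContinuousOn F (Icc 0 L ×ˢ Icc (-(1 / 2)) (1 / 2))) :
    MemLp F 2 (volume.restrict (strip L)) := by
  have hK : IsCompact (Icc 0 L ×ˢ Icc (-(1 / 2) : ℝ) (1 / 2)) := isCompact_Icc.prod isCompact_Icc
  have hsub : strip L ⊆ Icc 0 L ×ˢ Icc (-(1 / 2)) (1 / 2) :=
    prod_mono Ioo_subset_Icc_self Ioo_subset_Icc_self
  obtain ⟨C, hC⟩ := hK.exists_bound_of_continuousOn hF
  exact MemLp.of_bound ((hF.mono hsub).aestronglyMeasurable (measurableSet_strip L)) C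
    ((ae_restrict_mem (measurableSet_strip L)).mono fun x hx => hC x (hsub hx))

theorem contDiffOn_fderiv_dir {U : Set (ℝ × ℝ)} (hU : IsOpen U) {F : ℝ × ℝ → E3}
    (hF : ContDiffOn ℝ ∞ F U) (v : ℝ × ℝ) : ContDiffOn ℝ ∞ (fun z => fderiv ℝ F z v) U :=
  (hF.fderiv_of_isOpen hU (by norm_num)).clm_apply contDiffOn_const

/-- The rescaling `x ↦ F (x₁, w x₂)` of a smooth map. -/
theorem exists_W22_of_contDiffOn {L w : ℝ} (hw : 0 < w) {U : Set (ℝ × ℝ)} (hU : IsOpen U)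
    (hsub : ∀ x ∈ Icc 0 L ×ˢ Icc (-(1 / 2) : ℝ) (1 / 2), (x.1, w * x.2) ∈ U) {F : ℝ × ℝ → E3}
    (hF : ContDiffOn ℝ ∞ F U) :
    ∃ f : W22 (strip L), (∀ j x, f.gradW w j x = fderiv ℝ F (x.1, w * x.2) (dir j)) ∧
      ∀ i j x, (W22.scale w i * W22.scale w j) • f.hess i j x
        = fderiv ℝ (fun z => fderiv ℝ F z (dir j)) (x.1, w * x.2) (dir i) := by
  set κ : Fin 2 → ℝ := ![1, w] with hκ
  have hκs : ∀ i, W22.scale w i * κ i = 1 := fun i => by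
    fin_cases i
    · simp [W22.scale, hκ]
    · simp [W22.scale, hκ, hw.ne']
  set S : ℝ × ℝ → ℝ × ℝ := fun x => (x.1, w * x.2) with hS
  have hSc : Continuous S := continuous_fst.prodMk (continuous_const.mul continuous_snd)
  have hcomp : ∀ {u : ℝ × ℝ → E3}, ContDiffOn ℝ ∞ u U →
      ContinuousOn (fun x => u (S x)) (Icc 0 L ×ˢ Icc (-(1 / 2)) (1 / 2)) := fun hu =>
    hu.continuousOn.comp hSc.continuousOn hsub
  have hstrip : strip L ⊆ Icc 0 L ×ˢ Icc (-(1 / 2)) (1 / 2) :=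
    prod_mono Ioo_subset_Icc_self Ioo_subset_Icc_self
  have hline : ∀ {u : ℝ × ℝ → E3}, ContDiffOn ℝ ∞ u U → ∀ i, ∀ x ∈ strip L,
      HasLineDerivAt ℝ (fun x => u (S x)) (κ i • fderiv ℝ u (S x) (dir i)) x (dir i) := by
    intro u hu i x hx
    have h1 : HasFDerivAt u (fderiv ℝ u (S x)) (S x) :=
      ((hu.contDiffAt (hU.mem_nhds (hsub x (hstrip hx)))).differentiableAt (by norm_num)).hasFDerivAt
    have h2 : HasFDerivAt S ((ContinuousLinearMap.fst ℝ ℝ ℝ).prod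
        (w • ContinuousLinearMap.snd ℝ ℝ ℝ)) x :=
      hasFDerivAt_fst.prodMk (hasFDerivAt_snd.const_mul w)
    have h3 := (h1.comp x h2).hasLineDerivAt (dir i)
    have e : ((ContinuousLinearMap.fst ℝ ℝ ℝ).prod (w • ContinuousLinearMap.snd ℝ ℝ ℝ)) (dir i)
        = κ i • dir i := by fin_cases i <;> simp [dir, hκ]
    rw [ContinuousLinearMap.comp_apply, e, map_smul] at h3
    exact h3
  have g := contDiffOn_fderiv_dir hU hF
  have hh := fun j i => contDiffOn_fderiv_dir hU (g (dir j)) (dir i)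
  have smul : ∀ (c : ℝ) {u : ℝ × ℝ → E3}, ContDiffOn ℝ ∞ u U → ContDiffOn ℝ ∞ (fun z => c • u z) U :=
    fun c u hu => hu.const_smul c
  refine ⟨⟨fun x => F (S x), fun j x => κ j • fderiv ℝ F (S x) (dir j),
    fun i j x => (κ i * κ j) • fderiv ℝ (fun z => fderiv ℝ F z (dir j)) (S x) (dir i),
    memLp_of_continuousOn_closedStrip (hcomp hF),
    fun j => memLp_of_continuousOn_closedStrip (hcomp (smul _ (g (dir j)))),
    fun i j => memLp_of_continuousOn_closedStrip (hcomp (smul _ (hh j i))), fun i => ?_, fun i j => ?_⟩,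
    fun j x => ?_, fun i j x => ?_⟩
  · exact .of_hasLineDerivAt (isOpen_strip L) ((hcomp hF).mono hstrip)
      ((hcomp (smul _ (g (dir i)))).mono hstrip) (hline hF i)
  · refine .of_hasLineDerivAt (isOpen_strip L) ((hcomp (smul _ (g (dir j)))).mono hstrip)
      ((hcomp (smul _ (hh j i))).mono hstrip) fun x hx => ?_
    have := (hline (g (dir j)) i x hx).const_smul (κ j)
    rwa [smul_smul, mul_comm] at this
  · show W22.scale w j • κ j • fderiv ℝ F (S x) (dir j) = _
    rw [smul_smul, hκs, one_smul]
  · show (W22.scale w i * W22.scale w j) • (κ i * κ j) • _ = _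
    rw [smul_smul, show W22.scale w i * W22.scale w j * (κ i * κ j)
      = (W22.scale w i * κ i) * (W22.scale w j * κ j) by ring, hκs, hκs, one_mul, one_smul]

end Ribbon

/-! ### Moving frames, the planar picture of the ribbon, and the foot of a ruling -/

namespace Ribbon

section Primitive

variable {E : Type*} [NormedAddCommGroup E] [NormedSpace ℝ E]

theorem contDiff_of_hasDerivAt {f g : ℝ → E} (h : ∀ s, HasDerivAt f (g s) s) {n : ℕ}
    (hg : ContDiff ℝ n g) : ContDiff ℝ (n + 1) f := by
  rw [contDiff_succ_iff_deriv]
  refine ⟨fun s => (h s).differentiableAt, fun h => by simp at h, ?_⟩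
  rwa [show deriv f = g from funext fun s => (h s).deriv]

theorem contDiff_infty_of_hasDerivAt {f g : ℝ → E} (h : ∀ s, HasDerivAt f (g s) s)
    (hg : ContDiff ℝ ∞ g) : ContDiff ℝ ∞ f := by
  rw [contDiff_infty_iff_deriv]
  exact ⟨fun s => (h s).differentiableAt, by
    rwa [show deriv f = g from funext fun s => (h s).deriv]⟩

theorem exists_primitive [CompleteSpace E] {g : ℝ → E} (hg : ContDiff ℝ ∞ g) :
    ∃ f : ℝ → E, ContDiff ℝ ∞ f ∧ ∀ s, HasDerivAt f (g s) s := by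
  have h : ∀ s, HasDerivAt (fun x => ∫ t in (0 : ℝ)..x, g t) (g s) s := fun s =>
    (hg.continuous.integral_hasStrictDerivAt _ s).hasDerivAt
  exact ⟨_, contDiff_infty_of_hasDerivAt h hg, h⟩

end Primitive

namespace FlatGeometry

variable {R : FlatGeometry}

/-- Bootstrap: the Darboux equations express the derivative of each frame vector through the other
vectors with smooth coefficients, so each round gains one derivative. -/
theorem IsDarbouxFrame.contDiff {e : Fin 3 → ℝ → E3} (he : R.IsDarbouxFrame e) (i : Fin 3) :
    ContDiff ℝ ∞ (e i) := by
  rw [contDiff_infty]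
  intro n
  induction n generalizing i with
  | zero =>
    refine contDiff_zero.2 (continuous_iff_continuousAt.2 fun s => ?_)
    fin_cases i
    · exact (he.deriv₁ s).continuousAt
    · exact (he.deriv₂ s).continuousAt
    · exact (he.deriv₃ s).continuousAt
  | succ n ih =>
    have hκ : ContDiff ℝ n R.κ := contDiff_infty.1 R.smooth_κ n
    have hl : ContDiff ℝ n R.l₀ := contDiff_infty.1 R.contDiff_l₀ n
    have hm : ContDiff ℝ n R.m₀ := contDiff_infty.1 R.contDiff_m₀ n
    rw [Nat.cast_succ]
    fin_cases i
    · exact contDiff_of_hasDerivAt he.deriv₁ ((hκ.smul (ih 1)).add (hl.smul (ih 2)))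
    · exact contDiff_of_hasDerivAt he.deriv₂ ((hκ.smul (ih 0)).neg.add (hm.smul (ih 2)))
    · exact contDiff_of_hasDerivAt he.deriv₃ ((hl.smul (ih 0)).neg.sub (hm.smul (ih 1)))

theorem IsDarbouxFrame.inner_eq {e : Fin 3 → ℝ → E3} (he : R.IsDarbouxFrame e) (s : ℝ) :
    inner ℝ (e 0 s) (e 0 s) = 1 ∧ inner ℝ (e 1 s) (e 1 s) = 1 ∧ inner ℝ (e 0 s) (e 1 s) = 0 := by
  have h := orthonormal_iff_ite.1 (he.orthonormal s)
  exact ⟨by simpa using h 0 0, by simpa using h 1 1, by simpa using h 0 1⟩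

theorem IsDarbouxFrame.comb_eq {e : Fin 3 → ℝ → E3} (he : R.IsDarbouxFrame e) (s a b c : ℝ) :
    comb (e 0 s) (e 1 s) a b c = a • e 0 s + b • e 1 s + c • e 2 s := by
  rw [comb, he.oriented]

/-- A unit speed planar curve `(X₁, X₂)` with tangent angle `θ` and curvature `κ`. -/
structure IsPlanarMidline (R : FlatGeometry) (θ X₁ X₂ : ℝ → ℝ) : Prop where
  smooth : ContDiff ℝ ∞ θ ∧ ContDiff ℝ ∞ X₁ ∧ ContDiff ℝ ∞ X₂
  deriv_angle : ∀ s, HasDerivAt θ (R.κ s) s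
  deriv_fst : ∀ s, HasDerivAt X₁ (Real.cos (θ s)) s
  deriv_snd : ∀ s, HasDerivAt X₂ (Real.sin (θ s)) s

variable (R) in
theorem exists_isPlanarMidline : ∃ θ X₁ X₂, R.IsPlanarMidline θ X₁ X₂ := by
  obtain ⟨θ, h1, h2⟩ := exists_primitive R.smooth_κ
  obtain ⟨X₁, h3, h4⟩ := exists_primitive (Real.contDiff_cos.comp h1)
  obtain ⟨X₂, h5, h6⟩ := exists_primitive (Real.contDiff_sin.comp h1)
  exact ⟨θ, X₁, X₂, ⟨h1, h3, h5⟩, h2, h4, h6⟩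

namespace IsPlanarMidline

variable {θ X₁ X₂ : ℝ → ℝ}

/-- Tangential coordinate of a point of the plane with respect to the moving frame. -/
noncomputable def tangentCoord (θ X₁ X₂ : ℝ → ℝ) (y₁ y₂ s : ℝ) : ℝ :=
  (y₁ - X₁ s) * Real.cos (θ s) + (y₂ - X₂ s) * Real.sin (θ s)

/-- Normal coordinate of a point of the plane with respect to the moving frame. -/
noncomputable def normalCoord (θ X₁ X₂ : ℝ → ℝ) (y₁ y₂ s : ℝ) : ℝ :=
  -((y₁ - X₁ s) * Real.sin (θ s)) + (y₂ - X₂ s) * Real.cos (θ s)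

/-- The planar frame turns with the same curvature `κ` as the Darboux frame. The terms with `s'`
here and in `hasDerivAt_normalCoord` will therefore cancel against the tangential part of the
Darboux equations. -/
theorem hasDerivAt_tangentCoord (h : R.IsPlanarMidline θ X₁ X₂) {y₁ y₂ s : ℝ → ℝ} {y₁' y₂' s' t : ℝ}
    (h₁ : HasDerivAt y₁ y₁' t) (h₂ : HasDerivAt y₂ y₂' t) (hs : HasDerivAt s s' t) :
    HasDerivAt (fun t => tangentCoord θ X₁ X₂ (y₁ t) (y₂ t) (s t))
      (s' * (-1 + R.κ (s t) * normalCoord θ X₁ X₂ (y₁ t) (y₂ t) (s t))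
        + (y₁' * Real.cos (θ (s t)) + y₂' * Real.sin (θ (s t)))) t := by
  have a := (h.deriv_angle (s t)).comp t hs
  have d := ((h₁.sub ((h.deriv_fst (s t)).comp t hs)).mul a.cos).add
    ((h₂.sub ((h.deriv_snd (s t)).comp t hs)).mul a.sin)
  refine d.congr_deriv ?_
  simp only [normalCoord, Pi.sub_apply, Function.comp_apply]
  linear_combination (-s') * Real.sin_sq_add_cos_sq (θ (s t))

theorem hasDerivAt_normalCoord (h : R.IsPlanarMidline θ X₁ X₂) {y₁ y₂ s : ℝ → ℝ} {y₁' y₂' s' t : ℝ}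
    (h₁ : HasDerivAt y₁ y₁' t) (h₂ : HasDerivAt y₂ y₂' t) (hs : HasDerivAt s s' t) :
    HasDerivAt (fun t => normalCoord θ X₁ X₂ (y₁ t) (y₂ t) (s t))
      (s' * (-(R.κ (s t) * tangentCoord θ X₁ X₂ (y₁ t) (y₂ t) (s t)))
        + (-(y₁' * Real.sin (θ (s t))) + y₂' * Real.cos (θ (s t)))) t := by
  have a := (h.deriv_angle (s t)).comp t hs
  have d := ((h₁.sub ((h.deriv_fst (s t)).comp t hs)).mul a.sin).neg.add
    ((h₂.sub ((h.deriv_snd (s t)).comp t hs)).mul a.cos)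
  refine d.congr_deriv ?_
  simp only [tangentCoord, Pi.sub_apply, Function.comp_apply]
  ring

/-- The planar picture of the ribbon. -/
noncomputable def fermi (θ X₁ X₂ : ℝ → ℝ) (z : ℝ × ℝ) : ℝ × ℝ :=
  (X₁ z.1 - z.2 * Real.sin (θ z.1), X₂ z.1 + z.2 * Real.cos (θ z.1))

variable (R) in
/-- The partial derivatives of the planar picture. -/
noncomputable def fermiDeriv (θ : ℝ → ℝ) (j : Fin 2) (z : ℝ × ℝ) : ℝ × ℝ :=
  ![((1 - R.κ z.1 * z.2) * Real.cos (θ z.1), (1 - R.κ z.1 * z.2) * Real.sin (θ z.1)),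
    (-Real.sin (θ z.1), Real.cos (θ z.1))] j

theorem contDiff_fermi (h : R.IsPlanarMidline θ X₁ X₂) : ContDiff ℝ ∞ (fermi θ X₁ X₂) := by
  obtain ⟨h1, h2, h3⟩ := h.smooth
  unfold fermi
  fun_prop

theorem hasDerivAt_fermi (h : R.IsPlanarMidline θ X₁ X₂) (z : ℝ × ℝ) (j : Fin 2) :
    HasDerivAt (fun t : ℝ => (fermi θ X₁ X₂ (z + t • dir j)).1) (fermiDeriv R θ j z).1 0 ∧
      HasDerivAt (fun t : ℝ => (fermi θ X₁ X₂ (z + t • dir j)).2) (fermiDeriv R θ j z).2 0 := by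
  obtain rfl | rfl : j = 0 ∨ j = 1 := by omega
  · have e : ∀ t : ℝ, z + t • dir 0 = (z.1 + t, z.2) := fun t => by
      ext <;> simp [dir]
    simp only [e, fermi, fermiDeriv, Matrix.cons_val_zero]
    have hi : HasDerivAt (fun t : ℝ => z.1 + t) 1 0 := (hasDerivAt_id _).const_add _
    have at0 : z.1 + (0 : ℝ) = z.1 := add_zero _
    have a : HasDerivAt (fun t : ℝ => θ (z.1 + t)) (R.κ z.1) 0 := by
      have := HasDerivAt.comp (0 : ℝ) (h := fun t : ℝ => z.1 + t) (h.deriv_angle (z.1 + 0)) hi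
      rwa [mul_one, at0] at this
    have b : HasDerivAt (fun t : ℝ => X₁ (z.1 + t)) (Real.cos (θ z.1)) 0 := by
      have := HasDerivAt.comp (0 : ℝ) (h := fun t : ℝ => z.1 + t) (h.deriv_fst (z.1 + 0)) hi
      rwa [mul_one, at0] at this
    have c : HasDerivAt (fun t : ℝ => X₂ (z.1 + t)) (Real.sin (θ z.1)) 0 := by
      have := HasDerivAt.comp (0 : ℝ) (h := fun t : ℝ => z.1 + t) (h.deriv_snd (z.1 + 0)) hi
      rwa [mul_one, at0] at this
    refine ⟨(b.sub (a.sin.const_mul z.2)).congr_deriv ?_, (c.add (a.cos.const_mul z.2)).congr_deriv ?_⟩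
    · simp only [at0]; ring
    · simp only [at0]; ring
  · have e : ∀ t : ℝ, z + t • dir 1 = (z.1, z.2 + t) := fun t => by
      ext <;> simp [dir]
    simp only [e, fermi, fermiDeriv, Matrix.cons_val_one]
    have hi : HasDerivAt (fun t : ℝ => z.2 + t) 1 0 := (hasDerivAt_id _).const_add _
    refine ⟨((hi.mul_const _).const_sub _).congr_deriv (by simp),
      ((hi.mul_const _).const_add _).congr_deriv (by simp)⟩

end IsPlanarMidline

open IsPlanarMidline

/-- Coordinates of `∂ⱼ` of the planar picture at `z` in the moving frame at `s`. -/
noncomputable def frameCoord (R : FlatGeometry) (θ : ℝ → ℝ) (j : Fin 2) (z : ℝ × ℝ) (s : ℝ) : ℝ × ℝ :=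
  ((fermiDeriv R θ j z).1 * Real.cos (θ s) + (fermiDeriv R θ j z).2 * Real.sin (θ s),
    -((fermiDeriv R θ j z).1 * Real.sin (θ s)) + (fermiDeriv R θ j z).2 * Real.cos (θ s))

theorem contDiffOn_frameCoord {θ X₁ X₂ : ℝ → ℝ} (h : R.IsPlanarMidline θ X₁ X₂) {U : Set (ℝ × ℝ)}
    {σ : ℝ × ℝ → ℝ} (hσ : ContDiffOn ℝ ∞ σ U) (j : Fin 2) :
    ContDiffOn ℝ ∞ (fun z => (frameCoord R θ j z (σ z)).1) U ∧
      ContDiffOn ℝ ∞ (fun z => (frameCoord R θ j z (σ z)).2) U := by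
  have hθ := h.smooth.1
  have hκ := R.smooth_κ
  have c1 : ContDiffOn ℝ ∞ (fun z => Real.cos (θ (σ z))) U :=
    (Real.contDiff_cos.comp hθ).comp_contDiffOn hσ
  have c2 : ContDiffOn ℝ ∞ (fun z => Real.sin (θ (σ z))) U :=
    (Real.contDiff_sin.comp hθ).comp_contDiffOn hσ
  have d : ContDiffOn ℝ ∞ (fun z => (fermiDeriv R θ j z).1) U ∧
      ContDiffOn ℝ ∞ (fun z => (fermiDeriv R θ j z).2) U := by
    obtain rfl | rfl : j = 0 ∨ j = 1 := by omega
    · simp only [fermiDeriv, Matrix.cons_val_zero]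
      exact ⟨by fun_prop, by fun_prop⟩
    · simp only [fermiDeriv, Matrix.cons_val_one]
      exact ⟨by fun_prop, by fun_prop⟩
  exact ⟨(d.1.mul c1).add (d.2.mul c2), (d.1.mul c2).neg.add (d.2.mul c1)⟩

/-- Passing to the frame at `s` is a rotation, so the Gram matrix and the determinant are those of
the planar Fermi coordinates: the metric of the ribbon and its length density. -/
theorem frameCoord_relations (R : FlatGeometry) (θ : ℝ → ℝ) (z : ℝ × ℝ) (s : ℝ) :
    (frameCoord R θ 0 z s).1 ^ 2 + (frameCoord R θ 0 z s).2 ^ 2 = (1 - R.κ z.1 * z.2) ^ 2 ∧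
      (frameCoord R θ 1 z s).1 ^ 2 + (frameCoord R θ 1 z s).2 ^ 2 = 1 ∧
      (frameCoord R θ 0 z s).1 * (frameCoord R θ 1 z s).1
        + (frameCoord R θ 0 z s).2 * (frameCoord R θ 1 z s).2 = 0 ∧
      (frameCoord R θ 0 z s).1 * (frameCoord R θ 1 z s).2
        - (frameCoord R θ 0 z s).2 * (frameCoord R θ 1 z s).1 = 1 - R.κ z.1 * z.2 := by
  have t1 : Real.sin (θ s) ^ 2 = 1 - Real.cos (θ s) ^ 2 := Real.sin_sq _
  have t2 : Real.sin (θ z.1) ^ 2 = 1 - Real.cos (θ z.1) ^ 2 := Real.sin_sq _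
  simp only [frameCoord, fermiDeriv, Matrix.cons_val_zero, Matrix.cons_val_one]
  set p := 1 - R.κ z.1 * z.2
  set c := Real.cos (θ s)
  set d := Real.sin (θ s)
  set c' := Real.cos (θ z.1)
  set d' := Real.sin (θ z.1)
  refine ⟨?_, ?_, ?_, ?_⟩
  · linear_combination p ^ 2 * (c' ^ 2 + d' ^ 2) * t1 + p ^ 2 * t2
  · linear_combination (c' ^ 2 + d' ^ 2) * t1 + t2
  · ring
  · linear_combination p * (c' ^ 2 + d' ^ 2) * t1 + p * t2

theorem frameCoord_midline (R : FlatGeometry) (θ : ℝ → ℝ) (s : ℝ) :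
    frameCoord R θ 0 (s, 0) s = (1, 0) ∧ frameCoord R θ 1 (s, 0) s = (0, 1) := by
  have t := Real.sin_sq_add_cos_sq (θ s)
  constructor
  · refine Prod.ext ?_ ?_
    · simp only [frameCoord, fermiDeriv, Matrix.cons_val_zero]; linear_combination t
    · simp only [frameCoord, fermiDeriv, Matrix.cons_val_zero]; ring
  · refine Prod.ext ?_ ?_
    · simp only [frameCoord, fermiDeriv, Matrix.cons_val_zero, Matrix.cons_val_one]; ring
    · simp only [frameCoord, fermiDeriv, Matrix.cons_val_zero, Matrix.cons_val_one]; linear_combination t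

/-- The foot on the midline of the ruling through a point of the ribbon. -/
theorem exists_foot {L : ℝ} (hl : ∀ s ∈ Icc 0 L, R.l₀ s ≠ 0) {θ X₁ X₂ : ℝ → ℝ}
    (h : R.IsPlanarMidline θ X₁ X₂) :
    ∃ U : Set (ℝ × ℝ), ∃ σ : ℝ × ℝ → ℝ, IsOpen U ∧ (∀ s ∈ Icc 0 L, (s, (0 : ℝ)) ∈ U) ∧
      ContDiffOn ℝ ∞ σ U ∧
      (∀ z ∈ U, R.l₀ (σ z) * tangentCoord θ X₁ X₂ (fermi θ X₁ X₂ z).1 (fermi θ X₁ X₂ z).2 (σ z)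
        + R.m₀ (σ z) * normalCoord θ X₁ X₂ (fermi θ X₁ X₂ z).1 (fermi θ X₁ X₂ z).2 (σ z) = 0) ∧
      ∀ s ∈ Icc 0 L, σ (s, 0) = s := by
  obtain ⟨hθ, hX₁, hX₂⟩ := h.smooth
  have hY := h.contDiff_fermi
  have hls := R.contDiff_l₀
  have hms := R.contDiff_m₀
  -- With `(t, n)` the coordinates of a planar point in the frame at `s`, the equation $l_0t + m_0n
  -- = 0$ says that the point lies on the line through the midline point at `s` along the kernel of
  -- the first row of $\mathrm{II}^0$, that is, on the ruling.
  set G : (ℝ × ℝ) × ℝ → ℝ := fun p =>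
    R.l₀ p.2 * tangentCoord θ X₁ X₂ (fermi θ X₁ X₂ p.1).1 (fermi θ X₁ X₂ p.1).2 p.2
      + R.m₀ p.2 * normalCoord θ X₁ X₂ (fermi θ X₁ X₂ p.1).1 (fermi θ X₁ X₂ p.1).2 p.2 with hG
  have hGd : ContDiff ℝ ∞ G := by
    have y1 : ContDiff ℝ ∞ fun p : (ℝ × ℝ) × ℝ => (fermi θ X₁ X₂ p.1).1 :=
      contDiff_fst.comp (hY.comp contDiff_fst)
    have y2 : ContDiff ℝ ∞ fun p : (ℝ × ℝ) × ℝ => (fermi θ X₁ X₂ p.1).2 :=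
      contDiff_snd.comp (hY.comp contDiff_fst)
    simp only [hG, tangentCoord, normalCoord]
    fun_prop
  have hY0 : ∀ s, fermi θ X₁ X₂ (s, 0) = (X₁ s, X₂ s) := fun s => by simp [fermi]
  have hK : IsCompact ((fun s : ℝ => (s, (0 : ℝ))) '' Icc 0 L) :=
    isCompact_Icc.image (continuous_id.prodMk continuous_const)
  have tang0 : ∀ s, tangentCoord θ X₁ X₂ (X₁ s) (X₂ s) s = 0 := fun s => by simp [tangentCoord]
  have norm0 : ∀ s, normalCoord θ X₁ X₂ (X₁ s) (X₂ s) s = 0 := fun s => by simp [normalCoord]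
  obtain ⟨U, σ, hU, hKU, hσ, hGσ, hσK⟩ := exists_implicit hGd hK (s₀ := Prod.fst)
    continuous_fst.continuousOn (by
      rintro _ ⟨s, hs, rfl⟩
      simp only [hG, hY0, tang0, norm0, mul_zero, add_zero]) (by
      rintro _ ⟨s, hs, rfl⟩
      -- On the midline both coordinates vanish and the tangential one has derivative $-1$ in `s`,
      -- so the derivative of `G` is $-l_0(s) \ne 0$.
      have d1 : HasDerivAt (fun t : ℝ => G ((s, 0), t)) (fderiv ℝ G ((s, 0), s) (0, 1)) s := by
        have := (hGd.differentiable (by norm_num) ((s, 0), s)).hasFDerivAt.comp_hasDerivAt s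
          ((hasDerivAt_const s ((s, 0) : ℝ × ℝ)).prodMk (hasDerivAt_id s))
        exact this
      have c1 := hasDerivAt_const s (X₁ s)
      have c2 := hasDerivAt_const s (X₂ s)
      have dl := ((hls.differentiable (by norm_num)) s).hasDerivAt
      have dm := ((hms.differentiable (by norm_num)) s).hasDerivAt
      have d2 := (dl.mul (h.hasDerivAt_tangentCoord c1 c2 (hasDerivAt_id s))).add
        (dm.mul (h.hasDerivAt_normalCoord c1 c2 (hasDerivAt_id s)))
      have e : (fun t : ℝ => G ((s, 0), t)) = (R.l₀ * fun t => tangentCoord θ X₁ X₂ (X₁ s) (X₂ s) (id t))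
          + R.m₀ * fun t => normalCoord θ X₁ X₂ (X₁ s) (X₂ s) (id t) := by
        funext t
        simp only [hG, hY0]
        rfl
      rw [e] at d1
      rw [d1.unique d2]
      simp only [id, tang0, norm0]
      simpa using hl s hs)
  exact ⟨U, σ, hU, fun s hs => hKU ⟨s, hs, rfl⟩, hσ, hGσ, fun s hs => hσK _ ⟨s, hs, rfl⟩⟩

end FlatGeometry

end Ribbon

/-! ### The developable surface along the midline -/

namespace Ribbon.FlatGeometry

open IsPlanarMidline

variable {R : FlatGeometry}

/-- The derivative of a point of the moving frame picture, transported from the plane to space. -/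
theorem hasDerivAt_transport {e : Fin 3 → ℝ → E3} (he : R.IsDarbouxFrame e) {θ X₁ X₂ : ℝ → ℝ}
    (h : R.IsPlanarMidline θ X₁ X₂) {γ : ℝ → E3} (hγ : ∀ s, HasDerivAt γ (e 0 s) s)
    {y₁ y₂ s : ℝ → ℝ} {y₁' y₂' s' t : ℝ}
    (h₁ : HasDerivAt y₁ y₁' t) (h₂ : HasDerivAt y₂ y₂' t) (hs : HasDerivAt s s' t)
    (h0 : R.l₀ (s t) * tangentCoord θ X₁ X₂ (y₁ t) (y₂ t) (s t)
      + R.m₀ (s t) * normalCoord θ X₁ X₂ (y₁ t) (y₂ t) (s t) = 0) :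
    HasDerivAt (fun t => γ (s t) + tangentCoord θ X₁ X₂ (y₁ t) (y₂ t) (s t) • e 0 (s t)
        + normalCoord θ X₁ X₂ (y₁ t) (y₂ t) (s t) • e 1 (s t))
      (comb (e 0 (s t)) (e 1 (s t)) (y₁' * Real.cos (θ (s t)) + y₂' * Real.sin (θ (s t)))
        (-(y₁' * Real.sin (θ (s t))) + y₂' * Real.cos (θ (s t))) 0) t := by
  have d := (((hγ (s t)).scomp t hs).add ((h.hasDerivAt_tangentCoord h₁ h₂ hs).smul
    ((he.deriv₁ (s t)).scomp t hs))).add ((h.hasDerivAt_normalCoord h₁ h₂ hs).smul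
    ((he.deriv₂ (s t)).scomp t hs))
  refine d.congr_deriv ?_
  rw [he.comb_eq]
  set a := tangentCoord θ X₁ X₂ (y₁ t) (y₂ t) (s t)
  set b := normalCoord θ X₁ X₂ (y₁ t) (y₂ t) (s t)
  -- The only component out of the tangent plane; it vanishes by the equation of the ruling. All
  -- tangential terms with `s'` cancel.
  have e3 : (s' * (R.l₀ (s t) * a + R.m₀ (s t) * b)) • e 2 (s t) = 0 := by
    rw [h0, mul_zero, zero_smul]
  rw [← sub_eq_zero, ← e3]
  simp only [Function.comp_apply]
  module

/-- The second form at `z` of the developable with foot map `σ`. -/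
noncomputable def developableForm (R : FlatGeometry) (θ : ℝ → ℝ) (σ : ℝ × ℝ → ℝ) (z : ℝ × ℝ) : Mat2 :=
  Matrix.of fun i j => fderiv ℝ σ z (dir i) *
    (R.l₀ (σ z) * (frameCoord R θ j z (σ z)).1 + R.m₀ (σ z) * (frameCoord R θ j z (σ z)).2)

theorem hasDerivAt_line {E : Type*} [NormedAddCommGroup E] [NormedSpace ℝ E] {U : Set (ℝ × ℝ)}
    (hU : IsOpen U) {F : ℝ × ℝ → E} (hF : ContDiffOn ℝ ∞ F U) {z : ℝ × ℝ} (hz : z ∈ U) (v : ℝ × ℝ) :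
    HasDerivAt (fun t : ℝ => F (z + t • v)) (fderiv ℝ F z v) 0 :=
  ((hF.contDiffAt (hU.mem_nhds hz)).differentiableAt (by norm_num)).hasFDerivAt.hasLineDerivAt v

theorem eventually_line {U : Set (ℝ × ℝ)} (hU : IsOpen U) {z : ℝ × ℝ} (hz : z ∈ U) (v : ℝ × ℝ) :
    ∀ᶠ t : ℝ in 𝓝 0, z + t • v ∈ U := by
  have : Continuous fun t : ℝ => z + t • v := by fun_prop
  exact this.continuousAt.eventually_mem (by simpa using hU.mem_nhds hz)

/-- The developable surface along the midline of a Darboux frame with `det II⁰ = 0`. -/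
theorem exists_developable {e : Fin 3 → ℝ → E3} (he : R.IsDarbouxFrame e) {θ X₁ X₂ : ℝ → ℝ}
    (h : R.IsPlanarMidline θ X₁ X₂) {U : Set (ℝ × ℝ)} (hU : IsOpen U) {σ : ℝ × ℝ → ℝ}
    (hσ : ContDiffOn ℝ ∞ σ U)
    (h0 : ∀ z ∈ U, R.l₀ (σ z) * tangentCoord θ X₁ X₂ (fermi θ X₁ X₂ z).1 (fermi θ X₁ X₂ z).2 (σ z)
        + R.m₀ (σ z) * normalCoord θ X₁ X₂ (fermi θ X₁ X₂ z).1 (fermi θ X₁ X₂ z).2 (σ z) = 0)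
    (hp : ∀ z ∈ U, 0 < 1 - R.κ z.1 * z.2) :
    ∃ F : ℝ × ℝ → E3, ContDiffOn ℝ ∞ F U ∧
      (∀ z ∈ U, ∀ i j, inner ℝ (fderiv ℝ F z (dir i)) (fderiv ℝ F z (dir j)) = R.metric z i j) ∧
      ∀ z ∈ U, ∀ i j, inner ℝ (fderiv ℝ (fun z => fderiv ℝ F z (dir j)) z (dir i))
        (unitNormal (fderiv ℝ F z (dir 0)) (fderiv ℝ F z (dir 1))) = developableForm R θ σ z i j := by
  obtain ⟨γ, hγd, hγ⟩ := exists_primitive (he.contDiff 0)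
  obtain ⟨hθ, hX₁, hX₂⟩ := h.smooth
  have hY := h.contDiff_fermi
  -- Each ruling of the planar picture is placed rigidly into the plane of `e 0`, `e 1` at its foot.
  -- The gradient then has the planar coordinates, so the map is isometric.
  set F : ℝ × ℝ → E3 := fun z =>
    γ (σ z) + tangentCoord θ X₁ X₂ (fermi θ X₁ X₂ z).1 (fermi θ X₁ X₂ z).2 (σ z) • e 0 (σ z)
        + normalCoord θ X₁ X₂ (fermi θ X₁ X₂ z).1 (fermi θ X₁ X₂ z).2 (σ z) • e 1 (σ z) with hFdef
  have hF : ContDiffOn ℝ ∞ F U := by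
    have y1 : ContDiffOn ℝ ∞ (fun z => (fermi θ X₁ X₂ z).1) U := (contDiff_fst.comp hY).contDiffOn
    have y2 : ContDiffOn ℝ ∞ (fun z => (fermi θ X₁ X₂ z).2) U := (contDiff_snd.comp hY).contDiffOn
    have c1 : ContDiffOn ℝ ∞ (fun z => Real.cos (θ (σ z))) U :=
      (Real.contDiff_cos.comp hθ).comp_contDiffOn hσ
    have c2 : ContDiffOn ℝ ∞ (fun z => Real.sin (θ (σ z))) U :=
      (Real.contDiff_sin.comp hθ).comp_contDiffOn hσ
    have x1 := hX₁.comp_contDiffOn hσ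
    have x2 := hX₂.comp_contDiffOn hσ
    exact ((hγd.comp_contDiffOn hσ).add ((((y1.sub x1).mul c1).add ((y2.sub x2).mul c2)).smul
      ((he.contDiff 0).comp_contDiffOn hσ))).add
      ((((y1.sub x1).mul c2).neg.add ((y2.sub x2).mul c1)).smul ((he.contDiff 1).comp_contDiffOn hσ))
  have hgrad : ∀ z ∈ U, ∀ j, fderiv ℝ F z (dir j) = comb (e 0 (σ z)) (e 1 (σ z))
      (frameCoord R θ j z (σ z)).1 (frameCoord R θ j z (σ z)).2 0 := fun z hz j => by
    have z0 : z + (0 : ℝ) • dir j = z := by simp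
    obtain ⟨f1, f2⟩ := h.hasDerivAt_fermi z j
    have d := hasDerivAt_transport he h hγ f1 f2 (hasDerivAt_line hU hσ hz (dir j))
      (by rw [z0]; exact h0 z hz)
    have d' := (hasDerivAt_line hU hF hz (dir j)).unique d
    rw [d', z0]
    rfl
  have hnormal : ∀ z ∈ U, unitNormal (fderiv ℝ F z (dir 0)) (fderiv ℝ F z (dir 1)) = e 2 (σ z) :=
    fun z hz => by
    obtain ⟨i1, i2, i3⟩ := he.inner_eq (σ z)
    obtain ⟨-, -, -, r4⟩ := frameCoord_relations R θ z (σ z)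
    have hpz := hp z hz
    have n2 : ‖e 2 (σ z)‖ = 1 := (he.orthonormal (σ z)).1 2
    rw [hgrad z hz, hgrad z hz, unitNormal, cross_comb i1 i2 i3, he.comb_eq, r4]
    simp only [mul_zero, zero_mul, sub_self, zero_smul, zero_add]
    rw [norm_smul, n2, mul_one, Real.norm_of_nonneg hpz.le, smul_smul, inv_mul_cancel₀ hpz.ne', one_smul]
  refine ⟨F, hF, fun z hz i j => ?_, fun z hz i j => ?_⟩
  · obtain ⟨i1, i2, i3⟩ := he.inner_eq (σ z)
    obtain ⟨r1, r2, r3, -⟩ := frameCoord_relations R θ z (σ z)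
    rw [hgrad z hz, hgrad z hz, inner_comb i1 i2 i3]
    fin_cases i <;> fin_cases j <;> simp [metric] <;> linarith
  · rw [hnormal z hz]
    obtain ⟨i1, i2, i3⟩ := he.inner_eq (σ z)
    have z0 : z + (0 : ℝ) • dir i = z := by simp
    have d1 := hasDerivAt_line hU (contDiffOn_fderiv_dir hU hF (dir j)) hz (dir i)
    have d2 : HasDerivAt (fun t : ℝ => e 2 (σ (z + t • dir i))) _ 0 :=
      HasDerivAt.scomp (0 : ℝ) (he.deriv₃ (σ (z + (0 : ℝ) • dir i)))
        (hasDerivAt_line hU hσ hz (dir i))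
    have d3 := d1.inner ℝ d2
    -- Differentiating this orthogonality moves the second derivative of `F` onto `e 2 ∘ σ`, whose
    -- derivative is given by the third Darboux equation.
    have horth : ∀ z ∈ U, inner ℝ (fderiv ℝ F z (dir j)) (e 2 (σ z)) = 0 := fun z hz => by
      obtain ⟨i1, i2, i3⟩ := he.inner_eq (σ z)
      have := inner_comb i1 i2 i3 (frameCoord R θ j z (σ z)).1 (frameCoord R θ j z (σ z)).2 0 0 0 1
      rw [he.comb_eq _ 0 0 1] at this
      rw [hgrad z hz]
      simpa using this
    have d4 : HasDerivAt (fun t : ℝ => inner ℝ (fderiv ℝ F (z + t • dir i) (dir j))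
        (e 2 (σ (z + t • dir i)))) 0 0 := by
      refine (hasDerivAt_const (0 : ℝ) (0 : ℝ)).congr_of_eventuallyEq ?_
      filter_upwards [eventually_line hU hz (dir i)] with t ht
      exact horth _ ht
    have e1 := d3.unique d4
    rw [z0] at e1
    have e2 := inner_comb i1 i2 i3 (frameCoord R θ j z (σ z)).1 (frameCoord R θ j z (σ z)).2 0
      (-R.l₀ (σ z)) (-R.m₀ (σ z)) 0
    rw [← hgrad z hz, he.comb_eq] at e2
    have e3 : -(R.l₀ (σ z) • e 0 (σ z)) - R.m₀ (σ z) • e 1 (σ z)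
        = (-R.l₀ (σ z)) • e 0 (σ z) + (-R.m₀ (σ z)) • e 1 (σ z) + (0 : ℝ) • e 2 (σ z) := by module
    rw [inner_smul_right, e3, e2] at e1
    simp only [developableForm, Matrix.of_apply]
    linear_combination e1

/-- Differentiating the foot equation at the midline gives $l_0\,\nabla\sigma = (l_0, m_0)$, so the
form is the product of $(l_0, m_0)$ with itself divided by $l_0$. Its last entry $m_0^2/l_0$ is
$n_0$ because $\det \mathrm{II}^0 = 0$. -/
theorem developableForm_midline {L : ℝ} (hdet : ∀ s ∈ Icc 0 L, (R.II0 s).det = 0)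
    (hl : ∀ s ∈ Icc 0 L, R.l₀ s ≠ 0) {θ X₁ X₂ : ℝ → ℝ} (h : R.IsPlanarMidline θ X₁ X₂)
    {U : Set (ℝ × ℝ)} (hU : IsOpen U) {σ : ℝ × ℝ → ℝ} (hσ : ContDiffOn ℝ ∞ σ U)
    (h0 : ∀ z ∈ U, R.l₀ (σ z) * tangentCoord θ X₁ X₂ (fermi θ X₁ X₂ z).1 (fermi θ X₁ X₂ z).2 (σ z)
        + R.m₀ (σ z) * normalCoord θ X₁ X₂ (fermi θ X₁ X₂ z).1 (fermi θ X₁ X₂ z).2 (σ z) = 0)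
    {s : ℝ} (hs : s ∈ Icc 0 L) (hsU : (s, (0 : ℝ)) ∈ U) (hσs : σ (s, 0) = s) :
    developableForm R θ σ (s, 0) = R.II0 s := by
  have key : ∀ i, R.l₀ s * fderiv ℝ σ (s, 0) (dir i) = R.l₀ s * (frameCoord R θ i (s, 0) s).1
      + R.m₀ s * (frameCoord R θ i (s, 0) s).2 := fun i => by
    have z0 : (s, (0 : ℝ)) + (0 : ℝ) • dir i = (s, 0) := by simp
    obtain ⟨f1, f2⟩ := h.hasDerivAt_fermi (s, 0) i
    have ds := hasDerivAt_line hU hσ hsU (dir i)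
    have dl := HasDerivAt.comp (0 : ℝ) (h := fun t : ℝ => σ ((s, (0 : ℝ)) + t • dir i))
      ((R.contDiff_l₀.differentiable (by norm_num)) _).hasDerivAt ds
    have dm := HasDerivAt.comp (0 : ℝ) (h := fun t : ℝ => σ ((s, (0 : ℝ)) + t • dir i))
      ((R.contDiff_m₀.differentiable (by norm_num)) _).hasDerivAt ds
    have d1 := (dl.mul (h.hasDerivAt_tangentCoord f1 f2 ds)).add
      (dm.mul (h.hasDerivAt_normalCoord f1 f2 ds))
    have d2 := (hasDerivAt_const (0 : ℝ) (0 : ℝ)).congr_of_eventuallyEq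
      (show _ =ᶠ[𝓝 0] fun _ => (0 : ℝ) from by
        filter_upwards [eventually_line hU hsU (dir i)] with t ht
        exact h0 _ ht)
    have e := d1.unique d2
    have hY0 : fermi θ X₁ X₂ (s, 0) = (X₁ s, X₂ s) := by simp [fermi]
    simp only [Function.comp_apply, z0, hσs, hY0] at e
    have a0 : tangentCoord θ X₁ X₂ (X₁ s) (X₂ s) s = 0 := by simp [tangentCoord]
    have b0 : normalCoord θ X₁ X₂ (X₁ s) (X₂ s) s = 0 := by simp [normalCoord]
    rw [a0, b0] at e
    simp only [frameCoord]
    linear_combination -e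
  have hls := hl s hs
  have hd := hdet s hs
  rw [det_II0] at hd
  obtain ⟨c0, c1⟩ := frameCoord_midline R θ s
  have k0 := key 0
  have k1 := key 1
  rw [c0] at k0
  rw [c1] at k1
  simp only [mul_one, mul_zero, add_zero, zero_add] at k0 k1
  have k0' : fderiv ℝ σ (s, 0) (dir 0) = 1 := mul_left_cancel₀ hls (by rw [k0, mul_one])
  ext i j
  simp only [developableForm, Matrix.of_apply, hσs]
  obtain rfl | rfl : i = 0 ∨ i = 1 := by omega
  · rw [k0', one_mul]
    obtain rfl | rfl : j = 0 ∨ j = 1 := by omega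
    · rw [c0]; simp [l₀]
    · rw [c1]; simp [m₀]
  · obtain rfl | rfl : j = 0 ∨ j = 1 := by omega
    · rw [c0, II0_one_zero]; simp only [mul_one, mul_zero, add_zero]; linarith
    · rw [c1]
      simp only [mul_one, mul_zero, zero_add]
      refine mul_left_cancel₀ hls ?_
      show _ = R.l₀ s * R.n₀ s
      linear_combination R.m₀ s * k1 - hd

/-- Isometric immersions of thin ribbons whose second form is a fixed smooth field which agrees with
`II⁰` on the midline. -/
theorem exists_isometric_family {L : ℝ} (hdet : ∀ s ∈ Icc 0 L, (R.II0 s).det = 0)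
    (hl : ∀ s ∈ Icc 0 L, R.l₀ s ≠ 0) {e : Fin 3 → ℝ → E3} (he : R.IsDarbouxFrame e) :
    ∃ U : Set (ℝ × ℝ), ∃ H : ℝ × ℝ → Mat2, IsOpen U ∧ (∀ s ∈ Icc 0 L, (s, (0 : ℝ)) ∈ U) ∧
      (∀ i j, ContDiffOn ℝ ∞ (fun z => H z i j) U) ∧ (∀ s ∈ Icc 0 L, H (s, 0) = R.II0 s) ∧
      ∀ w > 0, (∀ x ∈ Icc 0 L ×ˢ Icc (-(1 / 2) : ℝ) (1 / 2), (x.1, w * x.2) ∈ U) →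
        ∃ f : W22 (strip L), R.IsIsometric L w f ∧
          ∀ x ∈ strip L, f.secondForm w x = H (x.1, w * x.2) := by
  obtain ⟨θ, X₁, X₂, h⟩ := R.exists_isPlanarMidline
  obtain ⟨V, σ, hV, hsV, hσV, h0V, hσs⟩ := exists_foot hl h
  -- The second condition keeps the Fermi coordinates immersive and the normal correctly oriented.
  set U := V ∩ {z | 0 < 1 - R.κ z.1 * z.2} with hUdef
  have hκ := R.smooth_κ.continuous
  have hU : IsOpen U := hV.inter (isOpen_lt continuous_const (by fun_prop))
  have hσ : ContDiffOn ℝ ∞ σ U := hσV.mono inter_subset_left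
  have h0 := fun z (hz : z ∈ U) => h0V z hz.1
  have hsU : ∀ s ∈ Icc 0 L, (s, (0 : ℝ)) ∈ U := fun s hs => ⟨hsV s hs, by simp⟩
  obtain ⟨F, hF, hF1, hF2⟩ := exists_developable he h hU hσ h0 fun z hz => hz.2
  refine ⟨U, developableForm R θ σ, hU, hsU, fun i j => ?_, fun s hs =>
    developableForm_midline hdet hl h hU hσ h0 hs (hsU s hs) (hσs s hs), fun w hw hsub => ?_⟩
  · obtain ⟨c1, c2⟩ := contDiffOn_frameCoord h hσ j
    have d : ContDiffOn ℝ ∞ (fun z => fderiv ℝ σ z (dir i)) U :=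
      (hσ.fderiv_of_isOpen hU (by norm_num)).clm_apply contDiffOn_const
    exact d.mul (((R.contDiff_l₀.comp_contDiffOn hσ).mul c1).add
      ((R.contDiff_m₀.comp_contDiffOn hσ).mul c2))
  · obtain ⟨f, hf1, hf2⟩ := exists_W22_of_contDiffOn hw hU hsub hF
    have hstrip : strip L ⊆ Icc 0 L ×ˢ Icc (-(1 / 2)) (1 / 2) :=
      prod_mono Ioo_subset_Icc_self Ioo_subset_Icc_self
    refine ⟨f, ?_, fun x hx => ?_⟩
    · filter_upwards [ae_restrict_mem (measurableSet_strip L)] with x hx i j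
      rw [hf1, hf1]
      exact hF1 _ (hsub x (hstrip hx)) i j
    · ext i j
      simp only [W22.secondForm, W22.normal, Matrix.of_apply, hf1, hf2]
      exact hF2 _ (hsub x (hstrip hx)) i j

end Ribbon.FlatGeometry

/-! ### Recovery sequence -/

namespace Ribbon.FlatGeometry

variable {R : FlatGeometry}

theorem eventually_len_pos (R : FlatGeometry) (L : ℝ) :
    ∀ᶠ w in 𝓝[>] (0 : ℝ), ∀ x ∈ strip L, 0 < R.len w x := by
  have hκ := R.smooth_κ.continuous
  obtain ⟨M, hM⟩ := exists_bound_strip L (k := fun y => R.κ y.2.1 * y.2.2) (by fun_prop)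
  have hpos : 0 < 1 / (|M| + 1) := by positivity
  filter_upwards [Ioo_mem_nhdsGT hpos] with w hw x hx
  have h1 := hM 1 ⟨one_pos, le_rfl⟩ x hx
  have h2 : w * (|M| + 1) < 1 := (lt_div_iff₀ (by positivity)).1 hw.2
  have h3 : w * (R.κ x.1 * x.2) ≤ w * (|M| + 1) :=
    mul_le_mul_of_nonneg_left ((le_abs_self _).trans (h1.trans (by linarith [le_abs_self M]))) hw.1.le
  show 0 < 1 - R.κ x.1 * (w * x.2)
  linarith

theorem continuousOn_slope {L : ℝ} (hl : ∀ s ∈ Icc 0 L, R.l₀ s ≠ 0) (i j : Fin 2) :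
    ContinuousOn (fun s => R.slope s i j) (Icc 0 L) := by
  have h0 := (R.contDiff_slope_zero 0).continuous
  have h1 := (R.contDiff_slope_zero 1).continuous
  have hm := R.contDiff_m₀.continuous
  have hn := R.contDiff_n₀.continuous
  obtain rfl | rfl : i = 0 ∨ i = 1 := by omega
  · exact (R.contDiff_slope_zero j).continuous.continuousOn
  · obtain rfl | rfl : j = 0 ∨ j = 1 := by omega
    · exact h1.continuousOn
    · have e : (fun s => R.slope s 1 1) = fun s =>
          (-(R.n₀ s * R.slope s 0 0) + 2 * R.m₀ s * R.slope s 0 1) / R.l₀ s := rfl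
      rw [e]
      exact ContinuousOn.div (by fun_prop) R.contDiff_l₀.continuous.continuousOn hl

theorem integral_strip_sq (L : ℝ) (f : ℝ → ℝ) :
    ∫ x in strip L, x.2 ^ 2 * f x.1 = (1 / 12) * ∫ s in Ioo 0 L, f s := by
  have h := integral_strip_mul L f fun t => t ^ 2
  have : ∫ t in Ioo (-(1 / 2) : ℝ) (1 / 2), t ^ 2 = 1 / 12 := by
    rw [← integral_Ioc_eq_integral_Ioo, ← intervalIntegral.integral_of_le (by norm_num)]
    simp; norm_num
  rw [this] at h
  rw [mul_comm, ← h]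
  congr 1; funext x; ring

theorem eqOn_of_integral_sq_eq_zero {L : ℝ} {c : ℝ → ℝ} (hc : ContinuousOn c (Icc 0 L))
    (h : ∫ s in Ioo 0 L, c s ^ 2 = 0) : ∀ s ∈ Ioo 0 L, c s = 0 := by
  have hi : IntegrableOn (fun s => c s ^ 2) (Ioo 0 L) :=
    ((hc.pow 2).integrableOn_compact isCompact_Icc).mono_set Ioo_subset_Icc_self
  have h1 := (integral_eq_zero_iff_of_nonneg (fun s => sq_nonneg (c s)) hi).1 h
  have h2 : c =ᵐ[volume.restrict (Ioo 0 L)] fun _ => 0 := by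
    filter_upwards [h1] with s hs
    exact pow_eq_zero_iff two_ne_zero |>.1 hs
  exact Measure.eqOn_open_of_ae_eq h2 isOpen_Ioo (hc.mono Ioo_subset_Icc_self) continuousOn_const

theorem exists_thin_subset {L : ℝ} {U : Set (ℝ × ℝ)} (hU : IsOpen U)
    (hsU : ∀ s ∈ Icc 0 L, (s, (0 : ℝ)) ∈ U) :
    ∃ r > 0, Icc 0 L ×ˢ Icc (-r) r ⊆ U := by
  obtain ⟨u, v, hu, hv, hLu, h0v, huv⟩ := generalized_tube_lemma (isCompact_Icc (a := 0) (b := L))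
    (isCompact_singleton (x := (0 : ℝ))) hU (by
      rintro ⟨s, t⟩ ⟨hs, ht⟩
      obtain rfl : t = 0 := ht
      exact hsU s hs)
  obtain ⟨r, hr, hrv⟩ := Metric.isOpen_iff.1 hv 0 (h0v rfl)
  refine ⟨r / 2, by positivity, (prod_mono hLu fun t ht => hrv ?_).trans huv⟩
  rw [Real.ball_eq_Ioo]
  exact ⟨by linarith [ht.1], by linarith [ht.2]⟩

/-- Uniform first order expansion in the transversal variable. -/
theorem eventually_expansion {L : ℝ} {U : Set (ℝ × ℝ)} (hU : IsOpen U)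
    (hsU : ∀ s ∈ Icc 0 L, (s, (0 : ℝ)) ∈ U) {h : ℝ × ℝ → ℝ} (hh : ContDiffOn ℝ ∞ h U) {ε : ℝ}
    (hε : 0 < ε) : ∀ᶠ w in 𝓝[>] (0 : ℝ), ∀ x ∈ strip L,
      |w⁻¹ * (h (x.1, w * x.2) - h (x.1, 0)) - x.2 * fderiv ℝ h (x.1, 0) (dir 1)| ≤ ε := by
  obtain ⟨r, hr, hrU⟩ := exists_thin_subset hU hsU
  have hd : ContinuousOn (fun z => fderiv ℝ h z (dir 1)) (Icc 0 L ×ˢ Icc (-r) r) :=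
    (((hh.fderiv_of_isOpen (m := ∞) hU (by norm_num)).clm_apply contDiffOn_const).continuousOn).mono hrU
  have huc := (isCompact_Icc.prod isCompact_Icc).uniformContinuousOn_of_continuous hd
  obtain ⟨δ, hδ, hδ'⟩ := Metric.uniformContinuousOn_iff.1 huc ε hε
  have hm : 0 < min r δ := lt_min hr hδ
  filter_upwards [Ioo_mem_nhdsGT hm] with w hw x hx
  have hwr : w < r := hw.2.trans_le (min_le_left _ _)
  have hwδ : w < δ := hw.2.trans_le (min_le_right _ _)
  have hx2 : |x.2| ≤ 1 := abs_le.2 ⟨by linarith [hx.2.1], by linarith [hx.2.2]⟩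
  have hin : ∀ τ ∈ Icc (0 : ℝ) 1, (x.1, τ * (w * x.2)) ∈ Icc 0 L ×ˢ Icc (-r) r ∧
      dist (x.1, τ * (w * x.2)) (x.1, 0) < δ := fun τ hτ => by
    have : |τ * (w * x.2)| ≤ w := by
      rw [abs_mul, abs_mul, abs_of_nonneg hτ.1, abs_of_pos hw.1]
      calc τ * (w * |x.2|) ≤ 1 * (w * 1) := by
            refine mul_le_mul hτ.2 (mul_le_mul_of_nonneg_left hx2 hw.1.le) ?_ zero_le_one
            exact mul_nonneg hw.1.le (abs_nonneg _)
        _ = w := by ring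
    refine ⟨⟨Ioo_subset_Icc_self hx.1, ?_⟩, ?_⟩
    · have := abs_le.1 this; exact ⟨by linarith, by linarith⟩
    · rw [Prod.dist_eq, dist_self, Real.dist_eq, sub_zero]
      exact max_lt hδ (this.trans_lt hwδ)
  have hder : ∀ τ ∈ Icc (0 : ℝ) 1, HasDerivAt (fun τ => h (x.1, τ * (w * x.2)))
      ((w * x.2) * fderiv ℝ h (x.1, τ * (w * x.2)) (dir 1)) τ := fun τ hτ => by
    have h1 := ((hh.contDiffAt (hU.mem_nhds (hrU (hin τ hτ).1))).differentiableAt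
      (by norm_num)).hasFDerivAt
    have h2 : HasDerivAt (fun τ : ℝ => (x.1, τ * (w * x.2))) (0, 1 * (w * x.2)) τ :=
      (hasDerivAt_const τ x.1).prodMk ((hasDerivAt_id τ).mul_const (w * x.2))
    have h3 := h1.comp_hasDerivAt τ h2
    have e : ((0 : ℝ), 1 * (w * x.2)) = (w * x.2) • dir 1 := by simp [dir]
    rw [e, map_smul, smul_eq_mul] at h3
    exact h3
  obtain ⟨τ, hτ, hτe⟩ := exists_hasDerivAt_eq_slope (fun τ => h (x.1, τ * (w * x.2)))
    (fun τ => (w * x.2) * fderiv ℝ h (x.1, τ * (w * x.2)) (dir 1)) one_pos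
    (fun τ hτ => (hder τ hτ).continuousAt.continuousWithinAt)
    (fun τ hτ => hder τ (Ioo_subset_Icc_self hτ))
  simp only [one_mul, zero_mul, sub_zero, div_one] at hτe
  have hd0 : (x.1, (0 : ℝ)) ∈ Icc 0 L ×ˢ Icc (-r) r :=
    ⟨Ioo_subset_Icc_self hx.1, by linarith, hr.le⟩
  obtain ⟨g1, g2⟩ := hin τ (Ioo_subset_Icc_self hτ)
  have hb := hδ' _ g1 _ hd0 g2
  rw [Real.dist_eq] at hb
  have hw0 : w ≠ 0 := hw.1.ne'
  rw [← hτe, show w⁻¹ * (w * x.2 * fderiv ℝ h (x.1, τ * (w * x.2)) (dir 1))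
      - x.2 * fderiv ℝ h (x.1, 0) (dir 1)
      = x.2 * (fderiv ℝ h (x.1, τ * (w * x.2)) (dir 1) - fderiv ℝ h (x.1, 0) (dir 1)) by
    field_simp, abs_mul]
  calc _ ≤ 1 * ε := mul_le_mul hx2 hb.le (abs_nonneg _) zero_le_one
    _ = ε := one_mul ε

/-- Recovery sequence: isometric immersions of the rescaled ribbons whose second form is
`II⁰ + w x₂ Θ + o(w)`, uniformly. -/
theorem exists_recovery {L : ℝ} (hL : 0 < L) (hdet : ∀ s ∈ Icc 0 L, (R.II0 s).det = 0)
    (hl : ∀ s ∈ Icc 0 L, R.l₀ s ≠ 0) {e : Fin 3 → ℝ → E3} (he : R.IsDarbouxFrame e) :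
    ∃ f : ℝ → W22 (strip L), (∀ᶠ w in 𝓝[>] (0 : ℝ), R.IsIsometric L w (f w)) ∧
      ∀ ε > 0, ∀ᶠ w in 𝓝[>] (0 : ℝ), ∀ x ∈ strip L, ∀ i j,
        |R.quot w ((f w).secondForm w) x i j - x.2 * R.slope x.1 i j| ≤ ε := by
  obtain ⟨U, H, hU, hsU, hH, hH0, hfam⟩ := exists_isometric_family hdet hl he
  obtain ⟨r, hr, hrU⟩ := exists_thin_subset hU hsU
  have hsub : ∀ w, 0 < w ∧ w ≤ r → ∀ x ∈ Icc 0 L ×ˢ Icc (-(1 / 2) : ℝ) (1 / 2), (x.1, w * x.2) ∈ U := by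
    rintro w ⟨hw, hwr⟩ x ⟨hx1, hx2⟩
    exact hrU ⟨hx1, by nlinarith [hx2.1], by nlinarith [hx2.2]⟩
  have hex : ∀ w, 0 < w ∧ w ≤ r → ∃ f : W22 (strip L), R.IsIsometric L w f ∧
      ∀ x ∈ strip L, f.secondForm w x = H (x.1, w * x.2) := fun w hw => hfam w hw.1 (hsub w hw)
  obtain ⟨f₀, -⟩ := hex r ⟨hr, le_rfl⟩
  classical
  -- The family must be defined for every `w`; outside $(0, r]$ it takes the arbitrary value `f₀`.
  choose! f hf1 hf2 using show ∀ w, ∃ f : W22 (strip L), (0 < w ∧ w ≤ r) → (R.IsIsometric L w f ∧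
      ∀ x ∈ strip L, f.secondForm w x = H (x.1, w * x.2)) from fun w => by
    by_cases h : 0 < w ∧ w ≤ r
    · obtain ⟨f, hf⟩ := hex w h
      exact ⟨f, fun _ => hf⟩
    · exact ⟨f₀, fun h' => absurd h' h⟩
  have hw : ∀ᶠ w in 𝓝[>] (0 : ℝ), 0 < w ∧ w ≤ r := Ioc_mem_nhdsGT hr
  set Z : ℝ → Fin 2 → Fin 2 → ℝ := fun s i j => fderiv ℝ (fun z => H z i j) (s, 0) (dir 1) with hZ
  have hZc : ∀ i j, ContinuousOn (fun s => Z s i j) (Icc 0 L) := fun i j => by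
    have h1 : ContinuousOn (fun z => fderiv ℝ (fun z => H z i j) z (dir 1)) U :=
      (((hH i j).fderiv_of_isOpen (m := ∞) hU (by norm_num)).clm_apply contDiffOn_const).continuousOn
    exact h1.comp (continuous_id.prodMk continuous_const).continuousOn hsU
  have hexp : ∀ ε > 0, ∀ᶠ w in 𝓝[>] (0 : ℝ), ∀ x ∈ strip L, ∀ i j,
      |R.quot w ((f w).secondForm w) x i j - x.2 * Z x.1 i j| ≤ ε := fun ε hε => by
    have h1 : ∀ᶠ w in 𝓝[>] (0 : ℝ), ∀ i j, ∀ x ∈ strip L,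
        |w⁻¹ * (H (x.1, w * x.2) i j - H (x.1, 0) i j) - x.2 * Z x.1 i j| ≤ ε :=
      eventually_all.2 fun i => eventually_all.2 fun j => eventually_expansion hU hsU (hH i j) hε
    filter_upwards [h1, hw] with w hw1 hw2 x hx i j
    have := hw1 i j x hx
    rw [hH0 _ (Ioo_subset_Icc_self hx.1), ← hf2 w hw2 x hx] at this
    exact this
  have hiso : ∀ᶠ w in 𝓝[>] (0 : ℝ), R.IsIsometric L w (f w) := hw.mono fun w h => hf1 w h
  have hGC : ∀ᶠ w in 𝓝[>] (0 : ℝ), R.IsGaussCodazzi L w ((f w).secondForm w) := by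
    filter_upwards [hiso, hw, R.eventually_len_pos L] with w h1 h2 h3
    exact R.isGaussCodazzi_secondForm h2.1 h3 h1
  have hslope := fun i j => continuousOn_slope hl i j
  choose M hM using fun i j => isCompact_Icc.exists_bound_of_continuousOn (hZc i j)
  set V := (volume.restrict (strip L)).real univ with hV
  obtain ⟨K, hK⟩ : ∃ K : ℝ, ∀ᶠ w in 𝓝[>] (0 : ℝ), ∀ i j,
      ∫ x in strip L, R.quot w ((f w).secondForm w) x i j ^ 2 ≤ K := by
    refine ⟨∑ i, ∑ j, (|M i j| + 1) ^ 2 * V, ?_⟩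
    filter_upwards [hexp 1 one_pos] with w h1 i j
    have hb : ∀ x ∈ strip L, R.quot w ((f w).secondForm w) x i j ^ 2 ≤ (|M i j| + 1) ^ 2 := fun x hx => by
      have a1 := h1 x hx i j
      have a2 := hM i j x.1 (Ioo_subset_Icc_self hx.1)
      rw [Real.norm_eq_abs] at a2
      have hx2 : |x.2| ≤ 1 := abs_le.2 ⟨by linarith [hx.2.1], by linarith [hx.2.2]⟩
      have a3 : |x.2 * Z x.1 i j| ≤ 1 * M i j := by
        rw [abs_mul]; exact mul_le_mul hx2 a2 (abs_nonneg _) zero_le_one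
      rw [sq_le_sq, abs_of_nonneg (a := |M i j| + 1) (by positivity)]
      have a4 := abs_add_le (R.quot w ((f w).secondForm w) x i j - x.2 * Z x.1 i j) (x.2 * Z x.1 i j)
      rw [sub_add_cancel] at a4
      linarith [le_abs_self (M i j)]
    have a5 : ∫ x in strip L, R.quot w ((f w).secondForm w) x i j ^ 2 ≤ (|M i j| + 1) ^ 2 * V := by
      calc _ ≤ ∫ x in strip L, (|M i j| + 1) ^ 2 := by
            refine integral_mono_of_nonneg (.of_forall fun x => sq_nonneg _) (integrable_const _) ?_
            filter_upwards [ae_restrict_mem (measurableSet_strip L)] with x hx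
            exact hb x hx
        _ = (|M i j| + 1) ^ 2 * V := by rw [integral_const, smul_eq_mul, mul_comm]
    refine a5.trans ?_
    have pos : ∀ i j, 0 ≤ (|M i j| + 1) ^ 2 * V := fun i j => mul_nonneg (sq_nonneg _) measureReal_nonneg
    exact (Finset.single_le_sum (f := fun j => (|M i j| + 1) ^ 2 * V) (fun j _ => pos i j)
      (Finset.mem_univ j)).trans (Finset.single_le_sum (f := fun i => ∑ j, (|M i j| + 1) ^ 2 * V)
        (fun i _ => Finset.sum_nonneg fun j _ => pos i j) (Finset.mem_univ i))
  -- The transversal derivative `Z` is not computed. By `tendsto_moment` the moment of $Q -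
  -- x_2\Theta$ against $x_2(Z - \Theta)$ tends to zero, while by the expansion it tends to
  -- $\frac1{12}\int (Z-\Theta)^2$.
  have hZs : ∀ i j, ∀ s ∈ Ioo 0 L, Z s i j - R.slope s i j = 0 := fun i j => by
    have hc : ContinuousOn (fun s => Z s i j - R.slope s i j) (Icc 0 L) := (hZc i j).sub (hslope i j)
    refine eqOn_of_integral_sq_eq_zero hc ?_
    have lim := R.tendsto_moment hL hdet hl hGC hK hc i j
    have lim2 : Tendsto (fun w => ∫ x in strip L, x.2 * (Z x.1 i j - R.slope x.1 i j) *
        (R.quot w ((f w).secondForm w) x i j - x.2 * R.slope x.1 i j)) (𝓝[>] 0)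
        (𝓝 (∫ x in strip L, x.2 * (Z x.1 i j - R.slope x.1 i j) *
          (x.2 * Z x.1 i j - x.2 * R.slope x.1 i j))) := by
      obtain ⟨B, hB⟩ := isCompact_Icc.exists_bound_of_continuousOn hc
      have mc : MemLp (fun x : ℝ × ℝ => x.2 * (Z x.1 i j - R.slope x.1 i j)) 2
          (volume.restrict (strip L)) :=
        continuousOn_memLp_strip (continuous_snd.continuousOn.mul (continuousOn_comp_fst hc))
      have ms : MemLp (fun x : ℝ × ℝ => x.2 * R.slope x.1 i j) 2 (volume.restrict (strip L)) :=
        continuousOn_memLp_strip (continuous_snd.continuousOn.mul (continuousOn_comp_fst (hslope i j)))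
      have mz : MemLp (fun x : ℝ × ℝ => x.2 * Z x.1 i j) 2 (volume.restrict (strip L)) :=
        continuousOn_memLp_strip (continuous_snd.continuousOn.mul (continuousOn_comp_fst (hZc i j)))
      refine tendsto_integral_mul_of_tendsto_sq mc (mz.sub ms) (hGC.mono fun w h =>
        (R.memLp_quot h i j).sub ms) ?_
      rw [Metric.tendsto_nhds]
      intro ε hε
      set η := √(ε / (2 * (V + 1))) with hη
      have hV0 : 0 ≤ V := measureReal_nonneg
      have hη0 : 0 < η := Real.sqrt_pos.2 (by positivity)
      have hη2 : η ^ 2 = ε / (2 * (V + 1)) := Real.sq_sqrt (by positivity)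
      filter_upwards [hexp η hη0] with w hw1
      rw [Real.dist_eq, sub_zero, abs_of_nonneg (integral_nonneg fun x => sq_nonneg _)]
      calc _ ≤ ∫ x in strip L, η ^ 2 := by
            refine integral_mono_of_nonneg (.of_forall fun x => sq_nonneg _) (integrable_const _) ?_
            filter_upwards [ae_restrict_mem (measurableSet_strip L)] with x hx
            have := abs_le.1 (hw1 x hx i j)
            show (R.quot w ((f w).secondForm w) x i j - x.2 * R.slope x.1 i j
              - (x.2 * Z x.1 i j - x.2 * R.slope x.1 i j)) ^ 2 ≤ η ^ 2
            exact sq_le_sq' (by linarith) (by linarith)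
        _ = V * η ^ 2 := by rw [integral_const, smul_eq_mul]
        _ ≤ ε / 2 := by
            rw [hη2, mul_div_assoc', div_le_div_iff₀ (by positivity) (by positivity)]
            nlinarith
        _ < ε := by linarith
    have h0 := tendsto_nhds_unique lim2 lim
    have e1 : ∀ x : ℝ × ℝ, x.2 * (Z x.1 i j - R.slope x.1 i j) *
          (x.2 * Z x.1 i j - x.2 * R.slope x.1 i j)
        = x.2 ^ 2 * (fun s => (Z s i j - R.slope s i j) ^ 2) x.1 := fun x => by ring
    simp only [e1] at h0
    rw [integral_strip_sq L fun s => (Z s i j - R.slope s i j) ^ 2] at h0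
    linarith
  refine ⟨f, hiso, fun ε hε => ?_⟩
  filter_upwards [hexp ε hε] with w hw1 x hx i j
  have := hw1 x hx i j
  rwa [sub_eq_zero.1 (hZs i j x.1 hx.1)] at this

end Ribbon.FlatGeometry

/-! ### Second order expansion of the elastic energy density -/

namespace Ribbon

/-- Since `a` is a minimum with value zero, `g` agrees with half its Hessian to second order. The
perturbations `X t` may be curves, not only rays, so that curves of rotations can be inserted later.
-/
theorem exists_quadratic_expansion {E : Type*} [NormedAddCommGroup E] [NormedSpace ℝ E] {g : E → ℝ}
    {a : E} (hg : ContDiffAt ℝ 2 g a) (hnn : ∀ x, 0 ≤ g x) (h0 : g a = 0) :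
    ∃ β : E →ₗ[ℝ] E →ₗ[ℝ] ℝ, (∀ B, fderiv ℝ (fderiv ℝ g) a B B = β B B) ∧
      (∀ B C, β B C = β C B) ∧
      ∀ (X : ℝ → E) (B : E), Tendsto (fun t : ℝ => t⁻¹ • X t) (𝓝[>] 0) (𝓝 B) →
        Tendsto (fun t : ℝ => (t ^ 2)⁻¹ * g (a + X t)) (𝓝[>] 0) (𝓝 (1 / 2 * β B B)) := by
  set H : E →L[ℝ] E →L[ℝ] ℝ := fderiv ℝ (fderiv ℝ g) a with hH
  have hsymm : ∀ B C, H B C = H C B := hg.isSymmSndFDerivAt (by simp)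
  have hd0 : fderiv ℝ g a = 0 := IsLocalMin.fderiv_eq_zero (.of_forall fun x => by
    rw [h0]; exact hnn x)
  have taylor : (fun X : E => g (a + X) - 1 / 2 * H X X) =o[𝓝 0] fun X => ‖X‖ ^ 2 := by
    have h1 : ∀ᶠ X in 𝓝 (0 : E), DifferentiableAt ℝ g (a + X) := by
      have h := hg.eventually (by simp)
      have hc : ContinuousAt (fun X : E => a + X) 0 := by fun_prop
      rw [← add_zero a] at h
      exact (hc.eventually h).mono fun X hX => hX.differentiableAt (by norm_num)
    have h2 : HasFDerivAt (fderiv ℝ g) H a :=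
      ((hg.fderiv_right (m := 1) (by norm_num)).differentiableAt (by norm_num)).hasFDerivAt
    have h3 := hasFDerivAt_iff_isLittleO_nhds_zero.1 h2
    have hq : ∀ X, HasFDerivAt (fun X : E => 1 / 2 * H X X) (H X) X := fun X => by
      have := (H.hasFDerivAt (x := X)).clm_apply (hasFDerivAt_id X)
      refine (this.const_mul (1 / 2)).congr_fderiv ?_
      ext Y
      simp only [smul_apply, add_apply, ContinuousLinearMap.comp_apply,
        ContinuousLinearMap.flip_apply, smul_eq_mul, ContinuousLinearMap.id_apply, id]
      rw [hsymm Y X]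
      ring
    rw [Asymptotics.isLittleO_iff]
    intro ε hε
    obtain ⟨δ, hδ, hball⟩ := Metric.eventually_nhds_iff_ball.1 (h1.and (h3.def hε))
    filter_upwards [Metric.ball_mem_nhds 0 hδ] with X hX
    rw [mem_ball_zero_iff] at hX
    -- Mean value inequality on the ball of radius `‖X‖`, where the gradient of the remainder is at
    -- most `ε ‖X‖`.
    have key := (convex_closedBall (0 : E) ‖X‖).norm_image_sub_le_of_norm_hasFDerivWithin_le
      (f := fun X : E => g (a + X) - 1 / 2 * H X X)
      (f' := fun Y => fderiv ℝ g (a + Y) - H Y) (C := ε * ‖X‖) (fun Y hY => ?_) (fun Y hY => ?_)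
      (Metric.mem_closedBall_self (norm_nonneg X)) (by simp : X ∈ Metric.closedBall 0 ‖X‖)
    · simp only [add_zero, map_zero, mul_zero, sub_zero, h0] at key
      rw [norm_pow, norm_norm, sq, ← mul_assoc]
      exact key
    · rw [mem_closedBall_zero_iff] at hY
      have hd := (hball Y (mem_ball_zero_iff.2 (hY.trans_lt hX))).1
      have hadd : HasFDerivAt (fun Y : E => a + Y) (ContinuousLinearMap.id ℝ E) Y :=
        (hasFDerivAt_id Y).const_add a
      have := hd.hasFDerivAt.comp Y hadd
      rw [ContinuousLinearMap.comp_id] at this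
      exact (this.sub (hq Y)).hasFDerivWithinAt
    · rw [mem_closedBall_zero_iff] at hY
      have hd := (hball Y (mem_ball_zero_iff.2 (hY.trans_lt hX))).2
      rw [hd0, sub_zero] at hd
      exact hd.trans (mul_le_mul_of_nonneg_left hY hε.le)
  refine ⟨LinearMap.mk₂ ℝ (fun B C => H B C) (by simp) (by simp) (by simp) (by simp), fun B => rfl,
    fun B C => hsymm B C, fun X B hX => ?_⟩
  show Tendsto _ _ (𝓝 (1 / 2 * H B B))
  have hpos : ∀ᶠ t in 𝓝[>] (0 : ℝ), (0 : ℝ) < t := self_mem_nhdsWithin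
  have ht : Tendsto (fun t : ℝ => t) (𝓝[>] 0) (𝓝 0) := nhdsWithin_le_nhds
  have hX0 : Tendsto X (𝓝[>] 0) (𝓝 0) := by
    have := ht.smul hX
    rw [zero_smul] at this
    refine this.congr' ?_
    filter_upwards [hpos] with t ht
    rw [smul_smul, mul_inv_cancel₀ ht.ne', one_smul]
  have h1 := taylor.comp_tendsto hX0
  have h2 : Tendsto (fun t : ℝ => 1 / 2 * H (t⁻¹ • X t) (t⁻¹ • X t)) (𝓝[>] 0)
      (𝓝 (1 / 2 * H B B)) := by
    have hc : Continuous fun B : E => 1 / 2 * H B B := by fun_prop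
    exact (hc.tendsto B).comp hX
  have h3 : Tendsto (fun t : ℝ => (t ^ 2)⁻¹ * (g (a + X t) - 1 / 2 * H (X t) (X t)))
      (𝓝[>] 0) (𝓝 0) := by
    have hb : (fun t => ‖X t‖ ^ 2) =O[𝓝[>] 0] fun t : ℝ => t ^ 2 := by
      have h := hX.norm.isBigO_one ℝ
      refine ((h.mul (Asymptotics.isBigO_refl (fun t : ℝ => t) _)).pow 2).congr' ?_ ?_
      · filter_upwards [hpos] with t ht
        rw [norm_smul, norm_inv, Real.norm_of_nonneg ht.le]
        field_simp
      · exact .of_forall fun t => by simp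
    have := (h1.trans_isBigO hb).tendsto_div_nhds_zero
    refine this.congr fun t => ?_
    simp only [Function.comp_apply]
    rw [div_eq_mul_inv, mul_comm]
  have h4 := h3.add h2
  rw [zero_add] at h4
  refine h4.congr' ?_
  filter_upwards [hpos] with t ht
  simp only [map_smul, smul_apply, smul_eq_mul]
  field_simp
  ring

/-! ### The quadratic form `𝒬₃` -/

theorem norm_sq_eq_sum {n : ℕ} (A : Matrix (Fin n) (Fin n) ℝ) : ‖A‖ ^ 2 = ∑ i, ∑ j, A i j ^ 2 := by
  rw [Matrix.frobenius_norm_def, ← Real.rpow_natCast, ← Real.rpow_mul (by positivity)]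
  norm_num

theorem abs_entry_le_norm {n : ℕ} (A : Matrix (Fin n) (Fin n) ℝ) (i j : Fin n) : |A i j| ≤ ‖A‖ := by
  refine abs_le_of_sq_le_sq ?_ (norm_nonneg A)
  rw [norm_sq_eq_sum]
  exact (Finset.single_le_sum (f := fun j => A i j ^ 2) (fun j _ => sq_nonneg _)
    (Finset.mem_univ j)).trans (Finset.single_le_sum (f := fun i => ∑ j, A i j ^ 2)
      (fun i _ => Finset.sum_nonneg fun j _ => sq_nonneg _) (Finset.mem_univ i))

theorem one_mem_SO3 : (1 : Mat3) ∈ SO3 := one_mem (Matrix.specialOrthogonalGroup (Fin 3) ℝ)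

/-- A lower bound for the distance to the rotations that is explicit in the matrix: $A^TA - 1 =
(A-S)^TA + S^T(A-S)$, and all rotations have the norm of the identity. -/
theorem norm_gram_sub_one_le (A : Mat3) {S : Mat3} (hS : S ∈ SO3) :
    ‖Aᵀ * A - 1‖ ≤ ‖A - S‖ * (‖A‖ + ‖(1 : Mat3)‖) := by
  have hSS : Sᵀ * S = 1 := by
    have h := (Matrix.mem_specialOrthogonalGroup_iff.1 hS).1
    exact (Matrix.mem_orthogonalGroup_iff' (Fin 3) ℝ).1 h
  have hnS : ‖S‖ = ‖(1 : Mat3)‖ := by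
    have tr : ∀ A : Mat3, ‖A‖ ^ 2 = (Aᵀ * A).trace := fun A => by
      rw [norm_sq_eq_sum, Finset.sum_comm]
      simp only [Matrix.trace, Matrix.diag, Matrix.mul_apply, Matrix.transpose_apply, sq]
    have : ‖S‖ ^ 2 = ‖(1 : Mat3)‖ ^ 2 := by
      rw [tr, tr, hSS, Matrix.transpose_one, one_mul]
    exact (sq_eq_sq₀ (norm_nonneg _) (norm_nonneg _)).1 this
  have e : Aᵀ * A - 1 = (A - S)ᵀ * A + Sᵀ * (A - S) := by
    rw [Matrix.transpose_sub, sub_mul, mul_sub, hSS]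
    abel
  rw [e]
  refine (norm_add_le _ _).trans ?_
  have h1 := Matrix.frobenius_norm_mul (A - S)ᵀ A
  have h2 := Matrix.frobenius_norm_mul Sᵀ (A - S)
  rw [Matrix.frobenius_norm_transpose] at h1 h2
  rw [hnS] at h2
  linarith

namespace IsEnergyDensity

variable {W : Mat3 → ℝ≥0∞}

theorem toReal_eq_zero (hW : IsEnergyDensity W) {A : Mat3} (hA : A ∈ SO3) : (W A).toReal = 0 := by
  rw [(hW.zero_iff A).2 hA, ENNReal.toReal_zero]

theorem exists_hessian (hW : IsEnergyDensity W) : ∃ β : Mat3 →ₗ[ℝ] Mat3 →ₗ[ℝ] ℝ, (∀ B, Q3 W B = 1 / 2 * β B B) ∧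
    (∀ B C, β B C = β C B) ∧
    ∀ (X : ℝ → Mat3) (B : Mat3), Tendsto (fun t : ℝ => t⁻¹ • X t) (𝓝[>] 0) (𝓝 B) →
      Tendsto (fun t : ℝ => (t ^ 2)⁻¹ * (W (1 + X t)).toReal) (𝓝[>] 0) (𝓝 (Q3 W B)) := by
  obtain ⟨U, hU, hSU, -, hd⟩ := hW.regular
  obtain ⟨β, h1, h2, h3⟩ := exists_quadratic_expansion (hd.contDiffAt (hU.mem_nhds (hSU one_mem_SO3)))
    (fun _ => ENNReal.toReal_nonneg) (hW.toReal_eq_zero one_mem_SO3)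
  have h4 : ∀ B, Q3 W B = 1 / 2 * β B B := fun B => congrArg (fun r => 1 / 2 * r) (h1 B)
  exact ⟨β, h4, h2, fun X B hX => by rw [h4]; exact h3 X B hX⟩

end IsEnergyDensity

end Ribbon

/-! ### Kernel and coercivity of the Hessian -/

namespace Ribbon

theorem bilinear_eq_sum (β : Mat3 →ₗ[ℝ] Mat3 →ₗ[ℝ] ℝ) (B C : Mat3) :
    β B C = ∑ i, ∑ j, ∑ k, ∑ l, B i j * (C k l *
      β (Matrix.single i j 1) (Matrix.single k l 1)) := by
  have e : ∀ D : Mat3, D = ∑ i, ∑ j, D i j • Matrix.single i j (1 : ℝ) := fun D => by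
    conv_lhs => rw [Matrix.matrix_eq_sum_single D]
    refine Finset.sum_congr rfl fun i _ => Finset.sum_congr rfl fun j _ => ?_
    rw [Matrix.smul_single, smul_eq_mul, mul_one]
  have h1 : ∀ D : Mat3, β D C = ∑ i, ∑ j, D i j * β (Matrix.single i j 1) C := fun D => by
    conv_lhs => rw [e D]
    simp only [map_sum, LinearMap.sum_apply, map_smul, LinearMap.smul_apply, smul_eq_mul]
  have h2 : ∀ P D : Mat3, β P D = ∑ i, ∑ j, D i j * β P (Matrix.single i j 1) := fun P D => by
    conv_lhs => rw [e D]
    simp only [map_sum, map_smul, smul_eq_mul]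
  rw [h1]
  refine Finset.sum_congr rfl fun i _ => Finset.sum_congr rfl fun j _ => ?_
  rw [h2 _ C]
  simp only [Finset.mul_sum]

theorem exists_bilinear_bound (β : Mat3 →ₗ[ℝ] Mat3 →ₗ[ℝ] ℝ) :
    ∃ C : ℝ, 0 < C ∧ ∀ B, β B B ≤ C * ‖B‖ ^ 2 := by
  refine ⟨(∑ i, ∑ j, ∑ k, ∑ l, |β (Matrix.single i j 1) (Matrix.single k l 1)|) + 1, ?_, fun B => ?_⟩
  · positivity
  · rw [bilinear_eq_sum, add_mul, one_mul]
    refine le_add_of_le_of_nonneg ?_ (sq_nonneg _)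
    simp only [Finset.sum_mul]
    refine Finset.sum_le_sum fun i _ => Finset.sum_le_sum fun j _ => Finset.sum_le_sum fun k _ =>
      Finset.sum_le_sum fun l _ => ?_
    refine (le_abs_self _).trans ?_
    rw [abs_mul, abs_mul, sq, ← mul_assoc, mul_comm (|B i j| * |B k l|)]
    exact mul_le_mul_of_nonneg_left (mul_le_mul (abs_entry_le_norm B i j) (abs_entry_le_norm B k l)
      (abs_nonneg _) (norm_nonneg _)) (abs_nonneg _)

/-- Bounds for the Hessian of a frame indifferent energy density. -/
structure IsElasticForm (β : Mat3 →ₗ[ℝ] Mat3 →ₗ[ℝ] ℝ) (c C : ℝ) : Prop where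
  pos : 0 < c
  pos' : 0 < C
  symm : ∀ B D, β B D = β D B
  skew : ∀ K D, Kᵀ = -K → β K D = 0
  lower : ∀ B, c * ‖B + Bᵀ‖ ^ 2 ≤ β B B
  upper : ∀ B, β B B ≤ C * ‖B‖ ^ 2

/-- A null vector of a semidefinite form lies in its kernel: a quadratic polynomial in `t` with no
quadratic term stays nonnegative only if its linear term vanishes. -/
theorem apply_eq_zero_of_psd {V : Type*} [AddCommGroup V] [Module ℝ V] {β : V →ₗ[ℝ] V →ₗ[ℝ] ℝ}
    (hs : ∀ B D, β B D = β D B) (hp : ∀ B, 0 ≤ β B B) {K : V} (hK : β K K = 0) (D : V) : β K D = 0 := by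
  have h : ∀ t : ℝ, 0 ≤ 0 * (t * t) + 2 * β K D * t + β D D := fun t => by
    have := hp (D + t • K)
    simp only [map_add, map_smul, LinearMap.add_apply, LinearMap.smul_apply, smul_eq_mul, hK,
      hs D K] at this
    linarith
  have := discrim_le_zero h
  rw [discrim] at this
  nlinarith [sq_nonneg (β K D)]

theorem tendsto_sin_div : Tendsto (fun t : ℝ => t⁻¹ * Real.sin t) (𝓝[>] 0) (𝓝 1) := by
  have h := (hasDerivAt_iff_tendsto_slope_zero.1 (Real.hasDerivAt_sin 0)).mono_left
    (nhdsWithin_mono 0 (s := Ioi 0) (t := {0}ᶜ) fun t ht => (ne_of_gt ht))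
  simpa using h

theorem tendsto_one_sub_cos_div : Tendsto (fun t : ℝ => t⁻¹ * (1 - Real.cos t)) (𝓝[>] 0) (𝓝 0) := by
  have h := (hasDerivAt_iff_tendsto_slope_zero.1 (Real.hasDerivAt_cos 0)).mono_left
    (nhdsWithin_mono 0 (s := Ioi 0) (t := {0}ᶜ) fun t ht => (ne_of_gt ht))
  have h' := h.neg
  simp only [zero_add, Real.cos_zero, smul_eq_mul, Real.sin_zero, neg_zero] at h'
  refine h'.congr fun t => ?_
  ring

namespace IsEnergyDensity

variable {W : Mat3 → ℝ≥0∞}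

/-- The energy vanishes along this one-parameter group of rotations, whose tangent at the identity
is `K`. -/
theorem Q3_eq_zero_of_rotation (hW : IsEnergyDensity W) {K P : Mat3}
    (h : ∀ t : ℝ, 1 + (Real.sin t • K + (1 - Real.cos t) • P) ∈ SO3) : Q3 W K = 0 := by
  obtain ⟨β, h1, h2, h3⟩ := hW.exists_hessian
  have lim : Tendsto (fun t : ℝ => t⁻¹ • (Real.sin t • K + (1 - Real.cos t) • P)) (𝓝[>] 0) (𝓝 K) := by
    have := (tendsto_sin_div.smul_const K).add (tendsto_one_sub_cos_div.smul_const P)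
    rw [one_smul, zero_smul, add_zero] at this
    refine this.congr fun t => ?_
    rw [smul_add, smul_smul, smul_smul]
  have := h3 _ K lim
  simp only [hW.toReal_eq_zero (h _), mul_zero] at this
  exact tendsto_nhds_unique this tendsto_const_nhds |>.symm ▸ rfl

/-- For $A = 1 + tB$ the matrix $A^TA - 1$ is $t(B + B^T) + O(t^2)$, so `norm_gram_sub_one_le`
bounds the distance to the rotations from below. Dividing the coercivity of `W` by $t^2$ gives the
claim; the factor $4\|1\|^2$ is the limit of $(\|A\| + \|1\|)^2$. -/
theorem exists_lower_bound (hW : IsEnergyDensity W) :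
    ∃ c : ℝ, 0 < c ∧ ∀ B, c * ‖B + Bᵀ‖ ^ 2 ≤ Q3 W B := by
  obtain ⟨c, hc, hcW⟩ := hW.coercive
  obtain ⟨U, hU, hSU, hfin, -⟩ := hW.regular
  obtain ⟨β, -, -, h3⟩ := hW.exists_hessian
  have n1 : 0 < ‖(1 : Mat3)‖ := norm_pos_iff.2 one_ne_zero
  refine ⟨c / (4 * ‖(1 : Mat3)‖ ^ 2), by positivity, fun B => ?_⟩
  have hpos : ∀ᶠ t in 𝓝[>] (0 : ℝ), (0 : ℝ) < t := self_mem_nhdsWithin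
  have ht : Tendsto (fun t : ℝ => t) (𝓝[>] 0) (𝓝 0) := nhdsWithin_le_nhds
  have lim := h3 (fun t => t • B) B (tendsto_const_nhds.congr' (by
    filter_upwards [hpos] with t ht
    rw [smul_smul, inv_mul_cancel₀ ht.ne', one_smul]))
  have lA : Tendsto (fun t : ℝ => (1 : Mat3) + t • B) (𝓝[>] 0) (𝓝 1) := by
    have := (ht.smul_const B).const_add (1 : Mat3)
    rwa [zero_smul, add_zero] at this
  have lS : Tendsto (fun t : ℝ => B + Bᵀ + t • (Bᵀ * B)) (𝓝[>] 0) (𝓝 (B + Bᵀ)) := by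
    have := (ht.smul_const (Bᵀ * B)).const_add (B + Bᵀ)
    rwa [zero_smul, add_zero] at this
  have lim2 : Tendsto (fun t : ℝ => c * (‖B + Bᵀ + t • (Bᵀ * B)‖ / (‖(1 : Mat3) + t • B‖
      + ‖(1 : Mat3)‖)) ^ 2) (𝓝[>] 0) (𝓝 (c * (‖B + Bᵀ‖ / (‖(1 : Mat3)‖ + ‖(1 : Mat3)‖)) ^ 2)) :=
    ((lS.norm.div (lA.norm.add_const _) (by positivity)).pow 2).const_mul c
  have e : c * (‖B + Bᵀ‖ / (‖(1 : Mat3)‖ + ‖(1 : Mat3)‖)) ^ 2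
      = c / (4 * ‖(1 : Mat3)‖ ^ 2) * ‖B + Bᵀ‖ ^ 2 := by
    field_simp
    ring
  rw [← e]
  refine le_of_tendsto_of_tendsto lim2 lim ?_
  filter_upwards [hpos, lA.eventually_mem (hU.mem_nhds (hSU one_mem_SO3))] with t ht htU
  have hden : 0 < ‖(1 : Mat3) + t • B‖ + ‖(1 : Mat3)‖ := by positivity
  have hd : ‖((1 : Mat3) + t • B)ᵀ * (1 + t • B) - 1‖ / (‖(1 : Mat3) + t • B‖ + ‖(1 : Mat3)‖)
      ≤ Metric.infDist ((1 : Mat3) + t • B) SO3 := by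
    refine (Metric.le_infDist ⟨1, one_mem_SO3⟩).2 fun S hS => ?_
    rw [div_le_iff₀ hden, dist_eq_norm]
    exact norm_gram_sub_one_le _ hS
  have eq : ((1 : Mat3) + t • B)ᵀ * (1 + t • B) - 1 = t • (B + Bᵀ + t • (Bᵀ * B)) := by
    simp only [Matrix.transpose_add, Matrix.transpose_one, Matrix.transpose_smul, add_mul, mul_add,
      one_mul, mul_one, Matrix.smul_mul, Matrix.mul_smul, smul_add]
    abel
  rw [eq, norm_smul, Real.norm_of_nonneg ht.le] at hd
  have hW' : c * Metric.infDist ((1 : Mat3) + t • B) SO3 ^ 2 ≤ (W (1 + t • B)).toReal := by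
    have := (ENNReal.ofReal_le_iff_le_toReal (hfin _ htU)).1 (hcW (1 + t • B))
    exact this
  have h5 : c * (t * ‖B + Bᵀ + t • (Bᵀ * B)‖ / (‖(1 : Mat3) + t • B‖ + ‖(1 : Mat3)‖)) ^ 2
      ≤ (W (1 + t • B)).toReal :=
    (mul_le_mul_of_nonneg_left (pow_le_pow_left₀ (by positivity) hd 2) hc.le).trans hW'
  rw [inv_mul_eq_div, le_div_iff₀ (by positivity)]
  calc _ = c * (t * ‖B + Bᵀ + t • (Bᵀ * B)‖ / (‖(1 : Mat3) + t • B‖ + ‖(1 : Mat3)‖)) ^ 2 := by ring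
    _ ≤ _ := h5

/-- The quadratic form `𝒬₃` vanishes on skew matrices and is coercive on symmetric ones. -/
theorem exists_isElasticForm (hW : IsEnergyDensity W) : ∃ (β : Mat3 →ₗ[ℝ] Mat3 →ₗ[ℝ] ℝ) (c C : ℝ),
    IsElasticForm β c C ∧ ∀ B, Q3 W B = 1 / 2 * β B B := by
  obtain ⟨β, h1, h2, -⟩ := hW.exists_hessian
  obtain ⟨c, hc, hcb⟩ := hW.exists_lower_bound
  obtain ⟨C, hC, hCb⟩ := exists_bilinear_bound β
  have hlow : ∀ B, c * ‖B + Bᵀ‖ ^ 2 ≤ β B B := fun B => by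
    have := hcb B
    rw [h1] at this
    have h0 : 0 ≤ c * ‖B + Bᵀ‖ ^ 2 := by positivity
    linarith
  have hpsd : ∀ B, 0 ≤ β B B := fun B => le_trans (by positivity) (hlow B)
  have mem : ∀ A : Mat3, A ∈ SO3 ↔ Aᵀ * A = 1 ∧ A.det = 1 := fun A => by
    show A ∈ Matrix.specialOrthogonalGroup (Fin 3) ℝ ↔ _
    rw [Matrix.mem_specialOrthogonalGroup_iff, Matrix.mem_orthogonalGroup_iff']
  have zero : ∀ {K P : Mat3}, (∀ t : ℝ, 1 + (Real.sin t • K + (1 - Real.cos t) • P) ∈ SO3) →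
      ∀ D, β K D = 0 := fun hK D => by
    refine apply_eq_zero_of_psd h2 hpsd ?_ D
    have := hW.Q3_eq_zero_of_rotation hK
    rw [h1] at this
    linarith
  -- The rotations about the three coordinate axes; their generators span the skew matrices.
  have z0 := zero (K := !![0, -1, 0; 1, 0, 0; 0, 0, 0]) (P := !![-1, 0, 0; 0, -1, 0; 0, 0, 0]) fun t => by
    have := Real.sin_sq_add_cos_sq t
    rw [mem]
    constructor
    · ext i j
      fin_cases i <;> fin_cases j <;>
        simp [Matrix.mul_apply, Fin.sum_univ_three] <;> nlinarith
    · rw [Matrix.det_fin_three]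
      simp
      nlinarith
  have z1 := zero (K := !![0, 0, -1; 0, 0, 0; 1, 0, 0]) (P := !![-1, 0, 0; 0, 0, 0; 0, 0, -1]) fun t => by
    have := Real.sin_sq_add_cos_sq t
    rw [mem]
    constructor
    · ext i j
      fin_cases i <;> fin_cases j <;>
        simp [Matrix.mul_apply, Fin.sum_univ_three] <;> nlinarith
    · rw [Matrix.det_fin_three]
      simp
      nlinarith
  have z2 := zero (K := !![0, 0, 0; 0, 0, -1; 0, 1, 0]) (P := !![0, 0, 0; 0, -1, 0; 0, 0, -1]) fun t => by
    have := Real.sin_sq_add_cos_sq t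
    rw [mem]
    constructor
    · ext i j
      fin_cases i <;> fin_cases j <;>
        simp [Matrix.mul_apply, Fin.sum_univ_three] <;> nlinarith
    · rw [Matrix.det_fin_three]
      simp
      nlinarith
  refine ⟨β, c, C, ⟨hc, hC, h2, fun K D hK => ?_, hlow, hCb⟩, h1⟩
  have hij : ∀ i j, K j i = -K i j := fun i j => congrFun (congrFun hK i) j
  have e : K = K 1 0 • !![0, -1, 0; 1, 0, 0; 0, 0, 0] + K 2 0 • !![0, 0, -1; 0, 0, 0; 1, 0, 0]
      + K 2 1 • !![0, 0, 0; 0, 0, -1; 0, 1, 0] := by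
    ext i j
    have d0 := hij 0 0
    have d1 := hij 1 1
    have d2 := hij 2 2
    have o1 := hij 0 1
    have o2 := hij 0 2
    have o3 := hij 1 2
    fin_cases i <;> fin_cases j <;> simp <;> linarith
  rw [e]
  simp only [map_add, map_smul, LinearMap.add_apply, LinearMap.smul_apply, z0, z1, z2, smul_zero, add_zero]

end IsEnergyDensity

end Ribbon

/-! ### Relaxation over the entries outside the upper left block -/

namespace Ribbon

theorem continuousOn_det {X : Type*} [TopologicalSpace X] {n : ℕ} {K : X → Matrix (Fin n) (Fin n) ℝ}
    {s : Set X} (h : ∀ i j, ContinuousOn (fun x => K x i j) s) : ContinuousOn (fun x => (K x).det) s := by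
  simp only [Matrix.det_apply']
  exact continuousOn_finsetSum _ fun σ _ => continuousOn_const.mul
    (continuousOn_finsetProd _ fun i _ => h _ _)

theorem continuousOn_inv {X : Type*} [TopologicalSpace X] {n : ℕ} {K : X → Matrix (Fin n) (Fin n) ℝ}
    {s : Set X} (h : ∀ i j, ContinuousOn (fun x => K x i j) s) (hd : ∀ x ∈ s, (K x).det ≠ 0) (i j : Fin n) :
    ContinuousOn (fun x => (K x)⁻¹ i j) s := by
  simp only [Matrix.inv_def, Matrix.smul_apply, smul_eq_mul, Ring.inverse_eq_inv', Matrix.adjugate_apply]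
  refine ((continuousOn_det h).inv₀ hd).mul (continuousOn_det fun k l => ?_)
  simp only [Matrix.updateRow_apply]
  split_ifs
  · exact continuousOn_const
  · exact h k l

theorem continuousOn_mul {X : Type*} [TopologicalSpace X] {n : ℕ} {K M : X → Matrix (Fin n) (Fin n) ℝ}
    {s : Set X} (h : ∀ i j, ContinuousOn (fun x => K x i j) s) (h' : ∀ i j, ContinuousOn (fun x => M x i j) s)
    (i j : Fin n) : ContinuousOn (fun x => (K x * M x) i j) s := by
  simp only [Matrix.mul_apply]
  exact continuousOn_finsetSum _ fun k _ => (h i k).mul (h' k j)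

theorem norm_sq_eq_trace {n : ℕ} (A : Matrix (Fin n) (Fin n) ℝ) : ‖A‖ ^ 2 = (Aᵀ * A).trace := by
  rw [norm_sq_eq_sum, Finset.sum_comm]
  simp only [Matrix.trace, Matrix.diag, Matrix.mul_apply, Matrix.transpose_apply, sq]

theorem norm_conj_of_orthogonal {n : ℕ} {M : Matrix (Fin n) (Fin n) ℝ} (hM : Mᵀ * M = 1)
    (A : Matrix (Fin n) (Fin n) ℝ) : ‖Mᵀ * A * M‖ = ‖A‖ := by
  have hM' : M * Mᵀ = 1 := mul_eq_one_comm.1 hM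
  refine (sq_eq_sq₀ (norm_nonneg _) (norm_nonneg _)).1 ?_
  rw [norm_sq_eq_trace, norm_sq_eq_trace]
  have : (Mᵀ * A * M)ᵀ * (Mᵀ * A * M) = Mᵀ * (Aᵀ * A) * M := by
    simp only [Matrix.transpose_mul, Matrix.transpose_transpose, Matrix.mul_assoc]
    rw [← Matrix.mul_assoc M Mᵀ, hM', Matrix.one_mul]
  rw [this, Matrix.trace_mul_comm, ← Matrix.mul_assoc, hM', Matrix.one_mul]

/-- Minimisation of a positive semidefinite form over an affine space. -/
theorem isLeast_schur {V : Type*} [AddCommGroup V] [Module ℝ V] {β : V →ₗ[ℝ] V →ₗ[ℝ] ℝ}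
    (hs : ∀ B D, β B D = β D B) (hp : ∀ B, 0 ≤ β B B) {n : ℕ} (e : Fin n → V)
    (hK : (Matrix.of fun i j => β (e i) (e j)).det ≠ 0) (x : V) :
    IsLeast (range fun d : Fin n → ℝ => β (x + ∑ i, d i • e i) (x + ∑ i, d i • e i))
      (β x x - ∑ i, ∑ j, (Matrix.of fun i j => β (e i) (e j))⁻¹ i j * β (e i) x * β (e j) x) := by
  set K : Matrix (Fin n) (Fin n) ℝ := Matrix.of fun i j => β (e i) (e j)
  set v : Fin n → ℝ := fun i => β (e i) x
  -- The coefficients of the `β`-orthogonal projection of `x` onto the span of the `e i`; the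
  -- minimum is the energy of the remainder `y`.
  set d₀ : Fin n → ℝ := K⁻¹ *ᵥ v
  set y : V := x - ∑ i, d₀ i • e i
  have hKd : K *ᵥ d₀ = v := by
    rw [Matrix.mulVec_mulVec, Matrix.mul_nonsing_inv _ (isUnit_iff_ne_zero.2 hK), Matrix.one_mulVec]
  have hy : ∀ i, β (e i) y = 0 := fun i => by
    have := congrFun hKd i
    simp only [Matrix.mulVec, dotProduct, v] at this
    simp only [y, map_sub, map_sum, map_smul, smul_eq_mul, ← this, K, Matrix.of_apply]
    rw [sub_eq_zero]
    exact Finset.sum_congr rfl fun j _ => mul_comm _ _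
  have hy' : ∀ d : Fin n → ℝ, β (∑ i, d i • e i) y = 0 := fun d => by
    simp only [map_sum, LinearMap.sum_apply, map_smul, LinearMap.smul_apply, hy, smul_zero,
      Finset.sum_const_zero]
  have hyy : β y y = β x x - ∑ i, ∑ j, K⁻¹ i j * β (e i) x * β (e j) x := by
    have h1 : β y y = β x y := by
      have : β (x - ∑ i, d₀ i • e i) y = β x y := by
        rw [LinearMap.map_sub₂, hy', sub_zero]
      exact this
    rw [h1]
    simp only [y, map_sub, map_sum, map_smul, smul_eq_mul, d₀, Matrix.mulVec, dotProduct, v, Finset.sum_mul]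
    congr 1
    refine Finset.sum_congr rfl fun i _ => Finset.sum_congr rfl fun j _ => ?_
    rw [hs x (e i)]
    ring
  rw [← hyy]
  refine ⟨⟨fun i => -d₀ i, ?_⟩, ?_⟩
  · simp only [neg_smul, Finset.sum_neg_distrib, ← sub_eq_add_neg]
    rfl
  · rintro _ ⟨d, rfl⟩
    have e1 : x + ∑ i, d i • e i = y + ∑ i, (d i + d₀ i) • e i := by
      simp only [add_smul, Finset.sum_add_distrib, y]
      abel
    have e2 : ∀ z, β z y = 0 → β y y ≤ β (y + z) (y + z) := fun z hz => by
      have := hp z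
      rw [LinearMap.map_add₂, map_add, map_add, hs y z, hz]
      linarith
    show _ ≤ β (x + ∑ i, d i • e i) (x + ∑ i, d i • e i)
    rw [e1]
    exact e2 _ (hy' _)

/-- The `3 × 3` matrix with upper left block `F` and zeros elsewhere. -/
def extend : Mat2 →ₗ[ℝ] Mat3 where
  toFun F := !![F 0 0, F 0 1, 0; F 1 0, F 1 1, 0; 0, 0, 0]
  map_add' F G := by
    ext i j
    fin_cases i <;> fin_cases j <;> simp
  map_smul' t F := by
    ext i j
    fin_cases i <;> fin_cases j <;> simp

theorem extend_block (F : Mat2) (i j : Fin 2) : extend F i.castSucc j.castSucc = F i j := by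
  obtain rfl | rfl : i = 0 ∨ i = 1 := by omega
  all_goals obtain rfl | rfl : j = 0 ∨ j = 1 := by omega
  all_goals rfl

theorem norm_extend (F : Mat2) : ‖extend F‖ = ‖F‖ := by
  refine (sq_eq_sq₀ (norm_nonneg _) (norm_nonneg _)).1 ?_
  rw [norm_sq_eq_sum, norm_sq_eq_sum]
  simp [extend, Fin.sum_univ_three]

/-- `B ↦ Mᵀ B M` as a linear map. -/
def pull (M : Mat3) : Mat3 →ₗ[ℝ] Mat3 where
  toFun B := Mᵀ * B * M
  map_add' B D := by rw [mul_add, add_mul]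
  map_smul' t B := by rw [Matrix.mul_smul, Matrix.smul_mul, RingHom.id_apply]

theorem pull_apply (M B : Mat3) : pull M B = Mᵀ * B * M := rfl

theorem pull_transpose (M B : Mat3) : pull M Bᵀ = (pull M B)ᵀ := by
  simp only [pull_apply, Matrix.transpose_mul, Matrix.transpose_transpose, Matrix.mul_assoc]

/-- The matrix units along which `𝒬₃` is relaxed. -/
def colUnit (i : Fin 3) : Mat3 := Matrix.single i 2 1

/-- The Gram matrix of the relaxation directions. -/
def gram (β : Mat3 →ₗ[ℝ] Mat3 →ₗ[ℝ] ℝ) (M : Mat3) : Mat3 :=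
  Matrix.of fun i j => β (pull M (colUnit i)) (pull M (colUnit j))

/-- The relaxation of `(F, H) ↦ β (Mᵀ F M) (Mᵀ H M)` over all entries outside the upper left block. -/
noncomputable def relaxed (β : Mat3 →ₗ[ℝ] Mat3 →ₗ[ℝ] ℝ) (M : Mat3) : Mat2 →ₗ[ℝ] Mat2 →ₗ[ℝ] ℝ :=
  LinearMap.mk₂ ℝ (fun F H => β (pull M (extend F)) (pull M (extend H)) - ∑ i, ∑ j,
      (gram β M)⁻¹ i j * β (pull M (colUnit i)) (pull M (extend F)) *
        β (pull M (colUnit j)) (pull M (extend H)))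
    (fun F G H => by
      simp only [map_add, LinearMap.add_apply, mul_add, add_mul, Finset.sum_add_distrib]
      ring)
    (fun t F H => by
      simp only [map_smul, LinearMap.smul_apply, smul_eq_mul, mul_sub, Finset.mul_sum]
      congr 1
      exact Finset.sum_congr rfl fun i _ => Finset.sum_congr rfl fun j _ => by ring)
    (fun F G H => by
      simp only [map_add, mul_add, Finset.sum_add_distrib]
      ring)
    (fun t F H => by
      simp only [map_smul, smul_eq_mul, mul_sub, Finset.mul_sum]
      congr 1
      exact Finset.sum_congr rfl fun i _ => Finset.sum_congr rfl fun j _ => by ring)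

theorem relaxed_apply (β : Mat3 →ₗ[ℝ] Mat3 →ₗ[ℝ] ℝ) (M : Mat3) (F H : Mat2) : relaxed β M F H =
    β (pull M (extend F)) (pull M (extend H)) - ∑ i, ∑ j,
      (gram β M)⁻¹ i j * β (pull M (colUnit i)) (pull M (extend F)) *
        β (pull M (colUnit j)) (pull M (extend H)) := rfl

theorem bilinear_eq_sum_two (b : Mat2 →ₗ[ℝ] Mat2 →ₗ[ℝ] ℝ) (F H : Mat2) :
    b F H = ∑ i, ∑ j, ∑ k, ∑ l, F i j * (H k l *
      b (Matrix.single i j 1) (Matrix.single k l 1)) := by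
  have e : ∀ D : Mat2, D = ∑ i, ∑ j, D i j • Matrix.single i j (1 : ℝ) := fun D => by
    conv_lhs => rw [Matrix.matrix_eq_sum_single D]
    refine Finset.sum_congr rfl fun i _ => Finset.sum_congr rfl fun j _ => ?_
    rw [Matrix.smul_single, smul_eq_mul, mul_one]
  have h1 : ∀ D : Mat2, b D H = ∑ i, ∑ j, D i j * b (Matrix.single i j 1) H := fun D => by
    conv_lhs => rw [e D]
    simp only [map_sum, LinearMap.sum_apply, map_smul, LinearMap.smul_apply, smul_eq_mul]
  have h2 : ∀ P D : Mat2, b P D = ∑ i, ∑ j, D i j * b P (Matrix.single i j 1) := fun P D => by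
    conv_lhs => rw [e D]
    simp only [map_sum, map_smul, smul_eq_mul]
  rw [h1]
  refine Finset.sum_congr rfl fun i _ => Finset.sum_congr rfl fun j _ => ?_
  rw [h2 _ H]
  simp only [Finset.mul_sum]

namespace IsElasticForm

variable {β : Mat3 →ₗ[ℝ] Mat3 →ₗ[ℝ] ℝ} {c C : ℝ}

theorem nonneg (hβ : IsElasticForm β c C) (B : Mat3) : 0 ≤ β B B :=
  le_trans (mul_nonneg hβ.pos.le (sq_nonneg _)) (hβ.lower B)

/-- A combination `E` of the relaxation directions with zero energy has skew pullback, hence is skew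
itself since `M` is invertible. A matrix supported in its last column is skew only if it vanishes.
-/
theorem det_gram_ne_zero (hβ : IsElasticForm β c C) {M : Mat3} (hM : M.det ≠ 0) :
    (gram β M).det ≠ 0 := by
  intro h0
  obtain ⟨d, hd, hKd⟩ := Matrix.exists_mulVec_eq_zero_iff.2 h0
  set E : Mat3 := ∑ i, d i • colUnit i
  have h1 : β (pull M E) (pull M E) = 0 := by
    have : ∀ i, β (pull M (colUnit i)) (pull M E) = 0 := fun i => by
      have := congrFun hKd i
      simp only [Matrix.mulVec, dotProduct, gram, Matrix.of_apply, Pi.zero_apply] at this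
      simp only [E, map_sum, map_smul, smul_eq_mul]
      rw [← this]
      exact Finset.sum_congr rfl fun j _ => mul_comm _ _
    conv_lhs => enter [1]; simp only [E, map_sum, map_smul]
    simp only [LinearMap.sum_apply, LinearMap.smul_apply, this, smul_zero,
      Finset.sum_const_zero]
  have h2 := hβ.lower (pull M E)
  rw [h1] at h2
  have h3 : ‖pull M E + (pull M E)ᵀ‖ ^ 2 = 0 := by
    have := hβ.pos
    nlinarith [sq_nonneg ‖pull M E + (pull M E)ᵀ‖]
  have h4 : pull M (E + Eᵀ) = 0 := by
    rw [map_add, pull_transpose]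
    exact norm_eq_zero.1 (pow_eq_zero_iff (two_ne_zero)|>.1 h3)
  have h5 : E + Eᵀ = 0 := by
    have hu : IsUnit M.det := isUnit_iff_ne_zero.2 hM
    have hu' : IsUnit Mᵀ.det := by rwa [Matrix.det_transpose]
    rw [pull_apply] at h4
    have : (Mᵀ)⁻¹ * (Mᵀ * (E + Eᵀ) * M) * M⁻¹ = 0 := by rw [h4, mul_zero, zero_mul]
    rwa [Matrix.mul_assoc Mᵀ, Matrix.nonsing_inv_mul_cancel_left _ _ hu',
      Matrix.mul_nonsing_inv_cancel_right _ _ hu] at this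
  apply hd
  have q : ∀ i j, E i j = if j = 2 then d i else 0 := fun i j => by
    simp only [E, colUnit, Fin.sum_univ_three]
    fin_cases i <;> fin_cases j <;> simp
  ext i
  have := congrFun (congrFun h5 i) 2
  simp only [Matrix.add_apply, Matrix.transpose_apply, q, Matrix.zero_apply, if_true] at this
  fin_cases i <;> simp at this ⊢ <;> linarith

theorem isLeast_relaxed (hβ : IsElasticForm β c C) {M : Mat3} (hM : M.det ≠ 0) (F : Mat2) :
    IsLeast {t | ∃ G : Mat3, (∀ i j : Fin 2, G i.castSucc j.castSucc = F i j) ∧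
      t = β (pull M G) (pull M G)} (relaxed β M F F) := by
  have h := isLeast_schur hβ.symm hβ.nonneg (fun i => pull M (colUnit i)) (hβ.det_gram_ne_zero hM)
    (pull M (extend F))
  constructor
  · obtain ⟨d, hd⟩ := h.1
    refine ⟨extend F + ∑ i, d i • colUnit i, fun i j => ?_, ?_⟩
    · rw [Matrix.add_apply, extend_block]
      simp only [colUnit, Fin.sum_univ_three]
      obtain rfl | rfl : i = 0 ∨ i = 1 := by omega
      all_goals obtain rfl | rfl : j = 0 ∨ j = 1 := by omega
      all_goals simp
    · rw [relaxed_apply]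
      have e1 : pull M (extend F + ∑ i, d i • colUnit i)
          = pull M (extend F) + ∑ i, d i • pull M (colUnit i) := by
        simp only [map_add, map_sum, map_smul]
      rw [e1]
      exact hd.symm
  · rintro _ ⟨G, hG, rfl⟩
    -- Skew matrices cost no energy, so the last row of `G` may be folded into its last column. This
    -- is why three directions suffice although five entries are free.
    set d : Fin 3 → ℝ := ![G 0 2 + G 2 0, G 1 2 + G 2 1, G 2 2] with hd
    set H : Mat3 := extend F + ∑ i, d i • colUnit i with hH
    have hK : (G - H)ᵀ = -(G - H) := by
      have g00 := hG 0 0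
      have g01 := hG 0 1
      have g10 := hG 1 0
      have g11 := hG 1 1
      simp only [Fin.castSucc_zero, Fin.castSucc_one] at g00 g01 g10 g11
      have : G - H = !![0, 0, -G 2 0; 0, 0, -G 2 1; G 2 0, G 2 1, 0] := by
        ext i j
        simp only [hH, hd, colUnit, Fin.sum_univ_three, extend]
        fin_cases i <;> fin_cases j <;> simp [g00, g01, g10, g11]
      rw [this]
      ext i j
      fin_cases i <;> fin_cases j <;> simp
    have hz : ∀ D, β (pull M (G - H)) D = 0 := fun D => by
      refine hβ.skew _ D ?_
      rw [← pull_transpose, hK, map_neg]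
    have e : pull M G = pull M H + pull M (G - H) := by rw [← map_add]; congr 1; abel
    have e2 : β (pull M G) (pull M G) = β (pull M H) (pull M H) := by
      rw [e, LinearMap.map_add₂, hz, add_zero, map_add, hβ.symm (pull M H) (pull M (G - H)),
        hz, add_zero]
    rw [e2]
    have e1 : pull M H = pull M (extend F) + ∑ i, d i • pull M (colUnit i) := by
      simp only [hH, map_add, map_sum, map_smul]
    rw [e1]
    exact h.2 ⟨d, rfl⟩

theorem relaxed_symm (hβ : IsElasticForm β c C) (M : Mat3) (F H : Mat2) :
    relaxed β M F H = relaxed β M H F := by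
  have hg : (gram β M)ᵀ = gram β M := by
    ext i j
    exact hβ.symm _ _
  have hi : ∀ i j, (gram β M)⁻¹ j i = (gram β M)⁻¹ i j := fun i j => by
    rw [← Matrix.transpose_apply (gram β M)⁻¹, Matrix.transpose_nonsing_inv, hg]
  rw [relaxed_apply, relaxed_apply, hβ.symm (pull M (extend F)) (pull M (extend H)), Finset.sum_comm]
  congr 1
  refine Finset.sum_congr rfl fun i _ => Finset.sum_congr rfl fun j _ => ?_
  rw [hi]
  ring

theorem relaxed_nonneg (hβ : IsElasticForm β c C) {M : Mat3} (hM : M.det ≠ 0) (F : Mat2) :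
    0 ≤ relaxed β M F F := by
  obtain ⟨G, -, h⟩ := (hβ.isLeast_relaxed hM F).1
  rw [h]
  exact hβ.nonneg _

/-- Conjugation by an orthogonal matrix preserves the Frobenius norm, and the upper left block of $G
+ G^T$ is $2F$ for every competitor `G`. -/
theorem relaxed_lower (hβ : IsElasticForm β c C) {M : Mat3} (hM : Mᵀ * M = 1) {F : Mat2}
    (hF : F.IsSymm) : 4 * c * ‖F‖ ^ 2 ≤ relaxed β M F F := by
  have hdet : M.det ≠ 0 := (Matrix.isUnit_iff_isUnit_det _).1 (IsUnit.of_mul_eq_one _ (mul_eq_one_comm.1 hM)) |>.ne_zero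
  obtain ⟨G, hG, h⟩ := (hβ.isLeast_relaxed hdet F).1
  rw [h]
  have h1 := hβ.lower (pull M G)
  rw [← pull_transpose, ← map_add, pull_apply, norm_conj_of_orthogonal hM] at h1
  refine le_trans ?_ h1
  have h2 : 4 * ‖F‖ ^ 2 ≤ ‖G + Gᵀ‖ ^ 2 := by
    have g00 := hG 0 0
    have g01 := hG 0 1
    have g10 := hG 1 0
    have g11 := hG 1 1
    have s := hF.apply 0 1
    simp only [Fin.castSucc_zero, Fin.castSucc_one] at g00 g01 g10 g11
    rw [norm_sq_eq_sum, norm_sq_eq_sum]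
    simp only [Fin.sum_univ_three, Fin.sum_univ_two, Matrix.add_apply, Matrix.transpose_apply, g00, g01,
      g10, g11, s]
    nlinarith [sq_nonneg (G 0 2 + G 2 0), sq_nonneg (G 1 2 + G 2 1), sq_nonneg (G 2 0 + G 0 2),
      sq_nonneg (G 2 1 + G 1 2), sq_nonneg (G 2 2 + G 2 2)]
  have := hβ.pos
  nlinarith

theorem relaxed_upper (hβ : IsElasticForm β c C) {M : Mat3} (hM : Mᵀ * M = 1) (F : Mat2) :
    relaxed β M F F ≤ C * ‖F‖ ^ 2 := by
  have hdet : M.det ≠ 0 := (Matrix.isUnit_iff_isUnit_det _).1 (IsUnit.of_mul_eq_one _ (mul_eq_one_comm.1 hM)) |>.ne_zero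
  refine ((hβ.isLeast_relaxed hdet F).2 ⟨extend F, extend_block F, rfl⟩).trans ?_
  have := hβ.upper (pull M (extend F))
  rwa [pull_apply, norm_conj_of_orthogonal hM, norm_extend] at this

/-- The Schur complement formula makes continuity visible: it involves only polynomials in the
entries of `M` and the inverse of the Gram matrix, which is invertible. -/
theorem continuousOn_relaxed (hβ : IsElasticForm β c C) {X : Type*} [TopologicalSpace X] {M : X → Mat3}
    {s : Set X} (h : ∀ i j, ContinuousOn (fun x => M x i j) s) (hM : ∀ x ∈ s, (M x).det ≠ 0) (F H : Mat2) :
    ContinuousOn (fun x => relaxed β (M x) F H) s := by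
  have hp : ∀ B i j, ContinuousOn (fun x => pull (M x) B i j) s := fun B =>
    continuousOn_mul (continuousOn_mul (fun i j => h j i) fun i j => continuousOn_const) h
  have hb : ∀ B D, ContinuousOn (fun x => β (pull (M x) B) (pull (M x) D)) s := fun B D => by
    simp only [fun x => bilinear_eq_sum β (pull (M x) B) (pull (M x) D)]
    exact continuousOn_finsetSum _ fun i _ => continuousOn_finsetSum _ fun j _ =>
      continuousOn_finsetSum _ fun k _ => continuousOn_finsetSum _ fun l _ =>
        (hp B i j).mul ((hp D k l).mul continuousOn_const)
  have hg := continuousOn_inv (K := fun x => gram β (M x)) (s := s) (fun i j => hb _ _)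
    fun x hx => hβ.det_gram_ne_zero (hM x hx)
  simp only [relaxed_apply]
  exact (hb _ _).sub (continuousOn_finsetSum _ fun i _ => continuousOn_finsetSum _ fun j _ =>
    ((hg i j).mul (hb _ _)).mul (hb _ _))

end IsElasticForm

end Ribbon

/-! ### The matrix square root and regularity of $A_0$ -/

namespace Ribbon

theorem sqrt_mul_self {F : Mat3} (hF : F.PosSemidef) : cfc Real.sqrt F * cfc Real.sqrt F = F := by
  have hs := (Matrix.posSemidef_iff_isHermitian_and_spectrum_nonneg.1 hF).2
  rw [← cfc_mul Real.sqrt Real.sqrt F]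
  conv_rhs => rw [← cfc_id' ℝ F hF.isHermitian]
  exact cfc_congr fun x hx => Real.mul_self_sqrt (hs hx)

theorem sqrt_transpose (F : Mat3) : (cfc Real.sqrt F)ᵀ = cfc Real.sqrt F :=
  cfc_predicate Real.sqrt F

theorem posSemidef_sqrt {F : Mat3} (hF : F.PosSemidef) : (cfc Real.sqrt F).PosSemidef := by
  refine Matrix.posSemidef_iff_isHermitian_and_spectrum_nonneg.2 ⟨cfc_predicate Real.sqrt F, ?_⟩
  have h : spectrum ℝ (cfc Real.sqrt F) = Real.sqrt '' spectrum ℝ F :=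
    cfc_map_spectrum (R := ℝ) Real.sqrt F hF.isHermitian
  intro y hy
  obtain ⟨x, -, rfl⟩ : y ∈ Real.sqrt '' spectrum ℝ F := h ▸ hy
  exact Real.sqrt_nonneg x

theorem det_sqrt_ne_zero {F : Mat3} (hF : F.PosSemidef) (hd : F.det ≠ 0) :
    (cfc Real.sqrt F).det ≠ 0 := fun h => hd (by
  rw [← sqrt_mul_self hF, Matrix.det_mul, h, zero_mul])

theorem sqrt_one : cfc Real.sqrt (1 : Mat3) = 1 := by
  rw [cfc_apply_one, Real.sqrt_one, map_one]

/-- The square root is locally Lipschitz at positive definite matrices. -/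
theorem exists_norm_sqrt_sub_le {F : Mat3} (hF : F.PosSemidef) (hd : F.det ≠ 0) :
    ∃ C : ℝ, ∀ G : Mat3, G.PosSemidef → ‖cfc Real.sqrt F - cfc Real.sqrt G‖ ≤ C * ‖F - G‖ := by
  set S := cfc Real.sqrt F
  have hS : S.PosSemidef := posSemidef_sqrt hF
  set P := cfc Real.sqrt S
  have hP : P * P = S := sqrt_mul_self hS
  have hPt : Pᵀ = P := sqrt_transpose S
  have hPu : IsUnit P.det := isUnit_iff_ne_zero.2 (det_sqrt_ne_zero hS (det_sqrt_ne_zero hF hd))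
  refine ⟨‖P⁻¹‖ ^ 2, fun G hG => ?_⟩
  set T := cfc Real.sqrt G
  set Q := cfc Real.sqrt T
  have hQ : Q * Q = T := sqrt_mul_self (posSemidef_sqrt hG)
  have hQt : Qᵀ = Q := sqrt_transpose T
  set D := S - T
  have hDt : Dᵀ = D := by
    rw [Matrix.transpose_sub, sqrt_transpose, sqrt_transpose]
  have e : F - G = S * D + D * T := by
    rw [← sqrt_mul_self hF, ← sqrt_mul_self hG]
    simp only [D, mul_sub, sub_mul]
    abel
  -- With $S = \sqrt F$, $T = \sqrt G$ and $D = S - T$ one has $F - G = SD + DT$. Pairing with `D`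
  -- gives two nonnegative terms, and the first controls $\|D\|^2$ through the invertible root `P`
  -- of `S`.
  have h1 : (D * (F - G)).trace = ‖P * D‖ ^ 2 + ‖D * Q‖ ^ 2 := by
    rw [norm_sq_eq_trace, norm_sq_eq_trace, e, mul_add, Matrix.trace_add]
    congr 1
    · rw [Matrix.transpose_mul, hPt, hDt, ← hP]
      simp only [Matrix.mul_assoc]
    · rw [Matrix.transpose_mul, hQt, hDt, ← hQ]
      rw [← Matrix.mul_assoc D D, ← Matrix.mul_assoc (D * D), Matrix.trace_mul_comm]
      simp only [Matrix.mul_assoc]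
  have h2 : (D * (F - G)).trace ≤ ‖D‖ * ‖F - G‖ := by
    have h : (D * (F - G)).trace = ∑ p : Fin 3 × Fin 3, D p.1 p.2 * (F - G) p.2 p.1 := by
      rw [Fintype.sum_prod_type]
      simp only [Matrix.trace, Matrix.diag, Matrix.mul_apply]
    refine abs_le_of_sq_le_sq' ?_ (by positivity) |>.2
    rw [h, mul_pow, norm_sq_eq_sum, norm_sq_eq_sum]
    refine (Finset.sum_mul_sq_le_sq_mul_sq _ _ _).trans (le_of_eq ?_)
    rw [Fintype.sum_prod_type, Fintype.sum_prod_type]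
    congr 1
    exact Finset.sum_comm
  have h3 : ‖D‖ ≤ ‖P⁻¹‖ * ‖P * D‖ := by
    have := Matrix.frobenius_norm_mul P⁻¹ (P * D)
    rwa [Matrix.nonsing_inv_mul_cancel_left _ _ hPu] at this
  rcases (norm_nonneg D).eq_or_lt with h0 | h0
  · rw [← h0]
    positivity
  · have h4 : ‖D‖ ^ 2 ≤ ‖P⁻¹‖ ^ 2 * (‖D‖ * ‖F - G‖) := by
      calc ‖D‖ ^ 2 ≤ (‖P⁻¹‖ * ‖P * D‖) ^ 2 := pow_le_pow_left₀ h0.le h3 2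
        _ = ‖P⁻¹‖ ^ 2 * ‖P * D‖ ^ 2 := by ring
        _ ≤ _ := mul_le_mul_of_nonneg_left (by nlinarith [sq_nonneg ‖D * Q‖]) (sq_nonneg _)
    nlinarith

theorem continuousOn_sqrt {X : Type*} [TopologicalSpace X] {F : X → Mat3} {s : Set X}
    (h : ∀ i j, ContinuousOn (fun x => F x i j) s) (hF : ∀ x ∈ s, (F x).PosSemidef)
    (hd : ∀ x ∈ s, (F x).det ≠ 0) (i j : Fin 3) :
    ContinuousOn (fun x => cfc Real.sqrt (F x) i j) s := by
  intro x hx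
  obtain ⟨C, hC⟩ := exists_norm_sqrt_sub_le (hF x hx) (hd x hx)
  have h1 : Tendsto (fun y => C * √(∑ i, ∑ j, (F x i j - F y i j) ^ 2)) (𝓝[s] x) (𝓝 0) := by
    have : Tendsto (fun y => C * √(∑ i, ∑ j, (F x i j - F y i j) ^ 2)) (𝓝[s] x)
        (𝓝 (C * √(∑ i, ∑ j, (F x i j - F x i j) ^ 2))) :=
      ((tendsto_finsetSum _ fun i _ => tendsto_finsetSum _ fun j _ =>
        ((h i j x hx).tendsto.const_sub (F x i j)).pow 2).sqrt).const_mul C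
    simpa using this
  have h2 : Tendsto (fun y => cfc Real.sqrt (F x) i j - cfc Real.sqrt (F y) i j) (𝓝[s] x) (𝓝 0) := by
    refine squeeze_zero_norm' ?_ h1
    filter_upwards [self_mem_nhdsWithin] with y hy
    have := (abs_entry_le_norm _ i j).trans (hC (F y) (hF y hy))
    have e : ‖F x - F y‖ = √(∑ i, ∑ j, (F x i j - F y i j) ^ 2) := by
      rw [← Real.sqrt_sq (norm_nonneg (F x - F y)), norm_sq_eq_sum]
      rfl
    rw [e] at this
    exact this
  have := h2.const_sub (cfc Real.sqrt (F x) i j)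
  simpa [ContinuousWithinAt] using this

namespace FlatGeometry

variable {R : FlatGeometry} {e : Fin 3 → ℝ → E3}

theorem contDiff_Phi (he : R.IsDarbouxFrame e) : ContDiff ℝ ∞ (R.Phi e) := by
  have h0 := he.contDiff 0
  have h1 := he.contDiff 1
  have h2 := he.contDiff 2
  have hm := R.contDiff_m₀
  have hn := R.contDiff_n₀
  have hI : ContDiff ℝ ∞ (fun x : ℝ => ∫ s in (0 : ℝ)..x, e 0 s) :=
    contDiff_infty_of_hasDerivAt (fun s => (h0.continuous.integral_hasStrictDerivAt _ s).hasDerivAt) h0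
  unfold Phi
  have hI' := hI.comp (contDiff_fst (𝕜 := ℝ) (E := ℝ) (F := ℝ))
  refine ((hI'.add (contDiff_snd.smul (h1.comp contDiff_fst))).add ?_).sub ?_
  · exact (((contDiff_snd.pow 2).div_const 2).mul (hn.comp contDiff_fst)).smul (h2.comp contDiff_fst)
  · exact (((contDiff_snd.pow 3).div_const 6).mul (hn.comp contDiff_fst)).smul
      (((hm.comp contDiff_fst).smul (h0.comp contDiff_fst)).add
        ((hn.comp contDiff_fst).smul (h1.comp contDiff_fst)))

theorem deriv_Phi (he : R.IsDarbouxFrame e) (z : ℝ × ℝ) :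
    deriv (fun s => R.Phi e (s, z.2)) z.1 = fderiv ℝ (R.Phi e) z (dir 0) ∧
      deriv (fun r => R.Phi e (z.1, r)) z.2 = fderiv ℝ (R.Phi e) z (dir 1) := by
  have h := ((contDiff_Phi he).differentiable (by norm_num) z).hasFDerivAt
  constructor
  · exact (h.comp_hasDerivAt (f := fun s => (s, z.2)) z.1
      ((hasDerivAt_id z.1).prodMk (hasDerivAt_const _ _))).deriv
  · exact (h.comp_hasDerivAt (f := fun r => (z.1, r)) z.2
      ((hasDerivAt_const _ _).prodMk (hasDerivAt_id z.2))).deriv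

theorem deriv_Phi_midline (he : R.IsDarbouxFrame e) (s : ℝ) :
    deriv (fun t => R.Phi e (t, 0)) s = e 0 s ∧ deriv (fun r => R.Phi e (s, r)) 0 = e 1 s := by
  constructor
  · have : (fun t => R.Phi e (t, 0)) = fun x : ℝ => ∫ s in (0 : ℝ)..x, e 0 s := by
      funext t
      simp [Phi]
    rw [this]
    exact ((he.contDiff 0).continuous.integral_hasStrictDerivAt _ s).hasDerivAt.deriv
  · refine HasDerivAt.deriv ?_
    have h1 := (hasDerivAt_id (0 : ℝ)).smul_const (e 1 s)
    have h2 := ((((hasDerivAt_id (0 : ℝ)).pow 2).div_const 2).mul_const (R.n₀ s)).smul_const (e 2 s)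
    have h3 := ((((hasDerivAt_id (0 : ℝ)).pow 3).div_const 6).mul_const (R.n₀ s)).smul_const
      (R.m₀ s • e 0 s + R.n₀ s • e 1 s)
    exact (((h1.const_add (∫ s in (0 : ℝ)..s, e 0 s)).add h2).sub h3).congr_deriv (by simp)

theorem frameMatrix_eq (he : R.IsDarbouxFrame e) (z : ℝ × ℝ) : R.frameMatrix e z =
    Matrix.of fun i j => (![fderiv ℝ (R.Phi e) z (dir 0), fderiv ℝ (R.Phi e) z (dir 1),
      unitNormal (fderiv ℝ (R.Phi e) z (dir 0)) (fderiv ℝ (R.Phi e) z (dir 1))] j) i := by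
  rw [← (deriv_Phi he z).1, ← (deriv_Phi he z).2]
  rfl

theorem frameMatrix_midline (he : R.IsDarbouxFrame e) (s : ℝ) :
    R.frameMatrix e (s, 0) = Matrix.of fun i j => e j s i := by
  have hn : unitNormal (e 0 s) (e 1 s) = e 2 s := by
    rw [unitNormal, he.oriented, (he.orthonormal s).1 2, inv_one, one_smul]
  rw [frameMatrix]
  simp only [(deriv_Phi_midline he s).1, (deriv_Phi_midline he s).2, hn]
  ext i j
  fin_cases j <;> rfl

theorem frameMatrix_midline_orthogonal (he : R.IsDarbouxFrame e) (s : ℝ) :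
    (R.frameMatrix e (s, 0))ᵀ * R.frameMatrix e (s, 0) = 1 := by
  have h := orthonormal_iff_ite.1 (he.orthonormal s)
  rw [frameMatrix_midline he]
  ext i j
  rw [Matrix.mul_apply, Matrix.one_apply, ← h i j, inner_eq_sum, Fin.sum_univ_three]
  rfl

/-- On the midline the metric is Euclidean and the frame matrix orthogonal, so `F₀` is the identity.
Consequently $A_0$ is orthogonal there, which frees the bounds for the plate form from the geometry.
-/
theorem A₀_midline (he : R.IsDarbouxFrame e) (s : ℝ) : R.A₀ e (s, 0) = R.frameMatrix e (s, 0) := by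
  have ho := frameMatrix_midline_orthogonal he s
  have hi : (R.frameMatrix e (s, 0))⁻¹ = (R.frameMatrix e (s, 0))ᵀ := Matrix.inv_eq_left_inv ho
  have h1 : Matrix.diagonal ![((1 : ℝ) - R.κ s * 0) ^ 2, 1, 1] = 1 := by
    ext i j
    fin_cases i <;> fin_cases j <;> simp
  have hF : R.F₀ e (s, 0) = 1 := by
    rw [F₀, hi]
    dsimp only
    rw [h1, Matrix.mul_one, Matrix.transpose_transpose]
    exact mul_eq_one_comm.1 ho
  rw [A₀, hF, sqrt_one, one_mul]

theorem continuous_cross {X : Type*} [TopologicalSpace X] {u v : X → E3} {s : Set X} (hu : ContinuousOn u s)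
    (hv : ContinuousOn v s) : ContinuousOn (fun x => cross (u x) (v x)) s := by
  have hi : ∀ {u : X → E3}, ContinuousOn u s → ∀ i, ContinuousOn (fun x => u x i) s := fun hu i =>
    (EuclideanSpace.proj (𝕜 := ℝ) (ι := Fin 3) i).continuous.comp_continuousOn hu
  refine (PiLp.continuous_toLp 2 _).comp_continuousOn (continuousOn_pi.2 fun i => ?_)
  have h3 : i = 0 ∨ i = 1 ∨ i = 2 := by omega
  simp only [cross_apply]
  obtain rfl | rfl | rfl := h3
  · exact ((hi hu 1).mul (hi hv 2)).sub ((hi hu 2).mul (hi hv 1))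
  · exact ((hi hu 2).mul (hi hv 0)).sub ((hi hu 0).mul (hi hv 2))
  · exact ((hi hu 0).mul (hi hv 1)).sub ((hi hu 1).mul (hi hv 0))

/-- Near the midline the matrix field `A₀` is continuous and invertible. -/
theorem exists_A₀_regular (L : ℝ) (he : R.IsDarbouxFrame e) :
    ∃ r > 0, (∀ z ∈ Icc 0 L ×ˢ Icc (-r) r, (R.A₀ e z).det ≠ 0) ∧
      ∀ i j, ContinuousOn (fun z => R.A₀ e z i j) (Icc 0 L ×ˢ Icc (-r) r) := by
  set v : Fin 2 → ℝ × ℝ → E3 := fun i z => fderiv ℝ (R.Phi e) z (dir i) with hv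
  have cv : ∀ i, Continuous (v i) := fun i =>
    ((contDiff_Phi he).continuous_fderiv (by norm_num)).clm_apply continuous_const
  have cc : Continuous fun z => cross (v 0 z) (v 1 z) := by
    rw [← continuousOn_univ]
    exact continuous_cross (cv 0).continuousOn (cv 1).continuousOn
  set U₀ : Set (ℝ × ℝ) := {z | cross (v 0 z) (v 1 z) ≠ 0}
  have hU₀ : IsOpen U₀ := isOpen_ne_fun cc continuous_const
  have cN : ∀ i j, ContinuousOn (fun z => R.frameMatrix e z i j) U₀ := fun i j => by
    simp only [frameMatrix_eq he]
    refine (EuclideanSpace.proj (𝕜 := ℝ) (ι := Fin 3) i).continuous.comp_continuousOn ?_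
    have h3 : j = 0 ∨ j = 1 ∨ j = 2 := by omega
    obtain rfl | rfl | rfl := h3
    · exact (cv 0).continuousOn
    · exact (cv 1).continuousOn
    · exact ((cc.norm.continuousOn).inv₀ fun z hz => norm_ne_zero_iff.2 hz).smul cc.continuousOn
  have cκ : Continuous fun z : ℝ × ℝ => 1 - R.κ z.1 * z.2 :=
    continuous_const.sub ((R.smooth_κ.continuous.comp continuous_fst).mul continuous_snd)
  -- Three open conditions: the normal is defined, the frame matrix is invertible, and `F₀` is
  -- positive definite. All hold on the midline, hence on a thin neighbourhood of it.
  set U : Set (ℝ × ℝ) := (U₀ ∩ (fun z => (R.frameMatrix e z).det) ⁻¹' {0}ᶜ) ∩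
    {z | 1 - R.κ z.1 * z.2 ≠ 0}
  have hU : IsOpen U := ((continuousOn_det cN).isOpen_inter_preimage hU₀ isOpen_compl_singleton).inter
    (isOpen_ne_fun cκ continuous_const)
  have hmid : ∀ s ∈ Icc 0 L, (s, (0 : ℝ)) ∈ U := fun s _ => by
    have ho := frameMatrix_midline_orthogonal he s
    refine ⟨⟨?_, fun h => ?_⟩, ?_⟩
    · have h0 : v 0 (s, 0) = e 0 s :=
        (deriv_Phi he (s, 0)).1.symm.trans (deriv_Phi_midline he s).1
      have h1 : v 1 (s, 0) = e 1 s :=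
        (deriv_Phi he (s, 0)).2.symm.trans (deriv_Phi_midline he s).2
      show cross (v 0 (s, 0)) (v 1 (s, 0)) ≠ 0
      rw [h0, h1, he.oriented]
      exact (he.orthonormal s).ne_zero 2
    · have h' : (R.frameMatrix e (s, 0)).det = 0 := h
      have := congrArg Matrix.det ho
      rw [Matrix.det_mul, h', mul_zero, Matrix.det_one] at this
      exact zero_ne_one this
    · show 1 - R.κ s * 0 ≠ 0
      norm_num
  obtain ⟨r, hr, hrU⟩ := exists_thin_subset hU hmid
  have hNu : ∀ z ∈ U, (R.frameMatrix e z).det ≠ 0 := fun z hz => hz.1.2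
  have hNi : ∀ z ∈ U, (R.frameMatrix e z)⁻¹.det ≠ 0 := fun z hz => by
    rw [Matrix.det_nonsing_inv, Ring.inverse_eq_inv']
    exact inv_ne_zero (hNu z hz)
  have cNi := continuousOn_inv (fun i j => (cN i j).mono fun z (hz : z ∈ U) => hz.1.1) hNu
  have cF : ∀ i j, ContinuousOn (fun z => R.F₀ e z i j) U := by
    refine continuousOn_mul (continuousOn_mul (fun i j => cNi j i) fun i j => ?_) cNi
    simp only [Matrix.diagonal_apply]
    split_ifs
    · have h3 : i = 0 ∨ i = 1 ∨ i = 2 := by omega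
      obtain rfl | rfl | rfl := h3
      · exact (cκ.pow 2).continuousOn
      · exact continuousOn_const
      · exact continuousOn_const
    · exact continuousOn_const
  have pF : ∀ z ∈ U, (R.F₀ e z).PosSemidef := fun z _ => by
    have : (Matrix.diagonal ![(1 - R.κ z.1 * z.2) ^ 2, 1, 1]).PosSemidef := by
      have h3 : ∀ i : Fin 3, i = 0 ∨ i = 1 ∨ i = 2 := by omega
      refine Matrix.PosSemidef.diagonal fun i => ?_
      obtain rfl | rfl | rfl := h3 i
      · exact sq_nonneg _
      · exact zero_le_one
      · exact zero_le_one
    exact this.conjTranspose_mul_mul_same (R.frameMatrix e z)⁻¹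
  have dF : ∀ z ∈ U, (R.F₀ e z).det ≠ 0 := fun z hz => by
    rw [F₀, Matrix.det_mul, Matrix.det_mul, Matrix.det_transpose, Matrix.det_diagonal,
      Fin.prod_univ_three]
    refine mul_ne_zero (mul_ne_zero (hNi z hz) ?_) (hNi z hz)
    simpa using hz.2
  refine ⟨r, hr, fun z hz => ?_, fun i j => ?_⟩
  · rw [A₀, Matrix.det_mul]
    exact mul_ne_zero (det_sqrt_ne_zero (pF z (hrU hz)) (dF z (hrU hz))) (hNu z (hrU hz))
  · exact (continuousOn_mul (continuousOn_sqrt cF pF dF)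
      (fun i j => (cN i j).mono fun z (hz : z ∈ U) => hz.1.1) i j).mono hrU

end FlatGeometry

end Ribbon

/-! ### The plate form and its expansion near the midline -/

namespace Ribbon

/-- A continuous field of quadratic forms on `2 × 2` matrices near the midline, uniformly coercive
on symmetric matrices along the midline. -/
structure IsPlateForm (L r c C : ℝ) (b : ℝ × ℝ → Mat2 →ₗ[ℝ] Mat2 →ₗ[ℝ] ℝ) : Prop where
  radius_pos : 0 < r
  pos : 0 < c
  pos' : 0 < C
  symm : ∀ z F H, b z F H = b z H F
  nonneg : ∀ z ∈ Icc 0 L ×ˢ Icc (-r) r, ∀ F, 0 ≤ b z F F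
  continuousOn : ∀ F H, ContinuousOn (fun z => b z F H) (Icc 0 L ×ˢ Icc (-r) r)
  lower : ∀ s, ∀ F : Mat2, F.IsSymm → c * ‖F‖ ^ 2 ≤ b (s, 0) F F
  upper : ∀ s F, b (s, 0) F F ≤ C * ‖F‖ ^ 2

/-- The constants are chosen before the geometry: they come from the Hessian of `W` and are
unaffected by the orthogonal matrix $A_0$ on the midline. Only the radius `r` depends on the ribbon.
-/
theorem exists_isPlateForm {W : Mat3 → ℝ≥0∞} (hW : IsEnergyDensity W) : ∃ c C : ℝ, 0 < c ∧ 0 < C ∧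
    ∀ (L : ℝ), 0 < L → ∀ (R : FlatGeometry) (e : Fin 3 → ℝ → E3), R.IsDarbouxFrame e →
      ∃ r b, IsPlateForm L r c C b ∧ ∀ w x F, (x.1, w * x.2) ∈ Icc 0 L ×ˢ Icc (-r) r →
        R.Qw W e w x F = b (x.1, w * x.2) F F := by
  obtain ⟨β, c, C, hβ, hQ⟩ := hW.exists_isElasticForm
  refine ⟨2 * c, C / 2, by linarith [hβ.pos], by linarith [hβ.pos'], fun L hL R e he => ?_⟩
  obtain ⟨r, hr, hdet, hcont⟩ := FlatGeometry.exists_A₀_regular L he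
  have hdi : ∀ z ∈ Icc 0 L ×ˢ Icc (-r) r, (R.A₀ e z)⁻¹.det ≠ 0 := fun z hz => by
    rw [Matrix.det_nonsing_inv, Ring.inverse_eq_inv']
    exact inv_ne_zero (hdet z hz)
  have horth : ∀ s, ((R.A₀ e (s, 0))⁻¹)ᵀ * (R.A₀ e (s, 0))⁻¹ = 1 := fun s => by
    have ho := FlatGeometry.frameMatrix_midline_orthogonal he s
    rw [FlatGeometry.A₀_midline he, Matrix.inv_eq_left_inv ho, Matrix.transpose_transpose]
    exact mul_eq_one_comm.1 ho
  refine ⟨r, fun z => (1 / 2 : ℝ) • relaxed β (R.A₀ e z)⁻¹, ⟨hr, by linarith [hβ.pos],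
    by linarith [hβ.pos'], fun z F H => ?_, fun z hz F => ?_, fun F H => ?_, fun s F hF => ?_,
    fun s F => ?_⟩, fun w x F hx => ?_⟩
  · simp only [LinearMap.smul_apply, hβ.relaxed_symm _ F H]
  · have := hβ.relaxed_nonneg (hdi z hz) F
    simp only [LinearMap.smul_apply, smul_eq_mul]
    linarith
  · exact (hβ.continuousOn_relaxed (continuousOn_inv hcont hdet) hdi F H).const_smul (1 / 2 : ℝ)
  · have := hβ.relaxed_lower (horth s) hF
    simp only [LinearMap.smul_apply, smul_eq_mul]
    linarith
  · have := hβ.relaxed_upper (horth s) F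
    simp only [LinearMap.smul_apply, smul_eq_mul]
    linarith
  · have h := hβ.isLeast_relaxed (hdi _ hx) F
    have h2 : IsLeast (range fun G : {G : Mat3 // ∀ i j : Fin 2, G i.castSucc j.castSucc = F i j} =>
        Q3 W (((R.A₀ e (x.1, w * x.2))⁻¹)ᵀ * G.1 * (R.A₀ e (x.1, w * x.2))⁻¹))
        (1 / 2 * relaxed β (R.A₀ e (x.1, w * x.2))⁻¹ F F) := by
      constructor
      · obtain ⟨G, hG, hGe⟩ := h.1
        exact ⟨⟨G, hG⟩, (hQ _).trans (by rw [hGe]; rfl)⟩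
      · rintro _ ⟨⟨G, hG⟩, rfl⟩
        have := h.2 ⟨G, hG, rfl⟩
        refine le_trans ?_ (hQ _).ge
        exact mul_le_mul_of_nonneg_left this (by norm_num)
    -- The minimum is attained, so the real infimum in `Qw` is a genuine one and not a default
    -- value.
    exact h2.csInf_eq

/-- The factor 16 counts the pairs of matrix units. -/
theorem abs_bilinear_le {b : Mat2 →ₗ[ℝ] Mat2 →ₗ[ℝ] ℝ} {ε : ℝ}
    (h : ∀ i j k l, |b (Matrix.single i j 1) (Matrix.single k l 1)| ≤ ε) (F H : Mat2) :
    |b F H| ≤ 16 * ε * (‖F‖ * ‖H‖) := by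
  have key : ∀ i j k l, |F i j * (H k l * b (Matrix.single i j 1) (Matrix.single k l 1))|
      ≤ ε * (‖F‖ * ‖H‖) := fun i j k l => by
    rw [← mul_assoc, abs_mul, abs_mul, mul_comm]
    exact mul_le_mul (h i j k l) (mul_le_mul (abs_entry_le_norm F i j) (abs_entry_le_norm H k l)
      (abs_nonneg _) (norm_nonneg _)) (by positivity) ((abs_nonneg _).trans (h 0 0 0 0))
  rw [bilinear_eq_sum_two]
  refine (Finset.abs_sum_le_sum_abs _ _).trans ((Finset.sum_le_sum fun i _ =>
    (Finset.abs_sum_le_sum_abs _ _).trans (Finset.sum_le_sum fun j _ =>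
      (Finset.abs_sum_le_sum_abs _ _).trans (Finset.sum_le_sum fun k _ =>
        (Finset.abs_sum_le_sum_abs _ _).trans (Finset.sum_le_sum fun l _ => key i j k l)))).trans ?_)
  simp only [Finset.sum_const, Finset.card_univ, Fintype.card_fin, nsmul_eq_mul]
  push_cast
  linarith

theorem norm_le_of_abs_entry_le {F : Mat2} {t : ℝ} (h : ∀ i j, |F i j| ≤ t) : ‖F‖ ≤ 2 * t := by
  have ht : 0 ≤ t := (abs_nonneg _).trans (h 0 0)
  refine abs_le_of_sq_le_sq' ?_ (by linarith) |>.2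
  rw [norm_sq_eq_sum]
  have : ∀ i j, F i j ^ 2 ≤ t ^ 2 := fun i j => sq_le_sq' (abs_le.1 (h i j)).1 (abs_le.1 (h i j)).2
  simp only [Fin.sum_univ_two]
  nlinarith [this 0 0, this 0 1, this 1 0, this 1 1]

theorem eventually_abs_sub_midline_le {L r : ℝ} (hr : 0 < r) {k : ℝ × ℝ → ℝ}
    (hk : ContinuousOn k (Icc 0 L ×ˢ Icc (-r) r)) {ε : ℝ} (hε : 0 < ε) :
    ∀ᶠ w in 𝓝[>] (0 : ℝ), ∀ x ∈ strip L, |k (x.1, w * x.2) - k (x.1, 0)| ≤ ε := by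
  have huc := (isCompact_Icc.prod isCompact_Icc).uniformContinuousOn_of_continuous hk
  obtain ⟨δ, hδ, hδ'⟩ := Metric.uniformContinuousOn_iff.1 huc ε hε
  filter_upwards [Ioo_mem_nhdsGT (lt_min hr hδ)] with w hw x hx
  have hwr : w < r := hw.2.trans_le (min_le_left _ _)
  have hwδ : w < δ := hw.2.trans_le (min_le_right _ _)
  have hb : |w * x.2| ≤ w := by
    rw [abs_mul, abs_of_pos hw.1]
    have := abs_lt.2 hx.2
    nlinarith [hw.1]
  have h0 : x.1 ∈ Icc 0 L := Ioo_subset_Icc_self hx.1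
  have := hδ' (x.1, w * x.2) ⟨h0, abs_le.1 (hb.trans hwr.le)⟩ (x.1, 0)
    ⟨h0, by linarith, hr.le⟩ (by
      rw [Prod.dist_eq, dist_self, Real.dist_eq, sub_zero]
      exact max_lt hδ (hb.trans_lt hwδ))
  exact (Real.dist_eq _ _ ▸ this).le

theorem eventually_mem_box {L r : ℝ} (hr : 0 < r) :
    ∀ᶠ w in 𝓝[>] (0 : ℝ), ∀ x ∈ Icc 0 L ×ˢ Icc (-(1 / 2) : ℝ) (1 / 2),
      (x.1, w * x.2) ∈ Icc 0 L ×ˢ Icc (-r) r := by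
  filter_upwards [Ioo_mem_nhdsGT hr] with w hw x hx
  refine ⟨hx.1, ?_⟩
  obtain ⟨h1, h2⟩ := hx.2
  constructor <;> dsimp only <;> nlinarith [hw.1, hw.2]

namespace FlatGeometry

variable {R : FlatGeometry}

theorem fderiv_II_midline (R : FlatGeometry) (s : ℝ) (i j : Fin 2) :
    fderiv ℝ (fun z => R.II z i j) (s, 0) (dir 1) = R.II1 s i j := by
  have h := ((R.smooth_II i j).differentiable (by norm_num) (s, 0)).hasFDerivAt
  exact ((h.comp_hasDerivAt (f := fun r => (s, r)) (0 : ℝ)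
      ((hasDerivAt_const _ _).prodMk (hasDerivAt_id _))).deriv).symm

/-- `II_f - II⁰ - w x₂ ∂₂II`, divided by `w`. -/
noncomputable def strain (R : FlatGeometry) (w : ℝ) (A : ℝ × ℝ → Mat2) (x : ℝ × ℝ) : Mat2 :=
  R.quot w A x - x.2 • R.II1 x.1

/-- The energy density differs little from the limit density along the midline. -/
theorem eventually_density_expansion {L r c C : ℝ} {b : ℝ × ℝ → Mat2 →ₗ[ℝ] Mat2 →ₗ[ℝ] ℝ}
    (hb : IsPlateForm L r c C b) {η : ℝ} (hη : 0 < η) :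
    ∀ᶠ w in 𝓝[>] (0 : ℝ), ∀ (A : ℝ × ℝ → Mat2), ∀ x ∈ strip L,
      |(w ^ 2)⁻¹ * b (x.1, w * x.2) (A x - R.II (x.1, w * x.2)) (A x - R.II (x.1, w * x.2))
        - b (x.1, 0) (R.strain w A x) (R.strain w A x)| ≤ η * (‖R.strain w A x‖ ^ 2 + 1) := by
  have hM : ∃ M : ℝ, 0 < M ∧ ∀ s ∈ Icc 0 L, ∀ i j k l,
      |b (s, 0) (Matrix.single i j 1) (Matrix.single k l 1)| ≤ M := by
    have h0 : ∀ s ∈ Icc 0 L, (s, (0 : ℝ)) ∈ Icc 0 L ×ˢ Icc (-r) r := fun s hs =>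
      ⟨hs, by linarith [hb.radius_pos], hb.radius_pos.le⟩
    choose N hN using fun i j k l => (isCompact_Icc.prod isCompact_Icc).exists_bound_of_continuousOn
      (hb.continuousOn (Matrix.single i j 1) (Matrix.single k l 1))
    refine ⟨(∑ i, ∑ j, ∑ k, ∑ l, |N i j k l|) + 1, by positivity, fun s hs i j k l => ?_⟩
    have h1 := (hN i j k l (s, 0) (h0 s hs)).trans (le_abs_self _)
    have h2 : |N i j k l| ≤ ∑ i, ∑ j, ∑ k, ∑ l, |N i j k l| :=
      (Finset.single_le_sum (f := fun l => |N i j k l|) (fun _ _ => abs_nonneg _) (Finset.mem_univ l)).trans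
      ((Finset.single_le_sum (f := fun k => ∑ l, |N i j k l|) (fun _ _ => by positivity)
        (Finset.mem_univ k)).trans
      ((Finset.single_le_sum (f := fun j => ∑ k, ∑ l, |N i j k l|) (fun _ _ => by positivity)
        (Finset.mem_univ j)).trans
      (Finset.single_le_sum (f := fun i => ∑ j, ∑ k, ∑ l, |N i j k l|) (fun _ _ => by positivity)
        (Finset.mem_univ i))))
    rw [Real.norm_eq_abs] at h1
    linarith
  obtain ⟨M, hM0, hM⟩ := hM
  -- Half of `η` pays for the variation of the form between $(x_1, wx_2)$ and the midline, the other
  -- half for the two terms containing the error `ρ` of size `δ`, which together cost $32M\delta$.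
  set δ : ℝ := min 1 (η / (64 * M)) with hδ
  have hδ0 : 0 < δ := lt_min one_pos (by positivity)
  have hδ1 : δ ≤ 1 := min_le_left _ _
  have hδM : 32 * M * δ ≤ η / 2 := by
    have : δ ≤ η / (64 * M) := min_le_right _ _
    rw [le_div_iff₀ (by positivity)] at this
    linarith
  have e1 : ∀ᶠ w in 𝓝[>] (0 : ℝ), ∀ i j k l, ∀ x ∈ strip L,
      |b (x.1, w * x.2) (Matrix.single i j 1) (Matrix.single k l 1)
        - b (x.1, 0) (Matrix.single i j 1) (Matrix.single k l 1)| ≤ η / 64 := by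
    simp only [eventually_all]
    exact fun i j k l => eventually_abs_sub_midline_le hb.radius_pos (hb.continuousOn _ _) (by positivity)
  have e2 : ∀ᶠ w in 𝓝[>] (0 : ℝ), ∀ i j, ∀ x ∈ strip L,
      |w⁻¹ * (R.II (x.1, w * x.2) i j - R.II (x.1, 0) i j)
        - x.2 * fderiv ℝ (fun z => R.II z i j) (x.1, 0) (dir 1)| ≤ δ / 2 := by
    simp only [eventually_all]
    exact fun i j => eventually_expansion (U := univ) isOpen_univ (fun s _ => mem_univ _)
      (R.smooth_II i j).contDiffOn (by positivity)
  have hpos : ∀ᶠ w in 𝓝[>] (0 : ℝ), (0 : ℝ) < w := self_mem_nhdsWithin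
  filter_upwards [e1, e2, hpos] with w h1 h2 hw A x hx
  set V := R.strain w A x with hV
  -- The Taylor remainder of $\mathrm{II}$ in the transversal variable, independent of `A`; hence
  -- the estimate is uniform over all fields.
  set ρ : Mat2 := x.2 • R.II1 x.1 - w⁻¹ • (R.II (x.1, w * x.2) - R.II0 x.1) with hρ
  have hρδ : ‖ρ‖ ≤ δ := by
    have : ‖ρ‖ ≤ 2 * (δ / 2) := norm_le_of_abs_entry_le fun i j => by
      have := h2 i j x hx
      rw [fderiv_II_midline, abs_sub_comm] at this
      exact this
    linarith
  have hY : A x - R.II (x.1, w * x.2) = w • (V + ρ) := by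
    have : V + ρ = w⁻¹ • (A x - R.II (x.1, w * x.2)) := by
      simp only [hV, hρ, strain, quot, smul_sub]
      abel
    rw [this, smul_smul, mul_inv_cancel₀ hw.ne', one_smul]
  have hYb : ∀ B : Mat2 →ₗ[ℝ] Mat2 →ₗ[ℝ] ℝ, (w ^ 2)⁻¹ * B (w • (V + ρ)) (w • (V + ρ))
      = B (V + ρ) (V + ρ) := fun B => by
    simp only [map_smul, LinearMap.smul_apply, smul_eq_mul]
    field_simp
  have hs : x.1 ∈ Icc 0 L := Ioo_subset_Icc_self hx.1
  have p1 : |(b (x.1, w * x.2) - b (x.1, 0)) (V + ρ) (V + ρ)| ≤ 16 * (η / 64) * (‖V + ρ‖ * ‖V + ρ‖) :=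
    abs_bilinear_le (fun i j k l => h1 i j k l x hx) _ _
  have p2 := abs_bilinear_le (hM x.1 hs) V ρ
  have p3 := abs_bilinear_le (hM x.1 hs) ρ ρ
  have q : b (x.1, 0) (V + ρ) (V + ρ)
      = b (x.1, 0) V V + 2 * b (x.1, 0) V ρ + b (x.1, 0) ρ ρ := by
    simp only [map_add, LinearMap.add_apply, hb.symm _ ρ V]
    ring
  rw [hY, hYb]
  have hV0 := norm_nonneg V
  have hρ0 := norm_nonneg ρ
  have n1 : ‖V + ρ‖ * ‖V + ρ‖ ≤ 2 * (‖V‖ ^ 2 + 1) := by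
    have h3 : ‖V + ρ‖ ≤ ‖V‖ + 1 := (norm_add_le _ _).trans (by linarith)
    nlinarith [norm_nonneg (V + ρ), sq_nonneg (‖V‖ - 1)]
  have n2 : ‖V‖ * ‖ρ‖ ≤ δ * ((‖V‖ ^ 2 + 1) / 2) := by
    have h3 : ‖V‖ * ‖ρ‖ ≤ ‖V‖ * δ := mul_le_mul_of_nonneg_left hρδ hV0
    nlinarith [sq_nonneg (‖V‖ - 1)]
  have n3 : ‖ρ‖ * ‖ρ‖ ≤ δ * (‖V‖ ^ 2 + 1) := by
    have h3 : ‖ρ‖ * ‖ρ‖ ≤ δ * 1 := mul_le_mul hρδ (hρδ.trans hδ1) hρ0 hδ0.le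
    nlinarith [sq_nonneg ‖V‖]
  have e3 : b (x.1, w * x.2) (V + ρ) (V + ρ) - b (x.1, 0) V V
      = (b (x.1, w * x.2) - b (x.1, 0)) (V + ρ) (V + ρ) + 2 * b (x.1, 0) V ρ + b (x.1, 0) ρ ρ := by
    simp only [LinearMap.sub_apply]
    rw [q]
    ring
  rw [e3]
  have t1 := abs_add_le ((b (x.1, w * x.2) - b (x.1, 0)) (V + ρ) (V + ρ) + 2 * b (x.1, 0) V ρ)
    (b (x.1, 0) ρ ρ)
  have t2 := abs_add_le ((b (x.1, w * x.2) - b (x.1, 0)) (V + ρ) (V + ρ)) (2 * b (x.1, 0) V ρ)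
  have t3 : |2 * b (x.1, 0) V ρ| = 2 * |b (x.1, 0) V ρ| := by rw [abs_mul, abs_two]
  have s1 : 16 * (η / 64) * (‖V + ρ‖ * ‖V + ρ‖) ≤ 16 * (η / 64) * (2 * (‖V‖ ^ 2 + 1)) :=
    mul_le_mul_of_nonneg_left n1 (by positivity)
  have s2 : 16 * M * (‖V‖ * ‖ρ‖) ≤ 16 * M * (δ * ((‖V‖ ^ 2 + 1) / 2)) :=
    mul_le_mul_of_nonneg_left n2 (by positivity)
  have s3 : 16 * M * (‖ρ‖ * ‖ρ‖) ≤ 16 * M * (δ * (‖V‖ ^ 2 + 1)) :=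
    mul_le_mul_of_nonneg_left n3 (by positivity)
  have s4 : 32 * M * δ * (‖V‖ ^ 2 + 1) ≤ η / 2 * (‖V‖ ^ 2 + 1) :=
    mul_le_mul_of_nonneg_right hδM (by positivity)
  linarith

end FlatGeometry

end Ribbon

/-! ### Splitting of the rescaled energy -/

namespace Ribbon

theorem integrable_continuousOn_mul {L : ℝ} {k u : ℝ × ℝ → ℝ}
    (hk : ContinuousOn k (Icc 0 L ×ˢ Icc (-(1 / 2)) (1 / 2))) (hu : IntegrableOn u (strip L)) :
    IntegrableOn (fun x => k x * u x) (strip L) := by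
  have hsub : strip L ⊆ Icc 0 L ×ˢ Icc (-(1 / 2)) (1 / 2) :=
    prod_mono Ioo_subset_Icc_self Ioo_subset_Icc_self
  obtain ⟨C, hC⟩ := (isCompact_Icc.prod isCompact_Icc).exists_bound_of_continuousOn hk
  exact Integrable.bdd_mul hu ((hk.mono hsub).aestronglyMeasurable (measurableSet_strip L))
    ((ae_restrict_mem (measurableSet_strip L)).mono fun x hx => hC x (hsub hx))

theorem integrable_bilinear {L : ℝ} {b : ℝ × ℝ → Mat2 →ₗ[ℝ] Mat2 →ₗ[ℝ] ℝ}
    (hb : ∀ F H, ContinuousOn (fun x => b x F H) (Icc 0 L ×ˢ Icc (-(1 / 2)) (1 / 2)))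
    {u v : ℝ × ℝ → Mat2} (hu : ∀ i j, MemLp (fun x => u x i j) 2 (volume.restrict (strip L)))
    (hv : ∀ i j, MemLp (fun x => v x i j) 2 (volume.restrict (strip L))) :
    IntegrableOn (fun x => b x (u x) (v x)) (strip L) := by
  have h : ∀ x, b x (u x) (v x) = ∑ i, ∑ j, ∑ k, ∑ l, b x (Matrix.single i j 1) (Matrix.single k l 1)
      * (u x i j * v x k l) := fun x => by
    rw [bilinear_eq_sum_two]
    refine Finset.sum_congr rfl fun i _ => Finset.sum_congr rfl fun j _ =>
      Finset.sum_congr rfl fun k _ => Finset.sum_congr rfl fun l _ => by ring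
  simp only [h]
  exact integrable_finsetSum _ fun i _ => integrable_finsetSum _ fun j _ =>
    integrable_finsetSum _ fun k _ => integrable_finsetSum _ fun l _ =>
      integrable_continuousOn_mul (hb _ _) (integrable_mul_of_memLp_two (hu i j) (hv k l))

theorem integrable_norm_sq {L : ℝ} {u : ℝ × ℝ → Mat2}
    (hu : ∀ i j, MemLp (fun x => u x i j) 2 (volume.restrict (strip L))) :
    IntegrableOn (fun x => ‖u x‖ ^ 2) (strip L) := by
  simp only [norm_sq_eq_sum]
  exact integrable_finsetSum _ fun i _ => integrable_finsetSum _ fun j _ =>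
    integrable_sq_of_memLp_two (hu i j)

theorem volume_real_strip {L : ℝ} (hL : 0 < L) : volume.real (strip L) = L := by
  rw [strip, Measure.volume_eq_prod, measureReal_prod_prod, Real.volume_real_Ioo_of_le hL.le,
    Real.volume_real_Ioo_of_le (by norm_num)]
  ring

namespace FlatGeometry

variable {R : FlatGeometry}

/-- `II_f - II⁰ - w x₂ Θ`, divided by `w`, with the limit slope `Θ` of the second form. -/
noncomputable def oscillation (R : FlatGeometry) (w : ℝ) (A : ℝ × ℝ → Mat2) (x : ℝ × ℝ) : Mat2 :=
  R.quot w A x - x.2 • R.slope x.1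

/-- The difference between the limit slope and the slope of the reference second form. -/
noncomputable def gap (R : FlatGeometry) (s : ℝ) : Mat2 := R.slope s - R.II1 s

theorem strain_eq (R : FlatGeometry) (w : ℝ) (A : ℝ × ℝ → Mat2) (x : ℝ × ℝ) :
    R.strain w A x = R.oscillation w A x + x.2 • R.gap x.1 := by
  simp only [strain, oscillation, gap, smul_sub]
  abel

theorem continuous_II1 (R : FlatGeometry) (i j : Fin 2) : Continuous fun s => R.II1 s i j := by
  have h : (fun s => R.II1 s i j) = fun s => fderiv ℝ (fun z => R.II z i j) (s, 0) (dir 1) :=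
    funext fun s => (R.fderiv_II_midline s i j).symm
  rw [h]
  exact (((R.smooth_II i j).continuous_fderiv (by norm_num)).clm_apply continuous_const).comp
    (continuous_id.prodMk continuous_const)

theorem continuousOn_gap {L : ℝ} (hl : ∀ s ∈ Icc 0 L, R.l₀ s ≠ 0) (i j : Fin 2) :
    ContinuousOn (fun s => R.gap s i j) (Icc 0 L) :=
  (continuousOn_slope hl i j).sub (R.continuous_II1 i j).continuousOn

theorem II1_one_zero (R : FlatGeometry) (s : ℝ) : R.II1 s 1 0 = R.II1 s 0 1 := by
  have : (fun r => R.II (s, r) 1 0) = fun r => R.II (s, r) 0 1 :=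
    funext fun r => (R.symm_II (s, r)).apply 0 1
  show deriv (fun r => R.II (s, r) 1 0) 0 = deriv (fun r => R.II (s, r) 0 1) 0
  rw [this]

theorem isSymm_of_eq {F : Mat2} (h : F 1 0 = F 0 1) : F.IsSymm :=
  Matrix.IsSymm.ext fun i j => by
    obtain rfl | rfl : i = 0 ∨ i = 1 := by omega
    all_goals obtain rfl | rfl : j = 0 ∨ j = 1 := by omega
    exacts [rfl, h, h.symm, rfl]

theorem isSymm_slope (R : FlatGeometry) (s : ℝ) : (R.slope s).IsSymm := isSymm_of_eq rfl

theorem isSymm_II1 (R : FlatGeometry) (s : ℝ) : (R.II1 s).IsSymm := isSymm_of_eq (R.II1_one_zero s)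

theorem isSymm_gap (R : FlatGeometry) (s : ℝ) : (R.gap s).IsSymm := (R.isSymm_slope s).sub (R.isSymm_II1 s)

section

variable {L w : ℝ} {A : ℝ × ℝ → Mat2}

theorem isSymm_quot (hA : R.IsGaussCodazzi L w A) :
    ∀ᵐ x ∂(volume.restrict (strip L)), (R.quot w A x).IsSymm := by
  filter_upwards [hA.symm] with x hx
  exact ((isSymm_of_eq hx).sub (R.symm_II (x.1, 0))).smul _

theorem isSymm_strain (hA : R.IsGaussCodazzi L w A) :
    ∀ᵐ x ∂(volume.restrict (strip L)), (R.strain w A x).IsSymm := by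
  filter_upwards [isSymm_quot hA] with x hx
  exact hx.sub ((R.isSymm_II1 x.1).smul _)

theorem isSymm_oscillation (hA : R.IsGaussCodazzi L w A) :
    ∀ᵐ x ∂(volume.restrict (strip L)), (R.oscillation w A x).IsSymm := by
  filter_upwards [isSymm_quot hA] with x hx
  exact hx.sub ((R.isSymm_slope x.1).smul _)

theorem memLp_snd_mul {k : ℝ → ℝ} (hk : ContinuousOn k (Icc 0 L)) :
    MemLp (fun x : ℝ × ℝ => x.2 * k x.1) 2 (volume.restrict (strip L)) :=
  continuousOn_memLp_strip (continuous_snd.continuousOn.mul (continuousOn_comp_fst hk))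

theorem memLp_strain (hA : R.IsGaussCodazzi L w A) (i j : Fin 2) :
    MemLp (fun x => R.strain w A x i j) 2 (volume.restrict (strip L)) :=
  (R.memLp_quot hA i j).sub (memLp_snd_mul (R.continuous_II1 i j).continuousOn)

theorem memLp_oscillation (hl : ∀ s ∈ Icc 0 L, R.l₀ s ≠ 0) (hA : R.IsGaussCodazzi L w A) (i j : Fin 2) :
    MemLp (fun x => R.oscillation w A x i j) 2 (volume.restrict (strip L)) :=
  (R.memLp_quot hA i j).sub (memLp_snd_mul (continuousOn_slope hl i j))

theorem memLp_sub_II (hA : R.IsGaussCodazzi L w A) (i j : Fin 2) :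
    MemLp (fun x => (A x - R.II (x.1, w * x.2)) i j) 2 (volume.restrict (strip L)) :=
  (hA.memLp i j).sub (continuousOn_memLp_strip (((R.smooth_II i j).continuous.comp
    (continuous_fst.prodMk (continuous_const.mul continuous_snd))).continuousOn))

end

/-- The rescaled energy of a second form. -/
noncomputable def formEnergy (R : FlatGeometry) (b : ℝ × ℝ → Mat2 →ₗ[ℝ] Mat2 →ₗ[ℝ] ℝ) (L w : ℝ)
    (A : ℝ × ℝ → Mat2) : ℝ :=
  ∫ x in strip L, (w ^ 2)⁻¹ * b (x.1, w * x.2) (A x - R.II (x.1, w * x.2)) (A x - R.II (x.1, w * x.2))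

section

variable {L r c C : ℝ} {b : ℝ × ℝ → Mat2 →ₗ[ℝ] Mat2 →ₗ[ℝ] ℝ}

theorem continuousOn_form_midline (hb : IsPlateForm L r c C b) (F H : Mat2) :
    ContinuousOn (fun s => b (s, 0) F H) (Icc 0 L) :=
  (hb.continuousOn F H).comp (continuous_id.prodMk continuous_const).continuousOn fun _ hs =>
    ⟨hs, by linarith [hb.radius_pos], hb.radius_pos.le⟩

theorem integrable_midline (hb : IsPlateForm L r c C b)
    {u v : ℝ × ℝ → Mat2} (hu : ∀ i j, MemLp (fun x => u x i j) 2 (volume.restrict (strip L)))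
    (hv : ∀ i j, MemLp (fun x => v x i j) 2 (volume.restrict (strip L))) :
    IntegrableOn (fun x => b (x.1, 0) (u x) (v x)) (strip L) :=
  integrable_bilinear (b := fun x => b (x.1, 0))
    (fun F H => continuousOn_comp_fst (continuousOn_form_midline hb F H)) hu hv

theorem eventually_integrable_form (hb : IsPlateForm L r c C b) :
    ∀ᶠ w in 𝓝[>] (0 : ℝ), ∀ A, R.IsGaussCodazzi L w A → IntegrableOn (fun x =>
      b (x.1, w * x.2) (A x - R.II (x.1, w * x.2)) (A x - R.II (x.1, w * x.2))) (strip L) := by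
  filter_upwards [eventually_mem_box (L := L) hb.radius_pos] with w hw A hA
  exact integrable_bilinear (b := fun x => b (x.1, w * x.2)) (fun F H =>
    (hb.continuousOn F H).comp (continuous_fst.prodMk (continuous_const.mul continuous_snd)).continuousOn hw)
    (memLp_sub_II hA) (memLp_sub_II hA)

theorem eventually_formEnergy_sub_le (hL : 0 < L) (hb : IsPlateForm L r c C b) {η : ℝ} (hη : 0 < η) :
    ∀ᶠ w in 𝓝[>] (0 : ℝ), ∀ A, R.IsGaussCodazzi L w A →
      |R.formEnergy b L w A - ∫ x in strip L, b (x.1, 0) (R.strain w A x) (R.strain w A x)|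
        ≤ η * ((∫ x in strip L, ‖R.strain w A x‖ ^ 2) + L) := by
  filter_upwards [eventually_density_expansion hb hη, eventually_integrable_form hb] with w h1 h2 A hA
  have i1 := (h2 A hA).const_mul (w ^ 2)⁻¹
  have i2 := integrable_midline hb (memLp_strain hA) (memLp_strain hA)
  have i3 := integrable_norm_sq (memLp_strain hA)
  have i4 : Integrable (fun x => η * (‖R.strain w A x‖ ^ 2 + 1)) (volume.restrict (strip L)) :=
    (i3.add (integrable_const 1)).const_mul η
  have e : ∫ x in strip L, η * (‖R.strain w A x‖ ^ 2 + 1)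
      = η * ((∫ x in strip L, ‖R.strain w A x‖ ^ 2) + L) := by
    rw [integral_const_mul, integral_add i3 (integrable_const 1), integral_const,
      measureReal_restrict_apply_univ, volume_real_strip hL, smul_eq_mul, mul_one]
  rw [formEnergy, ← integral_sub i1 i2, ← e]
  refine (abs_integral_le_integral_abs).trans (integral_mono_ae (i1.sub i2).abs i4 ?_)
  exact (ae_restrict_mem (measurableSet_strip L)).mono fun x hx => h1 A x hx

theorem integral_midline_lower (hb : IsPlateForm L r c C b) {u : ℝ × ℝ → Mat2}
    (hu : ∀ i j, MemLp (fun x => u x i j) 2 (volume.restrict (strip L)))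
    (hs : ∀ᵐ x ∂(volume.restrict (strip L)), (u x).IsSymm) :
    c * (∫ x in strip L, ‖u x‖ ^ 2) ≤ ∫ x in strip L, b (x.1, 0) (u x) (u x) := by
  rw [← integral_const_mul]
  exact integral_mono_ae ((integrable_norm_sq hu).const_mul c) (integrable_midline hb hu hu)
    (hs.mono fun x hx => hb.lower x.1 _ hx)

theorem integral_midline_upper (hb : IsPlateForm L r c C b) {u : ℝ × ℝ → Mat2}
    (hu : ∀ i j, MemLp (fun x => u x i j) 2 (volume.restrict (strip L))) :
    ∫ x in strip L, b (x.1, 0) (u x) (u x) ≤ C * ∫ x in strip L, ‖u x‖ ^ 2 := by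
  rw [← integral_const_mul]
  exact integral_mono (integrable_midline hb hu hu) ((integrable_norm_sq hu).const_mul C)
    fun x => hb.upper x.1 _

/-- The form is coercive on symmetric matrices only along the midline. The expansion with error `c /
2` absorbs half of that coercivity. -/
theorem eventually_coercive (hL : 0 < L) (hb : IsPlateForm L r c C b) :
    ∀ᶠ w in 𝓝[>] (0 : ℝ), ∀ A, R.IsGaussCodazzi L w A →
      c / 2 * (∫ x in strip L, ‖R.strain w A x‖ ^ 2) ≤ R.formEnergy b L w A + c / 2 * L := by
  filter_upwards [eventually_formEnergy_sub_le hL hb (half_pos hb.pos)] with w h A hA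
  have h1 := integral_midline_lower hb (memLp_strain hA) (isSymm_strain hA)
  have h2 := (abs_le.1 (h A hA)).1
  linarith

theorem integral_entry_sq_le {u : ℝ × ℝ → Mat2}
    (hu : ∀ i j, MemLp (fun x => u x i j) 2 (volume.restrict (strip L))) (i j : Fin 2) :
    ∫ x in strip L, u x i j ^ 2 ≤ ∫ x in strip L, ‖u x‖ ^ 2 :=
  integral_mono (integrable_sq_of_memLp_two (hu i j)) (integrable_norm_sq hu) fun x => by
    rw [← sq_abs]
    exact pow_le_pow_left₀ (abs_nonneg _) (abs_entry_le_norm _ i j) 2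

theorem integral_norm_add_sq_le {u v : ℝ × ℝ → Mat2}
    (hu : ∀ i j, MemLp (fun x => u x i j) 2 (volume.restrict (strip L)))
    (hv : ∀ i j, MemLp (fun x => v x i j) 2 (volume.restrict (strip L))) :
    ∫ x in strip L, ‖u x + v x‖ ^ 2
      ≤ 2 * (∫ x in strip L, ‖u x‖ ^ 2) + 2 * ∫ x in strip L, ‖v x‖ ^ 2 := by
  have i1 := integrable_norm_sq hu
  have i2 := integrable_norm_sq hv
  rw [← integral_const_mul, ← integral_const_mul,
    ← integral_add (i1.const_mul 2) (i2.const_mul 2)]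
  refine integral_mono (integrable_norm_sq (u := fun x => u x + v x) fun i j => (hu i j).add (hv i j))
    ((i1.const_mul 2).add (i2.const_mul 2)) fun x => ?_
  have := norm_add_le (u x) (v x)
  show ‖u x + v x‖ ^ 2 ≤ 2 * ‖u x‖ ^ 2 + 2 * ‖v x‖ ^ 2
  nlinarith [sq_nonneg (‖u x‖ - ‖v x‖), norm_nonneg (u x + v x)]

/-- Bounded energy bounds the strain by `eventually_coercive`, and the difference quotient differs
from the strain by the fixed field $x_2\,\partial_2\mathrm{II}$. This is where the $O(w)$ closeness
to $\mathrm{II}^0$ comes from. -/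
theorem exists_quot_bound (hL : 0 < L) (hb : IsPlateForm L r c C b) {A : ℝ → ℝ × ℝ → Mat2}
    (hA : ∀ᶠ w in 𝓝[>] (0 : ℝ), R.IsGaussCodazzi L w (A w)) {K : ℝ}
    (hK : ∀ᶠ w in 𝓝[>] (0 : ℝ), R.formEnergy b L w (A w) ≤ K) :
    ∃ K', ∀ᶠ w in 𝓝[>] (0 : ℝ), ∫ x in strip L, ‖R.strain w (A w) x‖ ^ 2 ≤ K' ∧
      ∫ x in strip L, ‖R.quot w (A w) x‖ ^ 2 ≤ K' := by
  have hII : ∀ i j, MemLp (fun x : ℝ × ℝ => (x.2 • R.II1 x.1) i j) 2 (volume.restrict (strip L)) :=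
    fun i j => memLp_snd_mul (R.continuous_II1 i j).continuousOn
  set M := ∫ x : ℝ × ℝ in strip L, ‖x.2 • R.II1 x.1‖ ^ 2
  set K₁ := (K + c / 2 * L) / (c / 2)
  refine ⟨max K₁ (2 * K₁ + 2 * M), ?_⟩
  filter_upwards [eventually_coercive hL hb, hA, hK] with w h1 h2 h3
  have h4 : ∫ x in strip L, ‖R.strain w (A w) x‖ ^ 2 ≤ K₁ := by
    rw [le_div_iff₀ (half_pos hb.pos)]
    have := h1 _ h2
    linarith
  have h5 := integral_norm_add_sq_le (memLp_strain h2) hII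
  have h6 : ∀ x, R.strain w (A w) x + x.2 • R.II1 x.1 = R.quot w (A w) x := fun x => sub_add_cancel _ _
  simp only [h6] at h5
  exact ⟨h4.trans (le_max_left _ _), (h5.trans (by linarith)).trans (le_max_right _ _)⟩

/-- The energy of the limit strain. -/
noncomputable def gapEnergy (R : FlatGeometry) (b : ℝ × ℝ → Mat2 →ₗ[ℝ] Mat2 →ₗ[ℝ] ℝ) (L : ℝ) : ℝ :=
  ∫ x in strip L, b (x.1, 0) (x.2 • R.gap x.1) (x.2 • R.gap x.1)

/-- Expanded in matrix entries, the cross term is a finite sum of moments of the oscillation against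
$x_2k(x_1)$ with continuous `k`, so `tendsto_moment` applies to each summand. -/
theorem tendsto_cross_term (hL : 0 < L) (hdet : ∀ s ∈ Icc 0 L, (R.II0 s).det = 0)
    (hl : ∀ s ∈ Icc 0 L, R.l₀ s ≠ 0) (hb : IsPlateForm L r c C b) {A : ℝ → ℝ × ℝ → Mat2}
    (hA : ∀ᶠ w in 𝓝[>] (0 : ℝ), R.IsGaussCodazzi L w (A w)) {K : ℝ}
    (hK : ∀ᶠ w in 𝓝[>] (0 : ℝ), ∫ x in strip L, ‖R.quot w (A w) x‖ ^ 2 ≤ K) :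
    Tendsto (fun w => ∫ x in strip L, b (x.1, 0) (R.oscillation w (A w) x) (x.2 • R.gap x.1))
      (𝓝[>] 0) (𝓝 0) := by
  have hK' : ∀ᶠ w in 𝓝[>] (0 : ℝ), ∀ i j, ∫ x in strip L, R.quot w (A w) x i j ^ 2 ≤ K := by
    filter_upwards [hA, hK] with w h1 h2 i j
    exact (integral_entry_sq_le (R.memLp_quot h1) i j).trans h2
  set k : Fin 2 → Fin 2 → Fin 2 → Fin 2 → ℝ → ℝ := fun i j k l s =>
    R.gap s k l * b (s, 0) (Matrix.single i j 1) (Matrix.single k l 1)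
  have hk : ∀ i j m l, ContinuousOn (k i j m l) (Icc 0 L) := fun i j m l =>
    (continuousOn_gap hl m l).mul (continuousOn_form_midline hb _ _)
  have key := tendsto_finsetSum Finset.univ fun i _ => tendsto_finsetSum Finset.univ fun j _ =>
    tendsto_finsetSum Finset.univ fun m _ => tendsto_finsetSum Finset.univ fun l _ =>
      R.tendsto_moment hL hdet hl hA hK' (hk i j m l) i j
  simp only [Finset.sum_const_zero] at key
  refine key.congr' ?_
  filter_upwards [hA] with w h1
  have hint : ∀ i j m l, Integrable (fun x : ℝ × ℝ => x.2 * k i j m l x.1 *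
      (R.quot w (A w) x i j - x.2 * R.slope x.1 i j)) (volume.restrict (strip L)) := fun i j m l =>
    integrable_mul_of_memLp_two (memLp_snd_mul (hk i j m l)) (memLp_oscillation hl h1 i j)
  have e : ∀ x : ℝ × ℝ, b (x.1, 0) (R.oscillation w (A w) x) (x.2 • R.gap x.1)
      = ∑ i, ∑ j, ∑ m, ∑ l, x.2 * k i j m l x.1 *
        (R.quot w (A w) x i j - x.2 * R.slope x.1 i j) := fun x => by
    rw [bilinear_eq_sum_two]
    refine Finset.sum_congr rfl fun i _ => Finset.sum_congr rfl fun j _ =>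
      Finset.sum_congr rfl fun m _ => Finset.sum_congr rfl fun l _ => ?_
    simp only [oscillation, k, Matrix.sub_apply, Matrix.smul_apply, smul_eq_mul]
    ring
  simp only [e]
  rw [integral_finsetSum _ fun i _ => integrable_finsetSum _ fun j _ => integrable_finsetSum _ fun m _ =>
    integrable_finsetSum _ fun l _ => hint i j m l]
  refine Finset.sum_congr rfl fun i _ => ?_
  rw [integral_finsetSum _ fun j _ => integrable_finsetSum _ fun m _ =>
    integrable_finsetSum _ fun l _ => hint i j m l]
  refine Finset.sum_congr rfl fun j _ => ?_
  rw [integral_finsetSum _ fun m _ => integrable_finsetSum _ fun l _ => hint i j m l]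
  refine Finset.sum_congr rfl fun m _ => ?_
  rw [integral_finsetSum _ fun l _ => hint i j m l]

/-- Along families of bounded energy, the rescaled energy splits into the energy of the limit strain
and the energy of the oscillation. -/
theorem tendsto_formEnergy_sub (hL : 0 < L) (hdet : ∀ s ∈ Icc 0 L, (R.II0 s).det = 0)
    (hl : ∀ s ∈ Icc 0 L, R.l₀ s ≠ 0) (hb : IsPlateForm L r c C b) {A : ℝ → ℝ × ℝ → Mat2}
    (hA : ∀ᶠ w in 𝓝[>] (0 : ℝ), R.IsGaussCodazzi L w (A w)) {K : ℝ}
    (hK : ∀ᶠ w in 𝓝[>] (0 : ℝ), R.formEnergy b L w (A w) ≤ K) :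
    Tendsto (fun w => R.formEnergy b L w (A w)
      - ∫ x in strip L, b (x.1, 0) (R.oscillation w (A w) x) (R.oscillation w (A w) x))
      (𝓝[>] 0) (𝓝 (R.gapEnergy b L)) := by
  obtain ⟨K', hK'⟩ := exists_quot_bound hL hb hA hK
  have hcross := tendsto_cross_term hL hdet hl hb hA (hK'.mono fun _ h => h.2)
  have hexp : Tendsto (fun w => R.formEnergy b L w (A w)
      - ∫ x in strip L, b (x.1, 0) (R.strain w (A w) x) (R.strain w (A w) x)) (𝓝[>] 0) (𝓝 0) := by
    rw [Metric.tendsto_nhds]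
    intro ε hε
    have hden : 0 < |K'| + L + 1 := by positivity
    filter_upwards [eventually_formEnergy_sub_le hL hb (div_pos hε hden), hA, hK'] with w h1 h2 h3
    rw [Real.dist_eq, sub_zero]
    refine (h1 _ h2).trans_lt ?_
    have h4 : (∫ x in strip L, ‖R.strain w (A w) x‖ ^ 2) + L < |K'| + L + 1 := by
      linarith [h3.1, le_abs_self K']
    calc _ < ε / (|K'| + L + 1) * (|K'| + L + 1) := mul_lt_mul_of_pos_left h4 (div_pos hε hden)
      _ = ε := div_mul_cancel₀ _ hden.ne'
  have hgap : ∀ i j, MemLp (fun x : ℝ × ℝ => (x.2 • R.gap x.1) i j) 2 (volume.restrict (strip L)) :=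
    fun i j => memLp_snd_mul (continuousOn_gap hl i j)
  have lim := (hexp.add (hcross.const_mul 2)).add_const (R.gapEnergy b L)
  rw [mul_zero, add_zero, zero_add] at lim
  refine lim.congr' ?_
  filter_upwards [hA] with w h1
  have ho := memLp_oscillation hl h1
  have i1 := integrable_midline hb ho ho
  have i2 := integrable_midline hb ho hgap
  have i3 := integrable_midline hb hgap hgap
  -- Polarisation of strain = oscillation + $x_2\cdot$gap; only the cross term needs an argument.
  have e : ∀ x, b (x.1, 0) (R.strain w (A w) x) (R.strain w (A w) x)
      = 1 * b (x.1, 0) (R.oscillation w (A w) x) (R.oscillation w (A w) x)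
        + 2 * b (x.1, 0) (R.oscillation w (A w) x) (x.2 • R.gap x.1)
        + 1 * b (x.1, 0) (x.2 • R.gap x.1) (x.2 • R.gap x.1) := fun x => by
    rw [strain_eq, LinearMap.map_add₂, map_add, map_add,
      hb.symm _ (x.2 • R.gap x.1) (R.oscillation w (A w) x)]
    ring
  simp only [e]
  rw [integral_linear_combination i1 i2 i3, gapEnergy]
  ring

end

end FlatGeometry

end Ribbon

/-! ### Convergence of the infima and behaviour of almost minimizers -/

namespace Ribbon

/-- Formulated without measurability of `f`, so that it applies directly to means over $x_2$. -/
theorem eLpNorm_two_le_of_norm_sq_le {α E : Type*} [MeasurableSpace α] {μ : Measure α} [NormedAddCommGroup E]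
    {f : α → E} {G : α → ℝ} (hG : Integrable G μ) (h : ∀ᵐ x ∂μ, ‖f x‖ ^ 2 ≤ G x) :
    eLpNorm f 2 μ ≤ ENNReal.ofReal √(∫ x, G x ∂μ) := by
  have h0 : (fun x => √(G x) ^ 2) =ᵐ[μ] G := by
    filter_upwards [h] with x hx
    exact Real.sq_sqrt ((sq_nonneg _).trans hx)
  have hm : MemLp (fun x => √(G x)) 2 μ := by
    rw [memLp_two_iff_integrable_sq (hG.1.aemeasurable.sqrt.aestronglyMeasurable)]
    exact hG.congr h0.symm
  have h1 : eLpNorm f 2 μ ≤ eLpNorm (fun x => √(G x)) 2 μ := eLpNorm_mono_ae_real (by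
    filter_upwards [h] with x hx
    exact Real.le_sqrt_of_sq_le hx)
  refine h1.trans (le_of_eq ?_)
  rw [eLpNorm_two_eq hm]
  simp only [Real.norm_eq_abs, sq_abs]
  rw [integral_congr_ae h0]

theorem integral_sq_le_of_unit_interval {g : ℝ → ℝ}
    (hg : IntegrableOn g (Ioo (-(1 / 2)) (1 / 2)))
    (hg2 : IntegrableOn (fun r => g r ^ 2) (Ioo (-(1 / 2)) (1 / 2))) :
    (∫ r in Ioo (-(1 / 2) : ℝ) (1 / 2), g r) ^ 2 ≤ ∫ r in Ioo (-(1 / 2) : ℝ) (1 / 2), g r ^ 2 := by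
  have h1 : MemLp g 2 (volume.restrict (Ioo (-(1 / 2) : ℝ) (1 / 2))) :=
    (memLp_two_iff_integrable_sq hg.1).2 hg2
  have h := integral_mul_sq_le h1 (memLp_const (1 : ℝ))
  simp only [mul_one, one_pow, integral_const, measureReal_restrict_apply_univ,
    Real.volume_real_Ioo_of_le (show (-(1 / 2) : ℝ) ≤ 1 / 2 by norm_num), smul_eq_mul] at h
  norm_num at h ⊢
  exact h

namespace FlatGeometry

variable {R : FlatGeometry} {L r c C : ℝ} {b : ℝ × ℝ → Mat2 →ₗ[ℝ] Mat2 →ₗ[ℝ] ℝ}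

theorem eventually_isGaussCodazzi (R : FlatGeometry) (L : ℝ) : ∀ᶠ w in 𝓝[>] (0 : ℝ),
    ∀ f : W22 (strip L), R.IsIsometric L w f → R.IsGaussCodazzi L w (f.secondForm w) := by
  have hpos : ∀ᶠ w in 𝓝[>] (0 : ℝ), (0 : ℝ) < w := self_mem_nhdsWithin
  filter_upwards [R.eventually_len_pos L, hpos] with w h1 h2 f hf
  exact R.isGaussCodazzi_secondForm h2 h1 hf

/-- The oscillation of the recovery sequence tends to zero uniformly, so its energy does, and the
splitting leaves the gap energy alone. -/
theorem exists_recovery_formEnergy (hL : 0 < L) (hdet : ∀ s ∈ Icc 0 L, (R.II0 s).det = 0)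
    (hl : ∀ s ∈ Icc 0 L, R.l₀ s ≠ 0) {e : Fin 3 → ℝ → E3} (he : R.IsDarbouxFrame e)
    (hb : IsPlateForm L r c C b) :
    ∃ f : ℝ → W22 (strip L), (∀ᶠ w in 𝓝[>] (0 : ℝ), R.IsIsometric L w (f w)) ∧
      Tendsto (fun w => R.formEnergy b L w ((f w).secondForm w)) (𝓝[>] 0) (𝓝 (R.gapEnergy b L)) := by
  obtain ⟨f, hf, happ⟩ := exists_recovery hL hdet hl he
  have hA : ∀ᶠ w in 𝓝[>] (0 : ℝ), R.IsGaussCodazzi L w ((f w).secondForm w) := by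
    filter_upwards [R.eventually_isGaussCodazzi L, hf] with w h1 h2 using h1 _ h2
  have hosc : ∀ ε > 0, ∀ᶠ w in 𝓝[>] (0 : ℝ),
      ∫ x in strip L, ‖R.oscillation w ((f w).secondForm w) x‖ ^ 2 ≤ 4 * ε ^ 2 * L := fun ε hε => by
    filter_upwards [happ ε hε, hA] with w h1 h2
    have h3 : ∫ x in strip L, ‖R.oscillation w ((f w).secondForm w) x‖ ^ 2
        ≤ ∫ _x in strip L, 4 * ε ^ 2 := by
      refine setIntegral_mono_on (integrable_norm_sq (memLp_oscillation hl h2)) (integrable_const _)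
        (measurableSet_strip L) fun x hx => ?_
      have := norm_le_of_abs_entry_le (F := R.oscillation w ((f w).secondForm w) x) (h1 x hx)
      nlinarith [norm_nonneg (R.oscillation w ((f w).secondForm w) x)]
    rw [integral_const, measureReal_restrict_apply_univ, volume_real_strip hL, smul_eq_mul] at h3
    linarith
  have hgap : ∀ i j, MemLp (fun x : ℝ × ℝ => (x.2 • R.gap x.1) i j) 2 (volume.restrict (strip L)) :=
    fun i j => memLp_snd_mul (continuousOn_gap hl i j)
  set M := ∫ x : ℝ × ℝ in strip L, ‖x.2 • R.gap x.1‖ ^ 2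
  have hK : ∀ᶠ w in 𝓝[>] (0 : ℝ), R.formEnergy b L w ((f w).secondForm w)
      ≤ (C + 1) * (2 * (4 * 1 ^ 2 * L) + 2 * M) + L := by
    filter_upwards [hosc 1 one_pos, hA, eventually_formEnergy_sub_le hL hb one_pos] with w h1 h2 h3
    have h4 := (abs_le.1 (h3 _ h2)).2
    have h5 := integral_midline_upper hb (memLp_strain h2)
    have h6 := integral_norm_add_sq_le (memLp_oscillation hl h2) hgap
    simp only [← strain_eq] at h6
    have h7 : (C + 1) * (∫ x in strip L, ‖R.strain w ((f w).secondForm w) x‖ ^ 2)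
        ≤ (C + 1) * (2 * (4 * 1 ^ 2 * L) + 2 * M) :=
      mul_le_mul_of_nonneg_left (h6.trans (by linarith)) (by linarith [hb.pos'])
    linarith
  refine ⟨f, hf, ?_⟩
  have h1 := tendsto_formEnergy_sub hL hdet hl hb hA hK
  have h2 : Tendsto (fun w => ∫ x in strip L, b (x.1, 0) (R.oscillation w ((f w).secondForm w) x)
      (R.oscillation w ((f w).secondForm w) x)) (𝓝[>] 0) (𝓝 0) := by
    rw [Metric.tendsto_nhds]
    intro ε hε
    have hC := hb.pos'
    -- Chosen so that the bound $C\cdot 4t^2L$ equals $\varepsilon/2$.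
    set t := √(ε / (8 * C * L)) with ht
    have ht0 : 0 < t := Real.sqrt_pos.2 (by positivity)
    have ht2 : t ^ 2 = ε / (8 * C * L) := Real.sq_sqrt (by positivity)
    filter_upwards [hosc t ht0, hA] with w h3 h4
    have ho := memLp_oscillation hl h4
    have h5 := integral_midline_upper hb ho
    have h6 := integral_midline_lower hb ho (isSymm_oscillation h4)
    have h7 : 0 ≤ c * ∫ x in strip L, ‖R.oscillation w ((f w).secondForm w) x‖ ^ 2 :=
      mul_nonneg hb.pos.le (integral_nonneg fun x => sq_nonneg _)
    rw [Real.dist_eq, sub_zero, abs_of_nonneg (h7.trans h6)]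
    refine (h5.trans (mul_le_mul_of_nonneg_left h3 hC.le)).trans_lt ?_
    rw [ht2]
    have : C * (4 * (ε / (8 * C * L)) * L) = ε / 2 := by field_simp; norm_num
    rw [this]
    exact half_lt_self hε
  have h3 := h1.add h2
  simpa using h3

/-- The representation of the plate energy by the plate form. -/
theorem eventually_plateEnergy_eq (hL : 0 < L) {W : Mat3 → ℝ≥0∞} {e : Fin 3 → ℝ → E3}
    (hb : IsPlateForm L r c C b)
    (hQ : ∀ w x F, (x.1, w * x.2) ∈ Icc 0 L ×ˢ Icc (-r) r → R.Qw W e w x F = b (x.1, w * x.2) F F) :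
    ∀ᶠ w in 𝓝[>] (0 : ℝ), ∀ f : W22 (strip L),
      (1 / w ^ 2) * R.plateEnergy W e L w f = 1 / (12 * L) * R.formEnergy b L w (f.secondForm w) := by
  have hsub : strip L ⊆ Icc 0 L ×ˢ Icc (-(1 / 2)) (1 / 2) :=
    prod_mono Ioo_subset_Icc_self Ioo_subset_Icc_self
  filter_upwards [eventually_mem_box (L := L) hb.radius_pos] with w hw f
  have h1 : ∫ x in strip L, R.density W e L w f x = ∫ x in strip L,
      b (x.1, w * x.2) (f.secondForm w x - R.II (x.1, w * x.2)) (f.secondForm w x - R.II (x.1, w * x.2)) :=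
    setIntegral_congr_fun (measurableSet_strip L) fun x hx => hQ w x _ (hw x (hsub hx))
  rw [plateEnergy, setAverage_eq, h1, volume_real_strip hL, formEnergy, integral_const_mul, smul_eq_mul]
  ring

section

variable {W : Mat3 → ℝ≥0∞} {e : Fin 3 → ℝ → E3}

theorem eventually_integrable_density (hb : IsPlateForm L r c C b)
    (hQ : ∀ w x F, (x.1, w * x.2) ∈ Icc 0 L ×ˢ Icc (-r) r → R.Qw W e w x F = b (x.1, w * x.2) F F) :
    ∀ᶠ w in 𝓝[>] (0 : ℝ), ∀ f : W22 (strip L), R.IsIsometric L w f →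
      IntegrableOn (R.density W e L w f) (strip L) := by
  have hsub : strip L ⊆ Icc 0 L ×ˢ Icc (-(1 / 2)) (1 / 2) :=
    prod_mono Ioo_subset_Icc_self Ioo_subset_Icc_self
  filter_upwards [eventually_mem_box (L := L) hb.radius_pos, R.eventually_isGaussCodazzi L,
    eventually_integrable_form (R := R) hb] with w hw hgc hint f hf
  exact (hint _ (hgc f hf)).congr_fun (fun x hx => (hQ w x _ (hw x (hsub hx))).symm)
    (measurableSet_strip L)

theorem eventually_energyValues_nonneg (hL : 0 < L) (hb : IsPlateForm L r c C b)
    (hQ : ∀ w x F, (x.1, w * x.2) ∈ Icc 0 L ×ˢ Icc (-r) r → R.Qw W e w x F = b (x.1, w * x.2) F F) :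
    ∀ᶠ w in 𝓝[>] (0 : ℝ), ∀ E ∈ R.energyValues W e L w, 0 ≤ E := by
  have hsub : strip L ⊆ Icc 0 L ×ˢ Icc (-(1 / 2)) (1 / 2) :=
    prod_mono Ioo_subset_Icc_self Ioo_subset_Icc_self
  filter_upwards [eventually_mem_box (L := L) hb.radius_pos] with w hw
  rintro _ ⟨f, -, rfl⟩
  rw [plateEnergy, setAverage_eq, volume_real_strip hL]
  have : 0 ≤ ∫ x in strip L, R.density W e L w f x :=
    setIntegral_nonneg (measurableSet_strip L) fun x hx => by
      have h := hw x (hsub hx)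
      rw [density, hQ w x _ h]
      exact hb.nonneg _ h _
  positivity

/-- The real `sInf` is meaningful only for nonempty sets that are bounded below. The recovery
sequence gives the first, nonnegativity of the energies the second. -/
theorem eventually_isGLB (hL : 0 < L) (hdet : ∀ s ∈ Icc 0 L, (R.II0 s).det = 0)
    (hl : ∀ s ∈ Icc 0 L, R.l₀ s ≠ 0) (he : R.IsDarbouxFrame e) (hb : IsPlateForm L r c C b)
    (hQ : ∀ w x F, (x.1, w * x.2) ∈ Icc 0 L ×ˢ Icc (-r) r → R.Qw W e w x F = b (x.1, w * x.2) F F) :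
    ∀ᶠ w in 𝓝[>] (0 : ℝ), IsGLB (R.energyValues W e L w) (R.infEnergy W e L w) := by
  obtain ⟨f, hf, -⟩ := exists_recovery hL hdet hl he
  filter_upwards [hf, eventually_energyValues_nonneg hL hb hQ] with w h1 h2
  exact isGLB_csInf ⟨_, f w, h1, rfl⟩ ⟨0, h2⟩

/-- Upper bound from the recovery sequence; lower bound from almost minimizers, whose oscillation
energy is nonnegative in the splitting. -/
theorem tendsto_infEnergy (hL : 0 < L) (hdet : ∀ s ∈ Icc 0 L, (R.II0 s).det = 0)
    (hl : ∀ s ∈ Icc 0 L, R.l₀ s ≠ 0) (he : R.IsDarbouxFrame e) (hb : IsPlateForm L r c C b)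
    (hQ : ∀ w x F, (x.1, w * x.2) ∈ Icc 0 L ×ˢ Icc (-r) r → R.Qw W e w x F = b (x.1, w * x.2) F F) :
    Tendsto (fun w => (1 / w ^ 2) * R.infEnergy W e L w) (𝓝[>] 0)
      (𝓝 (1 / (12 * L) * R.gapEnergy b L)) := by
  obtain ⟨f, hf, hflim⟩ := exists_recovery_formEnergy hL hdet hl he hb
  have hpos : ∀ᶠ w in 𝓝[>] (0 : ℝ), (0 : ℝ) < w := self_mem_nhdsWithin
  have hid : Tendsto (fun w : ℝ => w) (𝓝[>] 0) (𝓝 0) := nhdsWithin_le_nhds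
  have hglb := eventually_isGLB hL hdet hl he hb hQ
  have hrep := eventually_plateEnergy_eq (R := R) (W := W) (e := e) hL hb hQ
  -- Existence of minimizers is not needed: competitors within $w^3$ of the infimum lose only `w`
  -- after division by $w^2$.
  have hmin : ∃ g : ℝ → W22 (strip L), ∀ᶠ w in 𝓝[>] (0 : ℝ), R.IsIsometric L w (g w) ∧
      R.plateEnergy W e L w (g w) ≤ R.infEnergy W e L w + w ^ 3 := by
    have h : ∀ w, ∃ g : W22 (strip L), (0 < w ∧ R.IsIsometric L w (f w)) → R.IsIsometric L w g ∧
        R.plateEnergy W e L w g ≤ R.infEnergy W e L w + w ^ 3 := fun w => by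
      by_cases hw : 0 < w ∧ R.IsIsometric L w (f w)
      · have hne : (R.energyValues W e L w).Nonempty := ⟨_, f w, hw.2, rfl⟩
        obtain ⟨_, ⟨g, hg, rfl⟩, hlt⟩ := Real.lt_sInf_add_pos hne (pow_pos hw.1 3)
        exact ⟨g, fun _ => ⟨hg, hlt.le⟩⟩
      · exact ⟨f w, fun h => absurd h hw⟩
    choose g hg using h
    refine ⟨g, ?_⟩
    filter_upwards [hpos, hf] with w h1 h2 using hg w ⟨h1, h2⟩
  obtain ⟨g, hg⟩ := hmin
  have hA : ∀ᶠ w in 𝓝[>] (0 : ℝ), R.IsGaussCodazzi L w ((g w).secondForm w) := by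
    filter_upwards [R.eventually_isGaussCodazzi L, hg] with w h1 h2 using h1 _ h2.1
  have hgle : ∀ᶠ w in 𝓝[>] (0 : ℝ),
      1 / (12 * L) * R.formEnergy b L w ((g w).secondForm w) - w ≤ (1 / w ^ 2) * R.infEnergy W e L w := by
    filter_upwards [hpos, hg, hrep] with w h1 h2 h3
    rw [← h3]
    have := mul_le_mul_of_nonneg_left h2.2 (show 0 ≤ 1 / w ^ 2 by positivity)
    have e1 : 1 / w ^ 2 * (R.infEnergy W e L w + w ^ 3) = 1 / w ^ 2 * R.infEnergy W e L w + w := by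
      field_simp
    linarith
  have hfle : ∀ᶠ w in 𝓝[>] (0 : ℝ),
      (1 / w ^ 2) * R.infEnergy W e L w ≤ 1 / (12 * L) * R.formEnergy b L w ((f w).secondForm w) := by
    filter_upwards [hpos, hf, hrep, hglb] with w h1 h2 h3 h4
    rw [← h3]
    exact mul_le_mul_of_nonneg_left (h4.1 ⟨f w, h2, rfl⟩) (by positivity)
  -- The splitting requires an a priori energy bound, which comes from comparison with the recovery
  -- sequence. The loss `w < 1` becomes at most `12 * L` in `formEnergy`.
  have hK : ∀ᶠ w in 𝓝[>] (0 : ℝ), R.formEnergy b L w ((g w).secondForm w)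
      ≤ R.gapEnergy b L + 1 + 12 * L := by
    filter_upwards [hgle, hfle, hflim.eventually_le_const (lt_add_one _), Ioo_mem_nhdsGT one_pos]
      with w h1 h2 h3 h4
    have h5 : 1 / (12 * L) * R.formEnergy b L w ((g w).secondForm w)
        ≤ 1 / (12 * L) * (R.gapEnergy b L + 1 + 12 * L) := by
      have h6 : 1 / (12 * L) * R.formEnergy b L w ((f w).secondForm w)
          ≤ 1 / (12 * L) * (R.gapEnergy b L + 1) := mul_le_mul_of_nonneg_left h3 (by positivity)
      have h7 : 1 / (12 * L) * (R.gapEnergy b L + 1 + 12 * L)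
          = 1 / (12 * L) * (R.gapEnergy b L + 1) + 1 := by field_simp
      linarith [h4.2]
    exact le_of_mul_le_mul_left h5 (by positivity)
  have hlow := ((tendsto_formEnergy_sub hL hdet hl hb hA hK).const_mul (1 / (12 * L))).sub hid
  rw [sub_zero] at hlow
  refine tendsto_of_tendsto_of_tendsto_of_le_of_le' hlow (hflim.const_mul (1 / (12 * L))) ?_ hfle
  filter_upwards [hgle, hA] with w h1 h2
  refine le_trans ?_ h1
  have ho := memLp_oscillation hl h2
  have h6 := integral_midline_lower hb ho (isSymm_oscillation h2)
  have h7 : 0 ≤ c * ∫ x in strip L, ‖R.oscillation w ((g w).secondForm w) x‖ ^ 2 :=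
    mul_nonneg hb.pos.le (integral_nonneg fun x => sq_nonneg _)
  have h8 : 0 ≤ 1 / (12 * L) * ∫ x in strip L, b (x.1, 0) (R.oscillation w ((g w).secondForm w) x)
      (R.oscillation w ((g w).secondForm w) x) := mul_nonneg (by positivity) (h7.trans h6)
  rw [mul_sub]
  linarith

end

/-- The oscillation of almost minimisers vanishes in the limit. -/
theorem tendsto_oscillation (hL : 0 < L) (hdet : ∀ s ∈ Icc 0 L, (R.II0 s).det = 0)
    (hl : ∀ s ∈ Icc 0 L, R.l₀ s ≠ 0) (hb : IsPlateForm L r c C b) {A : ℝ → ℝ × ℝ → Mat2}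
    (hA : ∀ᶠ w in 𝓝[>] (0 : ℝ), R.IsGaussCodazzi L w (A w))
    (hlim : Tendsto (fun w => R.formEnergy b L w (A w)) (𝓝[>] 0) (𝓝 (R.gapEnergy b L))) :
    Tendsto (fun w => ∫ x in strip L, ‖R.oscillation w (A w) x‖ ^ 2) (𝓝[>] 0) (𝓝 0) := by
  have h1 := hlim.sub (tendsto_formEnergy_sub hL hdet hl hb hA (hlim.eventually_le_const (lt_add_one _)))
  rw [sub_self] at h1
  have h2 := h1.const_mul c⁻¹
  rw [mul_zero] at h2
  refine squeeze_zero' (Eventually.of_forall fun w => integral_nonneg fun x => sq_nonneg _) ?_ h2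
  filter_upwards [hA] with w h3
  rw [sub_sub_cancel, ← div_eq_inv_mul, le_div_iff₀ hb.pos, mul_comm]
  exact integral_midline_lower hb (memLp_oscillation hl h3) (isSymm_oscillation h3)

theorem eLpNorm_deviation_le {w : ℝ} (hw : 0 < w) {f : W22 (strip L)}
    (hA : R.IsGaussCodazzi L w (f.secondForm w)) {K : ℝ}
    (hK : ∫ x in strip L, ‖R.quot w (f.secondForm w) x‖ ^ 2 ≤ K ^ 2) (hK0 : 0 ≤ K) :
    eLpNorm (R.deviation L w f) 2 (volume.restrict (strip L)) ≤ ENNReal.ofReal (K * w) := by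
  have hi := (integrable_norm_sq (R.memLp_quot hA)).const_mul (w ^ 2)
  refine (eLpNorm_two_le_of_norm_sq_le hi (Eventually.of_forall fun x => ?_)).trans
    (ENNReal.ofReal_le_ofReal ?_)
  · have : R.deviation L w f x = w • R.quot w (f.secondForm w) x := by
      rw [quot, smul_smul, mul_inv_cancel₀ hw.ne', one_smul]
      rfl
    rw [this, norm_smul, mul_pow, Real.norm_of_nonneg hw.le]
  · rw [integral_const_mul]
    refine Real.sqrt_le_iff.2 ⟨by positivity, ?_⟩
    rw [mul_pow, mul_comm]
    exact mul_le_mul_of_nonneg_right hK (sq_nonneg w)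

/-- Averaging over $x_2$ annihilates the odd term $x_2\Theta$, so the mean of the difference
quotient is the mean of the oscillation; Jensen's inequality on the unit interval finishes. -/
theorem eLpNorm_meanDeviation_le {w : ℝ} (hw : 0 < w) (hl : ∀ s ∈ Icc 0 L, R.l₀ s ≠ 0)
    {f : W22 (strip L)} (hA : R.IsGaussCodazzi L w (f.secondForm w)) :
    eLpNorm (fun s => (1 / w) • R.meanDeviation L w f s) 2 (volume.restrict (Ioo 0 L))
      ≤ ENNReal.ofReal √(∫ x in strip L, ‖R.oscillation w (f.secondForm w) x‖ ^ 2) := by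
  set Z := R.oscillation w (f.secondForm w) with hZ
  have hm := memLp_oscillation hl hA
  have hprod : volume.restrict (strip L) = (volume.restrict (Ioo (0 : ℝ) L)).prod
      (volume.restrict (Ioo (-(1 / 2) : ℝ) (1 / 2))) := by
    rw [strip, Measure.volume_eq_prod, Measure.prod_restrict]
  have hn : Integrable (fun x => ‖Z x‖ ^ 2) ((volume.restrict (Ioo (0 : ℝ) L)).prod
      (volume.restrict (Ioo (-(1 / 2) : ℝ) (1 / 2)))) := hprod ▸ integrable_norm_sq hm
  rw [hprod, integral_prod _ hn]
  refine eLpNorm_two_le_of_norm_sq_le hn.integral_prod_left ?_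
  have h1 : ∀ i j, ∀ᵐ s ∂(volume.restrict (Ioo (0 : ℝ) L)),
      Integrable (fun r => Z (s, r) i j) (volume.restrict (Ioo (-(1 / 2) : ℝ) (1 / 2))) := fun i j => by
    have h : Integrable (fun x => Z x i j) ((volume.restrict (Ioo (0 : ℝ) L)).prod
      (volume.restrict (Ioo (-(1 / 2) : ℝ) (1 / 2)))) := hprod ▸ (hm i j).integrable one_le_two
    exact h.prod_right_ae
  have h2 : ∀ i j, ∀ᵐ s ∂(volume.restrict (Ioo (0 : ℝ) L)),
      Integrable (fun r => Z (s, r) i j ^ 2) (volume.restrict (Ioo (-(1 / 2) : ℝ) (1 / 2))) := fun i j => by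
    have h : Integrable (fun x => Z x i j ^ 2) ((volume.restrict (Ioo (0 : ℝ) L)).prod
      (volume.restrict (Ioo (-(1 / 2) : ℝ) (1 / 2)))) := hprod ▸ integrable_sq_of_memLp_two (hm i j)
    exact h.prod_right_ae
  filter_upwards [ae_all_iff.2 fun i => ae_all_iff.2 (h1 i), ae_all_iff.2 fun i => ae_all_iff.2 (h2 i)]
    with s hs1 hs2
  have hlen : volume.real (Ioo (-(1 / 2) : ℝ) (1 / 2)) = 1 := by
    rw [Real.volume_real_Ioo_of_le (by norm_num)]
    norm_num
  have hfirst : ∫ t in Ioo (-(1 / 2) : ℝ) (1 / 2), t = 0 := by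
    rw [← integral_Ioc_eq_integral_Ioo, ← intervalIntegral.integral_of_le (by norm_num), integral_id]
    norm_num
  have hid : Integrable (fun t : ℝ => t) (volume.restrict (Ioo (-(1 / 2) : ℝ) (1 / 2))) :=
    (continuous_id.integrableOn_Icc (a := (-(1 / 2) : ℝ)) (b := 1 / 2)).mono_set Ioo_subset_Icc_self
  have key : ∀ i j, ((1 / w) • R.meanDeviation L w f s) i j
      = ∫ t in Ioo (-(1 / 2) : ℝ) (1 / 2), Z (s, t) i j := fun i j => by
    have e : ∀ t, f.secondForm w (s, t) i j
        = 1 * R.II0 s i j + w * Z (s, t) i j + (w * R.slope s i j) * t := fun t => by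
      rw [eq_add_quot R hw.ne' (f.secondForm w) (s, t) i j]
      simp only [hZ, oscillation, Matrix.sub_apply, Matrix.smul_apply, smul_eq_mul]
      ring
    have e2 : ∫ t in (-(1 / 2) : ℝ)..(1 / 2), f.secondForm w (s, t) i j
        = R.II0 s i j + w * ∫ t in Ioo (-(1 / 2) : ℝ) (1 / 2), Z (s, t) i j := by
      rw [intervalIntegral.integral_of_le (by norm_num), integral_Ioc_eq_integral_Ioo]
      simp only [e]
      rw [integral_linear_combination (integrable_const _) (hs1 i j) hid, hfirst, integral_const,
        measureReal_restrict_apply_univ, hlen]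
      simp
    show (1 / w) * ((∫ t in (-(1 / 2) : ℝ)..(1 / 2), f.secondForm w (s, t) i j) - R.II0 s i j) = _
    rw [e2]
    field_simp
    ring
  have h3 : ∫ t in Ioo (-(1 / 2) : ℝ) (1 / 2), ‖Z (s, t)‖ ^ 2
      = ∑ i, ∑ j, ∫ t in Ioo (-(1 / 2) : ℝ) (1 / 2), Z (s, t) i j ^ 2 := by
    simp only [norm_sq_eq_sum]
    rw [integral_finsetSum _ fun i _ => integrable_finsetSum _ fun j _ => hs2 i j]
    exact Finset.sum_congr rfl fun i _ => integral_finsetSum _ fun j _ => hs2 i j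
  rw [h3, norm_sq_eq_sum]
  refine Finset.sum_le_sum fun i _ => Finset.sum_le_sum fun j _ => ?_
  rw [key]
  exact integral_sq_le_of_unit_interval (hs1 i j) (hs2 i j)

end FlatGeometry

end Ribbon

/-! ### Comparison of the gap energy with the deficits -/

namespace Ribbon.FlatGeometry

variable {R : FlatGeometry} {L r c C : ℝ} {b : ℝ × ℝ → Mat2 →ₗ[ℝ] Mat2 →ₗ[ℝ] ℝ}

theorem gap_zero_zero (R : FlatGeometry) (s : ℝ) : R.gap s 0 0 = -R.δC₁ s := by
  show deriv R.m₀ s - R.κ s * (R.l₀ s + R.n₀ s) - R.l₁ s = -R.δC₁ s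
  rw [δC₁]
  ring

theorem gap_zero_one (R : FlatGeometry) (s : ℝ) : R.gap s 0 1 = -R.δC₂ s := by
  show deriv R.n₀ s + R.κ s * R.m₀ s - R.m₁ s = -R.δC₂ s
  rw [δC₂]
  ring

/-- The slope satisfies the linearised Gauss equation, so multiplication by $l_0$ leaves the
corrected Gauss deficit. -/
theorem l₀_mul_gap_one_one {s : ℝ} (hl : R.l₀ s ≠ 0) : R.l₀ s * R.gap s 1 1
    = -(R.δG1 s - R.n₀ s * R.δC₁ s + 2 * R.m₀ s * R.δC₂ s) := by
  show R.l₀ s * ((-(R.n₀ s * (deriv R.m₀ s - R.κ s * (R.l₀ s + R.n₀ s)))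
      + 2 * R.m₀ s * (deriv R.n₀ s + R.κ s * R.m₀ s)) / R.l₀ s - R.n₁ s) = _
  rw [δG1, δC₁, δC₂, mul_sub, mul_div_cancel₀ _ hl]
  ring

/-- The integrand of the deficit. -/
noncomputable def deficitDensity (R : FlatGeometry) (s : ℝ) : ℝ :=
  (R.δC₁ s ^ 2 + R.δC₂ s ^ 2) + (R.δG1 s - R.n₀ s * R.δC₁ s + 2 * R.m₀ s * R.δC₂ s) ^ 2

theorem norm_gap_sq (R : FlatGeometry) (s : ℝ) :
    ‖R.gap s‖ ^ 2 = R.δC₁ s ^ 2 + 2 * R.δC₂ s ^ 2 + R.gap s 1 1 ^ 2 := by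
  rw [norm_sq_eq_sum]
  simp only [Fin.sum_univ_two, (R.isSymm_gap s).apply 0 1, gap_zero_zero, gap_zero_one]
  ring

theorem deficitDensity_eq {s : ℝ} (hl : R.l₀ s ≠ 0) :
    R.deficitDensity s = R.δC₁ s ^ 2 + R.δC₂ s ^ 2 + R.l₀ s ^ 2 * R.gap s 1 1 ^ 2 := by
  rw [deficitDensity, ← neg_sq (R.δG1 s - _ + _), ← l₀_mul_gap_one_one hl]
  ring

theorem deficitDensity_le {lmin lmax s : ℝ} (hlmin : 0 < lmin) (h : lmin ≤ |R.l₀ s| ∧ |R.l₀ s| ≤ lmax) :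
    R.deficitDensity s ≤ (1 + lmax ^ 2) * ‖R.gap s‖ ^ 2 := by
  have hl : R.l₀ s ≠ 0 := abs_pos.1 (hlmin.trans_le h.1)
  have h2 : R.l₀ s ^ 2 ≤ lmax ^ 2 := by
    rw [← sq_abs (R.l₀ s)]
    exact pow_le_pow_left₀ (abs_nonneg _) h.2 2
  rw [deficitDensity_eq hl, norm_gap_sq]
  have h3 := mul_le_mul_of_nonneg_right h2 (sq_nonneg (R.gap s 1 1))
  have h4 : 0 ≤ lmax ^ 2 * (R.δC₁ s ^ 2 + 2 * R.δC₂ s ^ 2) := by positivity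
  linarith [sq_nonneg (R.gap s 1 1), sq_nonneg (R.δC₂ s)]

theorem norm_gap_sq_le {lmin s : ℝ} (hlmin : 0 < lmin) (h : lmin ≤ |R.l₀ s|) :
    ‖R.gap s‖ ^ 2 ≤ (2 + (lmin ^ 2)⁻¹) * R.deficitDensity s := by
  have hl : R.l₀ s ≠ 0 := abs_pos.1 (hlmin.trans_le h)
  have h2 : lmin ^ 2 ≤ R.l₀ s ^ 2 := by
    rw [← sq_abs (R.l₀ s)]
    exact pow_le_pow_left₀ hlmin.le h 2
  rw [deficitDensity_eq hl, norm_gap_sq]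
  have h3 : R.gap s 1 1 ^ 2 ≤ (lmin ^ 2)⁻¹ * (R.l₀ s ^ 2 * R.gap s 1 1 ^ 2) := by
    rw [← div_eq_inv_mul, le_div_iff₀ (by positivity), mul_comm]
    exact mul_le_mul_of_nonneg_right h2 (sq_nonneg _)
  have h4 : 0 ≤ (lmin ^ 2)⁻¹ * (R.δC₁ s ^ 2 + R.δC₂ s ^ 2) := by positivity
  have h5 : 0 ≤ R.l₀ s ^ 2 * R.gap s 1 1 ^ 2 := by positivity
  linarith [sq_nonneg (R.δC₁ s)]

theorem deficit_eq (hL : 0 < L) : R.deficit L = ∫ s in Ioo 0 L, R.deficitDensity s := by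
  rw [deficit, intervalIntegral.integral_of_le hL.le, integral_Ioc_eq_integral_Ioo]
  rfl

theorem continuousOn_deficitDensity (hl : ∀ s ∈ Icc 0 L, R.l₀ s ≠ 0) :
    ContinuousOn R.deficitDensity (Icc 0 L) := by
  have h0 := continuousOn_gap hl 0 0
  have h1 := continuousOn_gap hl 0 1
  have h2 := continuousOn_gap hl 1 1
  have h3 := R.contDiff_l₀.continuous.continuousOn (s := Icc 0 L)
  refine (((h0.pow 2).add (h1.pow 2)).add ((h3.pow 2).mul (h2.pow 2))).congr fun s hs => ?_
  rw [deficitDensity_eq (hl s hs)]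
  simp only [Pi.add_apply, Pi.mul_apply, Pi.pow_apply, gap_zero_zero, gap_zero_one, neg_sq]

theorem gapEnergy_eq (R : FlatGeometry) (b : ℝ × ℝ → Mat2 →ₗ[ℝ] Mat2 →ₗ[ℝ] ℝ) (L : ℝ) :
    R.gapEnergy b L = 1 / 12 * ∫ s in Ioo 0 L, b (s, 0) (R.gap s) (R.gap s) := by
  rw [← integral_strip_sq, gapEnergy]
  congr 1
  funext x
  simp only [map_smul, LinearMap.smul_apply, smul_eq_mul]
  ring

theorem continuousOn_form_gap (hl : ∀ s ∈ Icc 0 L, R.l₀ s ≠ 0) (hb : IsPlateForm L r c C b) :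
    ContinuousOn (fun s => b (s, 0) (R.gap s) (R.gap s)) (Icc 0 L) := by
  have h := fun s => bilinear_eq_sum_two (b (s, 0)) (R.gap s) (R.gap s)
  simp only [h]
  exact continuousOn_finsetSum _ fun i _ => continuousOn_finsetSum _ fun j _ =>
    continuousOn_finsetSum _ fun k _ => continuousOn_finsetSum _ fun l _ =>
      (continuousOn_gap hl i j).mul ((continuousOn_gap hl k l).mul (continuousOn_form_midline hb _ _))

/-- The form is comparable to the squared norm along the midline, and the squared norm of the gap to
the deficit density. The upper bound on $|l_0|$ enters the first inequality, the lower bound the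
second. -/
theorem gapEnergy_bounds (hL : 0 < L) {lmin lmax : ℝ} (hlmin : 0 < lmin)
    (h : ∀ s ∈ Icc 0 L, lmin ≤ |R.l₀ s| ∧ |R.l₀ s| ≤ lmax) (hb : IsPlateForm L r c C b) :
    c / (12 * (1 + lmax ^ 2)) * R.deficit L ≤ R.gapEnergy b L ∧
      R.gapEnergy b L ≤ C * (2 + (lmin ^ 2)⁻¹) / 12 * R.deficit L := by
  have hl : ∀ s ∈ Icc 0 L, R.l₀ s ≠ 0 := fun s hs => abs_pos.1 (hlmin.trans_le (h s hs).1)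
  have hint : ∀ {k : ℝ → ℝ}, ContinuousOn k (Icc 0 L) → IntegrableOn k (Ioo 0 L) := fun hk =>
    (hk.integrableOn_Icc).mono_set Ioo_subset_Icc_self
  have i1 := hint (continuousOn_deficitDensity hl)
  have i2 := hint (continuousOn_form_gap hl hb)
  rw [deficit_eq hL, gapEnergy_eq]
  have hlo : (c / (1 + lmax ^ 2)) * ∫ s in Ioo 0 L, R.deficitDensity s
      ≤ ∫ s in Ioo 0 L, b (s, 0) (R.gap s) (R.gap s) := by
    rw [← integral_const_mul]
    refine setIntegral_mono_on (i1.const_mul _) i2 measurableSet_Ioo fun s hs => ?_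
    have h1 := deficitDensity_le hlmin (h s (Ioo_subset_Icc_self hs))
    refine le_trans ?_ (hb.lower s _ (R.isSymm_gap s))
    rw [div_mul_eq_mul_div, div_le_iff₀ (by positivity), mul_assoc, mul_comm (‖R.gap s‖ ^ 2)]
    exact mul_le_mul_of_nonneg_left h1 hb.pos.le
  have hup : ∫ s in Ioo 0 L, b (s, 0) (R.gap s) (R.gap s)
      ≤ (C * (2 + (lmin ^ 2)⁻¹)) * ∫ s in Ioo 0 L, R.deficitDensity s := by
    rw [← integral_const_mul]
    refine setIntegral_mono_on i2 (i1.const_mul _) measurableSet_Ioo fun s hs => ?_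
    have h1 := norm_gap_sq_le hlmin (h s (Ioo_subset_Icc_self hs)).1
    refine (hb.upper s _).trans ?_
    rw [mul_assoc]
    exact mul_le_mul_of_nonneg_left h1 hb.pos'.le
  constructor
  · refine le_trans (le_of_eq ?_) (mul_le_mul_of_nonneg_left hlo (by norm_num : (0 : ℝ) ≤ 1 / 12))
    field_simp
  · refine (mul_le_mul_of_nonneg_left hup (by norm_num : (0 : ℝ) ≤ 1 / 12)).trans (le_of_eq ?_)
    ring

end Ribbon.FlatGeometry

/-! ### Energy scaling and approximate minimizers -/

theorem mainTheorem10 (W : Ribbon.Mat3 → ℝ≥0∞) (hW : Ribbon.IsEnergyDensity W)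
    (L : ℝ) (hL : 0 < L) (lmin lmax : ℝ) (hlmin : 0 < lmin) :
    ∃ c C : ℝ, 0 < c ∧ 0 < C ∧
      ∀ (R : Ribbon.FlatGeometry) (e : Fin 3 → ℝ → Ribbon.E3), R.IsDarbouxFrame e →
        (∀ s ∈ Icc 0 L, (R.II0 s).det = 0) →
        (∀ s ∈ Icc 0 L, lmin ≤ |R.l₀ s| ∧ |R.l₀ s| ≤ lmax) →
        -- for small `w` the energy and its infimum are genuine
        (∀ᶠ w in 𝓝[>] (0 : ℝ),
          (∀ f : Ribbon.W22 (Ribbon.strip L), R.IsIsometric L w f →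
            IntegrableOn (R.density W e L w f) (Ribbon.strip L)) ∧
          IsGLB (R.energyValues W e L w) (R.infEnergy W e L w)) ∧
        -- energy scaling
        (∃ m : ℝ, Tendsto (fun w => (1 / w ^ 2) * R.infEnergy W e L w) (𝓝[>] 0) (𝓝 m) ∧
          c * R.deficit L ≤ m ∧ m ≤ C * R.deficit L) ∧
        -- approximate minimizers
        (∀ f : ℝ → Ribbon.W22 (Ribbon.strip L),
          (∀ᶠ w in 𝓝[>] (0 : ℝ), R.IsIsometric L w (f w)) →
          Tendsto (fun w => (1 / w ^ 2) * (R.plateEnergy W e L w (f w) - R.infEnergy W e L w))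
            (𝓝[>] 0) (𝓝 0) →
          (∃ K : ℝ, 0 < K ∧ ∀ᶠ w in 𝓝[>] (0 : ℝ),
            eLpNorm (R.deviation L w (f w)) 2 (volume.restrict (Ribbon.strip L))
              ≤ ENNReal.ofReal (K * w)) ∧
          Tendsto (fun w => eLpNorm (fun s => (1 / w) • R.meanDeviation L w (f w) s) 2
            (volume.restrict (Ioo 0 L))) (𝓝[>] 0) (𝓝 0)) := by
  obtain ⟨c, C, hc, hC, hform⟩ := Ribbon.exists_isPlateForm hW
  -- The first factor collects the prefactor of the plate energy and $|S| = L$; the second comes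
  -- from `gapEnergy_bounds`.
  refine ⟨1 / (12 * L) * (c / (12 * (1 + lmax ^ 2))), 1 / (12 * L) * (C * (2 + (lmin ^ 2)⁻¹) / 12),
    by positivity, by positivity, fun R e he hdet hlb => ?_⟩
  obtain ⟨r, b, hb, hQ⟩ := hform L hL R e he
  have hl : ∀ s ∈ Icc 0 L, R.l₀ s ≠ 0 := fun s hs => abs_pos.1 (hlmin.trans_le (hlb s hs).1)
  have hpos : ∀ᶠ w in 𝓝[>] (0 : ℝ), (0 : ℝ) < w := self_mem_nhdsWithin
  have hlim := Ribbon.FlatGeometry.tendsto_infEnergy hL hdet hl he hb hQ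
  have hbd := Ribbon.FlatGeometry.gapEnergy_bounds hL hlmin hlb hb
  refine ⟨(Ribbon.FlatGeometry.eventually_integrable_density hb hQ).and
    (Ribbon.FlatGeometry.eventually_isGLB hL hdet hl he hb hQ), ⟨_, hlim, ?_, ?_⟩, fun f hf hmin => ?_⟩
  · rw [mul_assoc]
    exact mul_le_mul_of_nonneg_left hbd.1 (by positivity)
  · rw [mul_assoc]
    exact mul_le_mul_of_nonneg_left hbd.2 (by positivity)
  have hA : ∀ᶠ w in 𝓝[>] (0 : ℝ), R.IsGaussCodazzi L w ((f w).secondForm w) := by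
    filter_upwards [R.eventually_isGaussCodazzi L, hf] with w h1 h2 using h1 _ h2
  -- Almost minimality together with convergence of the infima makes the energies converge to the
  -- gap energy, which bounds the difference quotient and leaves no energy for the oscillation.
  have hE : Tendsto (fun w => R.formEnergy b L w ((f w).secondForm w)) (𝓝[>] 0)
      (𝓝 (R.gapEnergy b L)) := by
    have h := (hmin.add hlim).const_mul (12 * L)
    rw [zero_add, ← mul_assoc, mul_one_div_cancel (by positivity), one_mul] at h
    refine h.congr' ?_
    filter_upwards [Ribbon.FlatGeometry.eventually_plateEnergy_eq (R := R) (W := W) (e := e) hL hb hQ]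
      with w h1
    rw [mul_sub, sub_add_cancel, h1, ← mul_assoc, mul_one_div_cancel (by positivity), one_mul]
  obtain ⟨K, hK⟩ := Ribbon.FlatGeometry.exists_quot_bound hL hb hA
    (hE.eventually_le_const (lt_add_one _))
  -- `eLpNorm_deviation_le` wants the squared norm bounded by a square, and $K \le (|K| + 1)^2$.
  refine ⟨⟨|K| + 1, by positivity, ?_⟩, ?_⟩
  · filter_upwards [hpos, hA, hK] with w h1 h2 h3
    refine Ribbon.FlatGeometry.eLpNorm_deviation_le h1 h2 (h3.2.trans ?_) (by positivity)
    nlinarith [le_abs_self K, abs_nonneg K]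
  · have hosc := Ribbon.FlatGeometry.tendsto_oscillation hL hdet hl hb hA hE
    have h0 : Tendsto (fun w => ENNReal.ofReal √(∫ x in Ribbon.strip L,
        ‖R.oscillation w ((f w).secondForm w) x‖ ^ 2)) (𝓝[>] 0) (𝓝 0) := by
      have := ENNReal.tendsto_ofReal hosc.sqrt
      rwa [Real.sqrt_zero, ENNReal.ofReal_zero] at this
    refine tendsto_of_tendsto_of_tendsto_of_le_of_le' tendsto_const_nhds h0
      (Eventually.of_forall fun w => zero_le) ?_
    filter_upwards [hpos, hA] with w h1 h2
    exact Ribbon.FlatGeometry.eLpNorm_meanDeviation_le h1 hl h2
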